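/- **Setting.** Let $k\ge 2$ be an integer, let $\Omega\subset\mathbb R^3$ be a bounded domain with boundary $\Gamma$ of class $C^1$, and let $\Omega'$ be an open set containing $\overline\Omega$. Let $\sigma>0$ and $0\le\delta<1$. *Meshes.* $\mathcal T_h$ is a finite non-empty mesh of closed straight-edged non-degenerate tetrahedra, any two of which meet in the convex hull of their common vertices (nothing, a common vertex, edge or face, or the whole element). Put $h=\max_{T}\operatorname{diam}T$, let $\Omega_h$ be the interior of $\bigcup_T T$, let $\Gamma_h=\partial\Omega_h$ and $\tilde\Omega_h=\Omega\cap\Omega_h$. All vertices of the mesh lie in $\overline\Omega$, and those on $\Gamma_h$ lie on $\Gamma$. The mesh is shape regular: every $T$ contains a ball of diameter $\rho_T$ with $\operatorname{diam}T\le\sigma\rho_T$. Every element has at most either one edge or one face contained in $\Gamma_h$ (the edges of that face not being counted). $\mathcal S_h$ is the set of elements with a face on $\Gamma_h$, and $\mathcal R_h$ is the set of the other elements having exactly one edge on $\Gamma_h$. To each edge $e\subset\Gamma_h$ a plane containing $e$ (the plane of the skin $\delta_e$) is attached which makes an angle of sine at most $\delta$ with the bisector plane of the two faces on $\Gamma_h$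 meeting at $e$ ($\delta=0$: the plane is the bisector). *Discrete spaces.* The Lagrangian nodes of $T$ are the points of $T$ whose barycentric coordinates are multiples of $1/k$. $V_h$ is the space of continuous functions on $\overline{\Omega}_h$ that vanish on $\Gamma_h$ and are polynomials of degree at most $k$ on every $T$. For a continuous $g:\Gamma\to\mathbb R$, $W_h^g$ is the set of (possibly discontinuous) families $w=(w_T)_T$ of polynomials of degree at most $k$ such that 1. $w$ is single-valued at all Lagrangian nodes not on $\Gamma_h$; 2. $w=g$ at all mesh vertices on $\Gamma_h$; 3. for $T\in\mathcal S_h$ with face $F_T\subset\Gamma_h$ and opposite vertex $O_T$, and for each Lagrangian node $M$ in the interior of $F_T$, $w_T(P)=g(P)$ at the point $P$ nearest to $M$ among the intersections of $\Gamma$ with the line $O_TM$; 4. for $T\in\mathcal S_h\cup\mathcal R_h$, each edge $e\subset\Gamma_h$ of $T$ and each Lagrangian node $M$ in the interior of $e$, $w_T(Q)=g(Q)$ at the point $Q$ nearest to $M$ among the intersections of $\Gamma$ with the line through $M$ orthogonal to $e$ in the plane attached to $e$. **Theorem.** There are constants $C'>0$ and $h_0>0$, depending only on $k$, $\Omega$,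 $\Omega'$, $\sigma$ and $\delta$, such that the following holds for every mesh as above with $h\le h_0$ and every choice of planes as above. Let $g\in C(\Gamma)$ and let $u\in H^{k+1}(\Omega)$ solve $-\Delta u=f$ in $\Omega$, $u=g$ on $\Gamma$ (traces are understood a.e. on $\Gamma$). Let $f'\in H^{k-1}(\Omega')$ with $f'=f$ in $\Omega$, and suppose there is $u'\in H^{k+1}(\Omega')$ with $-\Delta u'=f'$ in $\Omega'$, $u'=u$ in $\Omega$ and $u'=g$ a.e. on $\Gamma$. Then there is exactly one $u_h\in W_h^g$ with $$\sum_{T\in\mathcal T_h}\int_T \operatorname{grad}u_h\cdot\operatorname{grad}v=\int_{\Omega_h}f'v\qquad\forall v\in V_h,$$ and, with $\operatorname{grad}_h$ the elementwise gradient, $$\|\operatorname{grad}_h(u-u_h)\|_{0,\tilde\Omega_h}\le C'\,|u'|_{k+1,\Omega'}\,h^k .$$ -/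

import Mathlib

open MeasureTheory Set Filter Topology
open scoped ContDiff Laplacian

noncomputable section

namespace CurvedFEM

/-- Three-dimensional Euclidean space. -/
abbrev E3 : Type := EuclideanSpace ℝ (Fin 3)

/-! ### Domains -/

/-- A bounded domain (non-empty connected open set) of class `C¹`: near each boundary point the set
is the sublevel set `{ψ < 0}` of a `C¹` function with non-vanishing differential. -/
structure IsC1Domain (Ω : Set E3) : Prop where
  isOpen : IsOpen Ω
  isConnected : IsConnected Ω
  isBounded : Bornology.IsBounded Ω
  boundary : ∀ x ∈ frontier Ω, ∃ ψ : E3 → ℝ, ContDiffAt ℝ 1 ψ x ∧ ψ x = 0 ∧ fderiv ℝ ψ x ≠ 0 ∧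
    ∀ᶠ y in 𝓝 x, (y ∈ Ω ↔ ψ y < 0)

/-! ### Sobolev spaces, traces, the Poisson equation -/

/-- `φ` is a test function on `D`: smooth with compact support contained in `D`. -/
def IsTest (D : Set E3) (φ : E3 → ℝ) : Prop :=
  ContDiff ℝ ∞ φ ∧ HasCompactSupport φ ∧ tsupport φ ⊆ D

/-- `v ∈ L²(D)` is the weak partial derivative `∂_{s 0} ⋯ ∂_{s (m-1)} u` on `D`. -/
def HasWeakDeriv (D : Set E3) {m : ℕ} (s : Fin m → Fin 3) (u v : E3 → ℝ) : Prop :=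
  MemLp v 2 (volume.restrict D) ∧
    ∀ φ : E3 → ℝ, IsTest D φ →
      ∫ x in D, u x * iteratedFDeriv ℝ m φ x (fun i => EuclideanSpace.single (s i) (1 : ℝ)) =
        (-1) ^ m * ∫ x in D, v x * φ x

/-- `u ∈ H^m(D)`: `u` and all its weak partial derivatives of order at most `m` are in `L²(D)`. -/
def MemSobolev (m : ℕ) (D : Set E3) (u : E3 → ℝ) : Prop :=
  MemLp u 2 (volume.restrict D) ∧
    ∀ j ≤ m, ∀ s : Fin j → Fin 3, ∃ v, HasWeakDeriv D s u v

open Classical in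
/-- A representative of the (almost everywhere unique) weak partial derivative of `u` on `D`. -/
def weakDeriv (D : Set E3) {m : ℕ} (s : Fin m → Fin 3) (u : E3 → ℝ) : E3 → ℝ :=
  if h : ∃ v, HasWeakDeriv D s u v then h.choose else 0

/-- The semi-norm `|u|_{m,D}`: the `L²(D)` norm of the tensor of all `m`-th order partial
derivatives. -/
def sobolevSeminorm (m : ℕ) (D : Set E3) (u : E3 → ℝ) : ℝ :=
  Real.sqrt (∑ s : Fin m → Fin 3, ∫ x in D, weakDeriv D s u x ^ 2)

/-- The trace of `u`, a function on `D`, on the surface `S ⊆ closure D` equals `g` almost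
everywhere for the surface measure (two-dimensional Hausdorff measure): for almost every `y ∈ S`
the mean over `B(y, r) ∩ D` of `|u - g y|` tends to `0` with `r`. -/
def HasTrace (D S : Set E3) (u g : E3 → ℝ) : Prop :=
  ∀ᵐ y ∂((Measure.hausdorffMeasure 2 : Measure E3).restrict S),
    Tendsto (fun r : ℝ => ⨍ x in Metric.ball y r ∩ D, |u x - g y|) (𝓝[>] 0) (𝓝 0)

/-- `-Δ u = f` in `D`, in the sense of distributions. -/
def SolvesPoissonEq (D : Set E3) (f u : E3 → ℝ) : Prop :=
  ∀ φ : E3 → ℝ, IsTest D φ → -∫ x in D, u x * (Δ φ) x = ∫ x in D, f x * φ x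

/-! ### Tetrahedral meshes -/

/-- The closed convex hull of a finite set of vertices. -/
abbrev hull (s : Finset E3) : Set E3 := convexHull ℝ (s : Set E3)

/-- A mesh of straight-edged non-degenerate tetrahedra (each given by its four vertices) satisfying
the usual compatibility condition: two elements meet in the convex hull of their common vertices,
that is, in nothing or in a common vertex, edge or face. -/
structure TetMesh where
  elems : Finset (Finset E3)
  nonempty : elems.Nonempty
  card_eq : ∀ T ∈ elems, T.card = 4
  indep : ∀ T ∈ elems, AffineIndependent ℝ ((↑) : T → E3)
  compat : ∀ S ∈ elems, ∀ T ∈ elems, hull S ∩ hull T ⊆ convexHull ℝ ((S : Set E3) ∩ (T : Set E3))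

namespace TetMesh

variable (𝒯 : TetMesh)

/-- The type of elements of the mesh. -/
abbrev Elem : Type := {T : Finset E3 // T ∈ 𝒯.elems}

/-- The closed polyhedron, union of all elements. -/
def polyhedron : Set E3 := ⋃ T ∈ 𝒯.elems, hull T

/-- `Ω_h`, the interior of the polyhedron. -/
def interiorDomain : Set E3 := interior 𝒯.polyhedron

/-- `Γ_h`, the boundary of `Ω_h`. -/
def bdry : Set E3 := frontier 𝒯.interiorDomain

/-- The mesh size `h`, the largest diameter of an element. -/
def size : ℝ := 𝒯.elems.sup' 𝒯.nonempty (fun T => Metric.diam (hull T))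

/-- `F` is a face of the element `T` contained in `Γ_h`. -/
def IsBdryFace (T F : Finset E3) : Prop := F ⊆ T ∧ F.card = 3 ∧ hull F ⊆ 𝒯.bdry

/-- `e` is an edge of the element `T` contained in `Γ_h`. -/
def IsBdryEdge (T e : Finset E3) : Prop := e ⊆ T ∧ e.card = 2 ∧ hull e ⊆ 𝒯.bdry

/-- `T ∈ 𝒮_h`: the element `T` has a face on `Γ_h`. -/
def InS (T : Finset E3) : Prop := T ∈ 𝒯.elems ∧ ∃ F, 𝒯.IsBdryFace T F

/-- `T ∈ ℛ_h`: the element `T` has no face but exactly one edge on `Γ_h`. -/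
def InR (T : Finset E3) : Prop := T ∈ 𝒯.elems ∧ (¬ ∃ F, 𝒯.IsBdryFace T F) ∧ ∃! e, 𝒯.IsBdryEdge T e

/-- Every element has at most either one edge or one face contained in `Γ_h` (the edges of
the face not being counted). -/
def AtMostOneEdgeOrFace : Prop :=
  ∀ T ∈ 𝒯.elems,
    (∃ F, 𝒯.IsBdryFace T F ∧ (∀ F', 𝒯.IsBdryFace T F' → F' = F) ∧
      ∀ e, 𝒯.IsBdryEdge T e → e ⊆ F) ∨
    ((¬ ∃ F, 𝒯.IsBdryFace T F) ∧ ∀ e e', 𝒯.IsBdryEdge T e → 𝒯.IsBdryEdge T e' → e = e')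

/-- The mesh fits `Ω`: all mesh vertices are in the closure of `Ω`, and those on the boundary of
the polyhedron are on the boundary of `Ω`. -/
def Fits (Ω : Set E3) : Prop :=
  ∀ T ∈ 𝒯.elems, ∀ v ∈ T, v ∈ closure Ω ∧ (v ∈ 𝒯.bdry → v ∈ frontier Ω)

/-- Shape regularity with parameter `σ`: every element contains a closed ball, of radius `r` say,
such that the diameter of the element is at most `σ` times the diameter `2 r` of the ball. -/
def ShapeRegular (σ : ℝ) : Prop :=
  ∀ T ∈ 𝒯.elems, ∃ (c : E3) (r : ℝ), 0 < r ∧ Metric.closedBall c r ⊆ hull T ∧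
    Metric.diam (hull T) ≤ σ * (2 * r)

end TetMesh

/-! ### Plane skins -/

/-- `m` is the unit vector in the plane of the triangle `F`, orthogonal to its edge `e` and pointing
from `e` into `F`. -/
def IsConormal (e F : Finset E3) (m : E3) : Prop :=
  ‖m‖ = 1 ∧ (∀ x ∈ e, ∀ y ∈ e, inner ℝ m (x - y) = 0) ∧
    ∃ c ∈ F, c ∉ e ∧ ∃ p ∈ affineSpan ℝ (e : Set E3), ∃ t : ℝ, 0 < t ∧ c = p + t • m

/-- A choice of the planes of the skins `δ_e`: for each edge `e` on `Γ_h` the plane contains `e` and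
is spanned by `e` and the unit vector `ν e` orthogonal to `e`.  It is close to the bisector of
any two faces on `Γ_h` that meet at `e`: as the bisector plane has normal `m₁ - m₂`, where the
`mᵢ` are the conormals of the two faces, the sine of the angle between `ν e` and this plane is
required to be at most `δ` (for `δ = 0` the plane is the bisector). -/
def IsSkinChoice (𝒯 : TetMesh) (δ : ℝ) (ν : Finset E3 → E3) : Prop :=
  ∀ T ∈ 𝒯.elems, ∀ e, 𝒯.IsBdryEdge T e →
    ‖ν e‖ = 1 ∧ (∀ x ∈ e, ∀ y ∈ e, inner ℝ (ν e) (x - y) = 0) ∧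
    ∀ T₁ ∈ 𝒯.elems, ∀ T₂ ∈ 𝒯.elems, ∀ F₁ F₂, 𝒯.IsBdryFace T₁ F₁ → 𝒯.IsBdryFace T₂ F₂ →
      e ⊆ F₁ → e ⊆ F₂ → F₁ ≠ F₂ →
      ∀ m₁ m₂, IsConormal e F₁ m₁ → IsConormal e F₂ m₂ →
        |inner ℝ (ν e) (m₁ - m₂)| ≤ δ * ‖m₁ - m₂‖

/-! ### Finite element spaces -/

/-- The Lagrangian nodes of order `k` of the simplex with vertex set `s`. -/
def lagrangeNodes (k : ℕ) (s : Finset E3) : Set E3 :=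
  {x | ∃ a : E3 → ℕ, ∑ v ∈ s, a v = k ∧ x = ∑ v ∈ s, ((a v : ℝ) / k) • v}

/-- The Lagrangian nodes of order `k` in the relative interior of the simplex with vertex set `s`. -/
def innerLagrangeNodes (k : ℕ) (s : Finset E3) : Set E3 :=
  {x | ∃ a : E3 → ℕ, ∑ v ∈ s, a v = k ∧ (∀ v ∈ s, 0 < a v) ∧
    x = ∑ v ∈ s, ((a v : ℝ) / k) • v}

/-- `P` is a point of `A` nearest to `M`. -/
def IsNearestPoint (A : Set E3) (M P : E3) : Prop :=
  P ∈ A ∧ ∀ P' ∈ A, dist M P ≤ dist M P'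

/-- Value of a polynomial in three variables at a point of space. -/
def pval (p : MvPolynomial (Fin 3) ℝ) (x : E3) : ℝ := MvPolynomial.eval (fun i => x i) p

/-- The `i`-th partial derivative of a polynomial at a point of space. -/
def pgrad (p : MvPolynomial (Fin 3) ℝ) (i : Fin 3) (x : E3) : ℝ := pval (MvPolynomial.pderiv i p) x

/-- Piecewise polynomial (possibly discontinuous) functions: one polynomial for each element. -/
abbrev Piecewise (𝒯 : TetMesh) : Type := 𝒯.Elem → MvPolynomial (Fin 3) ℝ

/-- The space `V_h` of continuous piecewise polynomials of degree at most `k` that vanish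
on `Γ_h`. -/
def MemV (𝒯 : TetMesh) (k : ℕ) (v : Piecewise 𝒯) : Prop :=
  (∀ T, (v T).totalDegree ≤ k) ∧
    ∃ φ : E3 → ℝ, ContinuousOn φ 𝒯.polyhedron ∧ (∀ x ∈ 𝒯.bdry, φ x = 0) ∧
      ∀ T : 𝒯.Elem, ∀ x ∈ hull T.1, φ x = pval (v T) x

/-- The linear manifold `W_h^g`, where `Γ` is the true boundary and `ν` gives the planes
of the skins. -/
structure MemW (𝒯 : TetMesh) (Γ : Set E3) (ν : Finset E3 → E3) (k : ℕ) (g : E3 → ℝ)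
    (w : Piecewise 𝒯) : Prop where
  degree : ∀ T, (w T).totalDegree ≤ k
  /-- `w` is single-valued at the Lagrangian nodes that are not on `Γ_h`. -/
  single_valued : ∀ S T : 𝒯.Elem, ∀ N ∈ lagrangeNodes k S.1, N ∈ lagrangeNodes k T.1 →
    N ∉ 𝒯.bdry → pval (w S) N = pval (w T) N
  /-- `w = g` at the vertices on `Γ_h` (in particular `w` is single-valued there). -/
  vertex : ∀ T : 𝒯.Elem, ∀ S ∈ T.1, S ∈ 𝒯.bdry → pval (w T) S = g S
  /-- `w = g` at the points of `Γ` associated with the nodes `M` in the interior of a face `F` on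
  `Γ_h`: nearest to `M` on the line through `M` and the vertex `O` opposite to `F`. -/
  face : ∀ T : 𝒯.Elem, 𝒯.InS T.1 → ∀ F, 𝒯.IsBdryFace T.1 F → ∀ O ∈ T.1, O ∉ F →
    ∀ M ∈ innerLagrangeNodes k F, ∀ P, IsNearestPoint (Γ ∩ line[ℝ, O, M]) M P → pval (w T) P = g P
  /-- `w = g` at the points of `Γ` associated with the nodes `M` in the interior of an edge `e` on
  `Γ_h`: nearest to `M` on the line through `M` orthogonal to `e` in the plane of the skin. -/
  edge : ∀ T : 𝒯.Elem, (𝒯.InS T.1 ∨ 𝒯.InR T.1) → ∀ e, 𝒯.IsBdryEdge T.1 e →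
    ∀ M ∈ innerLagrangeNodes k e, ∀ Q,
      IsNearestPoint (Γ ∩ {x | ∃ t : ℝ, x = M + t • ν e}) M Q → pval (w T) Q = g Q

/-- The bilinear form `a_h(w, v) = ∫_{Ω_h} grad_h w · grad v`, summed over the elements. -/
def bilin (𝒯 : TetMesh) (w v : Piecewise 𝒯) : ℝ :=
  ∑ T : 𝒯.Elem, ∫ x in hull T.1, ∑ i : Fin 3, pgrad (w T) i x * pgrad (v T) i x

/-- The linear form `v ↦ ∫_{Ω_h} f v`, summed over the elements. -/
def load (𝒯 : TetMesh) (f : E3 → ℝ) (v : Piecewise 𝒯) : ℝ :=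
  ∑ T : 𝒯.Elem, ∫ x in hull T.1, f x * pval (v T) x

/-- `w` solves the approximate problem with right-hand side `f` and boundary datum `g`. -/
def IsDiscreteSolution (𝒯 : TetMesh) (Γ : Set E3) (ν : Finset E3 → E3) (k : ℕ) (f g : E3 → ℝ)
    (w : Piecewise 𝒯) : Prop :=
  MemW 𝒯 Γ ν k g w ∧ ∀ v, MemV 𝒯 k v → bilin 𝒯 w v = load 𝒯 f v

/-- The error `‖grad_h (u - w)‖` in `L²(Ω ∩ Ω_h)`, where `grad u` is the weak gradient on `Ω`;
the elements cover `Ω_h` and overlap in null sets only. -/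
def gradError (𝒯 : TetMesh) (Ω : Set E3) (u : E3 → ℝ) (w : Piecewise 𝒯) : ℝ :=
  Real.sqrt (∑ T : 𝒯.Elem, ∫ x in Ω ∩ hull T.1,
    ∑ i : Fin 3, (weakDeriv Ω (fun _ : Fin 1 => i) u x - pgrad (w T) i x) ^ 2)

end CurvedFEM

end

open CurvedFEM

open MeasureTheory Set Filter Topology
open scoped ContDiff Laplacian

noncomputable section

namespace CurvedFEM

/-! ### Polynomials as functions -/

/-! The extension `u'` satisfies the discrete equations exactly. A function of V_h extended by zero
is Lipschitz and supported in the polyhedron, which for small h lies in Ω', so it is admissible in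
the weak form of the Poisson equation (`SolvesPoissonEq.sum_integral_pgrad_eq_load`). There is no
consistency error, and the estimate reduces to two facts: stability of a discrete problem whose
trial and test spaces differ, and a good interpolant of `u'` in W_h^g.

Both rest on the position of the boundary interpolation points. A compact C¹ surface is uniformly
flat at small scales (`exists_flatAt`), so a line through a node M of Γ_h that is transversal to Γ
meets Γ near M in exactly one point (`FlatAt.exists_nearest`). Lines towards the opposite vertex of
a face are transversal by shape regularity. At a boundary edge a parity count yields two boundary
faces (`TetMesh.exists_two_bdry_faces`). They belong to different elements and are almost tangent to
Γ. Hence they are almost opposite, since otherwise the two elements would overlap, and their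
bisector plane is almost normal to Γ (`skin_transversal`). So for small h every interpolation point
is within θ diam T of its Lagrangian node, with θ as small as desired (`exists_modifiedNodes`).

Inverse inequalities make interpolation at such points stable. If w is in W_h^0 and v in V_h has the
same values at the interior nodes, then v vanishes at each node of Γ_h and w at a point within θ
diam T of it, so that grad_h (w - v) is O(θ) times grad_h w and a_h(w, v) ≥ ½ ‖grad_h w‖²
(`StableNodes.le_bilin`). Unique solvability follows by linear algebra (`StableNodes.existsUnique`),
and quasi-optimality by Young's inequality (`StableNodes.errSq_le`).

The continuous representative of `u'` equals g at every point of Γ (`eq_of_hasTrace`), so its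
interpolant at the modified nodes belongs to W_h^g. The interpolation error on an element is bounded
by averaging Taylor polynomials over a ball (`taylor_mean`), for mollifications of `u'` and then in
the limit (`exists_interp_error_limit`). The local bounds are added up by comparing volumes of
disjoint balls (`sum_mul_setIntegral_le`). -/

/-- Polynomials of total degree at most `k`. -/
abbrev Pk (k : ℕ) : Submodule ℝ (MvPolynomial (Fin 3) ℝ) :=
  MvPolynomial.restrictTotalDegree (Fin 3) ℝ k

lemma mem_Pk {k : ℕ} {p : MvPolynomial (Fin 3) ℝ} : p ∈ Pk k ↔ p.totalDegree ≤ k :=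
  MvPolynomial.mem_restrictTotalDegree _ _ _

section pval

variable (p q : MvPolynomial (Fin 3) ℝ) (x : E3) (a : ℝ) (i : Fin 3)

@[simp] lemma pval_add : pval (p + q) x = pval p x + pval q x := by simp [pval]
@[simp] lemma pval_sub : pval (p - q) x = pval p x - pval q x := by simp [pval]
@[simp] lemma pval_mul : pval (p * q) x = pval p x * pval q x := by simp [pval]
@[simp] lemma pval_smul : pval (a • p) x = a * pval p x := by simp [pval]
@[simp] lemma pval_one : pval 1 x = 1 := by simp [pval]
@[simp] lemma pval_zero : pval 0 x = 0 := by simp [pval]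
@[simp] lemma pval_C : pval (MvPolynomial.C a) x = a := by simp [pval]
@[simp] lemma pval_X : pval (MvPolynomial.X i) x = x i := by simp [pval]
@[simp] lemma pval_sum {ι : Type*} (s : Finset ι) (f : ι → MvPolynomial (Fin 3) ℝ) :
    pval (∑ j ∈ s, f j) x = ∑ j ∈ s, pval (f j) x := by simp [pval]
@[simp] lemma pval_prod {ι : Type*} (s : Finset ι) (f : ι → MvPolynomial (Fin 3) ℝ) :
    pval (∏ j ∈ s, f j) x = ∏ j ∈ s, pval (f j) x := by simp [pval]
@[simp] lemma pgrad_add : pgrad (p + q) i x = pgrad p i x + pgrad q i x := by simp [pgrad]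
@[simp] lemma pgrad_sub : pgrad (p - q) i x = pgrad p i x - pgrad q i x := by simp [pgrad]
@[simp] lemma pgrad_smul : pgrad (a • p) i x = a * pgrad p i x := by simp [pgrad]
@[simp] lemma pgrad_sum {ι : Type*} (s : Finset ι) (f : ι → MvPolynomial (Fin 3) ℝ) :
    pgrad (∑ j ∈ s, f j) i x = ∑ j ∈ s, pgrad (f j) i x := by simp [pgrad]

lemma hasFDerivAt_pval : HasFDerivAt (pval p)
    (∑ i, pgrad p i x • (EuclideanSpace.proj i : E3 →L[ℝ] ℝ)) x := by
  induction p using MvPolynomial.induction_on with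
  | C a =>
    have : pval (MvPolynomial.C a) = fun _ => a := by ext; simp
    rw [this]
    simpa [pgrad] using hasFDerivAt_const a x
  | add p q hp hq =>
    have : pval (p + q) = fun y => pval p y + pval q y := by ext; simp
    rw [this]
    convert! hp.add hq using 1
    simp [add_smul, Finset.sum_add_distrib]
  | mul_X p j hp =>
    have : pval (p * MvPolynomial.X j) = fun y => pval p y * (EuclideanSpace.proj j : E3 →L[ℝ] ℝ) y := by
      ext; simp
    rw [this]
    convert! hp.mul (EuclideanSpace.proj j : E3 →L[ℝ] ℝ).hasFDerivAt using 1
    ext v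
    simp only [pgrad, Derivation.leibniz, MvPolynomial.pderiv_X, smul_eq_mul, pval_add, pval_mul,
      pval_X, add_smul, Finset.sum_add_distrib, add_apply, smul_apply, Fin.sum_univ_three]
    fin_cases j <;> simp <;> ring

lemma contDiff_pval {n : WithTop ℕ∞} : ContDiff ℝ n (pval p) := by
  induction p using MvPolynomial.induction_on with
  | C a =>
    have : pval (MvPolynomial.C a) = fun _ => a := by ext; simp
    rw [this]
    exact contDiff_const
  | add p q hp hq =>
    have : pval (p + q) = fun y => pval p y + pval q y := by ext; simp
    rw [this]
    exact hp.add hq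
  | mul_X p j hp =>
    have : pval (p * MvPolynomial.X j) = fun y => pval p y * (EuclideanSpace.proj j : E3 →L[ℝ] ℝ) y := by
      ext; simp
    rw [this]
    exact hp.mul (ContinuousLinearMap.contDiff _)

lemma continuous_pval : Continuous (pval p) := (contDiff_pval p (n := 0)).continuous

lemma continuous_pgrad : Continuous (pgrad p i) := continuous_pval _

lemma fderiv_pval_single : fderiv ℝ (pval p) x (EuclideanSpace.single i (1 : ℝ)) = pgrad p i x := by
  rw [(hasFDerivAt_pval p x).fderiv]
  simp

lemma pderiv_mem_Pk {k : ℕ} {p : MvPolynomial (Fin 3) ℝ} (hp : p ∈ Pk k) (i : Fin 3) :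
    MvPolynomial.pderiv i p ∈ Pk k := by
  rw [mem_Pk] at *
  rw [MvPolynomial.totalDegree, Finset.sup_le_iff]
  intro m hm
  have h := MvPolynomial.le_totalDegree (p := p) (s := m + Finsupp.single i 1) (by
    rw [MvPolynomial.mem_support_iff] at hm ⊢
    rw [MvPolynomial.coeff_pderiv] at hm
    exact fun h => hm (by simp [h]))
  rw [Finsupp.sum_add_index' (by simp) (by simp)] at h
  lia

end pval

/-- Substituting affine polynomials for the variables does not raise the degree. This reduces
inequalities on arbitrary balls to the unit ball, where one finite-dimensional space serves for all
elements. -/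
lemma exists_comp_homothety {k : ℕ} {p : MvPolynomial (Fin 3) ℝ} (hp : p ∈ Pk k) (c : E3) (r : ℝ) :
    ∃ q ∈ Pk k, ∀ x, pval q x = pval p (c + r • x) := by
  refine ⟨MvPolynomial.bind₁ (fun i => MvPolynomial.C (c i) + MvPolynomial.C r * MvPolynomial.X i) p,
    ?_, fun x => ?_⟩
  · rw [mem_Pk] at *
    rw [MvPolynomial.bind₁, MvPolynomial.aeval_def, MvPolynomial.eval₂_eq]
    refine (MvPolynomial.totalDegree_finsetSum_le fun m hm => ?_)
    refine (MvPolynomial.totalDegree_mul _ _).trans ?_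
    have h1 : (algebraMap ℝ (MvPolynomial (Fin 3) ℝ) (MvPolynomial.coeff m p)).totalDegree = 0 := by
      simp [MvPolynomial.algebraMap_eq]
    rw [h1, zero_add]
    refine (MvPolynomial.totalDegree_finsetProd _ _).trans ?_
    refine le_trans (Finset.sum_le_sum (g := fun i => m i) fun i _ => ?_)
      ((MvPolynomial.le_totalDegree hm).trans hp)
    refine (MvPolynomial.totalDegree_pow _ _).trans ?_
    have : (MvPolynomial.C (c i) + MvPolynomial.C r * MvPolynomial.X i :
        MvPolynomial (Fin 3) ℝ).totalDegree ≤ 1 := by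
      refine (MvPolynomial.totalDegree_add _ _).trans (max_le (by simp) ?_)
      refine (MvPolynomial.totalDegree_mul _ _).trans ?_
      simp
    calc m i * _ ≤ m i * 1 := Nat.mul_le_mul_left _ this
      _ = m i := mul_one _
  · rw [pval, MvPolynomial.eval, MvPolynomial.eval₂Hom_bind₁]
    simp only [map_add, map_mul, MvPolynomial.eval₂Hom_C, MvPolynomial.eval₂Hom_X', RingHom.id_apply,
      pval, MvPolynomial.eval, PiLp.add_apply, PiLp.smul_apply, smul_eq_mul]

lemma pgrad_comp_homothety {p q : MvPolynomial (Fin 3) ℝ} {c : E3} {r : ℝ}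
    (h : ∀ x, pval q x = pval p (c + r • x)) (i : Fin 3) (x : E3) :
    pgrad q i x = r * pgrad p i (c + r • x) := by
  have h1 : pval q = fun x => pval p (c + r • x) := funext h
  have h2 : HasFDerivAt (fun x : E3 => c + r • x) (r • ContinuousLinearMap.id ℝ E3) x :=
    ((hasFDerivAt_id x).const_smul r).const_add c
  rw [← fderiv_pval_single, h1]
  change fderiv ℝ (pval p ∘ fun x => c + r • x) x _ = _
  rw [((hasFDerivAt_pval p (c + r • x)).comp x h2).fderiv]
  simp [mul_comm]

/-- The ball contains the cube [0, 1/2]³, and a polynomial vanishing on a product of infinite sets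
is zero. -/
lemma eq_zero_of_pval_eq_zero {p : MvPolynomial (Fin 3) ℝ}
    (h : ∀ x ∈ Metric.ball (0 : E3) 1, pval p x = 0) : p = 0 := by
  refine MvPolynomial.funext_set (fun _ => Set.Icc (0 : ℝ) (1 / 2))
    (fun _ => Set.Icc_infinite (by norm_num)) fun x hx => ?_
  have hx' : ∀ i, 0 ≤ x i ∧ x i ≤ 1 / 2 := fun i => hx i (mem_univ i)
  have := h (WithLp.toLp 2 x) (by
    rw [mem_ball_zero_iff, EuclideanSpace.norm_eq, Real.sqrt_lt' one_pos, Fin.sum_univ_three]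
    simp only [Real.norm_eq_abs, sq_abs]
    nlinarith [hx' 0, hx' 1, hx' 2])
  simpa [pval] using this

lemma setIntegral_closedBall_comp_homothety (f : E3 → ℝ) (c : E3) {r : ℝ} (hr : 0 < r) :
    r ^ 3 * ∫ x in Metric.closedBall (0 : E3) 1, f (c + r • x) = ∫ x in Metric.closedBall c r, f x := by
  have h1 := Measure.setIntegral_comp_smul_of_pos (volume : Measure E3) (fun x => f (c + x))
    (Metric.closedBall (0 : E3) 1) hr
  rw [h1, finrank_euclideanSpace_fin, smul_closedBall _ _ zero_le_one, smul_zero,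
    Real.norm_of_nonneg hr.le, mul_one, smul_eq_mul, ← mul_assoc,
    mul_inv_cancel₀ (pow_ne_zero _ hr.ne'), one_mul]
  have h2 : (fun x => c + x) ⁻¹' Metric.closedBall c r = Metric.closedBall (0 : E3) r := by
    ext x; simp
  rw [← h2]
  exact (measurePreserving_add_left volume c).setIntegral_preimage_emb
    (measurableEmbedding_addLeft c) f _

/-! ### Norm equivalence on polynomials and inverse inequalities. -/

lemma exists_bound_linearMap_of_core {V : Type*} [AddCommGroup V] [Module ℝ V]
    [FiniteDimensional ℝ V] (core : InnerProductSpace.Core ℝ V) (f : V →ₗ[ℝ] ℝ) :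
    ∃ C : ℝ, 0 ≤ C ∧ ∀ p : V, (f p) ^ 2 ≤ C * core.inner p p := by
  let _ : NormedAddCommGroup V := core.toNormedAddCommGroup
  let _ : InnerProductSpace ℝ V := InnerProductSpace.ofCore core.toCore
  refine ⟨‖f.toContinuousLinearMap‖ ^ 2, by positivity, fun p => ?_⟩
  have h3 : ‖p‖ ^ 2 = core.inner p p := (real_inner_self_eq_norm_sq p).symm
  rw [← h3, ← mul_pow, ← sq_abs]
  exact pow_le_pow_left₀ (abs_nonneg _) (f.toContinuousLinearMap.le_opNorm p) 2

/-- Continuity of linear functionals on polynomials with respect to the `L²` norm of the ball. -/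
lemma exists_bound_linear_functional (k : ℕ) (f : Pk k →ₗ[ℝ] ℝ) : ∃ C : ℝ, 0 ≤ C ∧
    ∀ p : Pk k, (f p) ^ 2 ≤ C * ∫ y in Metric.closedBall (0 : E3) 1, pval p y ^ 2 := by
  have hint : ∀ p q : MvPolynomial (Fin 3) ℝ,
      IntegrableOn (fun y => pval p y * pval q y) (Metric.closedBall (0 : E3) 1) := fun p q =>
    ((continuous_pval p).mul (continuous_pval q)).continuousOn.integrableOn_compact
      (isCompact_closedBall _ _)
  let core : InnerProductSpace.Core ℝ (Pk k) :=
    { inner := fun p q => ∫ y in Metric.closedBall (0 : E3) 1, pval p y * pval q y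
      conj_inner_symm := fun p q => by simp [mul_comm]
      re_inner_nonneg := fun p => by
        simp only [RCLike.re_to_real]
        exact integral_nonneg fun y => mul_self_nonneg _
      add_left := fun p q r => by
        simp only [Submodule.coe_add, pval_add, add_mul]
        exact integral_add (hint _ _) (hint _ _)
      smul_left := fun p q r => by
        simp [mul_assoc, integral_const_mul]
      definite := fun p hp => by
        have h1 := (setIntegral_eq_zero_iff_of_nonneg_ae
          (Filter.Eventually.of_forall fun y => mul_self_nonneg (pval p y)) (hint p p)).1 hp
        have h2 : EqOn (fun y => pval p y * pval p y) 0 (Metric.ball (0 : E3) 1) := by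
          refine Measure.eqOn_open_of_ae_eq (μ := volume) ?_ Metric.isOpen_ball
            ((continuous_pval _).mul (continuous_pval _)).continuousOn continuousOn_const
          exact ae_mono (Measure.restrict_mono Metric.ball_subset_closedBall le_rfl) h1
        refine Subtype.ext (eq_zero_of_pval_eq_zero fun x hx => ?_)
        simpa using h2 hx }
  obtain ⟨C, hC, h⟩ := exists_bound_linearMap_of_core core f
  refine ⟨C, hC, fun p => (h p).trans_eq ?_⟩
  simp only [pow_two]
  rfl

lemma pval_eq_sum_coord {ι : Type*} [Fintype ι] {k : ℕ} (b : Module.Basis ι ℝ (Pk k)) (p : Pk k)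
    (x : E3) : pval p x = ∑ i, b.coord i p * pval (b i) x := by
  have h := congrArg (fun q : Pk k => pval q x) (b.sum_repr p)
  simp only [Submodule.coe_sum, Submodule.coe_smul, pval_sum, pval_smul] at h
  exact h.symm

lemma pgrad_eq_sum_coord {ι : Type*} [Fintype ι] {k : ℕ} (b : Module.Basis ι ℝ (Pk k)) (p : Pk k)
    (j : Fin 3) (x : E3) : pgrad p j x = ∑ i, b.coord i p * pgrad (b i) j x := by
  have h := congrArg (fun q : Pk k => pgrad q j x) (b.sum_repr p)
  simp only [Submodule.coe_sum, Submodule.coe_smul, pgrad_sum, pgrad_smul] at h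
  exact h.symm

/-- Expansion in a basis: the L² norm bounds the coordinates, compactness bounds the basis
functions. R may exceed 1, so values outside the unit ball are controlled as well. -/
lemma exists_bound_pval (k : ℕ) (R : ℝ) : ∃ C : ℝ, 0 < C ∧ ∀ p ∈ Pk k,
    ∀ x ∈ Metric.closedBall (0 : E3) R,
      pval p x ^ 2 ≤ C * ∫ y in Metric.closedBall (0 : E3) 1, pval p y ^ 2 := by
  set b := Module.finBasis ℝ (Pk k)
  choose D hD0 hD using fun i => exists_bound_linear_functional k (b.coord i)
  have hM : ∀ i, ∃ M, ∀ x ∈ Metric.closedBall (0 : E3) R, ‖pval (b i) x‖ ≤ M := fun i =>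
    (isCompact_closedBall _ _).exists_bound_of_continuousOn (continuous_pval _).continuousOn
  choose M hM using hM
  refine ⟨1 + (∑ i, D i) * ∑ i, M i ^ 2, by
    have : 0 ≤ ∑ i, D i := Finset.sum_nonneg fun i _ => hD0 i
    positivity, fun p hp x hx => ?_⟩
  have h1 : pval p x = ∑ i, b.coord i ⟨p, hp⟩ * pval (b i) x := pval_eq_sum_coord b ⟨p, hp⟩ x
  have hI : 0 ≤ ∫ y in Metric.closedBall (0 : E3) 1, pval p y ^ 2 :=
    integral_nonneg fun y => sq_nonneg _
  rw [h1]
  refine (Finset.sum_mul_sq_le_sq_mul_sq _ _ _).trans ?_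
  calc (∑ i, b.coord i ⟨p, hp⟩ ^ 2) * ∑ i, pval (b i) x ^ 2
      ≤ (∑ i, D i * ∫ y in Metric.closedBall (0 : E3) 1, pval p y ^ 2) * ∑ i, M i ^ 2 := by
        refine mul_le_mul (Finset.sum_le_sum fun i _ => hD i ⟨p, hp⟩)
          (Finset.sum_le_sum fun i _ => ?_) (Finset.sum_nonneg fun i _ => sq_nonneg _)
          (Finset.sum_nonneg fun i _ => mul_nonneg (hD0 i) hI)
        rw [← sq_abs]
        exact pow_le_pow_left₀ (abs_nonneg _) (hM i x hx) 2
    _ = ((∑ i, D i) * ∑ i, M i ^ 2) * ∫ y in Metric.closedBall (0 : E3) 1, pval p y ^ 2 := by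
        rw [← Finset.sum_mul]; ring
    _ ≤ _ := mul_le_mul_of_nonneg_right (by linarith) hI

/-- Differentiation maps `Pk k` into itself and is bounded in L² of the unit ball, again by
expansion in a basis; the pointwise bound of values then applies to the derivative. -/
lemma exists_bound_pgrad_unit (k : ℕ) (R : ℝ) : ∃ C : ℝ, 0 < C ∧ ∀ p ∈ Pk k, ∀ i,
    ∀ x ∈ Metric.closedBall (0 : E3) R,
      pgrad p i x ^ 2 ≤ C * ∫ y in Metric.closedBall (0 : E3) 1, pval p y ^ 2 := by
  obtain ⟨C, hC, h⟩ := exists_bound_pval k R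
  have key : ∀ i, ∃ D : ℝ, 0 ≤ D ∧ ∀ p : Pk k,
      ∫ y in Metric.closedBall (0 : E3) 1, pgrad p i y ^ 2 ≤
        D * ∫ y in Metric.closedBall (0 : E3) 1, pval p y ^ 2 := fun i => by
    set b := Module.finBasis ℝ (Pk k)
    choose D hD0 hD using fun j => exists_bound_linear_functional k (b.coord j)
    have hint : ∀ q : MvPolynomial (Fin 3) ℝ,
        IntegrableOn (fun y => pgrad q i y ^ 2) (Metric.closedBall (0 : E3) 1) := fun q =>
      ((continuous_pgrad q i).pow 2).continuousOn.integrableOn_compact (isCompact_closedBall _ _)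
    refine ⟨(∑ j, D j) * ∑ j, ∫ y in Metric.closedBall (0 : E3) 1, pgrad (b j) i y ^ 2,
      mul_nonneg (Finset.sum_nonneg fun j _ => hD0 j)
        (Finset.sum_nonneg fun j _ => integral_nonneg fun y => sq_nonneg _), fun p => ?_⟩
    have h1 : ∀ y, pgrad p i y ^ 2 ≤ (∑ j, b.coord j p ^ 2) * ∑ j, pgrad (b j) i y ^ 2 := fun y => by
      rw [pgrad_eq_sum_coord b]
      exact Finset.sum_mul_sq_le_sq_mul_sq _ _ _
    have hs : IntegrableOn (fun y => ∑ j, pgrad (b j) i y ^ 2) (Metric.closedBall (0 : E3) 1) :=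
      integrable_finsetSum _ fun j _ => hint _
    calc _ ≤ ∫ y in Metric.closedBall (0 : E3) 1,
          (∑ j, b.coord j p ^ 2) * ∑ j, pgrad (b j) i y ^ 2 :=
          integral_mono (hint _) (hs.const_mul _) h1
      _ = (∑ j, b.coord j p ^ 2) * ∑ j, ∫ y in Metric.closedBall (0 : E3) 1, pgrad (b j) i y ^ 2 := by
          rw [integral_const_mul, integral_finsetSum _ fun j _ => hint _]
      _ ≤ (∑ j, D j * ∫ y in Metric.closedBall (0 : E3) 1, pval p y ^ 2) * _ :=
          mul_le_mul_of_nonneg_right (Finset.sum_le_sum fun j _ => hD j p)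
            (Finset.sum_nonneg fun j _ => integral_nonneg fun y => sq_nonneg _)
      _ = _ := by rw [← Finset.sum_mul]; ring
  choose D hD0 hD using key
  refine ⟨C * (1 + ∑ i, D i), by
    have : 0 ≤ ∑ i, D i := Finset.sum_nonneg fun i _ => hD0 i
    positivity, fun p hp i x hx => ?_⟩
  have hI : 0 ≤ ∫ y in Metric.closedBall (0 : E3) 1, pval p y ^ 2 :=
    integral_nonneg fun y => sq_nonneg _
  have h2 := h _ (pderiv_mem_Pk hp i) x hx
  have h3 : D i ≤ 1 + ∑ i, D i := by
    have := Finset.single_le_sum (fun i _ => hD0 i) (Finset.mem_univ i)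
    linarith
  calc _ ≤ _ := h2
    _ ≤ C * ((1 + ∑ i, D i) * ∫ y in Metric.closedBall (0 : E3) 1, pval p y ^ 2) :=
        mul_le_mul_of_nonneg_left ((hD i ⟨p, hp⟩).trans (mul_le_mul_of_nonneg_right h3 hI)) hC.le
    _ = _ := by ring

/-- Inverse inequality: bound of the values of a polynomial by its `L²` norm on a ball. -/
lemma exists_inverse_pval (k : ℕ) (R : ℝ) : ∃ C : ℝ, 0 < C ∧ ∀ p ∈ Pk k, ∀ (c : E3) (r : ℝ), 0 < r →
    ∀ x ∈ Metric.closedBall c (R * r),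
      pval p x ^ 2 * r ^ 3 ≤ C * ∫ y in Metric.closedBall c r, pval p y ^ 2 := by
  obtain ⟨C, hC, h⟩ := exists_bound_pval k R
  refine ⟨C, hC, fun p hp c r hr x hx => ?_⟩
  obtain ⟨q, hq, hqp⟩ := exists_comp_homothety hp c r
  have h1 := h q hq (r⁻¹ • (x - c)) (by
    rw [mem_closedBall_zero_iff, norm_smul, norm_inv, Real.norm_of_nonneg hr.le,
      inv_mul_le_iff₀ hr, mul_comm, ← dist_eq_norm]
    exact hx)
  rw [hqp, smul_inv_smul₀ hr.ne', add_sub_cancel] at h1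
  simp only [hqp] at h1
  rw [← setIntegral_closedBall_comp_homothety (fun y => pval p y ^ 2) c hr]
  nlinarith [pow_pos hr 3]

/-- Inverse inequality: bound of the gradient of a polynomial by its `L²` norm on a ball. -/
lemma exists_inverse_pgrad (k : ℕ) (R : ℝ) : ∃ C : ℝ, 0 < C ∧ ∀ p ∈ Pk k, ∀ (c : E3) (r : ℝ), 0 < r →
    ∀ i, ∀ x ∈ Metric.closedBall c (R * r),
      pgrad p i x ^ 2 * r ^ 5 ≤ C * ∫ y in Metric.closedBall c r, pval p y ^ 2 := by
  obtain ⟨C, hC, h⟩ := exists_bound_pgrad_unit k R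
  refine ⟨C, hC, fun p hp c r hr i x hx => ?_⟩
  obtain ⟨q, hq, hqp⟩ := exists_comp_homothety hp c r
  have h1 := h q hq i (r⁻¹ • (x - c)) (by
    rw [mem_closedBall_zero_iff, norm_smul, norm_inv, Real.norm_of_nonneg hr.le,
      inv_mul_le_iff₀ hr, mul_comm, ← dist_eq_norm]
    exact hx)
  -- The chain rule contributes r², which turns the volume factor r³ into r⁵.
  rw [pgrad_comp_homothety hqp, smul_inv_smul₀ hr.ne', add_sub_cancel] at h1
  simp only [hqp] at h1
  rw [← setIntegral_closedBall_comp_homothety (fun y => pval p y ^ 2) c hr]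
  nlinarith [pow_pos hr 3]

/-! ### Barycentric coordinates and the Lagrange basis of a tetrahedron -/

/-- `T` is the vertex set of a non-degenerate tetrahedron. -/
structure IsTet (T : Finset E3) : Prop where
  card_eq : T.card = 4
  indep : AffineIndependent ℝ ((↑) : T → E3)

lemma TetMesh.isTet {𝒯 : TetMesh} {T : Finset E3} (hT : T ∈ 𝒯.elems) : IsTet T :=
  ⟨𝒯.card_eq T hT, 𝒯.indep T hT⟩

/-- The vertices of a tetrahedron as an affine basis of the space. -/
def IsTet.basis {T : Finset E3} (hT : IsTet T) : AffineBasis T ℝ E3 :=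
  ⟨(↑), hT.indep, by
    rw [hT.indep.affineSpan_eq_top_iff_card_eq_finrank_add_one, finrank_euclideanSpace_fin,
      Fintype.card_coe, hT.card_eq]⟩

open Classical in
/-- The barycentric coordinate of the tetrahedron `T` attached to the vertex `v`. -/
def bary (T : Finset E3) (v : E3) : E3 →ᵃ[ℝ] ℝ :=
  if h : IsTet T ∧ v ∈ T then h.1.basis.coord ⟨v, h.2⟩ else 0

namespace IsTet

variable {T : Finset E3} (hT : IsTet T)
include hT

lemma bary_eq {v : E3} (hv : v ∈ T) : bary T v = hT.basis.coord ⟨v, hv⟩ := by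
  simp [bary, hT, hv]

lemma bary_self {v : E3} (hv : v ∈ T) : bary T v v = 1 := by
  rw [hT.bary_eq hv]
  exact hT.basis.coord_apply_eq ⟨v, hv⟩

lemma bary_of_ne {v w : E3} (hv : v ∈ T) (hw : w ∈ T) (h : v ≠ w) : bary T v w = 0 := by
  rw [hT.bary_eq hv]
  exact hT.basis.coord_apply_ne (i := ⟨v, hv⟩) (j := ⟨w, hw⟩) (by simpa using h)

lemma sum_bary (x : E3) : ∑ v ∈ T, bary T v x = 1 := by
  rw [← hT.basis.sum_coord_apply_eq_one x, ← Finset.sum_attach]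
  exact Finset.sum_congr rfl fun v _ => by rw [hT.bary_eq v.2]

lemma sum_bary_smul (x : E3) : ∑ v ∈ T, bary T v x • v = x := by
  conv_rhs => rw [← hT.basis.linear_combination_coord_eq_self x]
  rw [← Finset.sum_attach]
  exact Finset.sum_congr rfl fun v _ => by rw [hT.bary_eq v.2]; rfl

lemma bary_eq_of_sum {a : E3 → ℝ} (h1 : ∑ v ∈ T, a v = 1) {v : E3} (hv : v ∈ T) :
    bary T v (∑ w ∈ T, a w • w) = a v := by
  have h2 := Finset.affineCombination_eq_linear_combination T (fun w => w) a h1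
  rw [← h2, Finset.map_affineCombination _ _ _ h1,
    Finset.affineCombination_eq_linear_combination _ _ _ h1, Finset.sum_eq_single v]
  · simp [hT.bary_self hv]
  · intro w hw hwv
    simp [hT.bary_of_ne hv hw hwv.symm]
  · exact fun h => absurd hv h

lemma range_basis : range hT.basis = (T : Set E3) := Subtype.range_coe

lemma mem_hull_iff {x : E3} : x ∈ hull T ↔ ∀ v ∈ T, 0 ≤ bary T v x := by
  have h := hT.basis.convexHull_eq_nonneg_coord
  rw [hT.range_basis] at h
  rw [hull, h]
  exact ⟨fun h v hv => by rw [hT.bary_eq hv]; exact h ⟨v, hv⟩,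
    fun h v => by rw [← hT.bary_eq v.2]; exact h v v.2⟩

lemma mem_interior_iff {x : E3} : x ∈ interior (hull T) ↔ ∀ v ∈ T, 0 < bary T v x := by
  have h := hT.basis.interior_convexHull
  rw [hT.range_basis] at h
  rw [hull, h]
  exact ⟨fun h v hv => by rw [hT.bary_eq hv]; exact h ⟨v, hv⟩,
    fun h v => by rw [← hT.bary_eq v.2]; exact h v v.2⟩

lemma affine_apply (f : E3 →ᵃ[ℝ] ℝ) (x : E3) : f x = ∑ v ∈ T, bary T v x * f v := by
  have h1 := hT.sum_bary x
  conv_lhs => rw [← hT.sum_bary_smul x]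
  rw [← Finset.affineCombination_eq_linear_combination T (fun w => w) _ h1,
    Finset.map_affineCombination _ _ _ h1,
    Finset.affineCombination_eq_linear_combination _ _ _ h1]
  simp

end IsTet

lemma continuous_bary (T : Finset E3) (v : E3) : Continuous (bary T v) :=
  (bary T v).continuous_of_finiteDimensional

lemma bary_add (T : Finset E3) (v x y : E3) : bary T v (x + y) = bary T v x + (bary T v).linear y := by
  rw [add_comm x y, ← vadd_eq_add, AffineMap.map_vadd, vadd_eq_add, add_comm]

lemma bary_sub (T : Finset E3) (v x y : E3) :
    (bary T v).linear (x - y) = bary T v x - bary T v y := by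
  rw [← vsub_eq_sub x y, AffineMap.linearMap_vsub, vsub_eq_sub]

lemma IsTet.bary_nonneg {T : Finset E3} (hT : IsTet T) {v x : E3} (hv : v ∈ T) (hx : x ∈ hull T) :
    0 ≤ bary T v x := hT.mem_hull_iff.1 hx v hv

lemma IsTet.bary_le_one {T : Finset E3} (hT : IsTet T) {v x : E3} (hv : v ∈ T) (hx : x ∈ hull T) :
    bary T v x ≤ 1 := by
  rw [← hT.sum_bary x]
  exact Finset.single_le_sum (f := fun v => bary T v x) (fun w hw => hT.bary_nonneg hw hx) hv

/-- The gradient of a barycentric coordinate is controlled by the inscribed ball. -/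
lemma IsTet.abs_linear_bary_le {T : Finset E3} (hT : IsTet T) {c : E3} {r : ℝ} (hr : 0 < r)
    (hB : Metric.closedBall c r ⊆ hull T) {v : E3} (hv : v ∈ T) (η : E3) :
    2 * r * |(bary T v).linear η| ≤ ‖η‖ := by
  rcases eq_or_ne η 0 with rfl | hη
  · simp
  have hn : 0 < ‖η‖ := norm_pos_iff.2 hη
  -- The two ends of the diameter of the ball in direction η lie in T, where the coordinate has
  -- values in [0, 1]; hence it varies by at most 1 between them.
  have hmem : ∀ s : ℝ, |s| = r → c + (s / ‖η‖) • η ∈ hull T := fun s hs => hB (by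
    rw [Metric.mem_closedBall, dist_eq_norm, add_sub_cancel_left, norm_smul, Real.norm_eq_abs,
      abs_div, abs_norm, div_mul_cancel₀ _ hn.ne', hs])
  have h1 := hmem r (abs_of_pos hr)
  have h2 := hmem (-r) (by rw [abs_neg, abs_of_pos hr])
  have e1 := hT.bary_nonneg hv h1
  have e2 := hT.bary_nonneg hv h2
  have e3 := hT.bary_le_one hv h1
  have e4 := hT.bary_le_one hv h2
  rw [bary_add, map_smul, smul_eq_mul] at e1 e2 e3 e4
  have h3 : |2 * (r / ‖η‖) * (bary T v).linear η| ≤ 1 := by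
    rw [neg_div] at e2 e4
    rw [abs_le]
    constructor <;> linarith
  rw [abs_mul, abs_of_pos (by positivity)] at h3
  calc 2 * r * |(bary T v).linear η| = (2 * (r / ‖η‖) * |(bary T v).linear η|) * ‖η‖ := by field_simp
    _ ≤ 1 * ‖η‖ := by gcongr
    _ = ‖η‖ := one_mul _

/-- The barycentric coordinate as a polynomial. -/
def baryPoly (T : Finset E3) (v : E3) : MvPolynomial (Fin 3) ℝ :=
  MvPolynomial.C (bary T v 0) +
    ∑ i, MvPolynomial.C ((bary T v).linear (EuclideanSpace.single i 1)) * MvPolynomial.X i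

lemma pval_baryPoly (T : Finset E3) (v x : E3) : pval (baryPoly T v) x = bary T v x := by
  have hx : x = ∑ i, x i • EuclideanSpace.single i (1 : ℝ) := by
    ext j; simp [Pi.single_apply]
  have h1 : bary T v x = bary T v 0 + (bary T v).linear x := by rw [← bary_add, zero_add]
  have h2 : (bary T v).linear x = ∑ i, (bary T v).linear (EuclideanSpace.single i 1) * x i := by
    conv_lhs => rw [hx]
    rw [map_sum]
    exact Finset.sum_congr rfl fun i _ => by rw [map_smul, smul_eq_mul, mul_comm]
  rw [h1, h2, baryPoly]
  simp

lemma totalDegree_baryPoly_le (T : Finset E3) (v : E3) : (baryPoly T v).totalDegree ≤ 1 := by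
  refine (MvPolynomial.totalDegree_add _ _).trans (max_le (by simp) ?_)
  refine MvPolynomial.totalDegree_finsetSum_le fun i _ => ?_
  refine (MvPolynomial.totalDegree_mul _ _).trans ?_
  simp

open Classical in
/-- The multi-indices of the Lagrangian nodes of order `k` of the simplex `T`. -/
def nodeIdx (T : Finset E3) (k : ℕ) : Finset (E3 → ℕ) := Finset.piAntidiag T k

lemma mem_nodeIdx {T : Finset E3} {k : ℕ} {a : E3 → ℕ} :
    a ∈ nodeIdx T k ↔ ∑ v ∈ T, a v = k ∧ ∀ v, a v ≠ 0 → v ∈ T := by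
  classical
  simp [nodeIdx]

/-- The Lagrangian node with multi-index `a`. -/
def node (k : ℕ) (T : Finset E3) (a : E3 → ℕ) : E3 := ∑ v ∈ T, ((a v : ℝ) / k) • v

lemma node_eq_of_subset {k : ℕ} {s T : Finset E3} (h : s ⊆ T) {a : E3 → ℕ} (ha : ∀ v ∈ T, a v ≠ 0 → v ∈ s) :
    node k T a = node k s a := by
  refine (Finset.sum_subset h fun v hv hvs => ?_).symm
  have : a v = 0 := by_contra fun h => hvs (ha v hv h)
  simp [this]

/-- Multi-indices of `nodeIdx` vanish off T, which makes them finite in number and unique for a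
node; `lagrangeNodes` leaves their values off T free. -/
lemma mem_lagrangeNodes_iff {k : ℕ} {T : Finset E3} {x : E3} :
    x ∈ lagrangeNodes k T ↔ ∃ a ∈ nodeIdx T k, x = node k T a := by
  classical
  constructor
  · rintro ⟨a, ha, rfl⟩
    refine ⟨fun v => if v ∈ T then a v else 0, mem_nodeIdx.2 ⟨?_, fun v hv => ?_⟩, ?_⟩
    · rw [← ha]
      exact Finset.sum_congr rfl fun v hv => by simp [hv]
    · by_contra h
      simp [h] at hv
    · exact Finset.sum_congr rfl fun v hv => by simp [hv]
  · rintro ⟨a, ha, rfl⟩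
    exact ⟨a, (mem_nodeIdx.1 ha).1, rfl⟩

/-! ### Lagrange basis and unisolvence. -/

section Lagrange

variable {k : ℕ} {T : Finset E3}

lemma sum_div_eq_one (hk : 0 < k) {a : E3 → ℕ} (ha : a ∈ nodeIdx T k) : ∑ v ∈ T, (a v : ℝ) / k = 1 := by
  rw [← Finset.sum_div, ← Nat.cast_sum, (mem_nodeIdx.1 ha).1, div_self (by positivity)]

lemma bary_node (hT : IsTet T) (hk : 0 < k) {a : E3 → ℕ} (ha : a ∈ nodeIdx T k) {v : E3} (hv : v ∈ T) :
    bary T v (node k T a) = (a v : ℝ) / k :=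
  hT.bary_eq_of_sum (sum_div_eq_one hk ha) hv

lemma node_mem_hull (hT : IsTet T) (hk : 0 < k) {a : E3 → ℕ} (ha : a ∈ nodeIdx T k) :
    node k T a ∈ hull T :=
  hT.mem_hull_iff.2 fun v hv => by rw [bary_node hT hk ha hv]; positivity

/-- The Lagrange basis function of the node with multi-index `a`. -/
def lagr (k : ℕ) (T : Finset E3) (a : E3 → ℕ) : MvPolynomial (Fin 3) ℝ :=
  ∏ v ∈ T, ∏ j ∈ Finset.range (a v),
    (MvPolynomial.C ((k : ℝ) / (j + 1)) * baryPoly T v - MvPolynomial.C ((j : ℝ) / (j + 1)))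

/-- The inner product is the binomial coefficient "kλ_v over a_v", which vanishes when kλ_v is one
of 0, …, a_v - 1 and equals 1 when kλ_v = a_v. -/
lemma pval_lagr (k : ℕ) (T : Finset E3) (a : E3 → ℕ) (x : E3) :
    pval (lagr k T a) x =
      ∏ v ∈ T, ∏ j ∈ Finset.range (a v), (((k : ℝ) * bary T v x - j) / (j + 1)) := by
  simp only [lagr, pval_prod, pval_sub, pval_mul, pval_C, pval_baryPoly]
  refine Finset.prod_congr rfl fun v _ => Finset.prod_congr rfl fun j _ => ?_
  ring

lemma lagr_mem_Pk {a : E3 → ℕ} (ha : a ∈ nodeIdx T k) : lagr k T a ∈ Pk k := by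
  rw [mem_Pk, ← (mem_nodeIdx.1 ha).1]
  refine (MvPolynomial.totalDegree_finsetProd _ _).trans (Finset.sum_le_sum fun v _ => ?_)
  refine (MvPolynomial.totalDegree_finsetProd _ _).trans ?_
  refine (Finset.sum_le_card_nsmul _ _ 1 fun j _ => ?_).trans (by simp)
  refine (MvPolynomial.totalDegree_sub _ _).trans (max_le ?_ (by simp))
  refine (MvPolynomial.totalDegree_mul _ _).trans ?_
  simpa using totalDegree_baryPoly_le T v

lemma pval_lagr_eq_zero {a : E3 → ℕ} {v x : E3} (hv : v ∈ T) {i : ℕ} (hi : i < a v)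
    (hx : (k : ℝ) * bary T v x = i) : pval (lagr k T a) x = 0 := by
  rw [pval_lagr]
  refine Finset.prod_eq_zero hv (Finset.prod_eq_zero (Finset.mem_range.2 hi) ?_)
  rw [hx, sub_self, zero_div]

lemma pval_lagr_node_self (hT : IsTet T) (hk : 0 < k) {a : E3 → ℕ} (ha : a ∈ nodeIdx T k) :
    pval (lagr k T a) (node k T a) = 1 := by
  rw [pval_lagr]
  refine Finset.prod_eq_one fun v hv => ?_
  rw [bary_node hT hk ha hv, mul_div_cancel₀ _ (by positivity), Finset.prod_div_distrib]
  have h2 : ∏ j ∈ Finset.range (a v), ((j : ℝ) + 1) = ((a v).factorial : ℝ) := by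
    rw [← Finset.prod_range_add_one_eq_factorial]
    push_cast
    rfl
  have h3 : ∏ j ∈ Finset.range (a v), ((a v : ℝ) - j) = ((a v).factorial : ℝ) := by
    rw [← h2, ← Finset.prod_range_reflect]
    refine Finset.prod_congr rfl fun j hj => ?_
    have : j < a v := Finset.mem_range.1 hj
    rw [Nat.sub_sub, Nat.cast_sub (by lia)]
    push_cast
    ring
  rw [h2, h3, div_self (by positivity)]

/-- Two different multi-indices have the same sum, so `b v < a v` at some vertex, and the factor of
that vertex vanishes. -/
lemma pval_lagr_node_of_ne (hT : IsTet T) (hk : 0 < k) {a b : E3 → ℕ} (ha : a ∈ nodeIdx T k)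
    (hb : b ∈ nodeIdx T k) (hab : a ≠ b) : pval (lagr k T a) (node k T b) = 0 := by
  obtain ⟨v, hv, hlt⟩ : ∃ v ∈ T, b v < a v := by
    by_contra! h
    refine hab (funext fun v => ?_)
    have hs : ∑ v ∈ T, a v = ∑ v ∈ T, b v := by rw [(mem_nodeIdx.1 ha).1, (mem_nodeIdx.1 hb).1]
    by_cases hv : v ∈ T
    · exact (Finset.sum_eq_sum_iff_of_le h).1 hs v hv
    · rw [by_contra fun h => hv ((mem_nodeIdx.1 ha).2 v h),
        by_contra fun h => hv ((mem_nodeIdx.1 hb).2 v h)]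
  refine pval_lagr_eq_zero hv hlt ?_
  rw [bary_node hT hk hb hv, mul_div_cancel₀ _ (by positivity)]

lemma abs_pval_lagr_le (hT : IsTet T) {a : E3 → ℕ} (ha : a ∈ nodeIdx T k) {x : E3}
    (hx : x ∈ hull T) : |pval (lagr k T a) x| ≤ (k : ℝ) ^ k := by
  rw [pval_lagr, Finset.abs_prod]
  calc _ ≤ ∏ v ∈ T, (k : ℝ) ^ a v := by
        refine Finset.prod_le_prod (fun _ _ => abs_nonneg _) fun v hv => ?_
        rw [Finset.abs_prod]
        calc _ ≤ ∏ _j ∈ Finset.range (a v), (k : ℝ) := by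
              refine Finset.prod_le_prod (fun _ _ => abs_nonneg _) fun j hj => ?_
              have h0 := hT.bary_nonneg hv hx
              have h1 := hT.bary_le_one hv hx
              have h2 : a v ≤ k := by
                rw [← (mem_nodeIdx.1 ha).1]
                exact Finset.single_le_sum (fun _ _ => Nat.zero_le _) hv
              have h3 : (j : ℝ) ≤ k := by
                exact_mod_cast ((Finset.mem_range.1 hj).le.trans h2)
              have h4 : (0 : ℝ) ≤ j := by positivity
              have h5 : (0 : ℝ) ≤ k := by positivity
              have h6 : (k : ℝ) * bary T v x ≤ k := by nlinarith
              have h7 : 0 ≤ (k : ℝ) * bary T v x := by positivity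
              rw [abs_div, abs_of_pos (by positivity : (0 : ℝ) < j + 1)]
              refine (div_le_self (abs_nonneg _) (by linarith)).trans ?_
              rw [abs_le]
              constructor <;> linarith
          _ = _ := by simp
    _ = _ := by rw [Finset.prod_pow_eq_pow_sum, (mem_nodeIdx.1 ha).1]

/-- Homogenization: an exponent n of degree at most k is completed by the slack k - |n| to four
numbers with sum k, attached to the four vertices. -/
lemma finrank_Pk_le (hT : IsTet T) (k : ℕ) : Module.finrank ℝ (Pk k) ≤ (nodeIdx T k).card := by
  classical
  have hb := Module.finrank_eq_nat_card_basis
    (MvPolynomial.basisRestrictSupport (σ := Fin 3) ℝ { n : Fin 3 →₀ ℕ | (n.sum fun _ e => e) ≤ k })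
  rw [show Module.finrank ℝ (Pk k) = _ from hb]
  have e : T ≃ Fin 4 := T.equivFinOfCardEq hT.card_eq
  rw [← Nat.card_eq_finsetCard (nodeIdx T k)]
  let f : {n : Fin 3 →₀ ℕ | (n.sum fun _ e => e) ≤ k} → (E3 → ℕ) := fun n v =>
    if h : v ∈ T then (Fin.cons (k - n.1.sum fun _ e => e) n.1 : Fin 4 → ℕ) (e ⟨v, h⟩) else 0
  have hf : ∀ n, f n ∈ nodeIdx T k := fun n => by
    rw [mem_nodeIdx]
    refine ⟨?_, fun v hv => by by_contra h; simp [f, h] at hv⟩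
    rw [← Finset.sum_attach]
    have : ∀ v : T, f n v = (Fin.cons (k - n.1.sum fun _ e => e) n.1 : Fin 4 → ℕ) (e v) := fun v => by
      simp [f]
    simp only [this]
    have hn : (n.1.sum fun _ e => e) ≤ k := n.2
    rw [← Finset.univ_eq_attach, e.sum_comp (Fin.cons (k - n.1.sum fun _ e => e) n.1 : Fin 4 → ℕ),
      Fin.sum_univ_succ]
    simp only [Fin.cons_zero, Fin.cons_succ]
    rw [Finsupp.sum_fintype _ _ (by simp)] at hn ⊢
    lia
  refine Nat.card_le_card_of_injective (fun n => ⟨f n, hf n⟩) fun n m hnm => ?_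
  refine Subtype.ext (Finsupp.ext fun i => ?_)
  have h1 := congrFun (congrArg Subtype.val hnm) (e.symm i.succ)
  simpa [f] using h1

lemma pval_sum_lagr (hT : IsTet T) (hk : 0 < k) (c : (E3 → ℕ) → ℝ) {a : E3 → ℕ} (ha : a ∈ nodeIdx T k) :
    pval (∑ b ∈ nodeIdx T k, c b • lagr k T b) (node k T a) = c a := by
  rw [pval_sum, Finset.sum_eq_single a]
  · rw [pval_smul, pval_lagr_node_self hT hk ha, mul_one]
  · intro b hb hba
    rw [pval_smul, pval_lagr_node_of_ne hT hk hb ha hba, mul_zero]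
  · exact fun h => absurd ha h

lemma sum_lagr_mem_Pk (c : (E3 → ℕ) → ℝ) : ∑ b ∈ nodeIdx T k, c b • lagr k T b ∈ Pk k :=
  Submodule.sum_mem _ fun _ hb => Submodule.smul_mem _ _ (lagr_mem_Pk hb)

/-- Evaluation of polynomials at a family of points indexed by the Lagrangian nodes. -/
def evalAt (k : ℕ) (T : Finset E3) (pt : (E3 → ℕ) → E3) : Pk k →ₗ[ℝ] (nodeIdx T k → ℝ) where
  toFun p a := pval p (pt a)
  map_add' p q := by ext; simp
  map_smul' c p := by ext; simp

lemma evalAt_node_surjective (hT : IsTet T) (hk : 0 < k) :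
    Function.Surjective (evalAt k T (node k T)) := fun c => by
  classical
  refine ⟨⟨_, sum_lagr_mem_Pk (T := T) fun a => if h : a ∈ nodeIdx T k then c ⟨a, h⟩ else 0⟩, funext fun a => ?_⟩
  exact (pval_sum_lagr hT hk _ a.2).trans (by simp)

lemma card_nodeIdx (hT : IsTet T) (hk : 0 < k) : (nodeIdx T k).card = Module.finrank ℝ (Pk k) := by
  refine le_antisymm ?_ (finrank_Pk_le hT k)
  simpa using LinearMap.finrank_le_finrank_of_surjective (evalAt_node_surjective hT hk)

/-- There are as many nodes as dimensions, whatever the points `pt`; this is what allows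
interpolation at displaced nodes. -/
lemma evalAt_surjective_of_injective (hT : IsTet T) (hk : 0 < k) {pt : (E3 → ℕ) → E3}
    (h : Function.Injective (evalAt k T pt)) : Function.Surjective (evalAt k T pt) :=
  (LinearMap.injective_iff_surjective_of_finrank_eq_finrank
    (by simp [card_nodeIdx hT hk])).1 h

/-- A polynomial of degree at most `k` is determined by its values at the Lagrangian nodes. -/
lemma eq_sum_lagr (hT : IsTet T) (hk : 0 < k) {p : MvPolynomial (Fin 3) ℝ} (hp : p ∈ Pk k) :
    p = ∑ a ∈ nodeIdx T k, pval p (node k T a) • lagr k T a := by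
  have hinj : Function.Injective (evalAt k T (node k T)) :=
    (LinearMap.injective_iff_surjective_of_finrank_eq_finrank
      (by simp [card_nodeIdx hT hk])).2 (evalAt_node_surjective hT hk)
  have := @hinj ⟨p, hp⟩ ⟨_, sum_lagr_mem_Pk (T := T) fun a => pval p (node k T a)⟩
    (funext fun a => (pval_sum_lagr hT hk (fun a => pval p (node k T a)) a.2).symm)
  exact congrArg Subtype.val this

end Lagrange

/-! ### The boundary of the polyhedron -/

/-- The relative interior of the simplex with vertex set `s`. -/
def openHull (s : Finset E3) : Set E3 :=
  {x | ∃ μ : E3 → ℝ, (∀ v ∈ s, 0 < μ v) ∧ ∑ v ∈ s, μ v = 1 ∧ x = ∑ v ∈ s, μ v • v}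

lemma openHull_subset_hull (s : Finset E3) : openHull s ⊆ hull s := by
  rintro x ⟨μ, h0, h1, rfl⟩
  exact (convex_convexHull ℝ _).sum_mem (fun v hv => (h0 v hv).le) h1
    fun v hv => subset_convexHull ℝ _ hv

lemma openHull_nonempty {s : Finset E3} (hs : s.Nonempty) : (openHull s).Nonempty := by
  have : (0 : ℝ) < s.card := by exact_mod_cast hs.card_pos
  exact ⟨_, fun _ => (s.card : ℝ)⁻¹, fun v _ => by positivity, by simp [this.ne'], rfl⟩

lemma IsTet.mem_openHull_iff {T : Finset E3} (hT : IsTet T) {s : Finset E3} (hs : s ⊆ T) {x : E3} :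
    x ∈ openHull s ↔ ∀ v ∈ T, (v ∈ s → 0 < bary T v x) ∧ (v ∉ s → bary T v x = 0) := by
  classical
  constructor
  · rintro ⟨μ, h0, h1, rfl⟩ v hv
    have e1 : ∑ w ∈ s, μ w • w = ∑ w ∈ T, (if w ∈ s then μ w else 0) • w := by
      simp only [ite_smul, zero_smul]
      rw [← Finset.sum_filter, Finset.filter_mem_eq_inter, Finset.inter_eq_right.2 hs]
    have e2 : ∑ w ∈ T, (if w ∈ s then μ w else 0) = 1 := by
      rw [← Finset.sum_filter, Finset.filter_mem_eq_inter, Finset.inter_eq_right.2 hs, h1]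
    rw [e1, hT.bary_eq_of_sum e2 hv]
    exact ⟨fun h => by simpa [h] using h0 v h, fun h => by simp [h]⟩
  · intro h
    refine ⟨fun v => bary T v x, fun v hv => (h v (hs hv)).1 hv, ?_, ?_⟩
    · rw [← hT.sum_bary x]
      exact Finset.sum_subset hs fun v hv hvs => (h v hv).2 hvs
    · conv_lhs => rw [← hT.sum_bary_smul x]
      exact (Finset.sum_subset hs fun v hv hvs => by rw [(h v hv).2 hvs, zero_smul]).symm

lemma IsTet.exists_mem_openHull {T : Finset E3} (hT : IsTet T) {x : E3} (hx : x ∈ hull T) :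
    ∃ s ⊆ T, x ∈ openHull s := by
  classical
  refine ⟨T.filter fun v => 0 < bary T v x, Finset.filter_subset _ _,
    (hT.mem_openHull_iff (Finset.filter_subset _ _)).2 fun v hv => ?_⟩
  simp only [Finset.mem_filter, hv, true_and, not_lt, imp_self]
  exact fun h => le_antisymm h (hT.bary_nonneg hv hx)

lemma IsTet.interior_eq_openHull {T : Finset E3} (hT : IsTet T) : interior (hull T) = openHull T := by
  ext x
  rw [hT.mem_interior_iff, hT.mem_openHull_iff subset_rfl]
  exact ⟨fun h v hv => ⟨fun _ => h v hv, fun h' => absurd hv h'⟩, fun h v hv => (h v hv).1 hv⟩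

lemma isCompact_hull (s : Finset E3) : IsCompact (hull s) := s.finite_toSet.isCompact_convexHull (𝕜 := ℝ)

lemma isClosed_hull (s : Finset E3) : IsClosed (hull s) := (isCompact_hull s).isClosed

lemma convex_hull' (s : Finset E3) : Convex ℝ (hull s) := convex_convexHull ℝ _

lemma IsTet.nonempty {T : Finset E3} (hT : IsTet T) : T.Nonempty := by
  rw [← Finset.card_pos, hT.card_eq]; norm_num

lemma IsTet.closure_interior {T : Finset E3} (hT : IsTet T) : closure (interior (hull T)) = hull T := by
  rw [(convex_hull' T).closure_interior_eq_closure_of_nonempty_interior, (isClosed_hull T).closure_eq]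
  rw [hT.interior_eq_openHull]
  exact openHull_nonempty hT.nonempty

/-! ### Local structure of the polyhedron along its sub-simplices. -/

namespace TetMesh

variable {𝒯 : TetMesh}

lemma mem_polyhedron {x : E3} : x ∈ 𝒯.polyhedron ↔ ∃ T ∈ 𝒯.elems, x ∈ hull T := by
  simp [polyhedron]

lemma hull_subset_polyhedron {T : Finset E3} (hT : T ∈ 𝒯.elems) : hull T ⊆ 𝒯.polyhedron :=
  fun _ hx => mem_polyhedron.2 ⟨T, hT, hx⟩

lemma isCompact_polyhedron : IsCompact 𝒯.polyhedron :=
  𝒯.elems.isCompact_biUnion fun T _ => isCompact_hull T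

lemma isClosed_polyhedron : IsClosed 𝒯.polyhedron := isCompact_polyhedron.isClosed

lemma interior_hull_subset {T : Finset E3} (hT : T ∈ 𝒯.elems) : interior (hull T) ⊆ 𝒯.interiorDomain :=
  interior_mono (hull_subset_polyhedron hT)

/-- A tetrahedron is the closure of its interior, so the closure of Ω_h is the whole polyhedron. -/
lemma bdry_eq : 𝒯.bdry = 𝒯.polyhedron \ 𝒯.interiorDomain := by
  have h : closure 𝒯.interiorDomain = 𝒯.polyhedron := by
    refine subset_antisymm (closure_minimal interior_subset isClosed_polyhedron) fun x hx => ?_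
    obtain ⟨T, hT, hxT⟩ := mem_polyhedron.1 hx
    rw [← (isTet hT).closure_interior] at hxT
    exact closure_mono (interior_hull_subset hT) hxT
  rw [bdry, frontier, h, interiorDomain, interior_interior]

lemma isClosed_bdry : IsClosed 𝒯.bdry := isClosed_frontier

lemma eventually_mem_hull (x : E3) : ∀ᶠ y in 𝓝 x, ∀ T ∈ 𝒯.elems, y ∈ hull T → x ∈ hull T := by
  refine (Filter.eventually_all_finset _).2 fun T _ => ?_
  by_cases h : x ∈ hull T
  · exact Filter.Eventually.of_forall fun _ _ => h
  · filter_upwards [(isClosed_hull T).isOpen_compl.mem_nhds h] with y hy hy'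
    exact absurd hy' hy

/-- If a vertex v of s were missing from T, the common part of S and T would lie in the face λ_v = 0
of S, whereas λ_v > 0 at x. -/
lemma subset_of_mem_hull {S T s : Finset E3} (hS : S ∈ 𝒯.elems) (hT : T ∈ 𝒯.elems) (hs : s ⊆ S) {x : E3}
    (hx : x ∈ openHull s) (hxT : x ∈ hull T) : s ⊆ T := by
  intro v hv
  by_contra hvT
  have hxS : x ∈ hull S := convexHull_mono (by exact_mod_cast hs) (openHull_subset_hull s hx)
  have h1 := 𝒯.compat S hS T hT ⟨hxS, hxT⟩
  have h2 : convexHull ℝ ((S : Set E3) ∩ T) ⊆ {y | bary S v y = 0} := by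
    refine convexHull_min (fun w hw => (isTet hS).bary_of_ne (hs hv) hw.1 fun h => hvT (h ▸ hw.2)) ?_
    exact (convex_singleton (0 : ℝ)).affine_preimage (bary S v)
  have h3 := (((isTet hS).mem_openHull_iff hs).1 hx v (hs hv)).1 hv
  exact h3.ne' (h2 h1)

lemma eq_of_mem_interior {S T : Finset E3} (hS : S ∈ 𝒯.elems) (hT : T ∈ 𝒯.elems) {x : E3}
    (hx : x ∈ interior (hull S)) (hxT : x ∈ hull T) : S = T := by
  rw [(isTet hS).interior_eq_openHull] at hx
  exact Finset.eq_of_subset_of_card_le (subset_of_mem_hull hS hT subset_rfl hx hxT)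
    (by rw [(isTet hS).card_eq, (isTet hT).card_eq])

lemma eventually_bary_pos {S s : Finset E3} (hS : S ∈ 𝒯.elems) (hs : s ⊆ S) {x : E3} (hx : x ∈ openHull s) :
    ∀ᶠ y in 𝓝 x, ∀ T ∈ 𝒯.elems, y ∈ hull T → s ⊆ T ∧ x ∈ hull T := by
  filter_upwards [eventually_mem_hull (𝒯 := 𝒯) x] with y hy T hT hyT
  exact ⟨subset_of_mem_hull hS hT hs hx (hy T hT hyT), hy T hT hyT⟩

lemma eventually_pos_of_openHull {T s : Finset E3} (hT : IsTet T) (hs : s ⊆ T) {x : E3}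
    (hx : x ∈ openHull s) : ∀ᶠ y in 𝓝 x, ∀ v ∈ s, 0 < bary T v y := by
  refine (Filter.eventually_all_finset _).2 fun v hv => ?_
  exact (continuous_bary T v).continuousAt.eventually
    (lt_mem_nhds ((hT.mem_openHull_iff hs).1 hx v (hs hv) |>.1 hv))

/-- The local structure of the polyhedron is the same at all points of the relative interior of a
simplex of the mesh. -/
lemma mem_interiorDomain_of_openHull {S s : Finset E3} (hS : S ∈ 𝒯.elems) (hs : s ⊆ S) {x x' : E3}
    (hx : x ∈ openHull s) (hx' : x' ∈ openHull s) (h : x ∈ 𝒯.interiorDomain) : x' ∈ 𝒯.interiorDomain := by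
  have hev : ∀ᶠ y in 𝓝 x', ∀ T ∈ 𝒯.elems, s ⊆ T → ∀ v ∈ s, 0 < bary T v y := by
    refine (Filter.eventually_all_finset _).2 fun T hT => ?_
    by_cases hsT : s ⊆ T
    · filter_upwards [eventually_pos_of_openHull (isTet hT) hsT hx'] with y hy _ using hy
    · exact Filter.Eventually.of_forall fun _ h => absurd h hsT
  rw [interiorDomain, mem_interior_iff_mem_nhds]
  filter_upwards [hev] with y hy
  have hev2 : ∀ᶠ z in 𝓝 x, z ∈ 𝒯.polyhedron ∧ ∀ T ∈ 𝒯.elems, z ∈ hull T → s ⊆ T ∧ x ∈ hull T :=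
    Filter.Eventually.and (mem_interior_iff_mem_nhds.1 h) (eventually_bary_pos hS hs hx)
  -- The displacement y - x' is transported to x and shrunk. The coordinates off s vanish at both x
  -- and x', so along this displacement their signs do not depend on the base point or on t > 0;
  -- those on s remain positive nearby.
  have hcont : Tendsto (fun t : ℝ => x + t • (y - x')) (𝓝[>] 0) (𝓝 x) := by
    have : ContinuousAt (fun t : ℝ => x + t • (y - x')) 0 := by fun_prop
    have h2 := this.tendsto
    rw [zero_smul, add_zero] at h2
    exact h2.mono_left nhdsWithin_le_nhds
  obtain ⟨t, ht, ht0⟩ := ((hcont.eventually hev2).and self_mem_nhdsWithin).exists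
  obtain ⟨T, hT, hzT⟩ := mem_polyhedron.1 ht.1
  obtain ⟨hsT, -⟩ := ht.2 T hT hzT
  refine mem_polyhedron.2 ⟨T, hT, (isTet hT).mem_hull_iff.2 fun v hv => ?_⟩
  by_cases hvs : v ∈ s
  · exact (hy T hT hsT v hvs).le
  · have h1 := (isTet hT).bary_nonneg hv hzT
    have h2 := (((isTet hT).mem_openHull_iff hsT).1 hx v hv).2 hvs
    have h3 := (((isTet hT).mem_openHull_iff hsT).1 hx' v hv).2 hvs
    rw [bary_add, h2, zero_add, map_smul, smul_eq_mul, bary_sub, h3, sub_zero] at h1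
    exact nonneg_of_mul_nonneg_right h1 ht0

lemma hull_subset_closure_openHull {s : Finset E3} {x : E3} (hx : x ∈ openHull s) :
    hull s ⊆ closure (openHull s) := by
  intro y hy
  obtain ⟨w, hw0, hw1, rfl⟩ := Finset.mem_convexHull'.1 hy
  obtain ⟨μ, hμ0, hμ1, rfl⟩ := hx
  have hcont : Tendsto (fun t : ℝ => ∑ v ∈ s, ((1 - t) * w v + t * μ v) • v) (𝓝[>] 0)
      (𝓝 (∑ v ∈ s, w v • v)) := by
    have : ContinuousAt (fun t : ℝ => ∑ v ∈ s, ((1 - t) * w v + t * μ v) • v) 0 := by fun_prop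
    have h2 := this.tendsto
    simp only [sub_zero, one_mul, zero_mul, add_zero] at h2
    exact h2.mono_left nhdsWithin_le_nhds
  refine mem_closure_of_tendsto hcont ?_
  filter_upwards [Ioo_mem_nhdsGT (zero_lt_one (α := ℝ))] with t ht
  refine ⟨_, fun v hv => ?_, ?_, rfl⟩
  · exact add_pos_of_nonneg_of_pos (mul_nonneg (by linarith [ht.2]) (hw0 v hv)) (mul_pos ht.1 (hμ0 v hv))
  · rw [Finset.sum_add_distrib, ← Finset.mul_sum, ← Finset.mul_sum, hw1, hμ1]; ring

/-- A simplex of the mesh lies on the boundary if a point of its relative interior does. -/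
lemma hull_subset_bdry {S s : Finset E3} (hS : S ∈ 𝒯.elems) (hs : s ⊆ S) {x : E3}
    (hx : x ∈ openHull s) (h : x ∈ 𝒯.bdry) : hull s ⊆ 𝒯.bdry := by
  refine (hull_subset_closure_openHull hx).trans (closure_minimal (fun y hy => ?_) isClosed_bdry)
  rw [bdry_eq] at h ⊢
  refine ⟨hull_subset_polyhedron hS (convexHull_mono (by exact_mod_cast hs) (openHull_subset_hull s hy)),
    fun hy' => h.2 (mem_interiorDomain_of_openHull hS hs hy hx hy')⟩

lemma not_subset_bdry {T : Finset E3} (hT : T ∈ 𝒯.elems) {x : E3} (hx : x ∈ openHull T) : x ∉ 𝒯.bdry := by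
  rw [← (isTet hT).interior_eq_openHull] at hx
  rw [bdry_eq]
  exact fun h => h.2 (interior_hull_subset hT hx)

/-! ### Elements on the two sides of a face. -/

section Faces

variable {T T' s : Finset E3} {O O' : E3}

lemma exists_opposite (hT : IsTet T) (hs : s ⊆ T) (hc : s.card = 3) :
    ∃ O ∈ T, O ∉ s ∧ ∀ v ∈ T, v ∉ s → v = O := by
  classical
  have h1 : (T \ s).card = 1 := by rw [Finset.card_sdiff_of_subset hs, hT.card_eq, hc]
  obtain ⟨O, hO⟩ := Finset.card_eq_one.1 h1
  have h2 : O ∈ T \ s := by rw [hO]; exact Finset.mem_singleton_self O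
  rw [Finset.mem_sdiff] at h2
  refine ⟨O, h2.1, h2.2, fun v hv hvs => ?_⟩
  have : v ∈ T \ s := Finset.mem_sdiff.2 ⟨hv, hvs⟩
  rwa [hO, Finset.mem_singleton] at this

lemma isBdryFace_of_unique (hT : T ∈ 𝒯.elems) (hs : s ⊆ T) (hc : s.card = 3)
    (h : ∀ T' ∈ 𝒯.elems, s ⊆ T' → T' = T) : 𝒯.IsBdryFace T s := by
  obtain ⟨x, hx⟩ := openHull_nonempty (s := s) (Finset.card_pos.1 (by omega))
  refine ⟨hs, hc, hull_subset_bdry hT hs hx ?_⟩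
  have hxT : x ∈ hull T := convexHull_mono (by exact_mod_cast hs) (openHull_subset_hull s hx)
  rw [bdry_eq]
  refine ⟨hull_subset_polyhedron hT hxT, fun hint => ?_⟩
  obtain ⟨O, hO, hOs, -⟩ := exists_opposite (isTet hT) hs hc
  have hev2 : ∀ᶠ z in 𝓝 x, z ∈ 𝒯.polyhedron ∧ ∀ T ∈ 𝒯.elems, z ∈ hull T → s ⊆ T ∧ x ∈ hull T :=
    Filter.Eventually.and (mem_interior_iff_mem_nhds.1 hint) (eventually_bary_pos hT hs hx)
  -- Moving from x away from O makes the coordinate of O negative, so the point leaves T; any other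
  -- element reached near x would contain s.
  have hcont : Tendsto (fun t : ℝ => x + t • (x - O)) (𝓝[>] 0) (𝓝 x) := by
    have : ContinuousAt (fun t : ℝ => x + t • (x - O)) 0 := by fun_prop
    have h2 := this.tendsto
    rw [zero_smul, add_zero] at h2
    exact h2.mono_left nhdsWithin_le_nhds
  obtain ⟨t, ht, ht0⟩ := ((hcont.eventually hev2).and self_mem_nhdsWithin).exists
  obtain ⟨T', hT', hzT'⟩ := mem_polyhedron.1 ht.1
  obtain rfl := h T' hT' (ht.2 T' hT' hzT').1
  have h1 := (isTet hT).bary_nonneg hO hzT'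
  have h2 := (((isTet hT).mem_openHull_iff hs).1 hx O hO).2 hOs
  rw [bary_add, map_smul, bary_sub, h2, (isTet hT).bary_self hO, smul_eq_mul] at h1
  have : (0 : ℝ) < t := ht0
  linarith

/-- Two elements with a common face lie on different sides of it. -/
lemma exists_bary_eq_neg (hT : T ∈ 𝒯.elems) (hT' : T' ∈ 𝒯.elems) (hne : T ≠ T') (hs : s ⊆ T)
    (hs' : s ⊆ T') (hc : s.card = 3) (hO : O ∈ T) (hOs : O ∉ s) (hO' : O' ∈ T') (hOs' : O' ∉ s) :
    ∃ κ : ℝ, κ < 0 ∧ ∀ x, bary T' O' x = κ * bary T O x := by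
  have hop : ∀ v ∈ T, v ∉ s → v = O := by
    obtain ⟨O₁, -, -, h⟩ := exists_opposite (isTet hT) hs hc
    exact fun v hv hvs => (h v hv hvs).trans (h O hO hOs).symm
  have hop' : ∀ v ∈ T', v ∉ s → v = O' := by
    obtain ⟨O₁, -, -, h⟩ := exists_opposite (isTet hT') hs' hc
    exact fun v hv hvs => (h v hv hvs).trans (h O' hO' hOs').symm
  -- The coordinate of O' vanishes at the three vertices of s, so it is a multiple of the coordinate
  -- of O.
  have heq : ∀ x, bary T' O' x = bary T' O' O * bary T O x := fun x => by
    rw [(isTet hT).affine_apply (bary T' O') x, Finset.sum_eq_single O]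
    · ring
    · intro v hv hvO
      have hvs : v ∈ s := by_contra fun h => hvO (hop v hv h)
      rw [(isTet hT').bary_of_ne hO' (hs' hvs) (fun h => hOs' (h ▸ hvs)), mul_zero]
    · exact fun h => absurd hO h
  refine ⟨_, ?_, heq⟩
  -- If the factor were nonnegative, points slightly inside T near the face would also lie in T'.
  by_contra! hκ
  obtain ⟨x, hx⟩ := openHull_nonempty (s := s) (Finset.card_pos.1 (by omega))
  have hcont : Tendsto (fun t : ℝ => x + t • (O - x)) (𝓝[>] 0) (𝓝 x) := by
    have : ContinuousAt (fun t : ℝ => x + t • (O - x)) 0 := by fun_prop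
    have h2 := this.tendsto
    rw [zero_smul, add_zero] at h2
    exact h2.mono_left nhdsWithin_le_nhds
  have hev := ((hcont.eventually ((eventually_pos_of_openHull (isTet hT) hs hx).and
    (eventually_pos_of_openHull (isTet hT') hs' hx))).and self_mem_nhdsWithin)
  obtain ⟨t, ⟨h1, h2⟩, ht0⟩ := hev.exists
  have ht0 : (0 : ℝ) < t := ht0
  have hx0 := (((isTet hT).mem_openHull_iff hs).1 hx O hO).2 hOs
  have hOy : bary T O (x + t • (O - x)) = t := by
    rw [bary_add, map_smul, bary_sub, hx0, (isTet hT).bary_self hO, smul_eq_mul]; ring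
  refine hne (eq_of_mem_interior hT hT' (x := x + t • (O - x)) ((isTet hT).mem_interior_iff.2 ?_)
    ((isTet hT').mem_hull_iff.2 ?_))
  · intro v hv
    by_cases hvs : v ∈ s
    · exact h1 v hvs
    · rw [hop v hv hvs, hOy]; exact ht0
  · intro v hv
    by_cases hvs : v ∈ s
    · exact (h2 v hvs).le
    · rw [hop' v hv hvs, heq, hOy]; positivity

/-- Near x the coordinates of the vertices of s stay positive in both elements, and those of the
opposite vertices have opposite signs; every nearby point is thus in one of the two. -/
lemma mem_interiorDomain_of_face (hT : T ∈ 𝒯.elems) (hT' : T' ∈ 𝒯.elems) (hne : T ≠ T') (hs : s ⊆ T)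
    (hs' : s ⊆ T') (hc : s.card = 3) {x : E3} (hx : x ∈ openHull s) : x ∈ 𝒯.interiorDomain := by
  obtain ⟨O, hO, hOs, hop⟩ := exists_opposite (isTet hT) hs hc
  obtain ⟨O', hO', hOs', hop'⟩ := exists_opposite (isTet hT') hs' hc
  obtain ⟨κ, hκ, h⟩ := exists_bary_eq_neg hT hT' hne hs hs' hc hO hOs hO' hOs'
  rw [interiorDomain, mem_interior_iff_mem_nhds]
  filter_upwards [eventually_pos_of_openHull (isTet hT) hs hx,
    eventually_pos_of_openHull (isTet hT') hs' hx] with y h1 h2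
  rcases le_or_gt 0 (bary T O y) with h0 | h0
  · refine hull_subset_polyhedron hT ((isTet hT).mem_hull_iff.2 fun v hv => ?_)
    by_cases hvs : v ∈ s
    · exact (h1 v hvs).le
    · rwa [hop v hv hvs]
  · refine hull_subset_polyhedron hT' ((isTet hT').mem_hull_iff.2 fun v hv => ?_)
    by_cases hvs : v ∈ s
    · exact (h2 v hvs).le
    · rw [hop' v hv hvs, h]
      exact (mul_pos_of_neg_of_neg hκ h0).le

/-- Three elements cannot be pairwise on different sides of s: the product of two negative factors
is positive. -/
lemma card_elems_of_face_le (hc : s.card = 3) {T₁ T₂ T₃ : Finset E3} (h₁ : T₁ ∈ 𝒯.elems) (h₂ : T₂ ∈ 𝒯.elems)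
    (h₃ : T₃ ∈ 𝒯.elems) (hs₁ : s ⊆ T₁) (hs₂ : s ⊆ T₂) (hs₃ : s ⊆ T₃) (h12 : T₁ ≠ T₂) (h13 : T₁ ≠ T₃)
    (h23 : T₂ ≠ T₃) : False := by
  obtain ⟨O₁, hO₁, hOs₁, -⟩ := exists_opposite (isTet h₁) hs₁ hc
  obtain ⟨O₂, hO₂, hOs₂, -⟩ := exists_opposite (isTet h₂) hs₂ hc
  obtain ⟨O₃, hO₃, hOs₃, -⟩ := exists_opposite (isTet h₃) hs₃ hc
  obtain ⟨a, ha, e12⟩ := exists_bary_eq_neg h₁ h₂ h12 hs₁ hs₂ hc hO₁ hOs₁ hO₂ hOs₂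
  obtain ⟨b, hb, e23⟩ := exists_bary_eq_neg h₂ h₃ h23 hs₂ hs₃ hc hO₂ hOs₂ hO₃ hOs₃
  obtain ⟨c, hc', e13⟩ := exists_bary_eq_neg h₁ h₃ h13 hs₁ hs₃ hc hO₁ hOs₁ hO₃ hOs₃
  have h := e13 O₁
  rw [e23, e12, (isTet h₁).bary_self hO₁, mul_one] at h
  nlinarith [mul_pos_of_neg_of_neg hb ha]

end Faces

end TetMesh
-- Boundary edges and the boundary faces through them.
namespace TetMesh

variable {𝒯 : TetMesh}

/-- If every face containing the edge `e` belongs to several elements, then the edge is interior. -/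
lemma mem_interiorDomain_of_edge {T₀ e : Finset E3} (hT₀ : T₀ ∈ 𝒯.elems) (he : e ⊆ T₀) (hc : e.card = 2)
    {x : E3} (hx : x ∈ openHull e)
    (h : ∀ T ∈ 𝒯.elems, ∀ s ⊆ T, e ⊆ s → s.card = 3 → ∃ T' ∈ 𝒯.elems, T' ≠ T ∧ s ⊆ T') :
    x ∈ 𝒯.interiorDomain := by
  classical
  -- Otherwise some y outside the polyhedron is arbitrarily close to x. A segment from y to a point
  -- z inside `T₀` that avoids the line of e must leave Ω_h at a point of the polyhedron. That point
  -- lies in the open hull of a face through e or of an element, and all such points are interior.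
  by_contra hx'
  have hev1 : ∀ᶠ y in 𝓝 x, ∀ T ∈ 𝒯.elems, e ⊆ T → ∀ v ∈ e, 0 < bary T v y := by
    refine (Filter.eventually_all_finset _).2 fun T hT => ?_
    by_cases hsT : e ⊆ T
    · filter_upwards [eventually_pos_of_openHull (isTet hT) hsT hx] with y hy _ using hy
    · exact Filter.Eventually.of_forall fun _ h => absurd h hsT
  obtain ⟨ρ, hρ, hball⟩ := Metric.eventually_nhds_iff_ball.1
    (hev1.and (eventually_bary_pos hT₀ he hx))
  obtain ⟨y, hyρ, hyP⟩ : ∃ y ∈ Metric.ball x ρ, y ∉ 𝒯.polyhedron := by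
    by_contra! hcon
    exact hx' (mem_interior.2 ⟨_, hcon, Metric.isOpen_ball, Metric.mem_ball_self hρ⟩)
  have hcd : (T₀ \ e).card = 2 := by rw [Finset.card_sdiff_of_subset he, (isTet hT₀).card_eq, hc]
  obtain ⟨c, d, hcd', hTe⟩ := Finset.card_eq_two.1 hcd
  have hcm : c ∈ T₀ \ e := by simp [hTe]
  have hdm : d ∈ T₀ \ e := by simp [hTe]
  rw [Finset.mem_sdiff] at hcm hdm
  have hT := isTet hT₀
  have hxc := ((hT.mem_openHull_iff he).1 hx c hcm.1).2 hcm.2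
  have hxd := ((hT.mem_openHull_iff he).1 hx d hdm.1).2 hdm.2
  have hother : ∀ v ∈ T₀, v ∉ e → v = c ∨ v = d := fun v hv hve => by
    have : v ∈ T₀ \ e := Finset.mem_sdiff.2 ⟨hv, hve⟩
    simpa [hTe] using this
  -- a point of the interior of `T₀` from which `y` is seen past the line of `e`
  obtain ⟨z, hzρ, hzint, hzy⟩ : ∃ z ∈ Metric.ball x ρ, z ∈ interior (hull T₀) ∧
      ¬ ∃ q ∈ segment ℝ y z, bary T₀ c q = 0 ∧ bary T₀ d q = 0 := by
    have hy0 : ¬ (bary T₀ c y = 0 ∧ bary T₀ d y = 0) := fun h0 => hyP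
      (hull_subset_polyhedron hT₀ (hT.mem_hull_iff.2 fun v hv => by
        by_cases hve : v ∈ e
        · exact ((hball y hyρ).1 T₀ hT₀ he v hve).le
        · rcases hother v hv hve with rfl | rfl
          · exact h0.1.ge
          · exact h0.2.ge))
    -- The forms 2λ_d - λ_c and λ_d - 2λ_c have no common zero besides λ_c = λ_d = 0, so one of the
    -- directions (2, 1), (1, 2) is not aligned with y.
    obtain ⟨α, β, hα, hβ, hne⟩ : ∃ α β : ℝ, 0 < α ∧ 0 < β ∧ α * bary T₀ d y - β * bary T₀ c y ≠ 0 := by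
      by_cases h1 : 2 * bary T₀ d y - 1 * bary T₀ c y = 0
      · refine ⟨1, 2, one_pos, two_pos, fun h2 => hy0 ⟨by linarith, by linarith⟩⟩
      · exact ⟨2, 1, two_pos, one_pos, h1⟩
    have hcont : Tendsto (fun t : ℝ => x + t • (α • (c - x) + β • (d - x))) (𝓝[>] 0) (𝓝 x) := by
      have : ContinuousAt (fun t : ℝ => x + t • (α • (c - x) + β • (d - x))) 0 := by fun_prop
      have h2 := this.tendsto
      rw [zero_smul, add_zero] at h2
      exact h2.mono_left nhdsWithin_le_nhds
    obtain ⟨t, htρ, ht0⟩ :=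
      ((hcont.eventually (Metric.ball_mem_nhds x hρ)).and self_mem_nhdsWithin).exists
    have ht0 : (0 : ℝ) < t := ht0
    have hzc : bary T₀ c (x + t • (α • (c - x) + β • (d - x))) = t * α := by
      rw [bary_add, map_smul, map_add, map_smul, map_smul, bary_sub, bary_sub, hxc, hT.bary_self hcm.1,
        hT.bary_of_ne hcm.1 hdm.1 hcd']
      simp
    have hzd : bary T₀ d (x + t • (α • (c - x) + β • (d - x))) = t * β := by
      rw [bary_add, map_smul, map_add, map_smul, map_smul, bary_sub, bary_sub, hxd, hT.bary_self hdm.1,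
        hT.bary_of_ne hdm.1 hcm.1 hcd'.symm]
      simp
    refine ⟨_, htρ, hT.mem_interior_iff.2 fun v hv => ?_, ?_⟩
    · by_cases hve : v ∈ e
      · exact (hball _ htρ).1 T₀ hT₀ he v hve
      · rcases hother v hv hve with rfl | rfl
        · rw [hzc]; positivity
        · rw [hzd]; positivity
    · rintro ⟨q, ⟨a, b, ha, hb, hab, rfl⟩, hqc, hqd⟩
      have hcomb : ∀ v, bary T₀ v (a • y + b • (x + t • (α • (c - x) + β • (d - x)))) =
          a * bary T₀ v y + b * bary T₀ v (x + t • (α • (c - x) + β • (d - x))) := fun v => by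
        rw [Convex.combo_affine_apply hab]; rfl
      rw [hcomb, hzc] at hqc
      rw [hcomb, hzd] at hqd
      have h3 : b * t * (α * bary T₀ d y - β * bary T₀ c y) = 0 := by
        linear_combination (bary T₀ d y) * hqc - (bary T₀ c y) * hqd
      rcases mul_eq_zero.1 h3 with h4 | h4
      · have hb0 : b = 0 := (mul_eq_zero.1 h4).resolve_right ht0.ne'
        have ha1 : a = 1 := by linarith
        rw [hb0, ha1] at hqc hqd
        exact hy0 ⟨by linarith, by linarith⟩
      · exact hne h4
  -- the segment leaves the polyhedron at a boundary point
  obtain ⟨q, hq, hqP, hqi⟩ : ∃ q ∈ segment ℝ y z, q ∈ 𝒯.polyhedron ∧ q ∉ 𝒯.interiorDomain := by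
    by_contra! hcon
    have := (convex_segment (𝕜 := ℝ) y z).isPreconnected 𝒯.interiorDomain 𝒯.polyhedronᶜ isOpen_interior
      isClosed_polyhedron.isOpen_compl (fun q hq => by
        by_cases hqP : q ∈ 𝒯.polyhedron
        · exact Or.inl (hcon q hq hqP)
        · exact Or.inr hqP)
      ⟨z, right_mem_segment ℝ y z, interior_hull_subset hT₀ hzint⟩ ⟨y, left_mem_segment ℝ y z, hyP⟩
    obtain ⟨w, -, hw1, hw2⟩ := this
    exact hw2 (interior_subset hw1)
  have hqρ : q ∈ Metric.ball x ρ := (convex_ball x ρ).segment_subset hyρ hzρ hq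
  obtain ⟨T, hTm, hqT⟩ := mem_polyhedron.1 hqP
  obtain ⟨heT, -⟩ := (hball q hqρ).2 T hTm hqT
  obtain ⟨s, hs, hqs⟩ := (isTet hTm).exists_mem_openHull hqT
  have hes : e ⊆ s := fun v hv => by
    by_contra hvs
    have h1 := (((isTet hTm).mem_openHull_iff hs).1 hqs v (heT hv)).2 hvs
    exact ((hball q hqρ).1 T hTm heT v hv).ne' h1
  have hcard : s.card ≤ 4 := (Finset.card_le_card hs).trans (isTet hTm).card_eq.le
  have hcard2 : 2 ≤ s.card := hc ▸ Finset.card_le_card hes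
  obtain h2 | h3 | h4 : s.card = 2 ∨ s.card = 3 ∨ s.card = 4 := by omega
  · obtain rfl : e = s := Finset.eq_of_subset_of_card_le hes (by omega)
    have h5 := (hT.mem_openHull_iff he).1 hqs
    exact hzy ⟨q, hq, (h5 c hcm.1).2 hcm.2, (h5 d hdm.1).2 hdm.2⟩
  · obtain ⟨T', hT', hne, hsT'⟩ := h T hTm s hs hes h3
    exact hqi (mem_interiorDomain_of_face hTm hT' hne.symm hs hsT' h3 hqs)
  · obtain rfl : s = T := Finset.eq_of_subset_of_card_le hs (by rw [(isTet hTm).card_eq, h4])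
    rw [← (isTet hTm).interior_eq_openHull] at hqs
    exact hqi (interior_hull_subset hTm hqs)

/-- Two boundary faces meet at every boundary edge. -/
lemma exists_two_bdry_faces {T₀ e : Finset E3} (hT₀ : T₀ ∈ 𝒯.elems) (he : 𝒯.IsBdryEdge T₀ e) :
    ∃ T₁ ∈ 𝒯.elems, ∃ T₂ ∈ 𝒯.elems, ∃ F₁ F₂, 𝒯.IsBdryFace T₁ F₁ ∧ 𝒯.IsBdryFace T₂ F₂ ∧
      e ⊆ F₁ ∧ e ⊆ F₂ ∧ F₁ ≠ F₂ := by
  classical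
  obtain ⟨heT₀, hc, heb⟩ := he
  -- Parity: `deg c` counts the elements having the face e ∪ {c}. Every element around e has exactly
  -- two such faces, so the degrees have an even sum. They are at most 2, and degree 1 means a
  -- boundary face. A boundary edge has some vertex of degree 1, and the number of odd degrees is
  -- even, hence at least two.
  set star := 𝒯.elems.filter fun T => e ⊆ T with hstar
  set V := 𝒯.elems.sup id \ e with hV
  set deg : E3 → ℕ := fun c => (star.filter fun T => c ∈ T).card with hdeg
  have hins : ∀ c ∈ V, (insert c e).card = 3 := fun c hcV => by
    rw [Finset.card_insert_of_notMem (Finset.mem_sdiff.1 hcV).2, hc]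
  have hmem : ∀ c T, T ∈ star.filter (fun T => c ∈ T) ↔ T ∈ 𝒯.elems ∧ insert c e ⊆ T := fun c T => by
    simp only [hstar, Finset.mem_filter, Finset.insert_subset_iff]; tauto
  have hdeg2 : ∀ c ∈ V, deg c ≤ 2 := fun c hcV => by
    by_contra! h3
    obtain ⟨T₁, T₂, T₃, h1, h2, h3, h12, h13, h23⟩ := Finset.two_lt_card_iff.1 h3
    rw [hmem] at h1 h2 h3
    exact card_elems_of_face_le (hins c hcV) h1.1 h2.1 h3.1 h1.2 h2.2 h3.2 h12 h13 h23
  have hface : ∀ c ∈ V, deg c = 1 → ∃ T ∈ 𝒯.elems, 𝒯.IsBdryFace T (insert c e) := fun c hcV h1 => by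
    obtain ⟨T, hT⟩ := Finset.card_eq_one.1 h1
    have hT1 : T ∈ star.filter fun T => c ∈ T := by rw [hT]; exact Finset.mem_singleton_self T
    rw [hmem] at hT1
    refine ⟨T, hT1.1, isBdryFace_of_unique hT1.1 hT1.2 (hins c hcV) fun T' hT' hs => ?_⟩
    have : T' ∈ star.filter fun T => c ∈ T := (hmem c T').2 ⟨hT', hs⟩
    rwa [hT, Finset.mem_singleton] at this
  have hsum : Even (∑ c ∈ V, deg c) := by
    have h1 : ∑ c ∈ V, deg c = ∑ T ∈ star, (V.filter fun c => c ∈ T).card :=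
      Finset.sum_card_bipartiteAbove_eq_sum_card_bipartiteBelow (fun c T => c ∈ T)
    rw [h1]
    refine Finset.even_sum _ fun T hT => ?_
    rw [hstar, Finset.mem_filter] at hT
    have : V.filter (fun c => c ∈ T) = T \ e := by
      ext c
      simp only [hV, Finset.mem_filter, Finset.mem_sdiff]
      refine ⟨fun h => ⟨h.2, h.1.2⟩, fun h => ⟨⟨?_, h.2⟩, h.1⟩⟩
      exact Finset.le_sup (f := id) hT.1 h.1
    rw [this, Finset.card_sdiff_of_subset hT.2, (isTet hT.1).card_eq, hc]
    exact ⟨1, rfl⟩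
  have hex : ∃ c ∈ V, deg c = 1 := by
    by_contra! hcon
    obtain ⟨x, hx⟩ := openHull_nonempty (s := e) (Finset.card_pos.1 (by omega))
    have hxb := heb (openHull_subset_hull e hx)
    rw [bdry_eq] at hxb
    refine hxb.2 (mem_interiorDomain_of_edge hT₀ heT₀ hc hx fun T hT s hs hes hs3 => ?_)
    obtain ⟨c, hcs, hce⟩ : ∃ c ∈ s, c ∉ e := by
      by_contra! h
      have := Finset.card_le_card (show s ⊆ e from h)
      omega
    have hse : insert c e = s := Finset.eq_of_subset_of_card_le
      (Finset.insert_subset hcs hes) (by rw [Finset.card_insert_of_notMem hce]; omega)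
    have hcV : c ∈ V := Finset.mem_sdiff.2 ⟨Finset.le_sup (f := id) hT (hs hcs), hce⟩
    have hTm : T ∈ star.filter fun T => c ∈ T := (hmem c T).2 ⟨hT, hse ▸ hs⟩
    have h1 : 1 < deg c := by
      have : 0 < deg c := Finset.card_pos.2 ⟨T, hTm⟩
      have := hcon c hcV
      omega
    obtain ⟨T', hT', hne⟩ := Finset.exists_mem_ne h1 T
    rw [hmem, hse] at hT'
    exact ⟨T', hT'.1, hne, hT'.2⟩
  obtain ⟨c₁, hc₁, hd₁⟩ := hex
  have hodd : Even (V.filter fun c => Odd (deg c)).card := by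
    rw [← Nat.not_odd_iff_even, ← Finset.odd_sum_iff_odd_card_odd, Nat.not_odd_iff_even]
    exact hsum
  have hm₁ : c₁ ∈ V.filter fun c => Odd (deg c) := Finset.mem_filter.2 ⟨hc₁, by rw [hd₁]; exact odd_one⟩
  have hlt : 1 < (V.filter fun c => Odd (deg c)).card := by
    have : 0 < (V.filter fun c => Odd (deg c)).card := Finset.card_pos.2 ⟨c₁, hm₁⟩
    obtain ⟨m, hm⟩ := hodd
    omega
  obtain ⟨c₂, hc₂, hne⟩ := Finset.exists_mem_ne hlt c₁
  rw [Finset.mem_filter] at hc₂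
  have hd₂ : deg c₂ = 1 := by
    have h2 := hdeg2 c₂ hc₂.1
    obtain ⟨m, hm⟩ := hc₂.2
    omega
  obtain ⟨T₁, hT₁, hF₁⟩ := hface c₁ hc₁ hd₁
  obtain ⟨T₂, hT₂, hF₂⟩ := hface c₂ hc₂.1 hd₂
  refine ⟨T₁, hT₁, T₂, hT₂, _, _, hF₁, hF₂, Finset.subset_insert _ _, Finset.subset_insert _ _,
    fun h => ?_⟩
  have : c₂ ∈ insert c₁ e := h ▸ Finset.mem_insert_self c₂ e
  rcases Finset.mem_insert.1 this with h' | h'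
  · exact hne h'
  · exact (Finset.mem_sdiff.1 hc₂.1).2 h'

end TetMesh

/-! ### Geometry of a `C¹` boundary -/

/-- Near `x₀` the set `Ω` lies below the graph of a function over the plane orthogonal to `n`
which is Lipschitz with constant about `ε`. -/
structure FlatAt (Ω : Set E3) (ε r₀ : ℝ) (x₀ n : E3) : Prop where
  norm_eq : ‖n‖ = 1
  inner_le : ∀ y ∈ Metric.ball x₀ r₀, ∀ z ∈ Metric.ball x₀ r₀, y ∉ Ω → z ∈ closure Ω →
    inner ℝ n (z - y) ≤ ε * ‖z - y‖

/-- Strict differentiability compares ψ z - ψ y with the differential for all pairs near x₀ at once;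
ψ ≥ 0 off Ω and ψ ≤ 0 on its closure near x₀, and n is the normalized gradient. -/
lemma exists_flatAt_point {Ω : Set E3} (hΩ : IsC1Domain Ω) {ε : ℝ} (hε : 0 < ε) {x₀ : E3}
    (hx₀ : x₀ ∈ frontier Ω) : ∃ r₀ n, 0 < r₀ ∧ FlatAt Ω ε r₀ x₀ n := by
  obtain ⟨ψ, hψ, -, hd, hev⟩ := hΩ.boundary x₀ hx₀
  have hstrict := hψ.hasStrictFDerivAt one_ne_zero
  set L := fderiv ℝ ψ x₀
  have hL : 0 < ‖L‖ := norm_pos_iff.2 hd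
  set g := (InnerProductSpace.toDual ℝ E3).symm L with hg
  have hgn : ‖g‖ = ‖L‖ := LinearIsometryEquiv.norm_map _ _
  have hginner : ∀ v, inner ℝ g v = L v := fun v => InnerProductSpace.toDual_symm_apply
  have h1 := hstrict.isLittleO.def (mul_pos hε hL)
  have hcont : ∀ᶠ y in 𝓝 x₀, ContinuousAt ψ y :=
    (hψ.eventually (by simp)).mono fun y hy => hy.continuousAt
  rw [nhds_prod_eq] at h1
  obtain ⟨p, hp, hpp⟩ := (Filter.eventually_prod_self_iff
    (r := fun x y => ‖ψ x - ψ y - L (x - y)‖ ≤ ε * ‖L‖ * ‖x - y‖)).1 h1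
  obtain ⟨r₀, hr₀, hball⟩ := Metric.eventually_nhds_iff_ball.1
    (Filter.Eventually.and hp (hev.and hcont))
  refine ⟨r₀, ‖L‖⁻¹ • g, hr₀, ?_, fun y hy z hz hyΩ hzΩ => ?_⟩
  · rw [norm_smul, norm_inv, norm_norm, hgn, inv_mul_cancel₀ hL.ne']
  have hψy : 0 ≤ ψ y := not_lt.1 fun h => hyΩ ((hball y hy).2.1.2 h)
  have hψz : ψ z ≤ 0 := by
    by_contra! h
    have h2 : ∀ᶠ w in 𝓝 z, 0 < ψ w ∧ w ∈ Metric.ball x₀ r₀ :=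
      ((hball z hz).2.2.eventually (lt_mem_nhds h)).and (Metric.isOpen_ball.mem_nhds hz)
    obtain ⟨w, ⟨hw1, hw2⟩, hw3⟩ := mem_closure_iff_nhds.1 hzΩ _ h2
    exact absurd ((hball w hw2).2.1.1 hw3) (not_lt.2 hw1.le)
  have h3 := hpp z (hball z hz).1 y (hball y hy).1
  rw [Real.norm_eq_abs] at h3
  have h4 := neg_le_of_abs_le h3
  rw [inner_smul_left, RCLike.conj_to_real, hginner, inv_mul_le_iff₀ hL]
  nlinarith

lemma FlatAt.mono {Ω : Set E3} {ε r₀ r₁ : ℝ} {x₀ x₁ n : E3} (h : FlatAt Ω ε r₀ x₀ n)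
    (hs : Metric.ball x₁ r₁ ⊆ Metric.ball x₀ r₀) : FlatAt Ω ε r₁ x₁ n :=
  ⟨h.norm_eq, fun y hy z hz => h.inner_le y (hs hy) z (hs hz)⟩

/-- Uniform flatness of a compact `C¹` boundary. -/
lemma exists_flatAt {Ω : Set E3} (hΩ : IsC1Domain Ω) {ε : ℝ} (hε : 0 < ε) :
    ∃ r₀ > 0, ∀ x₀ ∈ frontier Ω, ∃ n, FlatAt Ω ε r₀ x₀ n := by
  have hK : IsCompact (frontier Ω) :=
    Metric.isCompact_of_isClosed_isBounded isClosed_frontier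
      (hΩ.isBounded.closure.subset frontier_subset_closure)
  choose r n hr hflat using fun x : frontier Ω => exists_flatAt_point hΩ hε x.2
  -- A Lebesgue number of the cover by flat balls is a radius that serves for all boundary points.
  obtain ⟨δ, hδ, hcov⟩ := lebesgue_number_lemma_of_metric (c := fun x : frontier Ω => Metric.ball x.1 (r x))
    hK (fun _ => Metric.isOpen_ball) fun x hx => mem_iUnion.2 ⟨⟨x, hx⟩, Metric.mem_ball_self (hr _)⟩
  refine ⟨δ, hδ, fun x₀ hx₀ => ?_⟩
  obtain ⟨i, hi⟩ := hcov x₀ hx₀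
  exact ⟨n i, (hflat i).mono hi⟩

section Flat

variable {Ω : Set E3} {ε r₀ : ℝ} {x₀ n : E3} (hf : FlatAt Ω ε r₀ x₀ n) (hΩ : IsOpen Ω)
include hf hΩ

/-- A boundary point is both outside the open set Ω and in its closure, so the one-sided estimate
applies in both orders. -/
lemma FlatAt.abs_inner_le {y z : E3} (hy : y ∈ Metric.ball x₀ r₀) (hz : z ∈ Metric.ball x₀ r₀)
    (hyΓ : y ∈ frontier Ω) (hzΓ : z ∈ frontier Ω) : |inner ℝ n (z - y)| ≤ ε * ‖z - y‖ := by
  have hyn : y ∉ Ω := fun h => hyΓ.2 (by rwa [hΩ.interior_eq])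
  have hzn : z ∉ Ω := fun h => hzΓ.2 (by rwa [hΩ.interior_eq])
  have h1 := hf.inner_le y hy z hz hyn hzΓ.1
  have h2 := hf.inner_le z hz y hy hzn hyΓ.1
  rw [← neg_sub z y, inner_neg_right, norm_neg] at h2
  exact abs_le.2 ⟨by linarith, h1⟩

/-- The line through a point `M` close to `Γ`, in a transversal direction, meets `Γ` near `M`
in a single point. -/
lemma FlatAt.exists_nearest {a M d : E3} {A : Set E3} {κ η τ : ℝ} (hA : ∀ x, x ∈ A ↔ ∃ t : ℝ, x = M + t • d)
    (hd : ‖d‖ = 1) (haΓ : a ∈ frontier Ω) (ha : a ∈ Metric.ball x₀ r₀) (hη : |inner ℝ n (M - a)| ≤ η)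
    (hκ : κ ≤ |inner ℝ n d|) (hεκ : ε < κ) (hε : 0 ≤ ε) (hτ : ε * (‖M - a‖ + τ) + η < κ * τ) (hτ0 : 0 ≤ τ)
    (hball : dist M x₀ + τ < r₀) :
    ∃ P ∈ frontier Ω, dist M P ≤ τ ∧ ∀ Q, IsNearestPoint (frontier Ω ∩ A) M Q ↔ Q = P := by
  -- Replacing d by -d leaves the line unchanged.
  wlog hpos : 0 ≤ inner ℝ n d generalizing d
  · refine this (d := -d) (fun x => (hA x).trans ⟨?_, ?_⟩) (by rwa [norm_neg])
      (by rwa [inner_neg_right, abs_neg]) (by rw [inner_neg_right]; linarith)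
    · rintro ⟨t, rfl⟩; exact ⟨-t, by simp⟩
    · rintro ⟨t, rfl⟩; exact ⟨-t, by simp⟩
  rw [abs_of_nonneg hpos] at hκ
  have hmem : ∀ t : ℝ, |t| ≤ τ → M + t • d ∈ Metric.ball x₀ r₀ := fun t ht => by
    rw [Metric.mem_ball]
    have h1 : dist (M + t • d) M = |t| := by
      rw [dist_eq_norm, add_sub_cancel_left, norm_smul, hd, mul_one, Real.norm_eq_abs]
    have := dist_triangle (M + t • d) M x₀
    linarith
  have hnorm : ∀ t : ℝ, |t| ≤ τ → ‖M + t • d - a‖ ≤ ‖M - a‖ + τ := fun t ht => by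
    rw [add_sub_right_comm]
    refine (norm_add_le _ _).trans ?_
    rw [norm_smul, hd, mul_one, Real.norm_eq_abs]
    linarith
  have hinner : ∀ t : ℝ, inner ℝ n (M + t • d - a) = inner ℝ n (M - a) + t * inner ℝ n d := fun t => by
    rw [add_sub_right_comm, inner_add_right, inner_smul_right]
  have han : a ∉ Ω := fun h => haΓ.2 (by rwa [hΩ.interior_eq])
  have hη' := abs_le.1 hη
  -- At the parameters ±τ the normal displacement, at least κτ, exceeds the flatness error ε(‖M - a‖
  -- + τ) + η; the line thus passes from Ω to the exterior and crosses Γ.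
  have hup : M + τ • d ∉ closure Ω := fun h => by
    have hτa : |τ| ≤ τ := (abs_of_nonneg hτ0).le
    have h1 := hf.inner_le a ha _ (hmem τ hτa) han h
    rw [hinner] at h1
    nlinarith [hnorm τ hτa, mul_le_mul_of_nonneg_left hκ hτ0]
  have hdown : M + (-τ) • d ∈ Ω := by
    by_contra h
    have hτa : |-τ| ≤ τ := by rw [abs_neg, abs_of_nonneg hτ0]
    have h1 := hf.inner_le _ (hmem (-τ) hτa) a ha h haΓ.1
    rw [← neg_sub, inner_neg_right, norm_neg, hinner] at h1
    nlinarith [hnorm (-τ) hτa, mul_le_mul_of_nonneg_left hκ hτ0]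
  obtain ⟨t, ht, htΓ⟩ : ∃ t ∈ Icc (-τ) τ, M + t • d ∈ frontier Ω := by
    by_contra! hcon
    have hc : Continuous fun t : ℝ => M + t • d := by fun_prop
    obtain ⟨t, -, h1, h2⟩ := isPreconnected_Icc ((fun t : ℝ => M + t • d) ⁻¹' Ω)
      ((fun t : ℝ => M + t • d) ⁻¹' (closure Ω)ᶜ) (hΩ.preimage hc) (isClosed_closure.isOpen_compl.preimage hc)
      (fun t ht => by
        by_contra h
        simp only [mem_union, mem_preimage, mem_compl_iff, not_or, not_not] at h
        exact hcon t ht ⟨h.2, by rw [hΩ.interior_eq]; exact h.1⟩)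
      ⟨-τ, left_mem_Icc.2 (by linarith), hdown⟩ ⟨τ, right_mem_Icc.2 (by linarith), hup⟩
    exact h2 (subset_closure h1)
  have hta : |t| ≤ τ := abs_le.2 ht
  have hdist : ∀ s : ℝ, dist M (M + s • d) = |s| := fun s => by
    rw [dist_eq_norm, sub_add_cancel_left, norm_neg, norm_smul, hd, mul_one, Real.norm_eq_abs]
  -- A secant of Γ along d would have slope at least κ > ε against the tangent plane.
  have huniq : ∀ s : ℝ, |s| ≤ τ → M + s • d ∈ frontier Ω → s = t := fun s hs hsΓ => by
    have h1 := hf.abs_inner_le hΩ (hmem t hta) (hmem s hs) htΓ hsΓ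
    rw [add_sub_add_left_eq_sub, ← sub_smul, inner_smul_right, norm_smul, hd, mul_one, abs_mul,
      abs_of_nonneg hpos, Real.norm_eq_abs, mul_comm] at h1
    by_contra hne
    have h2 : 0 < |s - t| := abs_pos.2 (sub_ne_zero.2 hne)
    nlinarith
  -- Γ may meet the line again farther away, but a nearest point is within τ of M, where the
  -- crossing is unique.
  refine ⟨M + t • d, htΓ, by rw [hdist]; exact hta, fun Q => ⟨fun hQ => ?_, ?_⟩⟩
  · obtain ⟨s, rfl⟩ := (hA Q).1 hQ.1.2
    have h1 := hQ.2 (M + t • d) ⟨htΓ, (hA _).2 ⟨t, rfl⟩⟩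
    rw [hdist, hdist] at h1
    rw [huniq s (h1.trans hta) hQ.1.1]
  · rintro rfl
    refine ⟨⟨htΓ, (hA _).2 ⟨t, rfl⟩⟩, fun P' hP' => ?_⟩
    obtain ⟨s, rfl⟩ := (hA P').1 hP'.2
    by_contra! h
    have h2 := h
    rw [hdist, hdist] at h2
    rw [huniq s (h2.le.trans hta) hP'.1] at h
    exact lt_irrefl _ h

end Flat

/-- Points of a simplex with vertices on `Γ` are close to the tangent plane. -/
lemma FlatAt.abs_inner_hull_le {Ω : Set E3} {ε r₀ : ℝ} {x₀ n : E3} (hf : FlatAt Ω ε r₀ x₀ n) (hΩ : IsOpen Ω)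
    (hε : 0 ≤ ε) {s : Finset E3} (hs : ∀ v ∈ s, v ∈ frontier Ω ∧ v ∈ Metric.ball x₀ r₀) {a M : E3} (ha : a ∈ s)
    (hM : M ∈ hull s) {h : ℝ} (hh : ∀ v ∈ s, ‖v - a‖ ≤ h) : |inner ℝ n (M - a)| ≤ ε * h := by
  have hconv : Convex ℝ {x | |inner ℝ n (x - a)| ≤ ε * h} := by
    have : {x | |inner ℝ n (x - a)| ≤ ε * h} =
        {x | inner ℝ n x ≤ ε * h + inner ℝ n a} ∩ {x | inner ℝ n a - ε * h ≤ inner ℝ n x} := by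
      ext x
      simp only [mem_ofPred_eq, mem_inter_iff, inner_sub_right, abs_le]
      constructor <;> rintro ⟨h1, h2⟩ <;> constructor <;> linarith
    rw [this]
    exact (convex_halfSpace_le (innerₛₗ ℝ n).isLinear _).inter (convex_halfSpace_ge (innerₛₗ ℝ n).isLinear _)
  refine convexHull_min (fun v hv => ?_) hconv hM
  exact (hf.abs_inner_le hΩ (hs a ha).2 (hs v hv).2 (hs a ha).1 (hs v hv).1).trans
    (mul_le_mul_of_nonneg_left (hh v hv) hε)

/-- The vertex opposite to a boundary face lies well inside. -/
lemma FlatAt.inner_opposite_le {Ω : Set E3} {ε r₀ : ℝ} {x₀ n : E3} (hf : FlatAt Ω ε r₀ x₀ n) (hΩ : IsOpen Ω)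
    (hε : 0 ≤ ε) {T F : Finset E3} (hT : IsTet T) (hF : F ⊆ T) (hFc : F.card = 3)
    (hFΓ : ∀ v ∈ F, v ∈ frontier Ω) (hball : ∀ v ∈ T, v ∈ Metric.ball x₀ r₀) {O : E3} (hO : O ∈ T) (hOF : O ∉ F)
    (hOΩ : O ∈ closure Ω) {c : E3} {r : ℝ} (hr : 0 < r) (hB : Metric.closedBall c r ⊆ hull T)
    (hεr : ε * Metric.diam (hull T) < r)
    {a : E3} (ha : a ∈ F) : inner ℝ n (O - a) ≤ ε * Metric.diam (hull T) - 2 * r := by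
  set h := Metric.diam (hull T)
  have hdist : ∀ v ∈ T, ‖v - a‖ ≤ h := fun v hv => by
    rw [← dist_eq_norm]
    exact Metric.dist_le_diam_of_mem (isCompact_hull T).isBounded (subset_convexHull ℝ _ hv)
      (subset_convexHull ℝ _ (hF ha))
  have hop : ∀ v ∈ T, v ∉ F → v = O := by
    obtain ⟨O₁, -, -, h⟩ := TetMesh.exists_opposite hT hF hFc
    exact fun v hv hvs => (h v hv hvs).trans (h O hO hOF).symm
  have han : a ∉ Ω := fun h => (hFΓ a ha).2 (by rwa [hΩ.interior_eq])
  have hFv : ∀ v ∈ F, |inner ℝ n (v - a)| ≤ ε * h := fun v hv =>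
    (hf.abs_inner_le hΩ (hball a (hF ha)) (hball v (hF hv)) (hFΓ a ha) (hFΓ v hv)).trans
      (mul_le_mul_of_nonneg_left (hdist v (hF hv)) hε)
  have hOle : inner ℝ n (O - a) ≤ ε * h :=
    (hf.inner_le a (hball a (hF ha)) O (hball O hO) han hOΩ).trans
      (mul_le_mul_of_nonneg_left (hdist O hO) hε)
  -- T lies in the slab between the heights m and εh above a, and it contains a ball of diameter 2r,
  -- so m ≤ εh - 2r. As εh < r, this minimum can only come from O.
  set m := min (inner ℝ n (O - a)) (-(ε * h)) with hm
  have hsub : hull T ⊆ {x | inner ℝ n x ≤ ε * h + inner ℝ n a} ∩ {x | m + inner ℝ n a ≤ inner ℝ n x} := by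
    refine convexHull_min (fun v hv => ?_) ((convex_halfSpace_le (innerₛₗ ℝ n).isLinear _).inter
      (convex_halfSpace_ge (innerₛₗ ℝ n).isLinear _))
    simp only [mem_inter_iff, mem_ofPred_eq]
    have e : inner ℝ n (v - a) = inner ℝ n v - inner ℝ n a := inner_sub_right _ _ _
    by_cases hvF : v ∈ F
    · have := abs_le.1 (hFv v hvF)
      have := min_le_right (inner ℝ n (O - a)) (-(ε * h))
      constructor <;> linarith
    · have := hop v hv hvF
      rw [this] at e ⊢
      have := min_le_left (inner ℝ n (O - a)) (-(ε * h))
      constructor <;> linarith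
  have hnn : inner ℝ n n = (1 : ℝ) := by rw [real_inner_self_eq_norm_sq, hf.norm_eq, one_pow]
  have hp : c + r • n ∈ hull T := hB (by
    rw [Metric.mem_closedBall, dist_eq_norm, add_sub_cancel_left, norm_smul, hf.norm_eq, mul_one,
      Real.norm_of_nonneg hr.le])
  have hq : c - r • n ∈ hull T := hB (by
    rw [Metric.mem_closedBall, dist_eq_norm, sub_sub_cancel_left, norm_neg, norm_smul, hf.norm_eq, mul_one,
      Real.norm_of_nonneg hr.le])
  have h1 := (hsub hp).1
  have h2 := (hsub hq).2
  simp only [mem_ofPred_eq, inner_add_right, inner_sub_right, inner_smul_right, hnn] at h1 h2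
  have h3 : m ≤ ε * h - 2 * r := by linarith
  rcases min_le_iff.1 h3 with h4 | h4
  · exact h4
  · linarith

/-! ### The planes of the skins are transversal to the boundary -/

lemma IsConormal.exists_eq {F : Finset E3} {a b m : E3} [DecidableEq E3] (h : IsConormal {a, b} F m) :
    ∃ c ∈ F, c ≠ a ∧ c ≠ b ∧ ∃ s t : ℝ, 0 < t ∧ c - a = s • (b - a) + t • m := by
  obtain ⟨-, -, c, hc, hce, p, hp, t, ht, h⟩ := h
  rw [Finset.coe_pair, mem_affineSpan_pair_iff_exists_lineMap_eq] at hp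
  obtain ⟨s, rfl⟩ := hp
  simp only [Finset.mem_insert, Finset.mem_singleton, not_or] at hce
  refine ⟨c, hc, hce.1, hce.2, s, t, ht, ?_⟩
  rw [h, AffineMap.lineMap_apply]
  simp
  abel

lemma exists_isConormal {T F : Finset E3} (hT : IsTet T) (hF : F ⊆ T) [DecidableEq E3] {a b : E3}
    (hab : a ≠ b) (he : {a, b} ⊆ F) (hFc : F.card = 3) : ∃ m, IsConormal {a, b} F m := by
  obtain ⟨c, hc, hce⟩ : ∃ c ∈ F, c ∉ ({a, b} : Finset E3) := by
    by_contra! h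
    have := Finset.card_le_card (show F ⊆ {a, b} from h)
    rw [Finset.card_pair hab] at this
    omega
  have ha : a ∈ F := he (by simp)
  have hb : b ∈ F := he (by simp)
  have hce' : c ≠ a ∧ c ≠ b := by simpa using hce
  have hba : b - a ≠ 0 := sub_ne_zero.2 hab.symm
  set s : ℝ := inner ℝ (b - a) (c - a) / ‖b - a‖ ^ 2 with hs
  set p : E3 := a + s • (b - a) with hp
  -- The coordinate of c vanishes on the whole line of the edge and is 1 at c, so c is not its own
  -- projection.
  have hcp : c - p ≠ 0 := fun h => by
    have h1 : bary T c p = 0 := by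
      rw [hp, bary_add, map_smul, bary_sub, hT.bary_of_ne (hF hc) (hF hb) hce'.2,
        hT.bary_of_ne (hF hc) (hF ha) hce'.1]
      simp
    rw [← sub_eq_zero.1 h, hT.bary_self (hF hc)] at h1
    exact one_ne_zero h1
  have hn : 0 < ‖c - p‖ := norm_pos_iff.2 hcp
  have horth : inner ℝ (c - p) (b - a) = (0 : ℝ) := by
    have : c - p = (c - a) - s • (b - a) := by rw [hp]; abel
    rw [this, inner_sub_left, inner_smul_left, real_inner_self_eq_norm_sq, RCLike.conj_to_real, hs,
      div_mul_cancel₀ _ (pow_ne_zero 2 (norm_ne_zero_iff.2 hba)), real_inner_comm, sub_self]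
  refine ⟨‖c - p‖⁻¹ • (c - p), ?_, ?_, c, hc, hce, p, ?_, ‖c - p‖, hn, ?_⟩
  · rw [norm_smul, norm_inv, norm_norm, inv_mul_cancel₀ hn.ne']
  · intro x hx y hy
    rw [inner_smul_left]
    simp only [Finset.mem_insert, Finset.mem_singleton] at hx hy
    rcases hx with rfl | rfl <;> rcases hy with rfl | rfl
    · simp
    · rw [← neg_sub y x, inner_neg_right, horth]; simp
    · rw [horth]; simp
    · simp
  · rw [Finset.coe_pair, mem_affineSpan_pair_iff_exists_lineMap_eq]
    exact ⟨s, by rw [AffineMap.lineMap_apply, hp]; simp [add_comm]⟩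
  · rw [smul_inv_smul₀ hn.ne', add_sub_cancel]

set_option maxHeartbeats 800000 in
/-- Conormals are almost tangent, and the directions pointing into an element along a boundary
face can be recognized from the approximate normal. -/
lemma FlatAt.conormal {Ω : Set E3} {ε r₀ σ : ℝ} {x₀ n : E3} (hf : FlatAt Ω ε r₀ x₀ n) (hΩ : IsOpen Ω)
    (hε : 0 ≤ ε) (hσ : 1 ≤ σ) (hεσ : ε * (128 * σ ^ 2) ≤ 1) [DecidableEq E3]
    {T F : Finset E3} (hT : IsTet T) (hF : F ⊆ T) (hFc : F.card = 3)
    (hFΓ : ∀ v ∈ F, v ∈ frontier Ω) (hTΩ : ∀ v ∈ T, v ∈ closure Ω) (hball : ∀ v ∈ T, v ∈ Metric.ball x₀ r₀)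
    {c₀ : E3} {r : ℝ} (hr : 0 < r) (hB : Metric.closedBall c₀ r ⊆ hull T)
    (hreg : Metric.diam (hull T) ≤ σ * (2 * r)) {a b m E : E3} (hab : a ≠ b) (he : {a, b} ⊆ F)
    (hE : E = ‖b - a‖⁻¹ • (b - a)) (hm : IsConormal {a, b} F m) :
    |inner ℝ n m| ≤ 2 * ε * σ ∧ ∀ d : E3, ‖d - m‖ < 1 / σ →
      inner ℝ (n - inner ℝ n E • E - inner ℝ n m • m) d < (0 : ℝ) →
      ∀ q ∈ openHull {a, b}, ∀ᶠ t in 𝓝[>] (0 : ℝ), q + t • d ∈ interior (hull T) := by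
  set h := Metric.diam (hull T)
  obtain ⟨c, hc, hca, hcb, s, t, ht, hst⟩ := hm.exists_eq
  have ha : a ∈ F := he (by simp)
  have hb : b ∈ F := he (by simp)
  have hmab : inner ℝ m (b - a) = (0 : ℝ) := hm.2.1 b (by simp) a (by simp)
  have hm1 : ‖m‖ = 1 := hm.1
  have hba : 0 < ‖b - a‖ := norm_pos_iff.2 (sub_ne_zero.2 hab.symm)
  have hbaE : b - a = ‖b - a‖ • E := by rw [hE, smul_inv_smul₀ hba.ne']
  have hE1 : ‖E‖ = 1 := by rw [hE, norm_smul, norm_inv, norm_norm, inv_mul_cancel₀ hba.ne']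
  have hmE : inner ℝ m E = (0 : ℝ) := by rw [hE, inner_smul_right, hmab, mul_zero]
  have hdist : ∀ v ∈ T, ‖v - a‖ ≤ h := fun v hv => by
    rw [← dist_eq_norm]
    exact Metric.dist_le_diam_of_mem (isCompact_hull T).isBounded (subset_convexHull ℝ _ hv)
      (subset_convexHull ℝ _ (hF ha))
  have h0 : 0 ≤ h := Metric.diam_nonneg
  -- t is the height of the triangle above the edge, so λ_c grows along m at the rate 1/t; below, t
  -- is shown to lie between 2r and h.
  have hlc : t * (bary T c).linear m = 1 := by
    have h1 : (bary T c).linear (c - a) = 1 := by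
      rw [bary_sub, hT.bary_self (hF hc), hT.bary_of_ne (hF hc) (hF ha) hca, sub_zero]
    rw [hst, map_add, map_smul, map_smul, bary_sub, hT.bary_of_ne (hF hc) (hF hb) hcb,
      hT.bary_of_ne (hF hc) (hF ha) hca, sub_zero, smul_zero, zero_add, smul_eq_mul] at h1
    exact h1
  have ht2r : 2 * r ≤ t := by
    have h1 := hT.abs_linear_bary_le hr hB (hF hc) m
    rw [hm1] at h1
    have h2 := le_abs_self ((bary T c).linear m)
    have h3 : 2 * r * (bary T c).linear m ≤ 1 :=
      (mul_le_mul_of_nonneg_left h2 (by positivity)).trans h1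
    have h4 : 0 < (bary T c).linear m := (pos_iff_pos_of_mul_pos (hlc ▸ one_pos)).1 ht
    exact le_of_mul_le_mul_right (h3.trans_eq hlc.symm) h4
  have hpyth : ‖c - a‖ ^ 2 = (|s| * ‖b - a‖) ^ 2 + t ^ 2 := by
    have h1 : inner ℝ (s • (b - a)) (t • m) = (0 : ℝ) := by
      rw [inner_smul_left, inner_smul_right, real_inner_comm, hmab]; simp
    have := norm_add_sq_eq_norm_sq_add_norm_sq_real h1
    rw [← hst] at this
    rw [pow_two, this, norm_smul, norm_smul, hm1, Real.norm_eq_abs, Real.norm_eq_abs, mul_one]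
    rw [← sq_abs t]
    ring
  have hcah := hdist c (hF hc)
  have hth : t ≤ h := (abs_le_of_sq_le_sq' (by linarith [sq_nonneg (|s| * ‖b - a‖)])
    (norm_nonneg (c - a))).2.trans hcah
  have hsh : |s| * ‖b - a‖ ≤ h := (abs_le_of_sq_le_sq' (by linarith [sq_nonneg t])
    (norm_nonneg (c - a))).2.trans hcah
  have hnba : |inner ℝ n (b - a)| ≤ ε * ‖b - a‖ :=
    hf.abs_inner_le hΩ (hball a (hF ha)) (hball b (hF hb)) (hFΓ a ha) (hFΓ b hb)
  have hnca : |inner ℝ n (c - a)| ≤ ε * h :=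
    (hf.abs_inner_le hΩ (hball a (hF ha)) (hball c (hF hc)) (hFΓ a ha) (hFΓ c hc)).trans
      (mul_le_mul_of_nonneg_left hcah hε)
  have hnE : |inner ℝ n E| ≤ ε := by
    rw [hE, inner_smul_right, abs_mul, abs_inv, abs_norm, inv_mul_le_iff₀ hba, mul_comm]
    exact hnba
  have hnm : |inner ℝ n m| ≤ 2 * ε * σ := by
    have h1 : t * inner ℝ n m = inner ℝ n (c - a) - s * inner ℝ n (b - a) := by
      rw [hst, inner_add_right, inner_smul_right, inner_smul_right]; ring
    have h2 : t * |inner ℝ n m| ≤ 2 * ε * h := by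
      rw [← abs_of_pos ht, ← abs_mul, h1]
      refine (abs_sub _ _).trans ?_
      rw [abs_mul]
      have := mul_le_mul_of_nonneg_left hnba (abs_nonneg s)
      linarith [mul_le_mul_of_nonneg_left hsh hε]
    have h3 : 2 * r * |inner ℝ n m| ≤ 2 * r * (2 * ε * σ) := by
      have h4 := mul_le_mul_of_nonneg_right ht2r (abs_nonneg (inner ℝ n m))
      have h5 := mul_le_mul_of_nonneg_left hreg (by positivity : 0 ≤ 2 * ε)
      linarith
    exact le_of_mul_le_mul_left h3 (by positivity)
  -- A direction starting on the edge enters T as soon as it raises the coordinates of the two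
  -- vertices off the edge, c and O.
  refine ⟨hnm, fun d hdm hnd q hq => ?_⟩
  obtain ⟨O, hO, hOF, hop⟩ := TetMesh.exists_opposite hT hF hFc
  -- n' is the part of n orthogonal to the plane of F. As n is almost orthogonal to E and m, O stays
  -- on the negative side of n', and the sign of ⟨n', d⟩ decides whether d rises towards O.
  set n' := n - inner ℝ n E • E - inner ℝ n m • m with hn'
  have hσ0 : 0 < σ := by linarith
  have hσ2 : σ ≤ σ ^ 2 := le_self_pow₀ hσ two_ne_zero
  have hOle : inner ℝ n (O - a) ≤ ε * h - 2 * r := by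
    refine hf.inner_opposite_le hΩ hε hT hF hFc hFΓ hball hO hOF (hTΩ O hO) hr hB ?_ ha
    have h1 := mul_le_mul_of_nonneg_left hreg hε
    have h2 : ε * σ * 128 ≤ 1 := by linarith [mul_le_mul_of_nonneg_left hσ2 hε]
    have h3 := mul_le_mul_of_nonneg_right h2 hr.le
    linarith
  have hμ : inner ℝ n' (O - a) < (0 : ℝ) := by
    rw [hn', inner_sub_left, inner_sub_left, inner_smul_left, inner_smul_left, RCLike.conj_to_real,
      RCLike.conj_to_real]
    have h1 : |inner ℝ n E * inner ℝ E (O - a)| ≤ ε * h := by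
      rw [abs_mul]
      refine mul_le_mul hnE ((abs_real_inner_le_norm _ _).trans ?_) (abs_nonneg _) hε
      rw [hE1, one_mul]
      exact hdist O hO
    have h2 : |inner ℝ n m * inner ℝ m (O - a)| ≤ 2 * ε * σ * h := by
      rw [abs_mul]
      refine mul_le_mul hnm ((abs_real_inner_le_norm _ _).trans ?_) (abs_nonneg _) (by positivity)
      rw [hm1, one_mul]
      exact hdist O hO
    have h3 := neg_le_of_abs_le h1
    have h4 := neg_le_of_abs_le h2
    have h5 : (2 * ε + 2 * ε * σ) * h ≤ (2 * ε + 2 * ε * σ) * (σ * (2 * r)) :=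
      mul_le_mul_of_nonneg_left hreg (by positivity)
    have h6 : (ε * σ + ε * σ ^ 2) * 64 ≤ 1 := by
      have := mul_le_mul_of_nonneg_left hσ2 hε
      linarith
    have h7 := mul_le_mul_of_nonneg_right h6 hr.le
    linarith
  have hn'E : inner ℝ n' (b - a) = (0 : ℝ) := by
    rw [hbaE, inner_smul_right, hn', inner_sub_left, inner_sub_left, inner_smul_left, inner_smul_left,
      RCLike.conj_to_real, RCLike.conj_to_real, real_inner_self_eq_norm_sq, hE1, hmE]
    ring
  have hn'm : inner ℝ n' m = (0 : ℝ) := by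
    rw [hn', inner_sub_left, inner_sub_left, inner_smul_left, inner_smul_left,
      RCLike.conj_to_real, RCLike.conj_to_real, real_inner_self_eq_norm_sq, hm1, real_inner_comm m E, hmE]
    ring
  have hn'c : inner ℝ n' (c - a) = (0 : ℝ) := by
    rw [hst, inner_add_right, inner_smul_right, inner_smul_right, hn'E, hn'm]; ring
  have hFeq : ∀ v ∈ F, v = a ∨ v = b ∨ v = c := by
    have h1 : ({c, a, b} : Finset E3) = F := by
      refine Finset.eq_of_subset_of_card_le (Finset.insert_subset hc he) ?_
      rw [Finset.card_insert_of_notMem (by simp [hca, hcb]), Finset.card_pair hab, hFc]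
    intro v hv
    rw [← h1] at hv
    simp only [Finset.mem_insert, Finset.mem_singleton] at hv
    tauto
  have hOa : O ≠ a := fun h => hOF (h ▸ ha)
  have hOb : O ≠ b := fun h => hOF (h ▸ hb)
  have hOc : O ≠ c := fun h => hOF (h ▸ hc)
  have hlO : (bary T O).linear d * inner ℝ n' (O - a) = inner ℝ n' d := by
    have h1 : (bary T O).linear d = bary T O (a + d) := by
      rw [bary_add, hT.bary_of_ne hO (hF ha) hOa, zero_add]
    have h2 : d = ∑ v ∈ T, bary T v (a + d) • (v - a) := by
      simp only [smul_sub]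
      rw [Finset.sum_sub_distrib, hT.sum_bary_smul, ← Finset.sum_smul, hT.sum_bary, one_smul,
        add_sub_cancel_left]
    conv_rhs => rw [h2]
    rw [inner_sum, Finset.sum_eq_single O, inner_smul_right, h1]
    · intro v hv hvO
      have hvF : v ∈ F := by_contra fun h => hvO (hop v hv h)
      rw [inner_smul_right]
      rcases hFeq v hvF with rfl | rfl | rfl
      · simp
      · rw [hn'E, mul_zero]
      · rw [hn'c, mul_zero]
    · exact fun h => absurd hO h
  have hdO : 0 < (bary T O).linear d := by
    by_contra! h1
    linarith [mul_nonneg_of_nonpos_of_nonpos h1 hμ.le]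
  -- λ_c grows along m at a rate at least 1/h ≥ 1/(2σr), and its gradient is at most 1/(2r); a
  -- perturbation of m shorter than 1/σ keeps the rate positive.
  have hdc : 0 < (bary T c).linear d := by
    have h1 : (bary T c).linear d = (bary T c).linear m + (bary T c).linear (d - m) := by
      rw [← map_add, add_sub_cancel]
    have h2 := hT.abs_linear_bary_le hr hB (hF hc) (d - m)
    have h3 := neg_abs_le ((bary T c).linear (d - m))
    rw [lt_div_iff₀ hσ0] at hdm
    set L := (bary T c).linear m
    set X := |(bary T c).linear (d - m)|
    have hX : 0 ≤ X := abs_nonneg _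
    have hLpos : 0 < L := (pos_iff_pos_of_mul_pos (hlc ▸ one_pos)).1 ht
    have h4 : 1 ≤ h * L := by rw [← hlc]; exact mul_le_mul_of_nonneg_right hth hLpos.le
    have h6 : 1 ≤ σ * (2 * r) * L := h4.trans (mul_le_mul_of_nonneg_right hreg hLpos.le)
    have h7 : σ * (2 * r) * X < 1 := by
      calc σ * (2 * r) * X = (2 * r * X) * σ := by ring
        _ ≤ ‖d - m‖ * σ := mul_le_mul_of_nonneg_right h2 hσ0.le
        _ < 1 := hdm
    have h8 : X < L := by
      have : σ * (2 * r) * X < σ * (2 * r) * L := by linarith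
      exact lt_of_mul_lt_mul_left this (by positivity)
    linarith
  have hcont : Tendsto (fun t : ℝ => q + t • d) (𝓝[>] 0) (𝓝 q) := by
    have : ContinuousAt (fun t : ℝ => q + t • d) 0 := by fun_prop
    have h2 := this.tendsto
    rw [zero_smul, add_zero] at h2
    exact h2.mono_left nhdsWithin_le_nhds
  have heT : {a, b} ⊆ T := he.trans hF
  filter_upwards [hcont.eventually (TetMesh.eventually_pos_of_openHull hT heT hq), self_mem_nhdsWithin] with t' ht' ht0
  have ht0 : (0 : ℝ) < t' := ht0
  refine hT.mem_interior_iff.2 fun v hv => ?_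
  have hq0 := (hT.mem_openHull_iff heT).1 hq
  by_cases hvF : v ∈ F
  · rcases hFeq v hvF with rfl | rfl | rfl
    · exact ht' v (by simp)
    · exact ht' v (by simp)
    · rw [bary_add, (hq0 v hv).2 (by simp [hca, hcb]), map_smul, smul_eq_mul, zero_add]
      positivity
  · rw [hop v hv hvF]
    rw [bary_add, (hq0 O hO).2 (by simp [hOa, hOb]), map_smul, smul_eq_mul, zero_add]
    positivity

/-- The diameter 2r of the inscribed ball is at most that of the element. For σ < 1 there are no
admissible meshes. -/
lemma TetMesh.ShapeRegular.one_le {𝒯 : TetMesh} {σ : ℝ} (h : 𝒯.ShapeRegular σ) : 1 ≤ σ := by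
  obtain ⟨T, hT⟩ := 𝒯.nonempty
  obtain ⟨c, r, hr, hB, hd⟩ := h T hT
  have h1 := Metric.diam_mono hB (isCompact_hull T).isBounded
  have h2 : 2 * r ≤ Metric.diam (Metric.closedBall c r) := by
    have hn : ‖(EuclideanSpace.single 0 1 : E3)‖ = 1 := by simp
    have e1 : c + r • (EuclideanSpace.single 0 1 : E3) ∈ Metric.closedBall c r := by
      rw [Metric.mem_closedBall, dist_eq_norm, add_sub_cancel_left, norm_smul, hn, mul_one,
        Real.norm_of_nonneg hr.le]
    have e2 : c - r • (EuclideanSpace.single 0 1 : E3) ∈ Metric.closedBall c r := by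
      rw [Metric.mem_closedBall, dist_eq_norm, sub_sub_cancel_left, norm_neg, norm_smul, hn, mul_one,
        Real.norm_of_nonneg hr.le]
    have := Metric.dist_le_diam_of_mem Metric.isBounded_closedBall e1 e2
    rwa [dist_eq_norm, add_sub_sub_cancel, ← add_smul, norm_smul, hn, mul_one,
      Real.norm_of_nonneg (by linarith), ← two_mul] at this
  nlinarith

lemma bdry_vertices {𝒯 : TetMesh} {Ω : Set E3} (hfit : 𝒯.Fits Ω) {T s : Finset E3} (hT : T ∈ 𝒯.elems)
    (hs : s ⊆ T) (hb : hull s ⊆ 𝒯.bdry) : ∀ v ∈ s, v ∈ frontier Ω := fun v hv =>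
  (hfit T hT v (hs hv)).2 (hb (subset_convexHull ℝ _ hv))

/-- Elementary estimate behind the transversality of the planes of the skins. -/
lemma abs_ge_of_skin {δ e n₁ n₂ α β x y D : ℝ} (hδ₀ : 0 ≤ δ) (he0 : 0 ≤ e) (he : 64 * e ≤ 1 - δ)
    (hn₁ : |n₁| ≤ e) (hn₂ : 1 / 4 ≤ n₂ ^ 2) (hxy : x ^ 2 + y ^ 2 = 1)
    (hβ : |β| ≤ 4 * e) (hα : α ≤ 0) (hD : D ^ 2 = (1 - α) ^ 2 + β ^ 2)
    (hs : |x * (1 - α) - y * β| ≤ δ * D) : (1 - δ) / 8 ≤ |n₁ * x + n₂ * y| := by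
  -- In the plane orthogonal to the edge, with first axis m₁: n = (n₁, n₂), m₂ = (α, β), ν = (x, y)
  -- and D = ‖m₁ - m₂‖. With α ≤ 0 and β small, m₁ - m₂ is almost along the first axis, so the skin
  -- condition gives |x| ≤ δ up to O(e). Hence |y| is bounded below, and n is almost along the
  -- second axis.
  have hy1 : |y| ≤ 1 := by rw [← sq_le_one_iff_abs_le_one]; linarith [sq_nonneg x]
  have hx1 : |x| ≤ 1 := by rw [← sq_le_one_iff_abs_le_one]; linarith [sq_nonneg y]
  have hα1 : 0 ≤ 1 - α := by linarith
  have hDle : D ≤ (1 - α) + |β| := by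
    refine abs_le_of_sq_le_sq' ?_ (by positivity) |>.2
    rw [hD, add_sq, sq_abs]
    have : 0 ≤ 2 * (1 - α) * |β| := by positivity
    linarith
  have h1 : |x| * (1 - α) ≤ δ * D + |y| * |β| := by
    have e1 : |x| * (1 - α) = |x * (1 - α)| := by rw [abs_mul, abs_of_pos (by linarith : 0 < 1 - α)]
    rw [e1, ← abs_mul]
    calc |x * (1 - α)| = |(x * (1 - α) - y * β) + y * β| := by ring_nf
      _ ≤ _ := (abs_add_le _ _).trans (by linarith)
  have hδ1 : δ ≤ 1 := by linarith
  have h2 : |x| ≤ δ + 2 * |β| := by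
    have e1 : |y| * |β| ≤ |β| := mul_le_of_le_one_left (abs_nonneg _) hy1
    have e2 : δ * D ≤ δ * ((1 - α) + |β|) := mul_le_mul_of_nonneg_left hDle hδ₀
    have e3 : δ * |β| ≤ |β| := mul_le_of_le_one_left (abs_nonneg _) hδ1
    by_contra! h
    have e4 : (δ + 2 * |β|) * (1 - α) < |x| * (1 - α) := mul_lt_mul_of_pos_right h (by linarith)
    have e5 : 0 ≤ 2 * |β| * (-α) := mul_nonneg (by positivity) (by linarith)
    linarith
  have h3 : |x| ≤ (1 + δ) / 2 := by linarith
  have h4 : (1 - δ) / 2 ≤ |y| := by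
    have e1 : x ^ 2 ≤ ((1 + δ) / 2) ^ 2 := by
      rw [← sq_abs]; exact pow_le_pow_left₀ (abs_nonneg _) h3 2
    have e2 : ((1 - δ) / 2) ^ 2 ≤ |y| ^ 2 := by rw [sq_abs]; nlinarith
    exact abs_le_of_sq_le_sq' e2 (abs_nonneg _) |>.2
  have h5 : 1 / 2 ≤ |n₂| := by
    have : (1 / 2 : ℝ) ^ 2 ≤ |n₂| ^ 2 := by rw [sq_abs]; linarith
    exact abs_le_of_sq_le_sq' this (abs_nonneg _) |>.2
  have h6 : |n₂ * y| ≤ |n₁ * x + n₂ * y| + |n₁ * x| := by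
    calc |n₂ * y| = |(n₁ * x + n₂ * y) - n₁ * x| := by ring_nf
      _ ≤ _ := abs_sub _ _
  have h7 : |n₁ * x| ≤ e := by
    rw [abs_mul]
    calc |n₁| * |x| ≤ e * 1 := mul_le_mul hn₁ hx1 (abs_nonneg _) he0
      _ = e := mul_one e
  have h8 : 1 / 2 * ((1 - δ) / 2) ≤ |n₂ * y| := by
    rw [abs_mul]
    exact mul_le_mul h5 h4 (by linarith) (abs_nonneg _)
  linarith

-- Both conormals are orthogonal to the edge and almost tangent to Γ, hence almost opposite or
-- almost equal. In the first case the bisector plane is almost normal to Γ and `abs_ge_of_skin`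
-- applies. In the second case the direction m₁ - κn leads from the edge into the interiors of both
-- elements by `FlatAt.conormal`, which is impossible for distinct elements. `AtMostOneEdgeOrFace`
-- makes them distinct.
set_option maxHeartbeats 1000000 in
lemma skin_transversal {𝒯 : TetMesh} {Ω : Set E3} {ε r₀ σ δ : ℝ} {x₀ n : E3} {ν : Finset E3 → E3}
    (hf : FlatAt Ω ε r₀ x₀ n) (hΩ : IsOpen Ω) (hε : 0 ≤ ε) (hδ₀ : 0 ≤ δ) (hεσ : ε * (128 * σ ^ 2) ≤ 1 - δ)
    (hfit : 𝒯.Fits Ω) (hreg : 𝒯.ShapeRegular σ) (hone : 𝒯.AtMostOneEdgeOrFace) (hν : IsSkinChoice 𝒯 δ ν)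
    {T₀ e : Finset E3} (hT₀ : T₀ ∈ 𝒯.elems) (he : 𝒯.IsBdryEdge T₀ e)
    (hball : ∀ T ∈ 𝒯.elems, e ⊆ T → ∀ v ∈ T, v ∈ Metric.ball x₀ r₀) :
    (1 - δ) / 8 ≤ |inner ℝ n (ν e)| := by
  classical
  obtain ⟨T₁, hT₁, T₂, hT₂, F₁, F₂, hF₁, hF₂, he₁, he₂, hne⟩ := TetMesh.exists_two_bdry_faces hT₀ he
  have hTne : T₁ ≠ T₂ := by
    rintro rfl
    rcases hone T₁ hT₁ with ⟨F, -, h, -⟩ | ⟨h, -⟩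
    · exact hne ((h F₁ hF₁).trans (h F₂ hF₂).symm)
    · exact h ⟨F₁, hF₁⟩
  have hσ := hreg.one_le
  have hεσ1 : ε * (128 * σ ^ 2) ≤ 1 := by linarith
  obtain ⟨hν1, hνe, hνm⟩ := hν T₀ hT₀ e he
  obtain ⟨a, b, hab, rfl⟩ := Finset.card_eq_two.1 he.2.1
  obtain ⟨m₁, hm₁⟩ := exists_isConormal (TetMesh.isTet hT₁) hF₁.1 hab he₁ hF₁.2.1
  obtain ⟨m₂, hm₂⟩ := exists_isConormal (TetMesh.isTet hT₂) hF₂.1 hab he₂ hF₂.2.1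
  have hskin := hνm T₁ hT₁ T₂ hT₂ F₁ F₂ hF₁ hF₂ he₁ he₂ hne m₁ m₂ hm₁ hm₂
  obtain ⟨c₁, r₁, hr₁, hB₁, hd₁⟩ := hreg T₁ hT₁
  obtain ⟨c₂, r₂, hr₂, hB₂, hd₂⟩ := hreg T₂ hT₂
  set E := ‖b - a‖⁻¹ • (b - a) with hE
  obtain ⟨hnm₁, hin₁⟩ := hf.conormal hΩ hε hσ hεσ1 (TetMesh.isTet hT₁) hF₁.1 hF₁.2.1
    (bdry_vertices hfit hT₁ hF₁.1 hF₁.2.2) (fun v hv => (hfit T₁ hT₁ v hv).1)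
    (hball T₁ hT₁ (he₁.trans hF₁.1)) hr₁ hB₁ hd₁ hab he₁ hE hm₁
  obtain ⟨hnm₂, hin₂⟩ := hf.conormal hΩ hε hσ hεσ1 (TetMesh.isTet hT₂) hF₂.1 hF₂.2.1
    (bdry_vertices hfit hT₂ hF₂.1 hF₂.2.2) (fun v hv => (hfit T₂ hT₂ v hv).1)
    (hball T₂ hT₂ (he₂.trans hF₂.1)) hr₂ hB₂ hd₂ hab he₂ hE hm₂
  have hba : 0 < ‖b - a‖ := norm_pos_iff.2 (sub_ne_zero.2 hab.symm)
  have hE1 : ‖E‖ = 1 := by rw [hE, norm_smul, norm_inv, norm_norm, inv_mul_cancel₀ hba.ne']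
  have horthE : ∀ u : E3, inner ℝ u (b - a) = (0 : ℝ) → inner ℝ E u = (0 : ℝ) := fun u hu => by
    rw [hE, inner_smul_left, real_inner_comm, hu, mul_zero]
  have hEm₁ := horthE m₁ (hm₁.2.1 b (by simp) a (by simp))
  have hEm₂ := horthE m₂ (hm₂.2.1 b (by simp) a (by simp))
  have hEν := horthE (ν {a, b}) (hνe b (by simp) a (by simp))
  have haΓ := bdry_vertices hfit hT₀ he.1 he.2.2 a (by simp)
  have hbΓ := bdry_vertices hfit hT₀ he.1 he.2.2 b (by simp)
  have hnE : |inner ℝ n E| ≤ ε := by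
    rw [hE, inner_smul_right, abs_mul, abs_inv, abs_norm, inv_mul_le_iff₀ hba, mul_comm]
    exact hf.abs_inner_le hΩ (hball T₀ hT₀ he.1 a (he.1 (by simp)))
      (hball T₀ hT₀ he.1 b (he.1 (by simp))) haΓ hbΓ
  -- an orthonormal frame adapted to the edge and the first face
  have horthn : Orthonormal ℝ (({0, 1} : Set (Fin 3)).domRestrict ![E, m₁, 0]) := by
    constructor
    · rintro ⟨i, hi⟩
      rcases hi with rfl | rfl
      · simpa using hE1
      · simpa using hm₁.1
    · rintro ⟨i, hi⟩ ⟨j, hj⟩ hij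
      rcases hi with rfl | rfl <;> rcases hj with rfl | rfl
      · exact absurd rfl hij
      · simpa using hEm₁
      · simpa [real_inner_comm] using hEm₁
      · exact absurd rfl hij
  obtain ⟨B, hB⟩ := horthn.exists_orthonormalBasis_extension_of_card_eq
    (by rw [finrank_euclideanSpace_fin]; simp)
  have hB0 : B 0 = E := by simpa using hB 0 (by simp)
  have hB1 : B 1 = m₁ := by simpa using hB 1 (by simp)
  have hsum : ∀ u v : E3, inner ℝ u v =
      inner ℝ u E * inner ℝ E v + inner ℝ u m₁ * inner ℝ m₁ v + inner ℝ u (B 2) * inner ℝ (B 2) v :=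
    fun u v => by rw [← B.sum_inner_mul_inner u v, Fin.sum_univ_three, hB0, hB1]
  set n₁ := inner ℝ n m₁
  set n₂ := inner ℝ n (B 2)
  set α := inner ℝ m₁ m₂ with hα
  set β := inner ℝ (B 2) m₂
  set x := inner ℝ m₁ (ν {a, b})
  set y := inner ℝ (B 2) (ν {a, b})
  set n₀ := inner ℝ n E
  have hnn : n₀ ^ 2 + n₁ ^ 2 + n₂ ^ 2 = 1 := by
    have := hsum n n
    rw [real_inner_self_eq_norm_sq, hf.norm_eq, real_inner_comm n E, real_inner_comm n m₁,
      real_inner_comm n (B 2)] at this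
    linarith
  have hmm : α ^ 2 + β ^ 2 = 1 := by
    have := hsum m₂ m₂
    rw [real_inner_self_eq_norm_sq, hm₂.1, hEm₂, real_inner_comm m₁ m₂, real_inner_comm (B 2) m₂] at this
    linarith
  have hxy : x ^ 2 + y ^ 2 = 1 := by
    have := hsum (ν {a, b}) (ν {a, b})
    rw [real_inner_self_eq_norm_sq, hν1, hEν, real_inner_comm m₁ (ν {a, b}),
      real_inner_comm (B 2) (ν {a, b})] at this
    linarith
  have hnm₂' : inner ℝ n m₂ = n₁ * α + n₂ * β := by rw [hsum n m₂, hEm₂]; ring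
  have hnν : inner ℝ n (ν {a, b}) = n₁ * x + n₂ * y := by rw [hsum n, hEν]; ring
  have hσ2 : σ ≤ σ ^ 2 := le_self_pow₀ hσ two_ne_zero
  have hεσ' : 128 * (ε * σ) ≤ 1 - δ := by linarith [mul_le_mul_of_nonneg_left hσ2 hε]
  have hεle : 128 * ε ≤ 1 := by linarith [mul_le_mul_of_nonneg_left hσ hε]
  set e := 2 * ε * σ with he_def
  have he0 : 0 ≤ e := by positivity
  have he64 : 64 * e ≤ 1 - δ := by linarith
  have hα1 : |α| ≤ 1 := by rw [← sq_le_one_iff_abs_le_one]; linarith [sq_nonneg β]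
  have hn0sq : n₀ ^ 2 ≤ 1 / 16 := by
    rw [← sq_abs]
    have : |n₀| ≤ 1 / 4 := by linarith
    calc |n₀| ^ 2 ≤ (1 / 4) ^ 2 := pow_le_pow_left₀ (abs_nonneg _) this 2
      _ = 1 / 16 := by norm_num
  have hn1sq : n₁ ^ 2 ≤ 1 / 16 := by
    rw [← sq_abs]
    have : |n₁| ≤ 1 / 4 := by linarith
    calc |n₁| ^ 2 ≤ (1 / 4) ^ 2 := pow_le_pow_left₀ (abs_nonneg _) this 2
      _ = 1 / 16 := by norm_num
  have hn2sq : 1 / 4 ≤ n₂ ^ 2 := by linarith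
  have hβ : |β| ≤ 4 * e := by
    have h5 : 1 / 2 ≤ |n₂| := by
      have : (1 / 2 : ℝ) ^ 2 ≤ |n₂| ^ 2 := by rw [sq_abs]; linarith
      exact abs_le_of_sq_le_sq' this (abs_nonneg _) |>.2
    have h6 : |n₂| * |β| ≤ 2 * e := by
      rw [← abs_mul]
      have e1 : n₂ * β = inner ℝ n m₂ - n₁ * α := by rw [hnm₂']; ring
      rw [e1]
      refine (abs_sub _ _).trans ?_
      rw [abs_mul]
      have : |n₁| * |α| ≤ e * 1 := mul_le_mul hnm₁ hα1 (abs_nonneg _) he0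
      linarith
    have h7 := mul_le_mul_of_nonneg_right h5 (abs_nonneg β)
    linarith
  have hdiff : ‖m₁ - m₂‖ ^ 2 = (1 - α) ^ 2 + β ^ 2 := by
    rw [norm_sub_sq_real, hm₁.1, hm₂.1, ← hα]
    linarith
  rw [hnν]
  rcases le_or_gt α 0 with hα0 | hα0
  · refine abs_ge_of_skin hδ₀ he0 he64 hnm₁ hn2sq hxy hβ hα0 hdiff ?_
    refine le_trans (le_of_eq ?_) hskin
    rw [inner_sub_right, hsum (ν {a, b}) m₂, real_inner_comm m₁ (ν {a, b}), hEm₂,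
      real_inner_comm (B 2) (ν {a, b})]
    congr 1
    ring
  -- otherwise the two elements overlap
  exfalso
  have hσ0 : 0 < σ := by linarith
  -- Half of the tolerance 1/σ of `FlatAt.conormal`; the other half absorbs m₁ - m₂ when the
  -- direction is compared with m₂.
  set κ := 1 / (2 * σ) with hκ
  have hκσ : κ * σ = 1 / 2 := by rw [hκ]; field_simp
  have hκ0 : 0 < κ := by rw [hκ]; positivity
  have hdle : ‖m₁ - m₂‖ ≤ 2 * |β| := by
    have h1 : 1 - α ≤ |β| := by
      have e0 : |β| ≤ 1 := by rw [← sq_le_one_iff_abs_le_one]; linarith [sq_nonneg α]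
      have e1 : |β| ^ 2 ≤ |β| := by rw [pow_two]; exact mul_le_of_le_one_left (abs_nonneg β) e0
      have e2 : α ^ 2 ≤ α := by rw [pow_two]; exact mul_le_of_le_one_left hα0.le (abs_le.1 hα1).2
      rw [sq_abs] at e1
      linarith
    have h2 : ‖m₁ - m₂‖ ^ 2 ≤ (2 * |β|) ^ 2 := by
      rw [hdiff, mul_pow, sq_abs]
      have h3 : (1 - α) ^ 2 ≤ |β| ^ 2 :=
        pow_le_pow_left₀ (by have := (abs_le.1 hα1).2; linarith) h1 2
      rw [sq_abs] at h3
      linarith [sq_nonneg β]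
    exact abs_le_of_sq_le_sq' h2 (by positivity) |>.2
  obtain ⟨q, hq⟩ := openHull_nonempty (s := ({a, b} : Finset E3)) ⟨a, by simp⟩
  have hself : inner ℝ n n = (1 : ℝ) := by rw [real_inner_self_eq_norm_sq, hf.norm_eq, one_pow]
  have h1 := hin₁ (m₁ - κ • n) (by
    rw [sub_sub_cancel_left, norm_neg, norm_smul, hf.norm_eq, mul_one, Real.norm_of_nonneg hκ0.le,
      lt_div_iff₀ hσ0, hκσ]
    norm_num) (by
    have e1 : inner ℝ (n - inner ℝ n E • E - inner ℝ n m₁ • m₁) (m₁ - κ • n) =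
        -(κ * (1 - n₀ ^ 2 - n₁ ^ 2)) := by
      simp only [inner_sub_left, inner_sub_right, inner_smul_left, inner_smul_right, RCLike.conj_to_real]
      rw [hEm₁, real_inner_self_eq_norm_sq m₁, hm₁.1, hself, real_inner_comm n E, real_inner_comm n m₁]
      ring
    rw [e1]
    have : 0 < κ * (1 - n₀ ^ 2 - n₁ ^ 2) := mul_pos hκ0 (by linarith)
    linarith) q hq
  have h2 := hin₂ (m₁ - κ • n) (by
    have e1 : m₁ - κ • n - m₂ = (m₁ - m₂) - κ • n := by abel
    rw [e1, lt_div_iff₀ hσ0]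
    have e2 : ‖m₁ - m₂ - κ • n‖ ≤ 2 * |β| + κ := by
      refine (norm_sub_le _ _).trans ?_
      rw [norm_smul, hf.norm_eq, mul_one, Real.norm_of_nonneg hκ0.le]
      linarith
    have e3 : |β| * σ ≤ 8 * (ε * σ ^ 2) := by
      have := mul_le_mul_of_nonneg_right hβ hσ0.le
      rw [he_def] at this
      linarith
    have e4 := mul_le_mul_of_nonneg_right e2 hσ0.le
    linarith) (by
    have e1 : inner ℝ (n - inner ℝ n E • E - inner ℝ n m₂ • m₂) (m₁ - κ • n) =
        n₁ - inner ℝ n m₂ * α - κ * (1 - n₀ ^ 2 - inner ℝ n m₂ ^ 2) := by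
      simp only [inner_sub_left, inner_sub_right, inner_smul_left, inner_smul_right, RCLike.conj_to_real]
      rw [hEm₁, real_inner_comm m₁ m₂, hself, real_inner_comm n E, real_inner_comm n m₂]
      ring
    rw [e1]
    have e2 : inner ℝ n m₂ ^ 2 ≤ 1 / 16 := by
      rw [← sq_abs]
      have : |inner ℝ n m₂| ≤ (1 / 4 : ℝ) := by linarith
      calc |inner ℝ n m₂| ^ 2 ≤ (1 / 4 : ℝ) ^ 2 := pow_le_pow_left₀ (abs_nonneg _) this 2
        _ = 1 / 16 := by norm_num
    have e3 : |n₁ - inner ℝ n m₂ * α| ≤ 2 * e := by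
      refine (abs_sub _ _).trans ?_
      rw [abs_mul]
      have : |inner ℝ n m₂| * |α| ≤ e * 1 := mul_le_mul hnm₂ hα1 (abs_nonneg _) he0
      linarith
    have e4 := le_of_abs_le e3
    have e5 : κ * (1 / 2) ≤ κ * (1 - n₀ ^ 2 - inner ℝ n m₂ ^ 2) :=
      mul_le_mul_of_nonneg_left (by linarith) hκ0.le
    have e6 : 2 * e < κ * (1 / 2) := by
      rw [hκ, div_mul_eq_mul_div, lt_div_iff₀ (by positivity), he_def]
      linarith
    linarith) q hq
  obtain ⟨t, ht1, ht2⟩ := (h1.and h2).exists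
  exact hTne (TetMesh.eq_of_mem_interior hT₁ hT₂ ht1 (interior_subset ht2))

/-! ### Modified nodes -/

open Classical in
/-- The smallest simplex of `T` that contains the node with multi-index `a`. -/
def carrier (T : Finset E3) (a : E3 → ℕ) : Finset E3 := T.filter fun v => 0 < a v

lemma carrier_subset (T : Finset E3) (a : E3 → ℕ) : carrier T a ⊆ T := Finset.filter_subset _ _

lemma mem_carrier {T : Finset E3} {a : E3 → ℕ} {v : E3} : v ∈ carrier T a ↔ v ∈ T ∧ 0 < a v := by
  simp [carrier]

section

variable {k : ℕ} {T : Finset E3}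

lemma sum_carrier {a : E3 → ℕ} (ha : a ∈ nodeIdx T k) : ∑ v ∈ carrier T a, a v = k := by
  rw [← (mem_nodeIdx.1 ha).1]
  refine Finset.sum_subset (carrier_subset T a) fun v hv h => ?_
  by_contra h0
  exact h (mem_carrier.2 ⟨hv, Nat.pos_of_ne_zero h0⟩)

lemma node_eq_carrier {a : E3 → ℕ} : node k T a = node k (carrier T a) a :=
  node_eq_of_subset (carrier_subset T a) fun _ hv h => mem_carrier.2 ⟨hv, Nat.pos_of_ne_zero h⟩

lemma node_mem_openHull (hk : 0 < k) {a : E3 → ℕ} (ha : a ∈ nodeIdx T k) :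
    node k T a ∈ openHull (carrier T a) := by
  refine ⟨fun v => (a v : ℝ) / k, fun v hv => ?_, ?_, node_eq_carrier⟩
  · have := (mem_carrier.1 hv).2
    positivity
  · rw [← Finset.sum_div, ← Nat.cast_sum, sum_carrier ha, div_self (by positivity)]

lemma node_mem_innerLagrangeNodes {a : E3 → ℕ} (ha : a ∈ nodeIdx T k) :
    node k T a ∈ innerLagrangeNodes k (carrier T a) :=
  ⟨a, sum_carrier ha, fun _ hv => (mem_carrier.1 hv).2, node_eq_carrier⟩

lemma exists_nodeIdx_of_inner {s : Finset E3} (hs : s ⊆ T) {M : E3} (hM : M ∈ innerLagrangeNodes k s) :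
    ∃ a ∈ nodeIdx T k, carrier T a = s ∧ node k T a = M := by
  classical
  obtain ⟨a, ha, hpos, rfl⟩ := hM
  have hidx : (fun v => if v ∈ s then a v else 0) ∈ nodeIdx T k := by
    refine mem_nodeIdx.2 ⟨?_, fun v hv => ?_⟩
    · rw [← Finset.sum_filter, Finset.filter_mem_eq_inter, Finset.inter_eq_right.2 hs, ha]
    · by_contra h
      exact hv (if_neg fun h' => h (hs h'))
  have hcar : carrier T (fun v => if v ∈ s then a v else 0) = s := by
    ext v
    rw [mem_carrier]
    constructor
    · rintro ⟨-, h⟩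
      by_contra hv
      simp [hv] at h
    · exact fun hv => ⟨hs hv, by simpa [hv] using hpos v hv⟩
  refine ⟨_, hidx, hcar, ?_⟩
  rw [node_eq_carrier, hcar]
  exact Finset.sum_congr rfl fun v hv => by simp [hv]

lemma exists_nodeIdx_vertex (hk : 0 < k) {v : E3} (hv : v ∈ T) :
    ∃ a ∈ nodeIdx T k, carrier T a = {v} ∧ node k T a = v :=
  exists_nodeIdx_of_inner (Finset.singleton_subset_iff.2 hv)
    ⟨fun _ => k, by simp, fun _ _ => hk, by simp [div_self (show (k : ℝ) ≠ 0 by positivity)]⟩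

end

lemma TetMesh.diam_le_size {𝒯 : TetMesh} {T : Finset E3} (hT : T ∈ 𝒯.elems) : Metric.diam (hull T) ≤ 𝒯.size :=
  Finset.le_sup' (fun T => Metric.diam (hull T)) hT

lemma dist_le_diam_hull {T : Finset E3} {x y : E3} (hx : x ∈ hull T) (hy : y ∈ hull T) :
    dist x y ≤ Metric.diam (hull T) := Metric.dist_le_diam_of_mem (isCompact_hull T).isBounded hx hy

lemma TetMesh.hull_carrier_subset_bdry {𝒯 : TetMesh} {k : ℕ} (hk : 0 < k) {T : Finset E3} (hT : T ∈ 𝒯.elems)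
    {a : E3 → ℕ} (ha : a ∈ nodeIdx T k) (hb : node k T a ∈ 𝒯.bdry) : hull (carrier T a) ⊆ 𝒯.bdry :=
  hull_subset_bdry hT (carrier_subset T a) (node_mem_openHull hk ha) hb

/-- A boundary node is not interior to its element, so its carrier is a vertex, an edge or a face:
the three cases of W_h^g. -/
lemma TetMesh.card_carrier {𝒯 : TetMesh} {k : ℕ} (hk : 0 < k) {T : Finset E3} (hT : T ∈ 𝒯.elems)
    {a : E3 → ℕ} (ha : a ∈ nodeIdx T k) (hb : node k T a ∈ 𝒯.bdry) :
    (carrier T a).card = 1 ∨ (carrier T a).card = 2 ∨ (carrier T a).card = 3 := by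
  have h1 : (carrier T a).card ≤ 4 := (Finset.card_le_card (carrier_subset T a)).trans (isTet hT).card_eq.le
  have h2 : (carrier T a).card ≠ 0 := fun h => by
    have := sum_carrier ha
    rw [Finset.card_eq_zero.1 h] at this
    simp at this
    omega
  have h3 : (carrier T a).card ≠ 4 := fun h => by
    have h4 := node_mem_openHull hk ha
    rw [Finset.eq_of_subset_of_card_le (carrier_subset T a) (by rw [(isTet hT).card_eq, h])] at h4
    exact not_subset_bdry hT h4 hb
  omega

/-- Description of the conditions on the boundary nodes of `W_h^g`: `P` is the point of `Γ` associated
with the boundary node with multi-index `a` of the element `T`. -/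
structure IsBdryPoint (Γ : Set E3) (ν : Finset E3 → E3) (k : ℕ) (T : Finset E3) (a : E3 → ℕ) (P : E3) :
    Prop where
  mem : P ∈ Γ
  vertex : (carrier T a).card = 1 → P = node k T a
  edge : (carrier T a).card = 2 → ∀ Q,
    IsNearestPoint (Γ ∩ {x | ∃ t : ℝ, x = node k T a + t • ν (carrier T a)}) (node k T a) Q ↔ Q = P
  face : (carrier T a).card = 3 → ∀ O ∈ T, O ∉ carrier T a → ∀ Q,
    IsNearestPoint (Γ ∩ line[ℝ, O, node k T a]) (node k T a) Q ↔ Q = P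

/-- `FlatAt.exists_nearest` is applied with τ = θ diam T. The transversality κ is (1 - δ)/8 for
edges, from `skin_transversal`, and 1/(2σ) for faces; vertices need no displacement. -/
lemma exists_isBdryPoint {Ω : Set E3} (hΩ : IsC1Domain Ω) {σ δ θ : ℝ} (hσ : 1 ≤ σ) (hδ₀ : 0 ≤ δ)
    (hδ : δ < 1) (hθ : 0 < θ) {k : ℕ} (hk : 0 < k) : ∃ h₁ > 0, ∀ (𝒯 : TetMesh) (ν : Finset E3 → E3),
      𝒯.Fits Ω → 𝒯.ShapeRegular σ → 𝒯.AtMostOneEdgeOrFace → IsSkinChoice 𝒯 δ ν → 𝒯.size ≤ h₁ →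
      ∀ T ∈ 𝒯.elems, ∀ a ∈ nodeIdx T k, node k T a ∈ 𝒯.bdry → ∃ P,
        dist (node k T a) P ≤ θ * Metric.diam (hull T) ∧ IsBdryPoint (frontier Ω) ν k T a P := by
  have hσ0 : 0 < σ := by linarith
  -- With ‖M - x₀‖ ≤ h, η = εh and τ = θh, the crossing condition of `FlatAt.exists_nearest` follows
  -- from ε(2 + θ) < κθ, required here for both values of κ.
  obtain ⟨ε, hε, hε1, hε2, hε3⟩ : ∃ ε : ℝ, 0 < ε ∧ ε * (128 * σ ^ 2) ≤ 1 - δ ∧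
      ε * (2 + θ) < (1 - δ) / 8 * θ ∧ ε * (2 + θ) < 1 / (2 * σ) * θ := by
    have h1 : 0 < 1 - δ := by linarith
    have ht : Tendsto (fun ε : ℝ => ε * (128 * σ ^ 2)) (𝓝[>] 0) (𝓝 0) := by
      have : ContinuousAt (fun ε : ℝ => ε * (128 * σ ^ 2)) 0 := by fun_prop
      simpa using this.tendsto.mono_left (nhdsWithin_le_nhds (s := Ioi 0))
    have ht' : Tendsto (fun ε : ℝ => ε * (2 + θ)) (𝓝[>] 0) (𝓝 0) := by
      have : ContinuousAt (fun ε : ℝ => ε * (2 + θ)) 0 := by fun_prop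
      simpa using this.tendsto.mono_left (nhdsWithin_le_nhds (s := Ioi 0))
    obtain ⟨ε, ⟨⟨hε1, hε2⟩, hε3⟩, hε⟩ := (((ht.eventually (ge_mem_nhds h1)).and
      (ht'.eventually (gt_mem_nhds (by positivity : 0 < (1 - δ) / 8 * θ)))).and
      (ht'.eventually (gt_mem_nhds (by positivity : 0 < 1 / (2 * σ) * θ)))).and self_mem_nhdsWithin |>.exists
    exact ⟨ε, hε, hε1, hε2, hε3⟩
  obtain ⟨r₀, hr₀, hflat⟩ := exists_flatAt hΩ hε
  -- The elements at x₀ and the displacements θh must fit into the flat ball of radius r₀.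
  refine ⟨r₀ / (2 * (1 + θ)), by positivity, fun 𝒯 ν hfit hreg hone hν hsize T hT a ha hb => ?_⟩
  set s := carrier T a with hs
  have hsT : s ⊆ T := carrier_subset T a
  have hsb : hull s ⊆ 𝒯.bdry := TetMesh.hull_carrier_subset_bdry hk hT ha hb
  have hsΓ := bdry_vertices hfit hT hsT hsb
  set M := node k T a with hMdef
  set h := Metric.diam (hull T) with hh
  have hMs : M ∈ hull s := openHull_subset_hull s (node_mem_openHull hk ha)
  have hMT : M ∈ hull T := node_mem_hull (TetMesh.isTet hT) hk ha
  obtain ⟨c, r, hr, hB, hd⟩ := hreg T hT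
  have hpos : 0 < h := by
    rw [hh]
    refine lt_of_lt_of_le ?_ (Metric.diam_mono hB (isCompact_hull T).isBounded)
    refine lt_of_lt_of_le hr ?_
    have hn : ‖(EuclideanSpace.single 0 1 : E3)‖ = 1 := by simp
    have := Metric.dist_le_diam_of_mem (Metric.isBounded_closedBall (x := c) (r := r))
      (Metric.mem_closedBall_self hr.le) (y := c + r • (EuclideanSpace.single 0 1 : E3)) (by
        rw [Metric.mem_closedBall, dist_eq_norm, add_sub_cancel_left, norm_smul, hn, mul_one,
        Real.norm_of_nonneg hr.le])
    rwa [dist_eq_norm, sub_add_cancel_left, norm_neg, norm_smul, hn, mul_one,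
      Real.norm_of_nonneg hr.le] at this
  have hsne : s.Nonempty := by
    rw [← Finset.card_pos]
    have : s.card = 1 ∨ s.card = 2 ∨ s.card = 3 := TetMesh.card_carrier hk hT ha hb
    omega
  obtain ⟨x₀, hx₀⟩ := hsne
  obtain ⟨n, hf⟩ := hflat x₀ (hsΓ x₀ hx₀)
  have hsize' : 𝒯.size * (1 + θ) < r₀ := by
    rw [le_div_iff₀ (by positivity)] at hsize
    linarith
  have hθs : 0 ≤ 𝒯.size := hpos.le.trans (TetMesh.diam_le_size hT)
  have hball : ∀ T' ∈ 𝒯.elems, x₀ ∈ T' → ∀ v ∈ T', v ∈ Metric.ball x₀ r₀ := fun T' hT' hx v hv => by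
    rw [Metric.mem_ball]
    have h1 := (dist_le_diam_hull (subset_convexHull ℝ _ hv) (subset_convexHull ℝ _ hx)).trans
      (TetMesh.diam_le_size hT')
    have h2 : 0 ≤ 𝒯.size * θ := by positivity
    linarith
  have hxT : x₀ ∈ hull T := subset_convexHull ℝ _ (hsT hx₀)
  have hMx : ‖M - x₀‖ ≤ h := by rw [← dist_eq_norm]; exact dist_le_diam_hull hMT hxT
  have hη : |inner ℝ n (M - x₀)| ≤ ε * h :=
    hf.abs_inner_hull_le hΩ.isOpen hε.le (fun v hv => ⟨hsΓ v hv, hball T hT (hsT hx₀) v (hsT hv)⟩) hx₀ hMs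
      fun v hv => by
        rw [← dist_eq_norm]; exact dist_le_diam_hull (subset_convexHull ℝ _ (hsT hv)) hxT
  have hτball : dist M x₀ + θ * h < r₀ := by
    rw [dist_eq_norm]
    have h1 : h ≤ 𝒯.size := TetMesh.diam_le_size hT
    have h2 := mul_le_mul_of_nonneg_left h1 hθ.le
    linarith
  have key : ∀ κ : ℝ, ε * (2 + θ) < κ * θ → ε * (‖M - x₀‖ + θ * h) + ε * h < κ * (θ * h) ∧ ε < κ :=
    fun κ hκ => by
      constructor
      · have h1 := mul_lt_mul_of_pos_right hκ hpos
        have h2 := mul_le_mul_of_nonneg_left hMx hε.le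
        linarith
      · by_contra! hcon
        have := mul_le_mul_of_nonneg_right hcon hθ.le
        linarith
  obtain h1 | h2 | h3 := TetMesh.card_carrier hk hT ha hb
  · refine ⟨M, by rw [dist_self]; positivity, ?_, fun _ => rfl, fun h => ?_, fun h => ?_⟩
    · obtain ⟨v, hv⟩ := Finset.card_eq_one.1 h1
      have : M = v := by
        have h4 := hMs
        rwa [hs, hv, hull, Finset.coe_singleton, convexHull_singleton] at h4
      rw [this]
      exact hsΓ v (by rw [hs, hv]; simp)
    · omega
    · omega
  · have hedge : 𝒯.IsBdryEdge T s := ⟨hsT, h2, hsb⟩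
    have htr := skin_transversal hf hΩ.isOpen hε.le hδ₀ hε1 hfit hreg hone hν hT hedge
      fun T' hT' hsT' => hball T' hT' (hsT' hx₀)
    obtain ⟨k1, k2⟩ := key _ hε2
    obtain ⟨P, hPΓ, hPd, hP⟩ := hf.exists_nearest hΩ.isOpen (a := x₀) (M := M) (d := ν s)
      (A := {x | ∃ t : ℝ, x = M + t • ν s}) (fun x => Iff.rfl) (hν T hT s hedge).1 (hsΓ x₀ hx₀)
      (Metric.mem_ball_self hr₀) hη htr k2 hε.le k1 (by positivity) hτball
    exact ⟨P, hPd, hPΓ, fun h => by omega, fun _ => hP, fun h => by omega⟩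
  · obtain ⟨O, hO, hOs, hop⟩ := TetMesh.exists_opposite (TetMesh.isTet hT) hsT h3
    have hεσ : ε * (4 * σ) ≤ 1 := by
      have hσ2 : σ ≤ σ ^ 2 := le_self_pow₀ hσ two_ne_zero
      have h1 := mul_le_mul_of_nonneg_left hσ2 hε.le
      have h2 : 0 ≤ ε * σ := by positivity
      linarith
    have hεr : ε * h < r := by
      have h1 := mul_le_mul_of_nonneg_left hd hε.le
      have h2 := mul_le_mul_of_nonneg_right hεσ hr.le
      linarith
    have hinO := hf.inner_opposite_le hΩ.isOpen hε.le (TetMesh.isTet hT) hsT h3 hsΓ (hball T hT (hsT hx₀)) hO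
      hOs (hfit T hT O hO).1 hr hB hεr hx₀
    have hinn : 2 * r - 2 * (ε * h) ≤ inner ℝ n (M - O) := by
      have e1 : M - O = (M - x₀) - (O - x₀) := by abel
      rw [e1, inner_sub_right]
      have := neg_le_of_abs_le hη
      linarith
    have hMO : 0 < ‖M - O‖ := by
      by_contra! h0
      have : M - O = 0 := norm_le_zero_iff.1 h0
      rw [this, inner_zero_right] at hinn
      linarith
    have hMOh : ‖M - O‖ ≤ h := by
      rw [← dist_eq_norm]; exact dist_le_diam_hull hMT (subset_convexHull ℝ _ hO)
    -- The normal component of M - O is at least 2r - 2εh ≥ r, while ‖M - O‖ ≤ h ≤ 2σr.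
    have htr : 1 / (2 * σ) ≤ |inner ℝ n (‖M - O‖⁻¹ • (M - O))| := by
      refine le_trans ?_ (le_abs_self _)
      rw [inner_smul_right, ← div_eq_inv_mul, le_div_iff₀ hMO, div_mul_eq_mul_div, one_mul,
        div_le_iff₀ (by positivity)]
      have h4 := mul_le_mul_of_nonneg_right hinn (by positivity : 0 ≤ 2 * σ)
      have h5 := mul_le_mul_of_nonneg_right hεσ hpos.le
      linarith
    obtain ⟨k1, k2⟩ := key _ hε3
    obtain ⟨P, hPΓ, hPd, hP⟩ := hf.exists_nearest hΩ.isOpen (a := x₀) (M := M) (d := ‖M - O‖⁻¹ • (M - O))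
      (A := line[ℝ, O, M]) (fun x => by
        rw [SetLike.mem_coe, mem_affineSpan_pair_iff_exists_lineMap_eq]
        constructor
        · rintro ⟨t, rfl⟩
          refine ⟨(t - 1) * ‖M - O‖, ?_⟩
          rw [mul_smul, smul_inv_smul₀ hMO.ne', AffineMap.lineMap_apply_module']
          module
        · rintro ⟨t, rfl⟩
          refine ⟨1 + t * ‖M - O‖⁻¹, ?_⟩
          rw [AffineMap.lineMap_apply_module', smul_smul]
          module) (by rw [norm_smul, norm_inv, norm_norm, inv_mul_cancel₀ hMO.ne']) (hsΓ x₀ hx₀)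
      (Metric.mem_ball_self hr₀) hη htr k2 hε.le k1 (by positivity) hτball
    refine ⟨P, hPd, hPΓ, fun h => by omega, fun h => by omega, fun _ O' hO' hOs' => ?_⟩
    rw [hop O' hO' hOs']
    exact hP

/-- The interpolation points used by `W_h^g`: the Lagrangian nodes, those on `Γ_h` being replaced
by nearby points of `Γ`. -/
structure ModifiedNodes (𝒯 : TetMesh) (Γ : Set E3) (ν : Finset E3 → E3) (k : ℕ) (θ : ℝ)
    (pt : Finset E3 → (E3 → ℕ) → E3) : Prop where
  dist_le : ∀ T ∈ 𝒯.elems, ∀ a ∈ nodeIdx T k, dist (node k T a) (pt T a) ≤ θ * Metric.diam (hull T)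
  eq_node : ∀ T ∈ 𝒯.elems, ∀ a ∈ nodeIdx T k, node k T a ∉ 𝒯.bdry → pt T a = node k T a
  mem : ∀ T ∈ 𝒯.elems, ∀ a ∈ nodeIdx T k, node k T a ∈ 𝒯.bdry → pt T a ∈ Γ
  -- Through this equivalence the discrete analysis never returns to planes, lines or nearest
  -- points: W_h^g is described by values at the points `pt`.
  memW_iff : ∀ g w, MemW 𝒯 Γ ν k g w ↔ (∀ T, w T ∈ Pk k) ∧
    (∀ S T : 𝒯.Elem, ∀ a ∈ nodeIdx S.1 k, ∀ b ∈ nodeIdx T.1 k, node k S.1 a = node k T.1 b →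
      node k S.1 a ∉ 𝒯.bdry → pval (w S) (node k S.1 a) = pval (w T) (node k T.1 b)) ∧
    ∀ T : 𝒯.Elem, ∀ a ∈ nodeIdx T.1 k, node k T.1 a ∈ 𝒯.bdry →
      pval (w T) (pt T.1 a) = g (pt T.1 a)

lemma exists_modifiedNodes {Ω : Set E3} (hΩ : IsC1Domain Ω) {σ δ θ : ℝ} (hσ : 1 ≤ σ) (hδ₀ : 0 ≤ δ)
    (hδ : δ < 1) (hθ : 0 < θ) {k : ℕ} (hk : 0 < k) : ∃ h₁ > 0, ∀ (𝒯 : TetMesh) (ν : Finset E3 → E3),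
      𝒯.Fits Ω → 𝒯.ShapeRegular σ → 𝒯.AtMostOneEdgeOrFace → IsSkinChoice 𝒯 δ ν → 𝒯.size ≤ h₁ →
      ∃ pt, ModifiedNodes 𝒯 (frontier Ω) ν k θ pt := by
  classical
  obtain ⟨h₁, hh₁, H⟩ := exists_isBdryPoint hΩ hσ hδ₀ hδ hθ hk
  refine ⟨h₁, hh₁, fun 𝒯 ν hfit hreg hone hν hsize => ?_⟩
  -- Away from Γ_h, and for irrelevant arguments, the point defaults to the node itself.
  have H1 : ∀ T a, ∃ P, T ∈ 𝒯.elems → a ∈ nodeIdx T k → (node k T a ∉ 𝒯.bdry → P = node k T a) ∧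
      dist (node k T a) P ≤ θ * Metric.diam (hull T) ∧
      (node k T a ∈ 𝒯.bdry → IsBdryPoint (frontier Ω) ν k T a P) := fun T a => by
    by_cases h : T ∈ 𝒯.elems ∧ a ∈ nodeIdx T k ∧ node k T a ∈ 𝒯.bdry
    · obtain ⟨P, hP1, hP2⟩ := H 𝒯 ν hfit hreg hone hν hsize T h.1 a h.2.1 h.2.2
      exact ⟨P, fun _ _ => ⟨fun h' => absurd h.2.2 h', hP1, fun _ => hP2⟩⟩
    · refine ⟨node k T a, fun hT ha => ⟨fun _ => rfl, ?_, fun hb => absurd ⟨hT, ha, hb⟩ h⟩⟩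
      rw [dist_self]
      exact mul_nonneg hθ.le Metric.diam_nonneg
  choose pt hpt using H1
  refine ⟨pt, fun T hT a ha => (hpt T a hT ha).2.1, fun T hT a ha => (hpt T a hT ha).1,
    fun T hT a ha hb => ((hpt T a hT ha).2.2 hb).mem, fun g w => ⟨fun hw => ⟨?_, ?_, ?_⟩, ?_⟩⟩
  · exact fun T => mem_Pk.2 (hw.degree T)
  · intro S T a ha b hb hab hbd
    rw [← hab]
    exact hw.single_valued S T _ (mem_lagrangeNodes_iff.2 ⟨a, ha, rfl⟩)
      (mem_lagrangeNodes_iff.2 ⟨b, hb, hab⟩) hbd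
  · intro T a ha hb
    have hP := (hpt T.1 a T.2 ha).2.2 hb
    have hsub := TetMesh.hull_carrier_subset_bdry hk T.2 ha hb
    obtain h1 | h2 | h3 := TetMesh.card_carrier hk T.2 ha hb
    · rw [hP.vertex h1]
      obtain ⟨v, hv⟩ := Finset.card_eq_one.1 h1
      have hM : node k T.1 a = v := by
        have h4 := openHull_subset_hull _ (node_mem_openHull hk ha)
        rwa [hv, hull, Finset.coe_singleton, convexHull_singleton] at h4
      have hvT : v ∈ T.1 := carrier_subset T.1 a (by rw [hv]; simp)
      rw [hM] at hb ⊢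
      exact hw.vertex T v hvT hb
    · have hedge : 𝒯.IsBdryEdge T.1 (carrier T.1 a) := ⟨carrier_subset _ _, h2, hsub⟩
      refine hw.edge T ?_ _ hedge _ (node_mem_innerLagrangeNodes ha) _ ((hP.edge h2 _).2 rfl)
      -- The edge condition of `MemW` is only imposed on 𝒮_h ∪ ℛ_h; an element with a boundary edge
      -- always belongs to it.
      rcases hone T.1 T.2 with ⟨F, hF, -⟩ | ⟨hno, huniq⟩
      · exact Or.inl ⟨T.2, F, hF⟩
      · exact Or.inr ⟨T.2, hno, _, hedge, fun e' he' => huniq _ _ he' hedge⟩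
    · have hface : 𝒯.IsBdryFace T.1 (carrier T.1 a) := ⟨carrier_subset _ _, h3, hsub⟩
      obtain ⟨O, hO, hOs, -⟩ := TetMesh.exists_opposite (TetMesh.isTet T.2) hface.1 h3
      exact hw.face T ⟨T.2, _, hface⟩ _ hface O hO hOs _ (node_mem_innerLagrangeNodes ha) _
        ((hP.face h3 O hO hOs _).2 rfl)
  · rintro ⟨hdeg, hsv, hval⟩
    refine ⟨fun T => mem_Pk.1 (hdeg T), ?_, ?_, ?_, ?_⟩
    · intro S T N hNS hNT hNb
      obtain ⟨a, ha, rfl⟩ := mem_lagrangeNodes_iff.1 hNS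
      obtain ⟨b, hb, hab⟩ := mem_lagrangeNodes_iff.1 hNT
      rw [hsv S T a ha b hb hab hNb, hab]
    · intro T v hv hb
      obtain ⟨a, ha, hc, hM⟩ := exists_nodeIdx_vertex hk hv
      rw [← hM] at hb
      have hP := (hpt T.1 a T.2 ha).2.2 hb
      have h1 := hval T a ha hb
      rwa [hP.vertex (by rw [hc]; simp), hM] at h1
    · intro T _ F hF O hO hOF M hM P hPn
      obtain ⟨a, ha, hc, rfl⟩ := exists_nodeIdx_of_inner hF.1 hM
      have hb : node k T.1 a ∈ 𝒯.bdry := by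
        have := openHull_subset_hull _ (node_mem_openHull hk ha)
        rw [hc] at this
        exact hF.2.2 this
      have hP := (hpt T.1 a T.2 ha).2.2 hb
      rw [(hP.face (by rw [hc]; exact hF.2.1) O hO (by rw [hc]; exact hOF) P).1 hPn]
      exact hval T a ha hb
    · intro T _ e he M hM Q hQn
      obtain ⟨a, ha, hc, rfl⟩ := exists_nodeIdx_of_inner he.1 hM
      have hb : node k T.1 a ∈ 𝒯.bdry := by
        have := openHull_subset_hull _ (node_mem_openHull hk ha)
        rw [hc] at this
        exact he.2.2 this
      have hP := (hpt T.1 a T.2 ha).2.2 hb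
      rw [(hP.edge (by rw [hc]; exact he.2.1) Q).1 (by rw [hc]; exact hQn)]
      exact hval T a ha hb

/-! ### Estimates on one element -/

lemma norm_fderiv_pval_le {p : MvPolynomial (Fin 3) ℝ} {x : E3} {K : ℝ} (hK : ∀ i, |pgrad p i x| ≤ K) :
    ‖fderiv ℝ (pval p) x‖ ≤ 3 * K := by
  have hK0 : 0 ≤ K := (abs_nonneg _).trans (hK 0)
  rw [(hasFDerivAt_pval p x).fderiv]
  refine ContinuousLinearMap.opNorm_le_bound _ (by positivity) fun v => ?_
  have h1 : ∀ i, |v i| ≤ ‖v‖ := fun i => PiLp.norm_apply_le v i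
  simp only [Fin.sum_univ_three, add_apply, smul_apply, smul_eq_mul, PiLp.proj_apply]
  have h2 : ∀ i, ‖pgrad p i x * v i‖ ≤ K * ‖v‖ := fun i => by
    rw [norm_mul]; exact mul_le_mul (hK i) (h1 i) (norm_nonneg _) hK0
  refine (norm_add₃_le).trans ?_
  linarith [h2 0, h2 1, h2 2]

lemma abs_pval_sub_le {p : MvPolynomial (Fin 3) ℝ} {s : Set E3} (hs : Convex ℝ s) {K : ℝ}
    (hK : ∀ z ∈ s, ∀ i, |pgrad p i z| ≤ K) {x y : E3} (hx : x ∈ s) (hy : y ∈ s) :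
    |pval p x - pval p y| ≤ 3 * K * dist x y := by
  rw [dist_eq_norm]
  exact hs.norm_image_sub_le_of_norm_fderiv_le
    (fun z _ => (hasFDerivAt_pval p z).differentiableAt) (fun z hz => norm_fderiv_pval_le (hK z hz)) hy hx

/-- The volume of the unit ball. -/
def unitVol : ℝ := volume.real (Metric.ball (0 : E3) 1)

lemma unitVol_pos : 0 < unitVol :=
  ENNReal.toReal_pos (Metric.measure_ball_pos _ _ one_pos).ne' measure_ball_lt_top.ne

lemma volume_real_closedBall (c : E3) {r : ℝ} (hr : 0 ≤ r) :
    volume.real (Metric.closedBall c r) = r ^ 3 * unitVol := by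
  rw [measureReal_def, Measure.addHaar_closedBall _ _ hr, finrank_euclideanSpace_fin, ENNReal.toReal_mul,
    ENNReal.toReal_ofReal (by positivity)]
  rfl

/-- Interpolation points of a shape regular element close to its Lagrangian nodes. -/
structure LocalNodes (k : ℕ) (σ θ : ℝ) (T : Finset E3) (c : E3) (r : ℝ) (pt : (E3 → ℕ) → E3) : Prop where
  isTet : IsTet T
  pos : 0 < r
  ball_subset : Metric.closedBall c r ⊆ hull T
  diam_le : Metric.diam (hull T) ≤ σ * (2 * r)
  dist_le : ∀ a ∈ nodeIdx T k, dist (node k T a) (pt a) ≤ θ * Metric.diam (hull T)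

namespace LocalNodes

variable {k : ℕ} {σ θ : ℝ} {T : Finset E3} {c : E3} {r : ℝ} {pt : (E3 → ℕ) → E3}
  (h : LocalNodes k σ θ T c r pt)
include h

lemma hull_subset : hull T ⊆ Metric.closedBall c (2 * σ * r) := fun x hx => by
  rw [Metric.mem_closedBall]
  have := dist_le_diam_hull hx (h.ball_subset (Metric.mem_closedBall_self h.pos.le))
  linarith [h.diam_le]

/-- T lies within 2σr of c, and θ ≤ 1 allows a displacement of at most another 2σr. The radius 4σr
is kept for all local estimates. -/
lemma pt_mem (hk : 0 < k) (hθ : θ ≤ 1) {a : E3 → ℕ} (ha : a ∈ nodeIdx T k) :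
    pt a ∈ Metric.closedBall c (4 * σ * r) := by
  rw [Metric.mem_closedBall]
  have h1 := h.hull_subset (node_mem_hull h.isTet hk ha)
  rw [Metric.mem_closedBall] at h1
  have h2 := h.dist_le a ha
  have h3 := dist_triangle_left (pt a) c (node k T a)
  have h4 : θ * Metric.diam (hull T) ≤ 1 * (σ * (2 * r)) :=
    mul_le_mul hθ h.diam_le Metric.diam_nonneg zero_le_one
  linarith

lemma hull_subset' (hσ : 1 ≤ σ) : hull T ⊆ Metric.closedBall c (4 * σ * r) :=
  h.hull_subset.trans (Metric.closedBall_subset_closedBall (by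
    have := h.pos
    have : 0 ≤ σ * r := by positivity
    linarith))

lemma volume_hull_le (hσ : 1 ≤ σ) : volume.real (hull T) ≤ (2 * σ * r) ^ 3 * unitVol := by
  have := h.pos
  rw [← volume_real_closedBall c (by positivity)]
  exact measureReal_mono h.hull_subset (isCompact_closedBall _ _).measure_lt_top.ne

end LocalNodes

lemma integrableOn_of_continuous {f : E3 → ℝ} (hf : Continuous f) {s : Set E3} (hs : IsCompact s) :
    IntegrableOn f s := hf.continuousOn.integrableOn_compact hs

/-- The square of the norm of the gradient. -/
def gradSq (p : MvPolynomial (Fin 3) ℝ) (x : E3) : ℝ := ∑ i, pgrad p i x ^ 2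

lemma continuous_gradSq (p : MvPolynomial (Fin 3) ℝ) : Continuous (gradSq p) :=
  continuous_finsetSum _ fun i _ => (continuous_pgrad p i).pow 2

lemma gradSq_nonneg (p : MvPolynomial (Fin 3) ℝ) (x : E3) : 0 ≤ gradSq p x :=
  Finset.sum_nonneg fun _ _ => sq_nonneg _

/-- Stability of the values at the Lagrangian nodes. -/
lemma exists_grad_bound_nodes (k : ℕ) (hk : 0 < k) (σ : ℝ) : ∃ C > 0,
    ∀ {θ T c r pt}, LocalNodes k σ θ T c r pt → ∀ p ∈ Pk k, ∀ i,
      ∀ x ∈ Metric.closedBall c (4 * σ * r),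
      |pgrad p i x| * r ≤ C * ∑ a ∈ nodeIdx T k, |pval p (node k T a)| := by
  obtain ⟨C, hC, H⟩ := exists_inverse_pgrad k (4 * σ)
  refine ⟨√(C * unitVol) * k ^ k, by have := unitVol_pos; positivity, fun {θ T c r pt} h p hp i x hx => ?_⟩
  set m := ∑ a ∈ nodeIdx T k, |pval p (node k T a)|
  have hm : 0 ≤ m := Finset.sum_nonneg fun _ _ => abs_nonneg _
  have hr := h.pos
  have h1 := H p hp c r hr i x hx
  -- On the inscribed ball the Lagrange basis is bounded by k^k; the inverse inequality carries the
  -- bound to gradients on the larger ball.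
  have hbd : ∀ y ∈ Metric.closedBall c r, pval p y ^ 2 ≤ (k ^ k * m) ^ 2 := fun y hy => by
    rw [← sq_abs]
    refine pow_le_pow_left₀ (abs_nonneg _) ?_ 2
    conv_lhs => rw [eq_sum_lagr h.isTet hk hp, pval_sum]
    refine (Finset.abs_sum_le_sum_abs _ _).trans ?_
    rw [Finset.mul_sum]
    refine Finset.sum_le_sum fun a ha => ?_
    rw [pval_smul, abs_mul, mul_comm]
    exact mul_le_mul_of_nonneg_right (abs_pval_lagr_le h.isTet ha (h.ball_subset hy)) (abs_nonneg _)
  have h2 : ∫ y in Metric.closedBall c r, pval p y ^ 2 ≤ (k ^ k * m) ^ 2 * (r ^ 3 * unitVol) := by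
    rw [← volume_real_closedBall c hr.le]
    have h3 := norm_setIntegral_le_of_norm_le_const (μ := volume) (f := fun y => pval p y ^ 2)
      (isCompact_closedBall c r).measure_lt_top (fun y hy => by
        rw [Real.norm_of_nonneg (sq_nonneg _)]; exact hbd y hy)
    exact (le_abs_self _).trans h3
  have h4 : (|pgrad p i x| * r) ^ 2 ≤ (√(C * unitVol) * k ^ k * m) ^ 2 := by
    have hV := unitVol_pos
    rw [mul_pow, mul_pow, mul_pow, Real.sq_sqrt (by positivity), sq_abs]
    have h5 := h1.trans (mul_le_mul_of_nonneg_left h2 hC.le)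
    have h6 : r ^ 3 * (pgrad p i x ^ 2 * r ^ 2) ≤ r ^ 3 * (C * unitVol * (k ^ k) ^ 2 * m ^ 2) := by
      linarith
    exact le_of_mul_le_mul_left h6 (by positivity)
  exact (abs_le_of_sq_le_sq' h4 (by positivity)).2

/-- Stability of the values at perturbed nodes. -/
lemma exists_grad_bound_pts (k : ℕ) (hk : 0 < k) {σ : ℝ} (hσ : 1 ≤ σ) : ∃ C > 0, ∃ θ₀ > 0, θ₀ ≤ 1 ∧
    ∀ {θ T c r pt}, θ ≤ θ₀ → LocalNodes k σ θ T c r pt → ∀ p ∈ Pk k,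
      (∑ a ∈ nodeIdx T k, |pval p (node k T a)| ≤ 2 * ∑ a ∈ nodeIdx T k, |pval p (pt a)|) ∧ ∀ i,
      ∀ x ∈ Metric.closedBall c (4 * σ * r),
      |pgrad p i x| * r ≤ C * ∑ a ∈ nodeIdx T k, |pval p (pt a)| := by
  obtain ⟨C, hC, H⟩ := exists_grad_bound_nodes k hk σ
  set N : ℝ := (Module.finrank ℝ (Pk k) : ℝ) with hN
  -- For this θ, summing the errors 6Cmσθ over the N nodes gives at most m/2, which is absorbed on
  -- the left.
  have hD : 0 < N * 12 * σ * C + 1 := by positivity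
  refine ⟨2 * C, by positivity, min 1 (1 / (N * 12 * σ * C + 1)), by positivity, min_le_left _ _,
    fun {θ T c r pt} hθ h p hp => ?_⟩
  have hθ1 : θ ≤ 1 := hθ.trans (min_le_left _ _)
  have hθ2 : θ * (N * 12 * σ * C + 1) ≤ 1 := by
    rw [← le_div_iff₀ hD]; exact hθ.trans (min_le_right _ _)
  set m := ∑ a ∈ nodeIdx T k, |pval p (node k T a)|
  have hm : 0 ≤ m := Finset.sum_nonneg fun _ _ => abs_nonneg _
  have hr := h.pos
  -- The gradient is at most Cm/r on the ball containing node and displaced point, whose distance is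
  -- at most 2σrθ.
  have h1 : ∀ a ∈ nodeIdx T k, |pval p (node k T a)| ≤ |pval p (pt a)| + 6 * C * m * σ * θ := fun a ha => by
    have hK : ∀ z ∈ Metric.closedBall c (4 * σ * r), ∀ i, |pgrad p i z| ≤ C * m / r := fun z hz i => by
      rw [le_div_iff₀ hr]; exact H h p hp i z hz
    have h2 := abs_pval_sub_le (convex_closedBall _ _) hK
      (h.hull_subset' hσ (node_mem_hull h.isTet hk ha)) (h.pt_mem hk hθ1 ha)
    have hθ0 : 0 ≤ θ * Metric.diam (hull T) := dist_nonneg.trans (h.dist_le a ha)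
    have h3 : 3 * (C * m / r) * dist (node k T a) (pt a) ≤ 6 * C * m * σ * θ := by
      have hdpos : 0 < Metric.diam (hull T) := by
        have h4 := Metric.diam_mono h.ball_subset (isCompact_hull T).isBounded
        refine lt_of_lt_of_le ?_ h4
        have hn : ‖(EuclideanSpace.single 0 1 : E3)‖ = 1 := by simp
        have := Metric.dist_le_diam_of_mem (Metric.isBounded_closedBall (x := c) (r := r))
          (Metric.mem_closedBall_self hr.le) (y := c + r • (EuclideanSpace.single 0 1 : E3)) (by
            rw [Metric.mem_closedBall, dist_eq_norm, add_sub_cancel_left, norm_smul, hn, mul_one,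
            Real.norm_of_nonneg hr.le])
        rw [dist_eq_norm, sub_add_cancel_left, norm_neg, norm_smul, hn, mul_one,
          Real.norm_of_nonneg hr.le] at this
        linarith
      have hθ0' : 0 ≤ θ := nonneg_of_mul_nonneg_left hθ0 hdpos
      calc _ ≤ 3 * (C * m / r) * (θ * (σ * (2 * r))) := by
            refine mul_le_mul_of_nonneg_left ((h.dist_le a ha).trans ?_) (by positivity)
            exact mul_le_mul_of_nonneg_left h.diam_le hθ0'
        _ = 6 * C * m * σ * θ := by field_simp; ring
    have h4 : |pval p (node k T a)| ≤ |pval p (node k T a) - pval p (pt a)| + |pval p (pt a)| := by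
      have := abs_add_le (pval p (node k T a) - pval p (pt a)) (pval p (pt a))
      rwa [sub_add_cancel] at this
    linarith
  have h2 : m ≤ 2 * ∑ a ∈ nodeIdx T k, |pval p (pt a)| := by
    have h3 := Finset.sum_le_sum h1
    rw [Finset.sum_add_distrib, Finset.sum_const, card_nodeIdx h.isTet hk, nsmul_eq_mul] at h3
    have h5 : N * (6 * C * m * σ * θ) ≤ m / 2 := by
      rcases le_or_gt 0 θ with h0 | h0
      · have h6 : θ * (N * 12 * σ * C) * m ≤ 1 * m :=
          mul_le_mul_of_nonneg_right (by linarith) hm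
        linarith
      · have : 0 ≤ N * (6 * C * m * σ * (-θ)) := by
          have : 0 ≤ -θ := by linarith
          positivity
        linarith
    linarith
  refine ⟨h2, fun i x hx => (H h p hp i x hx).trans ?_⟩
  have := mul_le_mul_of_nonneg_left h2 hC.le
  linarith

lemma eq_zero_of_pts {k : ℕ} (hk : 0 < k) {T : Finset E3} (hT : IsTet T) {pt : (E3 → ℕ) → E3}
    (h : ∀ p ∈ Pk k, ∑ a ∈ nodeIdx T k, |pval p (node k T a)| ≤ 2 * ∑ a ∈ nodeIdx T k, |pval p (pt a)|)
    {p : MvPolynomial (Fin 3) ℝ} (hp : p ∈ Pk k) (h0 : ∀ a ∈ nodeIdx T k, pval p (pt a) = 0) : p = 0 := by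
  have h1 := h p hp
  rw [Finset.sum_eq_zero (f := fun a => |pval p (pt a)|) fun a ha => by rw [h0 a ha, abs_zero],
    mul_zero] at h1
  have h2 := (Finset.sum_eq_zero_iff_of_nonneg fun a _ => abs_nonneg _).1
    (le_antisymm h1 (Finset.sum_nonneg fun a _ => abs_nonneg _))
  rw [eq_sum_lagr hT hk hp]
  exact Finset.sum_eq_zero fun a ha => by rw [abs_eq_zero.1 (h2 a ha), zero_smul]

/-- Replacing the perturbed boundary values of `w` by nodal ones changes its gradient little. -/
lemma exists_coercivity_local (k : ℕ) (hk : 0 < k) {σ : ℝ} (hσ : 1 ≤ σ) : ∃ C > 0,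
    ∀ {θ T c r pt}, 0 ≤ θ → θ ≤ 1 → LocalNodes k σ θ T c r pt → ∀ w ∈ Pk k, ∀ v ∈ Pk k,
      (∀ a ∈ nodeIdx T k, pval v (node k T a) = pval w (node k T a) ∨
        (pval v (node k T a) = 0 ∧ pval w (pt a) = 0)) →
      ∫ x in hull T, gradSq (w - v) x ≤ C * θ ^ 2 * ∫ x in hull T, gradSq w x := by
  obtain ⟨C₁, hC₁, H₁⟩ := exists_inverse_pval k (4 * σ)
  obtain ⟨C₃, hC₃, H₃⟩ := exists_grad_bound_nodes k hk σ
  set N : ℝ := (Module.finrank ℝ (Pk k) : ℝ) with hN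
  have hV := unitVol_pos
  refine ⟨1 + 3 * ((2 * σ) ^ 3 * unitVol) * (6 * N * C₃ * σ) ^ 2 * C₁, by positivity,
    fun {θ T c r pt} hθ0 hθ h w hw v hv hwv => ?_⟩
  have hr := h.pos
  set J := ∫ x in hull T, gradSq w x with hJ
  have hJ0 : 0 ≤ J := integral_nonneg fun x => gradSq_nonneg w x
  set K := √(C₁ * J / r ^ 3) with hKdef
  have hK : ∀ z ∈ Metric.closedBall c (4 * σ * r), ∀ i, |pgrad w i z| ≤ K := fun z hz i => by
    refine Real.abs_le_sqrt ?_
    rw [le_div_iff₀ (by positivity)]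
    refine (H₁ _ (pderiv_mem_Pk hw i) c r hr z hz).trans (mul_le_mul_of_nonneg_left ?_ hC₁.le)
    calc ∫ y in Metric.closedBall c r, pval (MvPolynomial.pderiv i w) y ^ 2
        ≤ ∫ y in Metric.closedBall c r, gradSq w y := by
          refine setIntegral_mono (integrableOn_of_continuous ((continuous_pval _).pow 2)
            (isCompact_closedBall _ _)) (integrableOn_of_continuous (continuous_gradSq w)
            (isCompact_closedBall _ _)) fun y => ?_
          exact Finset.single_le_sum (f := fun i => pgrad w i y ^ 2) (fun _ _ => sq_nonneg _)
            (Finset.mem_univ i)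
      _ ≤ J := setIntegral_mono_set (integrableOn_of_continuous (continuous_gradSq w) (isCompact_hull T))
          (Filter.Eventually.of_forall fun y => gradSq_nonneg w y) h.ball_subset.eventuallyLE
  have hK0 : 0 ≤ K := Real.sqrt_nonneg _
  have hm : ∑ a ∈ nodeIdx T k, |pval (w - v) (node k T a)| ≤ N * (6 * K * σ * θ * r) := by
    -- At a boundary node w - v equals w there, that is, the difference of w between the node and a
    -- zero of w at distance at most 2σrθ. K bounds the gradient of w by its L² norm.
    have h1 : ∀ a ∈ nodeIdx T k, |pval (w - v) (node k T a)| ≤ 6 * K * σ * θ * r := fun a ha => by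
      rw [pval_sub]
      rcases hwv a ha with h2 | ⟨h2, h3⟩
      · rw [h2, sub_self, abs_zero]; positivity
      · have h4 := abs_pval_sub_le (convex_closedBall _ _) hK
          (h.hull_subset' hσ (node_mem_hull h.isTet hk ha)) (h.pt_mem hk hθ ha)
        rw [h2, sub_zero]
        rw [h3, sub_zero] at h4
        refine h4.trans ?_
        have h5 := (h.dist_le a ha).trans (mul_le_mul_of_nonneg_left h.diam_le hθ0)
        have h6 := mul_le_mul_of_nonneg_left h5 (by positivity : 0 ≤ 3 * K)
        linarith
    have h3 := Finset.sum_le_sum h1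
    rwa [Finset.sum_const, card_nodeIdx h.isTet hk, nsmul_eq_mul] at h3
  have hq : ∀ x ∈ hull T, gradSq (w - v) x ≤ 3 * ((6 * N * C₃ * σ * θ) ^ 2 * (C₁ * J / r ^ 3)) := fun x hx => by
    have h1 : ∀ i, pgrad (w - v) i x ^ 2 ≤ (6 * N * C₃ * σ * θ) ^ 2 * (C₁ * J / r ^ 3) := fun i => by
      have h2 := (H₃ h _ (Submodule.sub_mem _ hw hv) i x (h.hull_subset' hσ hx)).trans
        (mul_le_mul_of_nonneg_left hm hC₃.le)
      have h3 : |pgrad (w - v) i x| ≤ 6 * N * C₃ * σ * θ * K := by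
        have : |pgrad (w - v) i x| * r ≤ 6 * N * C₃ * σ * θ * K * r := by linarith
        exact le_of_mul_le_mul_right this hr
      have h4 := pow_le_pow_left₀ (abs_nonneg _) h3 2
      rwa [sq_abs, mul_pow _ K, Real.sq_sqrt (by positivity)] at h4
    rw [gradSq, Fin.sum_univ_three]
    linarith [h1 0, h1 1, h1 2]
  have hB0 : 0 ≤ 3 * ((6 * N * C₃ * σ * θ) ^ 2 * (C₁ * J / r ^ 3)) := by positivity
  calc ∫ x in hull T, gradSq (w - v) x
      ≤ 3 * ((6 * N * C₃ * σ * θ) ^ 2 * (C₁ * J / r ^ 3)) * volume.real (hull T) := by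
        refine (le_abs_self _).trans ((Real.norm_eq_abs _).ge.trans (norm_setIntegral_le_of_norm_le_const
          (μ := volume) (f := gradSq (w - v)) (isCompact_hull T).measure_lt_top fun y hy => ?_))
        rw [Real.norm_of_nonneg (gradSq_nonneg _ _)]
        exact hq y hy
    _ ≤ 3 * ((6 * N * C₃ * σ * θ) ^ 2 * (C₁ * J / r ^ 3)) * ((2 * σ * r) ^ 3 * unitVol) :=
        mul_le_mul_of_nonneg_left (h.volume_hull_le hσ) hB0
    _ = 3 * ((2 * σ) ^ 3 * unitVol) * (6 * N * C₃ * σ) ^ 2 * C₁ * θ ^ 2 * J := by field_simp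
    _ ≤ _ := by
        have : 0 ≤ θ ^ 2 * J := by positivity
        linarith

/-! ### The conforming space -/

section Glue

variable {𝒯 : TetMesh} {k : ℕ}

/-- The piecewise polynomial with prescribed values at the Lagrangian nodes. -/
def glue (𝒯 : TetMesh) (k : ℕ) (c : E3 → ℝ) : Piecewise 𝒯 :=
  fun T => ∑ a ∈ nodeIdx T.1 k, c (node k T.1 a) • lagr k T.1 a

lemma glue_mem_Pk (c : E3 → ℝ) (T : 𝒯.Elem) : glue 𝒯 k c T ∈ Pk k :=
  sum_lagr_mem_Pk fun a => c (node k T.1 a)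

lemma pval_glue_node (hk : 0 < k) (c : E3 → ℝ) (T : 𝒯.Elem) {a : E3 → ℕ} (ha : a ∈ nodeIdx T.1 k) :
    pval (glue 𝒯 k c T) (node k T.1 a) = c (node k T.1 a) :=
  pval_sum_lagr (TetMesh.isTet T.2) hk (fun a => c (node k T.1 a)) ha

/-- On a sub-simplex the Lagrange interpolant depends only on the nodes of this sub-simplex. -/
lemma pval_sum_lagr_subset {S s : Finset E3} (hS : IsTet S) (hs : s ⊆ S) (c : E3 → ℝ)
    {μ : E3 → ℝ} (hμ : ∑ v ∈ s, μ v = 1) :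
    pval (∑ a ∈ nodeIdx S k, c (node k S a) • lagr k S a) (∑ v ∈ s, μ v • v) =
      ∑ a ∈ nodeIdx s k, c (node k s a) * ∏ v ∈ s, ∏ j ∈ Finset.range (a v), (((k : ℝ) * μ v - j) / (j + 1)) := by
  classical
  set x := ∑ v ∈ s, μ v • v with hx
  have hx' : x = ∑ v ∈ S, (if v ∈ s then μ v else 0) • v := by
    rw [hx, ← Finset.sum_subset hs]
    · exact Finset.sum_congr rfl fun v hv => by rw [if_pos hv]
    · intro v _ hv; rw [if_neg hv, zero_smul]
  have hsum : ∑ v ∈ S, (if v ∈ s then μ v else 0) = 1 := by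
    rw [← hμ, ← Finset.sum_subset hs]
    · exact Finset.sum_congr rfl fun v hv => by rw [if_pos hv]
    · intro v _ hv; rw [if_neg hv]
  have hb : ∀ v ∈ S, bary S v x = if v ∈ s then μ v else 0 := fun v hv => by
    rw [hx', hS.bary_eq_of_sum (a := fun v => if v ∈ s then μ v else 0) hsum hv]
  have hsub : nodeIdx s k ⊆ nodeIdx S k := fun a ha => by
    rw [mem_nodeIdx] at ha ⊢
    refine ⟨?_, fun v hv => hs (ha.2 v hv)⟩
    rw [← ha.1]
    refine (Finset.sum_subset hs fun v _ hv => ?_).symm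
    by_contra h
    exact hv (ha.2 v h)
  rw [pval_sum, ← Finset.sum_subset hsub]
  · refine Finset.sum_congr rfl fun a ha => ?_
    have ha' := (mem_nodeIdx.1 ha).2
    rw [pval_smul, node_eq_of_subset hs fun v _ h => ha' v h, pval_lagr, ← Finset.prod_subset hs]
    · congr 1
      exact Finset.prod_congr rfl fun v hv => Finset.prod_congr rfl fun j _ => by
        rw [hb v (hs hv), if_pos hv]
    · intro v _ hv
      have : a v = 0 := by_contra fun h => hv (ha' v h)
      simp [this]
  -- A multi-index charging a vertex off s yields a basis function with the factor kλ_v, which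
  -- vanishes on s.
  · intro a ha has
    have ha' := mem_nodeIdx.1 ha
    obtain ⟨v, hvS, hvs, hav⟩ : ∃ v ∈ S, v ∉ s ∧ 0 < a v := by
      by_contra! h
      refine has (mem_nodeIdx.2 ⟨?_, fun v hv => ?_⟩)
      · rw [← ha'.1]
        exact Finset.sum_subset hs fun v hv hvs => Nat.le_zero.1 (h v hv hvs)
      · by_contra hvs
        exact hv (Nat.le_zero.1 (h v (ha'.2 v hv) hvs))
    rw [pval_smul, pval_lagr_eq_zero hvS hav, mul_zero]
    rw [hb v hvS, if_neg hvs, mul_zero, Nat.cast_zero]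

/-- By compatibility x lies in the hull of the common vertices, where both interpolants are given by
the same formula in the same nodal values. -/
lemma glue_eq_on_inter (c : E3 → ℝ) {S T : 𝒯.Elem} {x : E3} (hxS : x ∈ hull S.1)
    (hxT : x ∈ hull T.1) : pval (glue 𝒯 k c S) x = pval (glue 𝒯 k c T) x := by
  classical
  have h := 𝒯.compat S.1 S.2 T.1 T.2 ⟨hxS, hxT⟩
  rw [← Finset.coe_inter, Finset.mem_convexHull'] at h
  obtain ⟨μ, _, hμ, rfl⟩ := h
  rw [glue, pval_sum_lagr_subset (TetMesh.isTet S.2) Finset.inter_subset_left c hμ, glue,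
    pval_sum_lagr_subset (TetMesh.isTet T.2) Finset.inter_subset_right c hμ]

lemma memV_glue (hk : 0 < k) {c : E3 → ℝ} (hc : ∀ x ∈ 𝒯.bdry, c x = 0) : MemV 𝒯 k (glue 𝒯 k c) := by
  classical
  refine ⟨fun T => mem_Pk.1 (glue_mem_Pk c T), ?_⟩
  let φ : E3 → ℝ := fun x => if h : ∃ T : 𝒯.Elem, x ∈ hull T.1 then pval (glue 𝒯 k c h.choose) x else 0
  have hφ : ∀ T : 𝒯.Elem, ∀ x ∈ hull T.1, φ x = pval (glue 𝒯 k c T) x := fun T x hx => by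
    have h : ∃ T : 𝒯.Elem, x ∈ hull T.1 := ⟨T, hx⟩
    simp only [φ, dif_pos h]
    exact glue_eq_on_inter c h.choose_spec hx
  refine ⟨φ, ?_, fun x hx => ?_, hφ⟩
  · have h1 : 𝒯.polyhedron = ⋃ T : 𝒯.Elem, hull T.1 := by
      rw [TetMesh.polyhedron, Set.iUnion_subtype]
    rw [h1]
    refine LocallyFinite.continuousOn_iUnion (locallyFinite_of_finite _) (fun T => isClosed_hull T.1) fun T => ?_
    exact (continuous_pval _).continuousOn.congr (hφ T)
  · have hxP : x ∈ 𝒯.polyhedron := by rw [TetMesh.bdry_eq] at hx; exact hx.1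
    obtain ⟨T, hT, hxT⟩ := TetMesh.mem_polyhedron.1 hxP
    obtain ⟨s, hsT, hxs⟩ := (TetMesh.isTet hT).exists_mem_openHull hxT
    -- All nodes of the sub-simplex carrying x are then on Γ_h, and only these determine the value
    -- at x.
    have hsb := TetMesh.hull_subset_bdry hT hsT hxs hx
    rw [hφ ⟨T, hT⟩ x hxT]
    have h := openHull_subset_hull s hxs
    rw [hull, Finset.mem_convexHull'] at h
    obtain ⟨μ, _, hμ, rfl⟩ := h
    rw [glue, pval_sum_lagr_subset (TetMesh.isTet hT) hsT c hμ]
    refine Finset.sum_eq_zero fun a ha => ?_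
    rw [hc, zero_mul]
    refine hsb ?_
    rw [hull, Finset.mem_convexHull']
    refine ⟨fun v => (a v : ℝ) / k, fun v _ => by positivity, ?_, rfl⟩
    rw [← Finset.sum_div, ← Nat.cast_sum, (mem_nodeIdx.1 ha).1, div_self (by positivity)]

lemma MemV.mem_Pk {v : Piecewise 𝒯} (hv : MemV 𝒯 k v) (T : 𝒯.Elem) : v T ∈ Pk k :=
  CurvedFEM.mem_Pk.2 (hv.1 T)

lemma MemV.exists_glue (hk : 0 < k) {v : Piecewise 𝒯} (hv : MemV 𝒯 k v) :
    ∃ c : E3 → ℝ, (∀ x ∈ 𝒯.bdry, c x = 0) ∧ v = glue 𝒯 k c := by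
  have hP := hv.mem_Pk
  obtain ⟨_, φ, _, hφ0, hφ⟩ := hv
  refine ⟨φ, hφ0, funext fun T => ?_⟩
  rw [eq_sum_lagr (TetMesh.isTet T.2) hk (hP T), glue]
  exact Finset.sum_congr rfl fun a ha => by rw [hφ T _ (node_mem_hull (TetMesh.isTet T.2) hk ha)]

/-- The sum over the elements of the squared norms of the gradient. -/
def gradNormSq (w : Piecewise 𝒯) : ℝ := ∑ T : 𝒯.Elem, ∫ x in hull T.1, gradSq (w T) x

lemma gradNormSq_nonneg (w : Piecewise 𝒯) : 0 ≤ gradNormSq w :=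
  Finset.sum_nonneg fun _ _ => integral_nonneg fun x => gradSq_nonneg _ x

/-- A polynomial with vanishing gradient in the mean on an element is constant. -/
lemma pval_eq_of_integral_gradSq {T : Finset E3} (hT : IsTet T) {p : MvPolynomial (Fin 3) ℝ}
    (hp : p ∈ Pk k) (h : ∫ x in hull T, gradSq p x ≤ 0) (x y : E3) : pval p x = pval p y := by
  obtain ⟨z, hz⟩ : (interior (hull T)).Nonempty := by
    rw [hT.interior_eq_openHull]
    exact openHull_nonempty (Finset.card_pos.1 (by rw [hT.card_eq]; norm_num))
  obtain ⟨r, hr, hB⟩ := Metric.nhds_basis_closedBall.mem_iff.1 (mem_interior_iff_mem_nhds.1 hz)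
  have h0 : ∀ i x, pgrad p i x = 0 := fun i x => by
    obtain ⟨C, hC, H⟩ := exists_inverse_pval k (dist x z / r)
    have h1 := H _ (pderiv_mem_Pk hp i) z r hr x (by
      rw [Metric.mem_closedBall, div_mul_cancel₀ _ hr.ne'])
    have h2 : ∫ y in Metric.closedBall z r, pval (MvPolynomial.pderiv i p) y ^ 2 ≤ 0 := by
      refine le_trans ?_ h
      refine le_trans (b := ∫ y in Metric.closedBall z r, gradSq p y) ?_ ?_
      · refine setIntegral_mono (integrableOn_of_continuous ((continuous_pval _).pow 2)
            (isCompact_closedBall _ _)) (integrableOn_of_continuous (continuous_gradSq p)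
            (isCompact_closedBall _ _)) fun y => ?_
        exact Finset.single_le_sum (f := fun i => pgrad p i y ^ 2) (fun _ _ => sq_nonneg _)
            (Finset.mem_univ i)
      · exact setIntegral_mono_set (integrableOn_of_continuous (continuous_gradSq p) (isCompact_hull T))
          (Filter.Eventually.of_forall fun y => gradSq_nonneg p y) hB.eventuallyLE
    have h3 : pval (MvPolynomial.pderiv i p) x ^ 2 * r ^ 3 ≤ 0 :=
      h1.trans (mul_nonpos_of_nonneg_of_nonpos hC.le h2)
    have h4 : pval (MvPolynomial.pderiv i p) x ^ 2 ≤ 0 := nonpos_of_mul_nonpos_left h3 (by positivity)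
    exact pow_eq_zero_iff two_ne_zero |>.1 (le_antisymm h4 (sq_nonneg _))
  have h1 := abs_pval_sub_le (p := p) convex_univ (K := 0) (fun z _ i => by rw [h0, abs_zero])
    (mem_univ x) (mem_univ y)
  rw [mul_zero, zero_mul] at h1
  exact sub_eq_zero.1 (abs_nonpos_iff.1 h1)

/-- The broken `H¹` semi-norm is a norm on `V_h`. -/
lemma MemV.eq_zero (hk : 0 < k) {v : Piecewise 𝒯} (hv : MemV 𝒯 k v) (h : gradNormSq v ≤ 0) : v = 0 := by
  classical
  have h1 : ∀ T : 𝒯.Elem, ∀ x y, pval (v T) x = pval (v T) y := fun T =>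
    pval_eq_of_integral_gradSq (TetMesh.isTet T.2) (hv.mem_Pk T) ((Finset.single_le_sum
      (f := fun T : 𝒯.Elem => ∫ x in hull T.1, gradSq (v T) x)
      (fun _ _ => integral_nonneg fun x => gradSq_nonneg _ x) (Finset.mem_univ T)).trans h)
  have hP := hv.mem_Pk
  obtain ⟨_, φ, hφc, hφ0, hφ⟩ := hv
  let ψ : E3 → ℝ := 𝒯.polyhedron.piecewise φ 0
  have hψ : Continuous ψ := by
    refine continuous_piecewise (fun x hx => ?_) ?_ continuousOn_const
    · refine hφ0 x ?_
      rw [TetMesh.bdry_eq]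
      rwa [frontier, TetMesh.isClosed_polyhedron.closure_eq] at hx
    · rwa [TetMesh.isClosed_polyhedron.closure_eq]
  -- The extension by zero is continuous on the connected space and takes finitely many values, so
  -- it is constant, and it vanishes off the compact polyhedron. No connectedness of the mesh is
  -- needed.
  let A : Set ℝ := insert 0 (range fun T : 𝒯.Elem => pval (v T) 0)
  have hA : A.Finite := (finite_range _).insert 0
  obtain ⟨y, _, hy⟩ := (isPreconnected_univ (α := E3)).eqOn_const_of_mapsTo (T := A) hA.isDiscrete hψ.continuousOn
    (fun x _ => by
      by_cases hx : x ∈ 𝒯.polyhedron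
      · obtain ⟨T, hT, hxT⟩ := TetMesh.mem_polyhedron.1 hx
        right
        refine ⟨⟨T, hT⟩, ?_⟩
        simp only [ψ, piecewise_eq_of_mem _ _ _ hx]
        rw [hφ ⟨T, hT⟩ x hxT]; exact h1 _ _ _
      · left; simp only [ψ, piecewise_eq_of_notMem _ _ _ hx]; rfl) ⟨0, mem_insert _ _⟩
  have hy0 : y = 0 := by
    obtain ⟨x, hx⟩ : ∃ x, x ∉ 𝒯.polyhedron := by
      by_contra! hall
      have : 𝒯.polyhedron = univ := eq_univ_of_forall hall
      exact noncompact_univ E3 (this ▸ TetMesh.isCompact_polyhedron)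
    have h2 := hy (mem_univ x)
    simp only [ψ, piecewise_eq_of_notMem _ _ _ hx] at h2
    exact h2.symm
  funext T
  rw [eq_sum_lagr (TetMesh.isTet T.2) hk (hP T)]
  refine Finset.sum_eq_zero fun a ha => ?_
  have h3 := node_mem_hull (TetMesh.isTet T.2) hk ha
  have h4 := hy (mem_univ (node k T.1 a))
  simp only [ψ, piecewise_eq_of_mem _ _ _ (TetMesh.hull_subset_polyhedron T.2 h3), hy0] at h4
  rw [← hφ T _ h3, h4, Function.const_apply, zero_smul]

end Glue

/-! ### The discrete problem -/

section Bilin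

variable {𝒯 : TetMesh} {k : ℕ}

lemma continuous_bilin_integrand (p q : MvPolynomial (Fin 3) ℝ) :
    Continuous fun x => ∑ i : Fin 3, pgrad p i x * pgrad q i x :=
  continuous_finsetSum _ fun i _ => (continuous_pgrad p i).mul (continuous_pgrad q i)

lemma bilin_comm (w v : Piecewise 𝒯) : bilin 𝒯 w v = bilin 𝒯 v w := by
  simp only [bilin, mul_comm]

lemma bilin_add_left (w w' v : Piecewise 𝒯) : bilin 𝒯 (w + w') v = bilin 𝒯 w v + bilin 𝒯 w' v := by
  simp only [bilin, ← Finset.sum_add_distrib]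
  refine Finset.sum_congr rfl fun T _ => ?_
  rw [← integral_add (integrableOn_of_continuous (continuous_bilin_integrand _ _) (isCompact_hull _))
    (integrableOn_of_continuous (continuous_bilin_integrand _ _) (isCompact_hull _))]
  simp only [Pi.add_apply, pgrad_add, add_mul, Finset.sum_add_distrib]

lemma bilin_smul_left (c : ℝ) (w v : Piecewise 𝒯) : bilin 𝒯 (c • w) v = c * bilin 𝒯 w v := by
  simp only [bilin, Finset.mul_sum, ← integral_const_mul, Pi.smul_apply, pgrad_smul, mul_assoc]

lemma bilin_add_right (w v v' : Piecewise 𝒯) : bilin 𝒯 w (v + v') = bilin 𝒯 w v + bilin 𝒯 w v' := by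
  rw [bilin_comm, bilin_add_left, bilin_comm v, bilin_comm v']

lemma bilin_smul_right (c : ℝ) (w v : Piecewise 𝒯) : bilin 𝒯 w (c • v) = c * bilin 𝒯 w v := by
  rw [bilin_comm, bilin_smul_left, bilin_comm]

lemma bilin_sub_left (w w' v : Piecewise 𝒯) : bilin 𝒯 (w - w') v = bilin 𝒯 w v - bilin 𝒯 w' v := by
  have := bilin_add_left (w - w') w' v
  rw [sub_add_cancel] at this
  linarith

lemma integrableOn_mul_pval {f : E3 → ℝ} {s : Set E3} (hs : IsCompact s) (hf : IntegrableOn f s)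
    (p : MvPolynomial (Fin 3) ℝ) : IntegrableOn (fun x => f x * pval p x) s :=
  hf.mul_continuousOn (continuous_pval p).continuousOn hs

lemma load_add {f : E3 → ℝ} (hf : ∀ T : 𝒯.Elem, IntegrableOn f (hull T.1)) (v v' : Piecewise 𝒯) :
    load 𝒯 f (v + v') = load 𝒯 f v + load 𝒯 f v' := by
  simp only [load, ← Finset.sum_add_distrib]
  refine Finset.sum_congr rfl fun T _ => ?_
  rw [← integral_add (integrableOn_mul_pval (isCompact_hull _) (hf T) _)
    (integrableOn_mul_pval (isCompact_hull _) (hf T) _)]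
  simp only [Pi.add_apply, pval_add, mul_add]

lemma load_smul {f : E3 → ℝ} (c : ℝ) (v : Piecewise 𝒯) : load 𝒯 f (c • v) = c * load 𝒯 f v := by
  simp only [load, Finset.mul_sum, ← integral_const_mul, Pi.smul_apply, pval_smul, mul_left_comm]

lemma glue_add (c d : E3 → ℝ) : glue 𝒯 k (c + d) = glue 𝒯 k c + glue 𝒯 k d := by
  funext T
  simp only [glue, Pi.add_apply, add_smul, Finset.sum_add_distrib]

lemma glue_smul (r : ℝ) (c : E3 → ℝ) : glue 𝒯 k (r • c) = r • glue 𝒯 k c := by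
  funext T
  simp only [glue, Pi.smul_apply, Finset.smul_sum, smul_smul, smul_eq_mul]

lemma gradSq_le (p q : MvPolynomial (Fin 3) ℝ) (x : E3) :
    gradSq q x ≤ 2 * gradSq p x + 2 * gradSq (p - q) x := by
  simp only [gradSq, pgrad_sub, Finset.mul_sum, ← Finset.sum_add_distrib]
  refine Finset.sum_le_sum fun i _ => ?_
  have := sq_nonneg (2 * pgrad p i x - pgrad q i x)
  linarith

/-- Componentwise the difference of the two sides is (p/2 - q)². With ‖grad(p - q)‖² ≤ ¼ ‖grad p‖²
this yields the coercivity constant ½. -/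
lemma sum_mul_ge (p q : MvPolynomial (Fin 3) ℝ) (x : E3) :
    3 / 4 * gradSq p x - gradSq (p - q) x ≤ ∑ i : Fin 3, pgrad p i x * pgrad q i x := by
  simp only [gradSq, pgrad_sub, Finset.mul_sum, ← Finset.sum_sub_distrib]
  refine Finset.sum_le_sum fun i _ => ?_
  have := sq_nonneg (pgrad p i x / 2 - pgrad q i x)
  linarith

lemma integrableOn_gradSq (p : MvPolynomial (Fin 3) ℝ) (T : Finset E3) :
    IntegrableOn (gradSq p) (hull T) :=
  integrableOn_of_continuous (continuous_gradSq p) (isCompact_hull T)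

lemma gradNormSq_le (w v : Piecewise 𝒯) :
    gradNormSq v ≤ 2 * gradNormSq w + 2 * gradNormSq (w - v) := by
  simp only [gradNormSq, Finset.mul_sum, ← Finset.sum_add_distrib, ← integral_const_mul]
  refine Finset.sum_le_sum fun T _ => ?_
  rw [← integral_add ((integrableOn_gradSq _ _).const_mul 2) ((integrableOn_gradSq _ _).const_mul 2)]
  exact setIntegral_mono (integrableOn_gradSq _ _)
    (((integrableOn_gradSq _ _).const_mul 2).add ((integrableOn_gradSq _ _).const_mul 2))
    fun x => gradSq_le _ _ x

lemma bilin_ge (w v : Piecewise 𝒯) : 3 / 4 * gradNormSq w - gradNormSq (w - v) ≤ bilin 𝒯 w v := by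
  simp only [gradNormSq, bilin, Finset.mul_sum, ← Finset.sum_sub_distrib, ← integral_const_mul]
  refine Finset.sum_le_sum fun T _ => ?_
  rw [← integral_sub ((integrableOn_gradSq _ _).const_mul _) (integrableOn_gradSq _ _)]
  exact setIntegral_mono (((integrableOn_gradSq _ _).const_mul _).sub (integrableOn_gradSq _ _))
    (integrableOn_of_continuous (continuous_bilin_integrand _ _) (isCompact_hull _))
    fun x => sum_mul_ge _ _ x

end Bilin

lemma exists_linear_solution {X : Type*} [AddCommGroup X] [Module ℝ X] [FiniteDimensional ℝ X]
    (A : X →ₗ[ℝ] X →ₗ[ℝ] ℝ) (hA : ∀ c, (∀ d, A c d = 0) → c = 0) (F : X →ₗ[ℝ] ℝ) :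
    ∃ c, ∀ d, A c d = F d := by
  have hinj : Function.Injective A := (injective_iff_map_eq_zero A).2 fun c hc => hA c fun d => by
    rw [hc]; rfl
  have hsurj : Function.Surjective A :=
    (LinearMap.injective_iff_surjective_of_finrank_eq_finrank (Subspace.dual_finrank_eq).symm).1 hinj
  obtain ⟨c, hc⟩ := hsurj F
  exact ⟨c, fun d => by rw [hc]⟩

/-- Modified nodes close enough to the Lagrangian nodes for the discrete problem to be well posed. -/
structure StableNodes (𝒯 : TetMesh) (Γ : Set E3) (ν : Finset E3 → E3) (k : ℕ) (θ : ℝ)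
    (pt : Finset E3 → (E3 → ℕ) → E3) : Prop extends ModifiedNodes 𝒯 Γ ν k θ pt where
  stable : ∀ T ∈ 𝒯.elems, ∀ p ∈ Pk k,
    ∑ a ∈ nodeIdx T k, |pval p (node k T a)| ≤ 2 * ∑ a ∈ nodeIdx T k, |pval p (pt T a)|
  close : ∀ w v : Piecewise 𝒯, MemW 𝒯 Γ ν k 0 w → MemV 𝒯 k v →
    (∀ T : 𝒯.Elem, ∀ a ∈ nodeIdx T.1 k, node k T.1 a ∉ 𝒯.bdry →
      pval (v T) (node k T.1 a) = pval (w T) (node k T.1 a)) →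
    gradNormSq (w - v) ≤ 1 / 4 * gradNormSq w

lemma TetMesh.ShapeRegular.exists_localNodes {𝒯 : TetMesh} {σ θ : ℝ} (hreg : 𝒯.ShapeRegular σ)
    {Γ : Set E3} {ν : Finset E3 → E3} {k : ℕ} {pt : Finset E3 → (E3 → ℕ) → E3}
    (hM : ModifiedNodes 𝒯 Γ ν k θ pt) {T : Finset E3} (hT : T ∈ 𝒯.elems) :
    ∃ c r, LocalNodes k σ θ T c r (pt T) := by
  obtain ⟨c, r, hr, hB, hd⟩ := hreg T hT
  exact ⟨c, r, TetMesh.isTet hT, hr, hB, hd, hM.dist_le T hT⟩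

/-- θ is chosen below the threshold of `exists_grad_bound_pts` and such that C₂θ² ≤ C₂θ ≤ 1/4, with
C₂ from `exists_coercivity_local`. -/
lemma exists_stable (k : ℕ) (hk : 0 < k) {σ : ℝ} (hσ : 1 ≤ σ) : ∃ θ₀ > 0, θ₀ ≤ 1 ∧ ∀ θ, 0 ≤ θ → θ ≤ θ₀ →
    ∀ (𝒯 : TetMesh) (Γ : Set E3) (ν : Finset E3 → E3) pt, 𝒯.ShapeRegular σ →
      ModifiedNodes 𝒯 Γ ν k θ pt → StableNodes 𝒯 Γ ν k θ pt := by
  obtain ⟨C₁, hC₁, θ₁, hθ₁, hθ₁1, H₁⟩ := exists_grad_bound_pts k hk hσ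
  obtain ⟨C₂, hC₂, H₂⟩ := exists_coercivity_local k hk hσ
  refine ⟨min θ₁ (1 / (4 * C₂ + 1)), by positivity, (min_le_left _ _).trans hθ₁1,
    fun θ hθ0 hθ 𝒯 Γ ν pt hreg hM => ⟨hM, fun T hT p hp => ?_, fun w v hw hv hwv => ?_⟩⟩
  · obtain ⟨c, r, hl⟩ := hreg.exists_localNodes hM hT
    exact (H₁ (hθ.trans (min_le_left _ _)) hl p hp).1
  · have hθ1 : θ ≤ 1 := hθ.trans ((min_le_left _ _).trans hθ₁1)
    have hsmall : C₂ * θ ^ 2 ≤ 1 / 4 := by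
      have h1 : θ * (4 * C₂ + 1) ≤ 1 := by
        rw [← le_div_iff₀ (by positivity)]; exact hθ.trans (min_le_right _ _)
      have h2 : θ ^ 2 ≤ θ := by
        have := mul_le_mul_of_nonneg_left hθ1 hθ0
        linarith
      have h3 := mul_le_mul_of_nonneg_left h2 hC₂.le
      linarith
    obtain ⟨hw1, hw2, hw3⟩ := (hM.memW_iff _ _).1 hw
    obtain ⟨c, hc0, rfl⟩ := hv.exists_glue hk
    rw [gradNormSq, gradNormSq, Finset.mul_sum]
    refine Finset.sum_le_sum fun T _ => ?_
    obtain ⟨z, r, hl⟩ := hreg.exists_localNodes hM T.2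
    refine (H₂ hθ0 hθ1 hl _ (hw1 T) _ (glue_mem_Pk c T) fun a ha => ?_).trans
      (mul_le_mul_of_nonneg_right hsmall (integral_nonneg fun x => gradSq_nonneg _ _))
    by_cases hb : node k T.1 a ∈ 𝒯.bdry
    · exact Or.inr ⟨by rw [pval_glue_node hk c T ha, hc0 _ hb], hw3 T a ha hb⟩
    · exact Or.inl (hwv T a ha hb)

/-! ### Well-posedness of the discrete problem. -/

section Solve

variable {𝒯 : TetMesh} {Γ : Set E3} {ν : Finset E3 → E3} {k : ℕ} {θ : ℝ} {pt : Finset E3 → (E3 → ℕ) → E3}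

lemma ModifiedNodes.memW_add (hM : ModifiedNodes 𝒯 Γ ν k θ pt) {g g' : E3 → ℝ} {w w' : Piecewise 𝒯}
    (hw : MemW 𝒯 Γ ν k g w) (hw' : MemW 𝒯 Γ ν k g' w') : MemW 𝒯 Γ ν k (g + g') (w + w') := by
  rw [hM.memW_iff] at hw hw' ⊢
  obtain ⟨h1, h2, h3⟩ := hw
  obtain ⟨h1', h2', h3'⟩ := hw'
  refine ⟨fun T => Submodule.add_mem _ (h1 T) (h1' T), fun S T a ha b hb hab hn => ?_, fun T a ha hb => ?_⟩
  · simp only [Pi.add_apply, pval_add, h2 S T a ha b hb hab hn, h2' S T a ha b hb hab hn]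
  · simp only [Pi.add_apply, pval_add, h3 T a ha hb, h3' T a ha hb]

lemma ModifiedNodes.memW_sub (hM : ModifiedNodes 𝒯 Γ ν k θ pt) {g : E3 → ℝ} {w w' : Piecewise 𝒯}
    (hw : MemW 𝒯 Γ ν k g w) (hw' : MemW 𝒯 Γ ν k g w') : MemW 𝒯 Γ ν k 0 (w - w') := by
  rw [hM.memW_iff] at hw hw' ⊢
  obtain ⟨h1, h2, h3⟩ := hw
  obtain ⟨h1', h2', h3'⟩ := hw'
  refine ⟨fun T => Submodule.sub_mem _ (h1 T) (h1' T), fun S T a ha b hb hab hn => ?_, fun T a ha hb => ?_⟩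
  · simp only [Pi.sub_apply, pval_sub, h2 S T a ha b hb hab hn, h2' S T a ha b hb hab hn]
  · simp only [Pi.sub_apply, pval_sub, h3 T a ha hb, h3' T a ha hb, sub_self, Pi.zero_apply]

/-- The conforming function with the same values at the interior nodes. -/
lemma ModifiedNodes.exists_conforming (hM : ModifiedNodes 𝒯 Γ ν k θ pt) (hk : 0 < k) {g : E3 → ℝ}
    {w : Piecewise 𝒯} (hw : MemW 𝒯 Γ ν k g w) : ∃ v, MemV 𝒯 k v ∧
      ∀ T : 𝒯.Elem, ∀ a ∈ nodeIdx T.1 k, node k T.1 a ∉ 𝒯.bdry →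
        pval (v T) (node k T.1 a) = pval (w T) (node k T.1 a) := by
  classical
  obtain ⟨h1, h2, h3⟩ := (hM.memW_iff _ _).1 hw
  -- The choice of the element is immaterial, since w is single-valued at interior nodes.
  let c : E3 → ℝ := fun x => if h : x ∉ 𝒯.bdry ∧ ∃ T : 𝒯.Elem, ∃ a ∈ nodeIdx T.1 k, node k T.1 a = x then
    pval (w h.2.choose) x else 0
  refine ⟨glue 𝒯 k c, memV_glue hk fun x hx => dif_neg fun h => h.1 hx, fun T a ha hb => ?_⟩
  have h : node k T.1 a ∉ 𝒯.bdry ∧ ∃ S : 𝒯.Elem, ∃ b ∈ nodeIdx S.1 k, node k S.1 b = node k T.1 a :=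
    ⟨hb, T, a, ha, rfl⟩
  rw [pval_glue_node hk c T ha]
  simp only [c, dif_pos h]
  obtain ⟨b, hb1, hb2⟩ := h.2.choose_spec
  have := h2 _ T b hb1 a ha hb2 (by rwa [hb2])
  rwa [hb2] at this

namespace StableNodes

variable (hM : StableNodes 𝒯 Γ ν k θ pt)
include hM

/-- Discrete coercivity. -/
lemma le_bilin {w v : Piecewise 𝒯} (hw : MemW 𝒯 Γ ν k 0 w) (hv : MemV 𝒯 k v)
    (h : ∀ T : 𝒯.Elem, ∀ a ∈ nodeIdx T.1 k, node k T.1 a ∉ 𝒯.bdry →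
      pval (v T) (node k T.1 a) = pval (w T) (node k T.1 a)) :
    1 / 2 * gradNormSq w ≤ bilin 𝒯 w v ∧ gradNormSq v ≤ 4 * gradNormSq w := by
  have h1 := hM.close w v hw hv h
  have h2 := bilin_ge w v
  have h3 := gradNormSq_le w v
  have h4 := gradNormSq_nonneg w
  constructor <;> linarith

/-- Coercivity annihilates both gradients, so v = 0 by `MemV.eq_zero`; then w vanishes at all
modified nodes, which determine it. -/
lemma eq_zero (hk : 0 < k) {w v : Piecewise 𝒯} (hw : MemW 𝒯 Γ ν k 0 w) (hv : MemV 𝒯 k v)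
    (h : ∀ T : 𝒯.Elem, ∀ a ∈ nodeIdx T.1 k, node k T.1 a ∉ 𝒯.bdry →
      pval (v T) (node k T.1 a) = pval (w T) (node k T.1 a)) (h0 : bilin 𝒯 w v = 0) : w = 0 ∧ v = 0 := by
  obtain ⟨h1, h2⟩ := hM.le_bilin hw hv h
  have hv0 : v = 0 := hv.eq_zero hk (by linarith)
  refine ⟨funext fun T => ?_, hv0⟩
  obtain ⟨h3, h4, h5⟩ := (hM.memW_iff _ _).1 hw
  refine eq_zero_of_pts hk (TetMesh.isTet T.2) (hM.stable T.1 T.2) (h3 T) fun a ha => ?_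
  by_cases hb : node k T.1 a ∈ 𝒯.bdry
  · exact h5 T a ha hb
  · rw [hM.eq_node T.1 T.2 a ha hb, ← h T a ha hb, hv0]; exact pval_zero _

lemma exists_interp (hk : 0 < k) : ∃ I : ∀ T : 𝒯.Elem, (nodeIdx T.1 k → ℝ) →ₗ[ℝ] Pk k,
    ∀ T b, ∀ a : nodeIdx T.1 k, pval (I T b) (pt T.1 a) = b a := by
  have h : ∀ T : 𝒯.Elem, ∃ J : (nodeIdx T.1 k → ℝ) →ₗ[ℝ] Pk k,
      ∀ b, ∀ a : nodeIdx T.1 k, pval (J b) (pt T.1 a) = b a := fun T => by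
    have hinj : Function.Injective (evalAt k T.1 (pt T.1)) :=
      (injective_iff_map_eq_zero _).2 fun p hp => Subtype.ext
        (eq_zero_of_pts hk (TetMesh.isTet T.2) (hM.stable T.1 T.2) p.2 fun a ha => congrFun hp ⟨a, ha⟩)
    obtain ⟨J, hJ⟩ := LinearMap.exists_rightInverse_of_surjective _
      (LinearMap.range_eq_top.2 (evalAt_surjective_of_injective (TetMesh.isTet T.2) hk hinj))
    exact ⟨J, fun b a => congrFun (LinearMap.congr_fun hJ b) a⟩
  choose I hI using h
  exact ⟨I, hI⟩

/-- The interpolant of a function at the modified nodes. -/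
lemma exists_memW (hk : 0 < k) {U g : E3 → ℝ} (hU : ∀ x ∈ Γ, U x = g x) :
    ∃ w, MemW 𝒯 Γ ν k g w ∧ ∀ T : 𝒯.Elem, ∀ a ∈ nodeIdx T.1 k, pval (w T) (pt T.1 a) = U (pt T.1 a) := by
  obtain ⟨I, hI⟩ := hM.exists_interp hk
  refine ⟨fun T => I T fun a => U (pt T.1 a), (hM.memW_iff _ _).2 ⟨fun T => (I T _).2, ?_, ?_⟩, ?_⟩
  · intro S T a ha b hb hab hn
    have h1 := hI S (fun a => U (pt S.1 a)) ⟨a, ha⟩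
    have h2 := hI T (fun a => U (pt T.1 a)) ⟨b, hb⟩
    rw [hM.eq_node S.1 S.2 a ha hn] at h1
    rw [hM.eq_node T.1 T.2 b hb (hab ▸ hn)] at h2
    rw [h1, h2, hab]
  · intro T a ha hb
    rw [← hU _ (hM.mem T.1 T.2 a ha hb)]
    exact hI T _ ⟨a, ha⟩
  · exact fun T a ha => hI T _ ⟨a, ha⟩

-- The unknowns are the values at the interior nodes. `W c` and `V c` are the elements of W_h^0 and
-- V_h with these values, and (c, d) ↦ a_h(W c, V d) is a square form, nondegenerate by pairing c
-- with itself. Adding one element `w₀` of W_h^g handles the boundary datum.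
open Classical in
theorem existsUnique (hk : 0 < k) {f g : E3 → ℝ} (hf : ∀ T : 𝒯.Elem, IntegrableOn f (hull T.1)) :
    ∃! u, IsDiscreteSolution 𝒯 Γ ν k f g u := by
  obtain ⟨I, hI⟩ := hM.exists_interp hk
  let N : Finset E3 := (𝒯.elems.biUnion fun T => (nodeIdx T k).image (node k T)).filter (· ∉ 𝒯.bdry)
  have hN : ∀ T : 𝒯.Elem, ∀ a ∈ nodeIdx T.1 k, node k T.1 a ∉ 𝒯.bdry → node k T.1 a ∈ N := fun T a ha hb =>
    Finset.mem_filter.2 ⟨Finset.mem_biUnion.2 ⟨T.1, T.2, Finset.mem_image_of_mem _ ha⟩, hb⟩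
  let ext : (N → ℝ) →ₗ[ℝ] (E3 → ℝ) :=
    { toFun := fun c x => if h : x ∈ N then c ⟨x, h⟩ else 0
      map_add' := fun c d => by funext x; by_cases h : x ∈ N <;> simp [h]
      map_smul' := fun r c => by funext x; by_cases h : x ∈ N <;> simp [h] }
  have hext0 : ∀ c, ∀ x ∈ 𝒯.bdry, ext c x = 0 := fun c x hx => by
    have h : x ∉ N := fun h => (Finset.mem_filter.1 h).2 hx
    change (if h : x ∈ N then c ⟨x, h⟩ else 0) = 0
    rw [dif_neg h]
  let W : (N → ℝ) →ₗ[ℝ] Piecewise 𝒯 :=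
    { toFun := fun c T => I T fun a => ext c (node k T.1 a)
      map_add' := fun c d => by
        funext T
        simp only [map_add, Pi.add_apply, ← Submodule.coe_add]
        rw [← map_add]; rfl
      map_smul' := fun r c => by
        funext T
        simp only [map_smul, Pi.smul_apply, RingHom.id_apply, ← Submodule.coe_smul]
        rw [← map_smul]; rfl }
  let V : (N → ℝ) →ₗ[ℝ] Piecewise 𝒯 :=
    { toFun := fun c => glue 𝒯 k (ext c)
      map_add' := fun c d => by rw [map_add, glue_add]
      map_smul' := fun r c => by rw [map_smul, glue_smul]; rfl }
  have hV : ∀ c, MemV 𝒯 k (V c) := fun c => memV_glue hk (hext0 c)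
  have hWpt : ∀ c (T : 𝒯.Elem), ∀ a ∈ nodeIdx T.1 k, pval (W c T) (pt T.1 a) = ext c (node k T.1 a) :=
    fun c T a ha => hI T (fun a => ext c (node k T.1 a)) ⟨a, ha⟩
  have hWn : ∀ c (T : 𝒯.Elem), ∀ a ∈ nodeIdx T.1 k, node k T.1 a ∉ 𝒯.bdry →
      pval (W c T) (node k T.1 a) = ext c (node k T.1 a) := fun c T a ha hn => by
    have := hWpt c T a ha
    rwa [hM.eq_node T.1 T.2 a ha hn] at this
  have hW : ∀ c, MemW 𝒯 Γ ν k 0 (W c) := fun c => (hM.memW_iff _ _).2 ⟨fun T => (I T _).2,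
    fun S T a ha b hb hab hn => by rw [hWn c S a ha hn, hWn c T b hb (hab ▸ hn), hab],
    fun T a ha hb => by rw [hWpt c T a ha, hext0 c _ hb]; rfl⟩
  have hWV : ∀ c, ∀ T : 𝒯.Elem, ∀ a ∈ nodeIdx T.1 k, node k T.1 a ∉ 𝒯.bdry →
      pval (V c T) (node k T.1 a) = pval (W c T) (node k T.1 a) := fun c T a ha hn => by
    rw [hWn c T a ha hn]; exact pval_glue_node hk _ T ha
  obtain ⟨w₀, hw₀, -⟩ := hM.exists_memW hk (U := g) (g := g) fun _ _ => rfl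
  let A : (N → ℝ) →ₗ[ℝ] (N → ℝ) →ₗ[ℝ] ℝ := LinearMap.mk₂ ℝ (fun c d => bilin 𝒯 (W c) (V d))
    (fun c c' d => by rw [map_add, bilin_add_left]) (fun r c d => by rw [map_smul, bilin_smul_left]; rfl)
    (fun c d d' => by rw [map_add, bilin_add_right]) (fun r c d => by rw [map_smul, bilin_smul_right]; rfl)
  let F : (N → ℝ) →ₗ[ℝ] ℝ :=
    { toFun := fun d => load 𝒯 f (V d) - bilin 𝒯 w₀ (V d)
      map_add' := fun d d' => by rw [map_add, load_add hf, bilin_add_right]; ring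
      map_smul' := fun r d => by
        rw [map_smul, load_smul, bilin_smul_right, RingHom.id_apply, smul_eq_mul]; ring }
  obtain ⟨c, hc⟩ := exists_linear_solution A (fun c hc => by
    have h0 : V c = 0 := (hM.eq_zero hk (hW c) (hV c) (hWV c) (hc c)).2
    funext x
    obtain ⟨T, hT, hx⟩ := Finset.mem_biUnion.1 (Finset.mem_filter.1 x.2).1
    obtain ⟨a, ha, hax⟩ := Finset.mem_image.1 hx
    have h1 : pval (V c ⟨T, hT⟩) (node k T a) = ext c (node k T a) := pval_glue_node hk (ext c) ⟨T, hT⟩ ha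
    rw [h0, hax] at h1
    have h2 : ext c x.1 = c x := dif_pos x.2
    rw [← h2, ← h1]; exact pval_zero _) F
  have hsol : MemW 𝒯 Γ ν k g (W c + w₀) := by
    have := hM.memW_add (hW c) hw₀
    rwa [zero_add] at this
  have hbil : ∀ v, MemV 𝒯 k v → bilin 𝒯 (W c + w₀) v = load 𝒯 f v := fun v hv => by
    obtain ⟨c', hc'0, rfl⟩ := hv.exists_glue hk
    have h1 : glue 𝒯 k c' = V fun x => c' x := by
      funext T
      refine Finset.sum_congr rfl fun a ha => ?_
      congr 1
      by_cases hb : node k T.1 a ∈ 𝒯.bdry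
      · rw [hc'0 _ hb, hext0 _ _ hb]
      · change _ = if h : node k T.1 a ∈ N then c' (node k T.1 a) else 0
        rw [dif_pos (hN T a ha hb)]
    have h2 : bilin 𝒯 (W c) (V fun x => c' x) = load 𝒯 f (V fun x => c' x) - bilin 𝒯 w₀ (V fun x => c' x) :=
      hc fun x => c' x
    rw [h1, bilin_add_left, h2, sub_add_cancel]
  refine ⟨W c + w₀, ⟨hsol, hbil⟩, fun u hu => ?_⟩
  have hd := hM.memW_sub hu.1 hsol
  obtain ⟨v, hv, hv'⟩ := hM.exists_conforming hk hd
  refine sub_eq_zero.1 (hM.eq_zero hk hd hv hv' ?_).1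
  rw [bilin_sub_left, hu.2 v hv, hbil v hv, sub_self]

end StableNodes

end Solve

/-! ### Mollification -/

open scoped Convolution
open ContinuousLinearMap (lsmul)

/-- The standard basis vectors. -/
abbrev ee (i : Fin 3) : E3 := EuclideanSpace.single i 1

/-- The partial derivative along a multi-index given as a sequence of directions. -/
def dpart {m : ℕ} (s : Fin m → Fin 3) (u : E3 → ℝ) (x : E3) : ℝ := iteratedFDeriv ℝ m u x fun i => ee (s i)

lemma ContDiff.dpart_succ {m : ℕ} {s : Fin (m + 1) → Fin 3} {u : E3 → ℝ} (hu : ContDiff ℝ ∞ u) (x : E3) :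
    dpart s u x = fderiv ℝ (dpart (Fin.tail s) u) x (ee (s 0)) :=
  (hu.differentiable_iteratedFDeriv (by exact_mod_cast WithTop.coe_lt_top _) x).iteratedFDeriv_succ_apply_left'

lemma ContDiff.contDiff_dpart {m : ℕ} {u : E3 → ℝ} (hu : ContDiff ℝ ∞ u) (s : Fin m → Fin 3) :
    ContDiff ℝ ∞ (dpart s u) := by
  have h : ContDiff ℝ ∞ (iteratedFDeriv ℝ m u) := hu.iteratedFDeriv_right (m := ∞) (by exact_mod_cast le_top)
  exact (ContinuousMultilinearMap.apply ℝ (fun _ : Fin m => E3) ℝ fun i => ee (s i)).contDiff.comp h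

lemma HasCompactSupport.dpart {m : ℕ} {u : E3 → ℝ} (hu : HasCompactSupport u) (s : Fin m → Fin 3) :
    HasCompactSupport (dpart s u) :=
  (hu.iteratedFDeriv (𝕜 := ℝ) m).comp_left
    (g := fun L : ContinuousMultilinearMap ℝ (fun _ : Fin m => E3) ℝ => L fun i => ee (s i)) rfl

lemma dpart_convolution {f g : E3 → ℝ} (hf : ContDiff ℝ ∞ f) (hcf : HasCompactSupport f)
    (hg : LocallyIntegrable g) : ∀ {m : ℕ} (s : Fin m → Fin 3) (x : E3),
      dpart s (f ⋆[lsmul ℝ ℝ, volume] g) x = (dpart s f ⋆[lsmul ℝ ℝ, volume] g) x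
  | 0, s, x => rfl
  | m + 1, s, x => by
    have hfg : ContDiff ℝ ∞ (f ⋆[lsmul ℝ ℝ, volume] g) := hcf.contDiff_convolution_left _ hf hg
    have h1 : dpart (Fin.tail s) (f ⋆[lsmul ℝ ℝ, volume] g) =
        dpart (Fin.tail s) f ⋆[lsmul ℝ ℝ, volume] g :=
      funext fun y => dpart_convolution hf hcf hg (Fin.tail s) y
    have h2 := ContDiff.contDiff_dpart hf (Fin.tail s)
    have h3 := HasCompactSupport.dpart hcf (Fin.tail s)
    have h4 := h3.hasFDerivAt_convolution_left (lsmul ℝ ℝ) (h2.of_le (by simp)) hg x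
    rw [ContDiff.dpart_succ hfg, h1, h4.fderiv, convolution_def, convolution_def,
      ContinuousLinearMap.integral_apply]
    · exact integral_congr_ae (Eventually.of_forall fun t => by
        simp only [ContDiff.dpart_succ hf]; rfl)
    · exact (h3.fderiv (𝕜 := ℝ)).convolutionExists_left _ (h2.continuous_fderiv (by simp)) hg x

/-- A sequence of bump functions with shrinking support. -/
def bump (n : ℕ) : ContDiffBump (0 : E3) where
  rIn := 1 / (2 * (n + 1))
  rOut := 1 / (n + 1)
  rIn_pos := by positivity
  rIn_lt_rOut := by
    have : (0 : ℝ) < n + 1 := by positivity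
    exact one_div_lt_one_div_of_lt this (by linarith)

/-- The radius of the support of the `n`-th mollifier. -/
def mrad (n : ℕ) : ℝ := 1 / (n + 1)

lemma tendsto_mrad : Tendsto mrad atTop (𝓝 0) := tendsto_one_div_add_atTop_nhds_zero_nat

/-- The mollifier. -/
def rho (n : ℕ) : E3 → ℝ := (bump n).normed volume

lemma contDiff_rho (n : ℕ) : ContDiff ℝ ∞ (rho n) := (bump n).contDiff_normed

lemma hasCompactSupport_rho (n : ℕ) : HasCompactSupport (rho n) := (bump n).hasCompactSupport_normed

lemma rho_nonneg (n : ℕ) (x : E3) : 0 ≤ rho n x := (bump n).nonneg_normed x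

lemma integral_rho (n : ℕ) : ∫ x, rho n x = 1 := (bump n).integral_normed

lemma integrable_rho (n : ℕ) : Integrable (rho n) := (bump n).integrable_normed

lemma rho_neg (n : ℕ) (x : E3) : rho n (-x) = rho n x := (bump n).normed_neg x

lemma rho_eq_zero {n : ℕ} {x : E3} (h : mrad n ≤ ‖x‖) : rho n x = 0 := by
  by_contra h1
  have : x ∈ Function.support (rho n) := h1
  rw [rho, (bump n).support_normed_eq, mem_ball_zero_iff] at this
  exact absurd this (not_lt.2 h)

/-- The mollification of a function. -/
def moll (n : ℕ) (u : E3 → ℝ) : E3 → ℝ := rho n ⋆[lsmul ℝ ℝ, volume] u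

lemma moll_apply (n : ℕ) (u : E3 → ℝ) (x : E3) : moll n u x = ∫ t, rho n t * u (x - t) := rfl

lemma contDiff_moll (n : ℕ) {u : E3 → ℝ} (hu : LocallyIntegrable u) : ContDiff ℝ ∞ (moll n u) :=
  (hasCompactSupport_rho n).contDiff_convolution_left _ (contDiff_rho n) hu

lemma integrable_moll_integrand (n : ℕ) {u : E3 → ℝ} (hu : LocallyIntegrable u) (x : E3) :
    Integrable fun t => rho n t * u (x - t) :=
  (hasCompactSupport_rho n).convolutionExists_left (lsmul ℝ ℝ) (contDiff_rho n).continuous hu x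

lemma dpart_neg_eq {m : ℕ} {f : E3 → ℝ} (hf : ContDiff ℝ ∞ f) (h : ∀ x, f (-x) = f x) (s : Fin m → Fin 3)
    (x : E3) : dpart s f (-x) = (-1) ^ m * dpart s f x := by
  have h1 : f ∘ (-ContinuousLinearMap.id ℝ E3) = f := funext fun x => h x
  have h2 := (-ContinuousLinearMap.id ℝ E3).iteratedFDeriv_comp_right (i := m) hf (-x)
    (by exact_mod_cast le_top)
  rw [h1] at h2
  have h3 : (-ContinuousLinearMap.id ℝ E3) (-x) = x := by simp
  rw [dpart, h2, h3, ContinuousMultilinearMap.compContinuousLinearMap_apply, dpart]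
  have h4 := (iteratedFDeriv ℝ m f x).map_smul_univ (fun _ => (-1 : ℝ)) fun i => ee (s i)
  simp only [Finset.prod_const, Finset.card_univ, Fintype.card_fin, smul_eq_mul] at h4
  rw [← h4]
  congr 1
  funext i
  simp

/-- Inside the domain, weak derivatives commute with mollification. -/
lemma dpart_moll {D : Set E3} (hD : MeasurableSet D) {m : ℕ} {s : Fin m → Fin 3} {u v : E3 → ℝ}
    (hu : LocallyIntegrable (D.indicator u)) (h : HasWeakDeriv D s u v) {n : ℕ} {x : E3}
    (hx : Metric.closedBall x (mrad n) ⊆ D) :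
    dpart s (moll n (D.indicator u)) x = moll n (D.indicator v) x := by
  rw [moll, dpart_convolution (contDiff_rho n) (hasCompactSupport_rho n) hu, moll, convolution_eq_swap,
    convolution_eq_swap]
  -- The test function in t is ρ_n(t - x); by evenness of ρ_n its derivatives of order m are (-1)^m
  -- times those of ρ_n at x - t, which cancels the sign in the weak derivative.
  let ψ : E3 → ℝ := fun t => rho n (t - x)
  have hψ : IsTest D ψ := by
    refine ⟨(contDiff_rho n).comp (contDiff_id.sub contDiff_const), ?_, ?_⟩
    · exact HasCompactSupport.intro (isCompact_closedBall x (mrad n)) fun t ht => rho_eq_zero (by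
        rw [Metric.mem_closedBall, dist_eq_norm, not_le] at ht; exact ht.le)
    · refine (closure_minimal (fun t ht => ?_) Metric.isClosed_closedBall).trans hx
      by_contra h1
      rw [Metric.mem_closedBall, dist_eq_norm, not_le] at h1
      exact ht (rho_eq_zero h1.le)
  have h1 := h.2 ψ hψ
  have h2 : ∀ t, iteratedFDeriv ℝ m ψ t (fun i => ee (s i)) = (-1) ^ m * dpart s (rho n) (x - t) := fun t => by
    rw [show ψ = fun t => rho n (t - x) from rfl, iteratedFDeriv_comp_sub, ← neg_sub t x,
      dpart_neg_eq (contDiff_rho n) (rho_neg n), ← mul_assoc, ← mul_pow]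
    simp [dpart]
  simp only [ee] at h2
  simp only [h2] at h1
  have h3 : ∫ t in D, u t * ((-1) ^ m * dpart s (rho n) (x - t)) =
      (-1) ^ m * ∫ t, lsmul ℝ ℝ (dpart s (rho n) (x - t)) (D.indicator u t) := by
    rw [← integral_indicator hD, ← integral_const_mul]
    congr 1
    funext t
    by_cases ht : t ∈ D
    · simp only [indicator_of_mem ht, ContinuousLinearMap.lsmul_apply, smul_eq_mul]; ring
    · simp only [indicator_of_notMem ht, map_zero, mul_zero]
  have h4 : ∫ t in D, v t * ψ t = ∫ t, lsmul ℝ ℝ (rho n (x - t)) (D.indicator v t) := by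
    rw [← integral_indicator hD]
    congr 1
    funext t
    by_cases ht : t ∈ D
    · simp only [indicator_of_mem ht, ContinuousLinearMap.lsmul_apply, smul_eq_mul, ψ]
      rw [← rho_neg n (x - t), neg_sub, mul_comm]
    · simp only [indicator_of_notMem ht, map_zero]
  rw [h3, h4] at h1
  exact mul_left_cancel₀ (pow_ne_zero m (by norm_num)) h1

lemma ae_tendsto_moll {u : E3 → ℝ} (hu : LocallyIntegrable u) :
    ∀ᵐ x, Tendsto (fun n => moll n u x) atTop (𝓝 (u x)) := by
  -- 2 is the ratio of the outer to the inner radius of `bump n`.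
  refine ContDiffBump.ae_convolution_tendsto_right_of_locallyIntegrable (K := 2) (φ := bump) tendsto_mrad
    (Eventually.of_forall fun n => ?_) hu
  have : (0 : ℝ) < n + 1 := by positivity
  simp only [bump]
  field_simp
  exact le_rfl

lemma abs_moll_le {u : E3 → ℝ} {K : ℝ} (hK : ∀ x, |u x| ≤ K) (n : ℕ) (x : E3) : |moll n u x| ≤ K := by
  rw [moll_apply]
  have h : ∫ t, rho n t * K = K := by rw [integral_mul_const, integral_rho, one_mul]
  rw [← h, ← Real.norm_eq_abs]
  refine norm_integral_le_of_norm_le ((integrable_rho n).mul_const K) (Eventually.of_forall fun t => ?_)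
  rw [norm_mul, Real.norm_of_nonneg (rho_nonneg n t)]
  exact mul_le_mul_of_nonneg_left (hK _) (rho_nonneg n t)

/-- Jensen's inequality, in the form that the variance of V(x - ·) under the probability density ρ_n
is nonnegative. -/
lemma moll_sq_le {V : E3 → ℝ} (hV : LocallyIntegrable V) (hV2 : LocallyIntegrable fun x => V x ^ 2) (n : ℕ)
    (x : E3) : moll n V x ^ 2 ≤ moll n (fun x => V x ^ 2) x := by
  set c := moll n V x with hc
  have h0 : 0 ≤ ∫ t, rho n t * (V (x - t) - c) ^ 2 :=
    integral_nonneg fun t => mul_nonneg (rho_nonneg n t) (sq_nonneg _)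
  have h1 : ∫ t, rho n t * (V (x - t) - c) ^ 2 =
      moll n (fun x => V x ^ 2) x - 2 * c * moll n V x + c ^ 2 := by
    have i1 := integrable_moll_integrand n hV2 x
    have i2 := (integrable_moll_integrand n hV x).const_mul (2 * c)
    have i3 := (integrable_rho n).mul_const (c ^ 2)
    rw [moll_apply, moll_apply, ← integral_const_mul, ← integral_sub i1 i2]
    conv_rhs => rw [← one_mul (c ^ 2), ← integral_rho n, ← integral_mul_const]
    have h2 := integral_add (i1.sub i2) i3
    simp only [Pi.sub_apply] at h2
    rw [← h2]
    congr 1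
    funext t
    ring
  rw [h1, ← hc] at h0
  linarith

/-- On the smaller ball only values of v at distance at most d matter, so v may be truncated;
Jensen's inequality and the unit mass of ρ_n do the rest. -/
lemma setIntegral_moll_sq_le {v : E3 → ℝ} (hv : MemLp v 2) {c : E3} {R d : ℝ} {n : ℕ} (hn : mrad n ≤ d) :
    ∫ x in Metric.closedBall c R, moll n v x ^ 2 ≤ ∫ x in Metric.closedBall c (R + d), v x ^ 2 := by
  set B := Metric.closedBall c (R + d) with hB
  have hBm : MeasurableSet B := Metric.isClosed_closedBall.measurableSet
  set V := B.indicator v with hVdef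
  have hV : MemLp V 2 := hv.indicator hBm
  have hVl : LocallyIntegrable V := hV.locallyIntegrable (by norm_num)
  have hV2 : Integrable fun x => V x ^ 2 := hV.integrable_sq
  have h1 : ∀ x ∈ Metric.closedBall c R, moll n v x = moll n V x := fun x hx => by
    rw [moll_apply, moll_apply]
    congr 1
    funext t
    rcases lt_or_ge ‖t‖ (mrad n) with ht | ht
    · rw [hVdef, indicator_of_mem]
      rw [hB, Metric.mem_closedBall]
      rw [Metric.mem_closedBall] at hx
      have : dist (x - t) x = ‖t‖ := by rw [dist_eq_norm, sub_sub_cancel_left, norm_neg]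
      linarith [dist_triangle (x - t) x c]
    · rw [rho_eq_zero ht, zero_mul, zero_mul]
  have hcont : Continuous (moll n V) := (contDiff_moll n hVl).continuous
  have hint : Integrable (moll n fun x => V x ^ 2) :=
    (integrable_rho n).integrable_convolution (lsmul ℝ ℝ) hV2
  calc ∫ x in Metric.closedBall c R, moll n v x ^ 2
      = ∫ x in Metric.closedBall c R, moll n V x ^ 2 :=
        setIntegral_congr_fun Metric.isClosed_closedBall.measurableSet fun x hx => by
          simp only [h1 x hx]
    _ ≤ ∫ x in Metric.closedBall c R, moll n (fun x => V x ^ 2) x :=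
        setIntegral_mono (integrableOn_of_continuous (hcont.pow 2) (isCompact_closedBall _ _))
          hint.integrableOn fun x => moll_sq_le hVl hV2.locallyIntegrable n x
    _ ≤ ∫ x, moll n (fun x => V x ^ 2) x :=
        setIntegral_le_integral hint (Eventually.of_forall fun x =>
          integral_nonneg fun t => mul_nonneg (rho_nonneg n t) (sq_nonneg _))
    _ = ∫ x, V x ^ 2 := by
        have := integral_convolution (μ := volume) (ν := volume) (lsmul ℝ ℝ) (integrable_rho n) hV2
        rw [integral_rho] at this
        simpa [moll] using this
    _ = ∫ x in B, v x ^ 2 := by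
        rw [← integral_indicator hBm]
        congr 1
        funext x
        by_cases hx : x ∈ B <;> simp [hVdef, hx]

/-! ### Taylor polynomials -/

/-- The partial derivative of a function. -/
def dd (i : Fin 3) (f : E3 → ℝ) (x : E3) : ℝ := fderiv ℝ f x (ee i)

lemma ContDiff.dd {f : E3 → ℝ} (hf : ContDiff ℝ ∞ f) (i : Fin 3) : ContDiff ℝ ∞ (dd i f) :=
  (hf.fderiv_right (m := ∞) (by exact_mod_cast le_top)).clm_apply contDiff_const

lemma dd_comm {f : E3 → ℝ} (hf : ContDiff ℝ ∞ f) (i j : Fin 3) : dd i (dd j f) = dd j (dd i f) := by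
  have h : ∀ i j x, dd i (dd j f) x = fderiv ℝ (fderiv ℝ f) x (ee i) (ee j) := fun i j x => by
    have h1 : DifferentiableAt ℝ (fderiv ℝ f) x :=
      (hf.fderiv_right (m := ∞) (by exact_mod_cast le_top)).contDiffAt.differentiableAt (by simp)
    have h2 := (h1.hasFDerivAt.clm_apply (hasFDerivAt_const (ee j) x)).fderiv
    rw [dd]
    change fderiv ℝ (fun y => fderiv ℝ f y (ee j)) x (ee i) = _
    rw [h2]
    simp
  funext x
  rw [h, h]
  have : IsSymmSndFDerivAt ℝ f x := hf.contDiffAt.isSymmSndFDerivAt (by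
    rw [minSmoothness_of_isRCLikeNormedField]; exact WithTop.coe_le_coe.2 (le_top : (2 : ℕ∞) ≤ ⊤))
  exact this (ee i) (ee j)

lemma eq_sum_ee (v : E3) : v = ∑ i, v i • ee i := by
  ext j; simp [Pi.single_apply]

lemma iteratedFDeriv_succ_dd {f : E3 → ℝ} (hf : ContDiff ℝ ∞ f) {m : ℕ} (x : E3) (v : Fin (m + 1) → E3) :
    iteratedFDeriv ℝ (m + 1) f x v =
      ∑ i, v (Fin.last m) i * iteratedFDeriv ℝ m (dd i f) x (Fin.init v) := by
  rw [iteratedFDeriv_succ_apply_right]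
  conv_lhs => rw [eq_sum_ee (v (Fin.last m)), map_sum]
  refine Finset.sum_congr rfl fun i _ => ?_
  rw [map_smul, smul_eq_mul]
  congr 1
  exact (iteratedFDeriv_clm_apply_const_apply (n := ∞)
    (hf.fderiv_right (m := ∞) (by exact_mod_cast le_top)) (by exact_mod_cast le_top)).symm

lemma dpart_snoc {f : E3 → ℝ} (hf : ContDiff ℝ ∞ f) {m : ℕ} (s : Fin m → Fin 3) (i : Fin 3) (x : E3) :
    dpart (Fin.snoc s i : Fin (m + 1) → Fin 3) f x = dpart s (dd i f) x := by
  rw [dpart, iteratedFDeriv_succ_dd hf, Finset.sum_eq_single i]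
  · simp only [Fin.snoc_last, dpart]
    rw [show (ee i) i = 1 by simp, one_mul]
    congr 1
    funext j
    simp [Fin.init]
  · intro j _ hj
    simp [hj]
  · simp

/-- The homogeneous part of degree `m` of the Taylor expansion at `y` (times `m!`). -/
def taylorTerm : ℕ → (E3 → ℝ) → E3 → MvPolynomial (Fin 3) ℝ
  | 0, f, y => MvPolynomial.C (f y)
  | m + 1, f, y => ∑ i, (MvPolynomial.X i - MvPolynomial.C (y i)) * taylorTerm m (dd i f) y

lemma taylorTerm_mem : ∀ (m : ℕ) (f : E3 → ℝ) (y : E3), taylorTerm m f y ∈ Pk m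
  | 0, f, y => by simp [mem_Pk, taylorTerm]
  | m + 1, f, y => by
    refine Submodule.sum_mem _ fun i _ => mem_Pk.2 ?_
    refine (MvPolynomial.totalDegree_mul _ _).trans ?_
    have h1 := mem_Pk.1 (taylorTerm_mem m (dd i f) y)
    have h2 : (MvPolynomial.X i - MvPolynomial.C (y i) : MvPolynomial (Fin 3) ℝ).totalDegree ≤ 1 :=
      (MvPolynomial.totalDegree_sub _ _).trans (by simp)
    omega

lemma pval_taylorTerm : ∀ (m : ℕ) {f : E3 → ℝ} (_ : ContDiff ℝ ∞ f) (y x : E3),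
    pval (taylorTerm m f y) x = iteratedFDeriv ℝ m f y fun _ => x - y
  | 0, f, _, y, x => by simp [taylorTerm]
  | m + 1, f, hf, y, x => by
    rw [iteratedFDeriv_succ_dd hf, taylorTerm, pval_sum]
    refine Finset.sum_congr rfl fun i _ => ?_
    rw [pval_mul, pval_taylorTerm m (ContDiff.dd hf i) y x]
    simp only [pval_sub, pval_X, pval_C]
    rfl

/-- The recursion places one derivative in front; since derivatives commute, differentiating any of
the m + 1 linear factors gives the same term. -/
lemma pderiv_taylorTerm : ∀ (m : ℕ) {f : E3 → ℝ} (_ : ContDiff ℝ ∞ f) (y : E3) (i : Fin 3),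
    MvPolynomial.pderiv i (taylorTerm (m + 1) f y) = ((m + 1 : ℕ) : ℝ) • taylorTerm m (dd i f) y
  | 0, f, _, y, i => by
    simp only [taylorTerm, map_sum, Derivation.leibniz, MvPolynomial.pderiv_C, zero_add, map_sub,
      sub_zero, smul_eq_mul, MvPolynomial.pderiv_X]
    rw [Finset.sum_eq_single i]
    · simp
    · intro j _ hj
      simp [hj]
    · simp
  | m + 1, f, hf, y, i => by
    rw [taylorTerm, map_sum]
    simp only [Derivation.leibniz, map_sub, MvPolynomial.pderiv_C, sub_zero, smul_eq_mul]
    simp only [pderiv_taylorTerm m (ContDiff.dd hf _) y i, Finset.sum_add_distrib]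
    have h1 : ∑ j, taylorTerm (m + 1) (dd j f) y * MvPolynomial.pderiv i (MvPolynomial.X j) =
        taylorTerm (m + 1) (dd i f) y := by
      rw [Finset.sum_eq_single i]
      · simp
      · intro j _ hj
        rw [MvPolynomial.pderiv_X_of_ne hj, mul_zero]
      · simp
    have h2 : ∑ j, (MvPolynomial.X j - MvPolynomial.C (y j)) * ((m + 1 : ℕ) : ℝ) • taylorTerm m (dd i (dd j f)) y =
        ((m + 1 : ℕ) : ℝ) • taylorTerm (m + 1) (dd i f) y := by
      rw [taylorTerm, Finset.smul_sum]
      refine Finset.sum_congr rfl fun j _ => ?_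
      rw [dd_comm hf i j, mul_smul_comm]
    rw [h1, h2, Nat.cast_succ (m + 1), add_smul, one_smul]

/-- The Taylor polynomial of degree `n` of `f` at `y`. -/
def taylorPoly (n : ℕ) (f : E3 → ℝ) (y : E3) : MvPolynomial (Fin 3) ℝ :=
  ∑ m ∈ Finset.range (n + 1), (m.factorial : ℝ)⁻¹ • taylorTerm m f y

lemma Pk_mono {m n : ℕ} (h : m ≤ n) : Pk m ≤ Pk n := fun _ hp => mem_Pk.2 ((mem_Pk.1 hp).trans h)

lemma taylorPoly_mem (n : ℕ) (f : E3 → ℝ) (y : E3) : taylorPoly n f y ∈ Pk n :=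
  Submodule.sum_mem _ fun m hm => Submodule.smul_mem _ _
    (Pk_mono (Nat.lt_succ_iff.1 (Finset.mem_range.1 hm)) (taylorTerm_mem m f y))

/-- The gradient error of a Taylor polynomial is thus a value error for the derivative, with the
degree lowered by one. -/
lemma pgrad_taylorPoly (n : ℕ) {f : E3 → ℝ} (hf : ContDiff ℝ ∞ f) (y : E3) (i : Fin 3) (x : E3) :
    pgrad (taylorPoly (n + 1) f y) i x = pval (taylorPoly n (dd i f) y) x := by
  rw [pgrad]
  congr 1
  rw [taylorPoly, Finset.sum_range_succ', map_add, map_sum, taylorPoly]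
  simp only [Derivation.map_smul, pderiv_taylorTerm _ hf]
  simp only [taylorTerm, MvPolynomial.pderiv_C, smul_zero, add_zero, smul_smul]
  refine Finset.sum_congr rfl fun m _ => ?_
  congr 1
  rw [Nat.factorial_succ]
  push_cast
  have : (m.factorial : ℝ) ≠ 0 := by positivity
  field_simp

lemma sub_pval_taylorPoly (n : ℕ) {f : E3 → ℝ} (hf : ContDiff ℝ ∞ f) (y x : E3) :
    f x - pval (taylorPoly n f y) x = (n.factorial : ℝ)⁻¹ * ∫ t in (0 : ℝ)..1,
      (1 - t) ^ n * iteratedFDeriv ℝ (n + 1) f (y + t • (x - y)) fun _ => x - y := by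
  have h := map_add_eq_sum_add_integral_iteratedFDeriv (f := f) (x := y) (y := x - y) (n := n)
    fun t _ => (hf.of_le (by exact_mod_cast le_top)).contDiffAt
  rw [add_sub_cancel] at h
  rw [h, taylorPoly, pval_sum]
  simp only [pval_smul, pval_taylorTerm _ hf, smul_eq_mul, add_sub_cancel_left]

/-! ### The Taylor remainder in the mean -/

/-- The sum of the absolute values of the derivatives of order `m`. -/
def dabs (m : ℕ) (f : E3 → ℝ) (x : E3) : ℝ := ∑ s : Fin m → Fin 3, |dpart s f x|

/-- The sum of the squares of the derivatives of order `m`. -/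
def dsq (m : ℕ) (f : E3 → ℝ) (x : E3) : ℝ := ∑ s : Fin m → Fin 3, dpart s f x ^ 2

lemma dabs_nonneg (m : ℕ) (f : E3 → ℝ) (x : E3) : 0 ≤ dabs m f x := Finset.sum_nonneg fun _ _ => abs_nonneg _

lemma dsq_nonneg (m : ℕ) (f : E3 → ℝ) (x : E3) : 0 ≤ dsq m f x := Finset.sum_nonneg fun _ _ => sq_nonneg _

lemma continuous_dpart {f : E3 → ℝ} (hf : ContDiff ℝ ∞ f) {m : ℕ} (s : Fin m → Fin 3) :
    Continuous (dpart s f) := (ContDiff.contDiff_dpart hf s).continuous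

lemma continuous_dabs {f : E3 → ℝ} (hf : ContDiff ℝ ∞ f) (m : ℕ) : Continuous (dabs m f) :=
  continuous_finsetSum _ fun s _ => (continuous_dpart hf s).abs

lemma continuous_dsq {f : E3 → ℝ} (hf : ContDiff ℝ ∞ f) (m : ℕ) : Continuous (dsq m f) :=
  continuous_finsetSum _ fun s _ => (continuous_dpart hf s).pow 2

lemma dabs_sq_le (m : ℕ) (f : E3 → ℝ) (x : E3) : dabs m f x ^ 2 ≤ 3 ^ m * dsq m f x := by
  have h := sq_sum_le_card_mul_sum_sq (s := Finset.univ) (f := fun s : Fin m → Fin 3 => |dpart s f x|)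
  simp only [sq_abs, Finset.card_univ, Fintype.card_fun, Fintype.card_fin] at h
  exact_mod_cast h

lemma dsq_dd_le {f : E3 → ℝ} (hf : ContDiff ℝ ∞ f) (m : ℕ) (i : Fin 3) (x : E3) :
    dsq m (dd i f) x ≤ dsq (m + 1) f x := by
  simp only [dsq, ← dpart_snoc hf]
  have hinj : Function.Injective fun s : Fin m → Fin 3 => (Fin.snoc s i : Fin (m + 1) → Fin 3) :=
    fun s s' h => by
      have := congrArg Fin.init h
      simpa using this
  rw [← Finset.sum_image (f := fun s : Fin (m + 1) → Fin 3 => dpart s f x ^ 2) hinj.injOn]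
  exact Finset.sum_le_sum_of_subset_of_nonneg (Finset.subset_univ _) fun _ _ _ => sq_nonneg _

lemma abs_iteratedFDeriv_le (m : ℕ) (f : E3 → ℝ) (x v : E3) :
    |iteratedFDeriv ℝ m f x fun _ => v| ≤ ‖v‖ ^ m * dabs m f x := by
  classical
  have h1 : (fun _ : Fin m => v) = fun _ => ∑ i, v i • ee i := funext fun _ => eq_sum_ee v
  rw [h1, ContinuousMultilinearMap.map_sum, dabs, Finset.mul_sum]
  refine (Finset.abs_sum_le_sum_abs _ _).trans (Finset.sum_le_sum fun s _ => ?_)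
  rw [ContinuousMultilinearMap.map_smul_univ, smul_eq_mul, abs_mul]
  refine mul_le_mul_of_nonneg_right ?_ (abs_nonneg _)
  rw [Finset.abs_prod]
  refine (Finset.prod_le_prod (fun _ _ => abs_nonneg _) fun j _ =>
    (PiLp.norm_apply_le v (s j) : |v (s j)| ≤ ‖v‖)).trans ?_
  simp

/-- Cauchy–Schwarz: the integral of (f - a)² is a nonnegative quadratic in a, so its discriminant is
nonpositive. -/
lemma sq_setIntegral_le {f : E3 → ℝ} (hf : Continuous f) {s : Set E3} (hs : IsCompact s) :
    (∫ x in s, f x) ^ 2 ≤ volume.real s * ∫ x in s, f x ^ 2 := by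
  have h : ∀ a : ℝ, 0 ≤ volume.real s * (a * a) + (-2 * ∫ x in s, f x) * a + ∫ x in s, f x ^ 2 := fun a => by
    have h1 : 0 ≤ ∫ x in s, (f x - a) ^ 2 := integral_nonneg fun _ => sq_nonneg _
    have i1 : IntegrableOn (fun x => f x ^ 2) s := integrableOn_of_continuous (hf.pow 2) hs
    have i2 := (integrableOn_of_continuous hf hs).const_mul (2 * a)
    have i3 := integrableOn_of_continuous (continuous_const (y := a ^ 2)) hs
    have h2 : ∫ x in s, (f x - a) ^ 2 = ∫ x in s, ((f x ^ 2 - 2 * a * f x) + a ^ 2) := by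
      congr 1; funext x; ring
    have h3 := integral_add (i1.sub i2) i3
    simp only [Pi.sub_apply] at h3
    rw [h2, h3, integral_sub i1 i2, integral_const_mul, setIntegral_const, smul_eq_mul] at h1
    linarith
  have := discrim_le_zero h
  rw [discrim] at this
  linarith

/-- y ↦ y + t(x - y) maps the ball onto a ball of radius (1 - t)R contained in it, with Jacobian (1
- t)³. -/
lemma setIntegral_closedBall_contract {g : E3 → ℝ} (hg : Continuous g) (hg0 : ∀ x, 0 ≤ g x) {c x : E3}
    {R : ℝ} (hR : 0 < R) (hx : x ∈ Metric.closedBall c R) {t : ℝ} (ht0 : 0 ≤ t) (ht1 : t < 1) :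
    (1 - t) ^ 3 * ∫ y in Metric.closedBall c R, g (y + t • (x - y)) ≤ ∫ y in Metric.closedBall c R, g y := by
  have h1 : 0 < 1 - t := by linarith
  set c' := c + t • (x - c) with hc'
  have h2 := setIntegral_closedBall_comp_homothety (fun y => g (y + t • (x - y))) c hR
  have h3 := setIntegral_closedBall_comp_homothety g c' (mul_pos h1 hR)
  have h4 : ∀ z : E3, c + R • z + t • (x - (c + R • z)) = c' + ((1 - t) * R) • z := fun z => by
    rw [hc']; module
  simp only [h4] at h2
  rw [← h2, ← mul_assoc, ← mul_pow, h3]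
  refine setIntegral_mono_set (integrableOn_of_continuous hg (isCompact_closedBall _ _))
    (Eventually.of_forall hg0) (Metric.closedBall_subset_closedBall' ?_).eventuallyLE
  rw [Metric.mem_closedBall, dist_eq_norm] at hx
  have h5 : dist c' c = t * ‖x - c‖ := by
    rw [dist_eq_norm, hc', add_sub_cancel_left, norm_smul, Real.norm_of_nonneg ht0]
  rw [h5]
  have := mul_le_mul_of_nonneg_left hx ht0
  linarith

lemma continuous_pval_taylorTerm : ∀ (m : ℕ) {f : E3 → ℝ} (_ : ContDiff ℝ ∞ f) (x : E3),
    Continuous fun y => pval (taylorTerm m f y) x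
  | 0, f, hf, x => by simpa [taylorTerm] using hf.continuous
  | m + 1, f, hf, x => by
    simp only [taylorTerm, pval_sum, pval_mul, pval_sub, pval_X, pval_C]
    exact continuous_finsetSum _ fun i _ => (continuous_const.sub (PiLp.continuous_apply 2 _ i)).mul
      (continuous_pval_taylorTerm m (ContDiff.dd hf i) x)

lemma continuous_pval_taylorPoly (n : ℕ) {f : E3 → ℝ} (hf : ContDiff ℝ ∞ f) (x : E3) :
    Continuous fun y => pval (taylorPoly n f y) x := by
  simp only [taylorPoly, pval_sum, pval_smul]
  exact continuous_finsetSum _ fun i _ => continuous_const.mul (continuous_pval_taylorTerm i hf x)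

lemma integral_one_sub_rpow : IntegrableOn (fun t : ℝ => (1 - t) ^ (-1 / 2 : ℝ)) (Ioc 0 1) ∧
    ∫ t in Ioc (0 : ℝ) 1, (1 - t) ^ (-1 / 2 : ℝ) = 2 := by
  have h1 : IntervalIntegrable (fun t : ℝ => t ^ (-1 / 2 : ℝ)) volume 0 1 :=
    intervalIntegral.intervalIntegrable_rpow' (by norm_num)
  have h2 := h1.comp_sub_left 1
  constructor
  · rw [← intervalIntegrable_iff_integrableOn_Ioc_of_le zero_le_one]
    simpa using h2.symm
  · rw [← intervalIntegral.integral_of_le zero_le_one,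
      intervalIntegral.integral_comp_sub_left (fun t : ℝ => t ^ (-1 / 2 : ℝ)) 1, sub_self, sub_zero,
      integral_rpow (Or.inl (by norm_num))]
    norm_num

/-- The mean over `y` of the Taylor remainder at `x`. -/
lemma taylor_mean {n : ℕ} (hn : 1 ≤ n) {f : E3 → ℝ} (hf : ContDiff ℝ ∞ f) {c x : E3} {R : ℝ} (hR : 0 < R)
    (hx : x ∈ Metric.closedBall c R) :
    ∫ y in Metric.closedBall c R, |f x - pval (taylorPoly n f y) x| ≤
      (2 * R) ^ (n + 1) * (2 * √(volume.real (Metric.closedBall c R) *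
        (3 ^ (n + 1) * ∫ y in Metric.closedBall c R, dsq (n + 1) f y))) := by
  set B := Metric.closedBall c R with hB
  have hBc : IsCompact B := isCompact_closedBall c R
  have hBm : MeasurableSet B := Metric.isClosed_closedBall.measurableSet
  set S := dabs (n + 1) f with hS
  have hSc : Continuous S := continuous_dabs hf _
  set K := √(volume.real B * (3 ^ (n + 1) * ∫ y in B, dsq (n + 1) f y)) with hK
  let G : E3 → ℝ → ℝ := fun y t => (1 - t) ^ n * S (y + t • (x - y))
  have hGc : Continuous (Function.uncurry G) := by
    change Continuous fun p : E3 × ℝ => (1 - p.2) ^ n * S (p.1 + p.2 • (x - p.1))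
    fun_prop
  have hGi : Integrable (Function.uncurry G) ((volume.restrict B).prod (volume.restrict (Ioc (0 : ℝ) 1))) := by
    rw [Measure.prod_restrict]
    exact (hGc.continuousOn.integrableOn_compact (hBc.prod isCompact_Icc)).mono_set
      (prod_mono_right Ioc_subset_Icc_self)
  have hpt : ∀ y ∈ B, |f x - pval (taylorPoly n f y) x| ≤ (2 * R) ^ (n + 1) * ∫ t in Ioc (0 : ℝ) 1, G y t := by
    intro y hy
    have hxy : ‖x - y‖ ≤ 2 * R := by
      rw [← dist_eq_norm]
      rw [hB, Metric.mem_closedBall] at hx hy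
      linarith [dist_triangle_right x y c]
    rw [sub_pval_taylorPoly n hf, abs_mul]
    have h1 : |∫ t in (0 : ℝ)..1, (1 - t) ^ n * iteratedFDeriv ℝ (n + 1) f (y + t • (x - y)) fun _ => x - y| ≤
        ∫ t in (0 : ℝ)..1, (2 * R) ^ (n + 1) * G y t := by
      rw [← Real.norm_eq_abs]
      refine intervalIntegral.norm_integral_le_of_norm_le zero_le_one ?_ ?_
      · refine Eventually.of_forall fun t ht => ?_
        rw [Real.norm_eq_abs, abs_mul, abs_of_nonneg (pow_nonneg (by linarith [ht.2]) n)]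
        have h2 := abs_iteratedFDeriv_le (n + 1) f (y + t • (x - y)) (x - y)
        have h3 : ‖x - y‖ ^ (n + 1) * S (y + t • (x - y)) ≤ (2 * R) ^ (n + 1) * S (y + t • (x - y)) :=
          mul_le_mul_of_nonneg_right (pow_le_pow_left₀ (norm_nonneg _) hxy _) (dabs_nonneg _ _ _)
        have h4 := mul_le_mul_of_nonneg_left (h2.trans h3) (pow_nonneg (by linarith [ht.2] : 0 ≤ 1 - t) n)
        refine h4.trans (le_of_eq ?_)
        simp only [G]; ring
      · have : Continuous fun t => (2 * R) ^ (n + 1) * G y t :=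
          continuous_const.mul (hGc.comp (continuous_const.prodMk continuous_id))
        exact this.intervalIntegrable _ _
    rw [intervalIntegral.integral_const_mul, intervalIntegral.integral_of_le (f := G y) zero_le_one] at h1
    have h5 : |((n.factorial : ℝ)⁻¹)| ≤ 1 := by
      rw [abs_of_nonneg (by positivity)]
      exact inv_le_one_of_one_le₀ (by exact_mod_cast n.factorial_pos)
    calc _ ≤ 1 * _ := mul_le_mul h5 h1 (abs_nonneg _) zero_le_one
      _ = _ := one_mul _
  -- For fixed t, Cauchy–Schwarz and the contraction cost (1 - t)^(-3/2). The weight (1 - t)^n with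
  -- n ≥ 1 leaves the integrable (1 - t)^(-1/2); this is where k ≥ 2 enters for the gradient. The
  -- null set t = 1 is excluded.
  have ht : ∀ t ∈ Ioc (0 : ℝ) 1, t ≠ 1 → ∫ y in B, G y t ≤ K * (1 - t) ^ (-1 / 2 : ℝ) := fun t ht ht1 => by
    have ht' : 0 < 1 - t := by linarith [lt_of_le_of_ne ht.2 ht1]
    have hSt : Continuous fun y => S (y + t • (x - y)) := by fun_prop
    set J := ∫ y in B, S (y + t • (x - y)) with hJ
    have hJ0 : 0 ≤ J := integral_nonneg fun y => dabs_nonneg _ _ _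
    have h1 := sq_setIntegral_le hSt hBc
    have h2 := setIntegral_closedBall_contract (g := fun y => S y ^ 2) (hSc.pow 2) (fun y => sq_nonneg _) hR hx
      ht.1.le (by linarith)
    have h3 : ∫ y in B, S y ^ 2 ≤ 3 ^ (n + 1) * ∫ y in B, dsq (n + 1) f y := by
      rw [← integral_const_mul]
      exact setIntegral_mono (integrableOn_of_continuous (hSc.pow 2) hBc)
        (integrableOn_of_continuous (continuous_const.mul (continuous_dsq hf _)) hBc)
        fun y => dabs_sq_le _ _ _
    have hI0 : 0 ≤ ∫ y in B, dsq (n + 1) f y := integral_nonneg fun y => dsq_nonneg _ _ _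
    have hK2 : K ^ 2 = volume.real B * (3 ^ (n + 1) * ∫ y in B, dsq (n + 1) f y) :=
      Real.sq_sqrt (by positivity)
    have h4 : (1 - t) ^ 3 * J ^ 2 ≤ K ^ 2 := by
      rw [hK2]
      calc (1 - t) ^ 3 * J ^ 2 ≤ (1 - t) ^ 3 * (volume.real B * ∫ y in B, S (y + t • (x - y)) ^ 2) :=
            mul_le_mul_of_nonneg_left h1 (by positivity)
        _ = volume.real B * ((1 - t) ^ 3 * ∫ y in B, S (y + t • (x - y)) ^ 2) := by ring
        _ ≤ _ := mul_le_mul_of_nonneg_left (h2.trans h3) measureReal_nonneg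
    have h5 : ((1 - t) ^ (-1 / 2 : ℝ)) ^ 2 = (1 - t)⁻¹ := by
      rw [← Real.rpow_natCast, ← Real.rpow_mul ht'.le]
      norm_num
      exact Real.rpow_neg_one _
    have h6 : ∫ y in B, G y t = (1 - t) ^ n * J := by
      rw [hJ, ← integral_const_mul]
    rw [h6]
    have h7 : ((1 - t) ^ n * J) ^ 2 ≤ (K * (1 - t) ^ (-1 / 2 : ℝ)) ^ 2 := by
      rw [mul_pow, mul_pow, h5, ← div_eq_mul_inv, le_div_iff₀ ht', ← pow_mul]
      have h8 : (1 - t) ^ (n * 2) ≤ (1 - t) ^ 2 :=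
        pow_le_pow_of_le_one ht'.le (by linarith [ht.1]) (by omega)
      have h9 := mul_le_mul_of_nonneg_right h8 (mul_nonneg (sq_nonneg J) ht'.le)
      linarith
    exact (abs_le_of_sq_le_sq' h7 (mul_nonneg (Real.sqrt_nonneg _) (Real.rpow_nonneg ht'.le _))).2
  have hswap : ∫ y in B, ∫ t in Ioc (0 : ℝ) 1, G y t = ∫ t in Ioc (0 : ℝ) 1, ∫ y in B, G y t :=
    integral_integral_swap hGi
  calc ∫ y in B, |f x - pval (taylorPoly n f y) x|
      ≤ ∫ y in B, (2 * R) ^ (n + 1) * ∫ t in Ioc (0 : ℝ) 1, G y t := by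
        refine setIntegral_mono_on (integrableOn_of_continuous
          (continuous_const.sub (continuous_pval_taylorPoly n hf x)).abs hBc) ?_ hBm hpt
        exact hGi.integral_prod_left.const_mul _
    _ = (2 * R) ^ (n + 1) * ∫ t in Ioc (0 : ℝ) 1, ∫ y in B, G y t := by rw [integral_const_mul, hswap]
    _ ≤ (2 * R) ^ (n + 1) * ∫ t in Ioc (0 : ℝ) 1, K * (1 - t) ^ (-1 / 2 : ℝ) := by
        refine mul_le_mul_of_nonneg_left ?_ (by positivity)
        refine setIntegral_mono_on_ae hGi.integral_prod_right (integral_one_sub_rpow.1.const_mul K)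
          measurableSet_Ioc ?_
        filter_upwards [compl_mem_ae_iff.2 (measure_singleton (1 : ℝ))] with t ht1 htm
        exact ht t htm ht1
    _ = _ := by rw [integral_const_mul, integral_one_sub_rpow.2]; ring

lemma taylor_mean_sq {n : ℕ} (hn : 1 ≤ n) {f : E3 → ℝ} (hf : ContDiff ℝ ∞ f) {c x : E3} {R : ℝ} (hR : 0 < R)
    (hx : x ∈ Metric.closedBall c R) :
    (∫ y in Metric.closedBall c R, |f x - pval (taylorPoly n f y) x|) ^ 2 ≤
      4 * 2 ^ (2 * (n + 1)) * 3 ^ (n + 1) * unitVol * (R ^ (2 * (n + 1)) * R ^ 3) *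
        ∫ y in Metric.closedBall c R, dsq (n + 1) f y := by
  have hI0 : 0 ≤ ∫ y in Metric.closedBall c R, dsq (n + 1) f y := integral_nonneg fun y => dsq_nonneg _ _ _
  have hV := unitVol_pos
  refine (pow_le_pow_left₀ (integral_nonneg fun y => abs_nonneg _) (taylor_mean hn hf hR hx) 2).trans
    (le_of_eq ?_)
  rw [volume_real_closedBall c hR.le, mul_pow, mul_pow 2 √_, Real.sq_sqrt (by positivity)]
  ring

lemma setIntegral_dsq_dd_le {f : E3 → ℝ} (hf : ContDiff ℝ ∞ f) (m : ℕ) (i : Fin 3) (c : E3) (R : ℝ) :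
    ∫ y in Metric.closedBall c R, dsq m (dd i f) y ≤ ∫ y in Metric.closedBall c R, dsq (m + 1) f y :=
  setIntegral_mono (integrableOn_of_continuous (continuous_dsq (ContDiff.dd hf i) _) (isCompact_closedBall _ _))
    (integrableOn_of_continuous (continuous_dsq hf _) (isCompact_closedBall _ _)) fun y => dsq_dd_le hf m i y

/-- For each centre y the Taylor polynomial at y is inserted: its difference with q is in `Pk (n +
1)` and controlled by its values at the points, where q agrees with u. Integration over y then
permits the averaged remainder estimate. -/
lemma abs_dd_sub_interp_mean {n : ℕ} {σ C₁ θ : ℝ}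
    {T : Finset E3} {c : E3} {r : ℝ} {pt : (E3 → ℕ) → E3} (h : LocalNodes (n + 1) σ θ T c r pt) {R : ℝ}
    (H : ∀ p ∈ Pk (n + 1), ∀ i, ∀ x ∈ Metric.closedBall c R,
      |pgrad p i x| * r ≤ C₁ * ∑ a ∈ nodeIdx T (n + 1), |pval p (pt a)|)
    {u : E3 → ℝ} (hu : ContDiff ℝ ∞ u) {q : MvPolynomial (Fin 3) ℝ} (hq : q ∈ Pk (n + 1))
    (hqu : ∀ a ∈ nodeIdx T (n + 1), pval q (pt a) = u (pt a)) {x : E3} (hx : x ∈ Metric.closedBall c R)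
    (i : Fin 3) :
    volume.real (Metric.closedBall c R) * |dd i u x - pgrad q i x| ≤
      (∫ y in Metric.closedBall c R, |dd i u x - pval (taylorPoly n (dd i u) y) x|) +
      C₁ / r * ∑ a ∈ nodeIdx T (n + 1),
        ∫ y in Metric.closedBall c R, |u (pt a) - pval (taylorPoly (n + 1) u y) (pt a)| := by
  have hBc : IsCompact (Metric.closedBall c R) := isCompact_closedBall c R
  have i1 : IntegrableOn (fun y => |dd i u x - pval (taylorPoly n (dd i u) y) x|) (Metric.closedBall c R) :=
    integrableOn_of_continuous (continuous_const.sub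
      (continuous_pval_taylorPoly n (ContDiff.dd hu i) x)).abs hBc
  have i2 : ∀ a ∈ nodeIdx T (n + 1), IntegrableOn
      (fun y => |u (pt a) - pval (taylorPoly (n + 1) u y) (pt a)|) (Metric.closedBall c R) := fun a _ =>
    integrableOn_of_continuous (continuous_const.sub (continuous_pval_taylorPoly (n + 1) hu (pt a))).abs hBc
  rw [← integral_finsetSum _ i2, ← integral_const_mul,
    ← integral_add i1 ((integrable_finsetSum _ i2).const_mul _), ← smul_eq_mul, ← setIntegral_const]
  refine setIntegral_mono (integrableOn_of_continuous continuous_const hBc)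
    (i1.add ((integrable_finsetSum _ i2).const_mul _)) fun y => ?_
  have hr := h.pos
  have h1 := H (taylorPoly (n + 1) u y - q) (Submodule.sub_mem _ (taylorPoly_mem _ _ _) hq) i x hx
  rw [pgrad_sub, pgrad_taylorPoly n hu] at h1
  have h2 : ∑ a ∈ nodeIdx T (n + 1), |pval (taylorPoly (n + 1) u y - q) (pt a)| =
      ∑ a ∈ nodeIdx T (n + 1), |u (pt a) - pval (taylorPoly (n + 1) u y) (pt a)| :=
    Finset.sum_congr rfl fun a ha => by rw [pval_sub, hqu a ha, abs_sub_comm]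
  rw [h2, ← le_div_iff₀ hr, mul_div_right_comm] at h1
  have h3 := abs_add_le (dd i u x - pval (taylorPoly n (dd i u) y) x)
    (pval (taylorPoly n (dd i u) y) x - pgrad q i x)
  rw [sub_add_sub_cancel] at h3
  linarith

/-- The interpolation error of a smooth function. -/
lemma exists_interp_error {k : ℕ} (hk : 1 < k) {σ : ℝ} (hσ : 1 ≤ σ) : ∃ C > 0, ∃ θ₀ > 0,
    ∀ {θ T c r pt}, θ ≤ θ₀ → LocalNodes k σ θ T c r pt → ∀ u : E3 → ℝ, ContDiff ℝ ∞ u → ∀ q ∈ Pk k,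
      (∀ a ∈ nodeIdx T k, pval q (pt a) = u (pt a)) → ∀ x ∈ hull T, ∀ i,
      (dd i u x - pgrad q i x) ^ 2 * r ^ 3 ≤
        C * r ^ (2 * k) * ∫ y in Metric.closedBall c (4 * σ * r), dsq (k + 1) u y := by
  obtain ⟨n, rfl⟩ : ∃ n, k = n + 1 := ⟨k - 1, by omega⟩
  have hn : 1 ≤ n := by omega
  obtain ⟨C₁, hC₁, θ₀, hθ₀, hθ₀1, H⟩ := exists_grad_bound_pts (n + 1) (by omega) hσ
  have hV := unitVol_pos
  set N : ℝ := (Module.finrank ℝ (Pk (n + 1)) : ℝ) with hN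
  set c₁ : ℝ := 4 * 2 ^ (2 * (n + 1)) * 3 ^ (n + 1) * unitVol with hc₁
  set c₂ : ℝ := 4 * 2 ^ (2 * (n + 1 + 1)) * 3 ^ (n + 1 + 1) * unitVol with hc₂
  set M : ℝ := √c₁ + C₁ * (N * (√c₂ * (4 * σ))) with hM
  have hM0 : 0 < M := by positivity
  refine ⟨M ^ 2 * (4 * σ) ^ (2 * (n + 1)) / unitVol ^ 2, by positivity, θ₀, hθ₀,
    fun {θ T c r pt} hθ h u hu q hq hqu x hx i => ?_⟩
  have hr := h.pos
  set R := 4 * σ * r with hR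
  have hR0 : 0 < R := by positivity
  have hrR : r ≤ R := by
    have : 1 * r ≤ 4 * σ * r := mul_le_mul_of_nonneg_right (by linarith) hr.le
    linarith
  set I := ∫ y in Metric.closedBall c R, dsq (n + 1 + 1) u y with hI
  have hI0 : 0 ≤ I := integral_nonneg fun y => dsq_nonneg _ _ _
  have hxB : x ∈ Metric.closedBall c R := h.hull_subset' hσ hx
  set Y := √(R ^ (2 * (n + 1)) * R ^ 3 * I) with hY
  have hY2 : Y ^ 2 = R ^ (2 * (n + 1)) * R ^ 3 * I := Real.sq_sqrt (by positivity)
  have hA0 : ∫ y in Metric.closedBall c R, |dd i u x - pval (taylorPoly n (dd i u) y) x| ≤ √c₁ * Y := by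
    rw [hY, ← Real.sqrt_mul (by positivity)]
    refine Real.le_sqrt_of_sq_le ((taylor_mean_sq hn (ContDiff.dd hu i) hR0 hxB).trans ?_)
    rw [mul_assoc]
    exact mul_le_mul_of_nonneg_left (mul_le_mul_of_nonneg_left (setIntegral_dsq_dd_le hu _ i c R)
      (by positivity)) (by positivity)
  -- The points may lie outside T, but not outside the ball over which the Taylor polynomials are
  -- averaged. The extra factor R compensates 1/r.
  have hAa : ∀ a ∈ nodeIdx T (n + 1), ∫ y in Metric.closedBall c R,
      |u (pt a) - pval (taylorPoly (n + 1) u y) (pt a)| ≤ √c₂ * (R * Y) := fun a ha => by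
    have h1 : R * Y = √(R ^ (2 * (n + 1 + 1)) * R ^ 3 * I) := by
      rw [hY, ← Real.sqrt_sq hR0.le, ← Real.sqrt_mul (sq_nonneg _), Real.sqrt_sq hR0.le]
      congr 1; ring
    rw [h1, ← Real.sqrt_mul (by positivity)]
    refine Real.le_sqrt_of_sq_le ((taylor_mean_sq (by omega) hu hR0
      (h.pt_mem (by omega) (hθ.trans hθ₀1) ha)).trans (le_of_eq ?_))
    rw [hc₂]; ring
  have h1 := abs_dd_sub_interp_mean h (H hθ h · · |>.2) hu hq hqu hxB i
  rw [← hR] at h1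
  have h2 : C₁ / r * ∑ a ∈ nodeIdx T (n + 1), ∫ y in Metric.closedBall c R,
      |u (pt a) - pval (taylorPoly (n + 1) u y) (pt a)| ≤ C₁ * (N * (√c₂ * (4 * σ))) * Y := by
    have h3 := Finset.sum_le_sum hAa
    rw [Finset.sum_const, card_nodeIdx h.isTet (by omega), nsmul_eq_mul] at h3
    refine (mul_le_mul_of_nonneg_left h3 (by positivity)).trans (le_of_eq ?_)
    rw [hR, hN]; field_simp
  rw [volume_real_closedBall c hR0.le] at h1
  set e := |dd i u x - pgrad q i x| with he
  have h3 : R ^ 3 * unitVol * e ≤ M * Y := by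
    rw [hM, add_mul]; linarith
  have h4 := pow_le_pow_left₀ (by positivity) h3 2
  rw [mul_pow M, hY2] at h4
  have h5 : e ^ 2 * R ^ 3 ≤ M ^ 2 * (4 * σ) ^ (2 * (n + 1)) / unitVol ^ 2 * r ^ (2 * (n + 1)) * I := by
    have h6 : R ^ 3 * (unitVol ^ 2 * (e ^ 2 * R ^ 3)) ≤ R ^ 3 * (M ^ 2 * (R ^ (2 * (n + 1)) * I)) := by
      linarith
    have h7 := le_of_mul_le_mul_left h6 (by positivity)
    rw [div_mul_eq_mul_div, div_mul_eq_mul_div, le_div_iff₀ (by positivity)]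
    have h8 : R ^ (2 * (n + 1)) = (4 * σ) ^ (2 * (n + 1)) * r ^ (2 * (n + 1)) := by rw [hR, mul_pow]
    rw [h8] at h7
    linarith
  rw [← sq_abs]
  exact (mul_le_mul_of_nonneg_left (pow_le_pow_left₀ hr.le hrR 3) (sq_nonneg _)).trans h5

lemma setIntegral_dabs_le {f : E3 → ℝ} (hf : ContDiff ℝ ∞ f) (m : ℕ) (c : E3) (R : ℝ) :
    ∫ y in Metric.closedBall c R, dabs m f y ≤
      √(volume.real (Metric.closedBall c R) * (3 ^ m * ∫ y in Metric.closedBall c R, dsq m f y)) := by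
  have hBc := isCompact_closedBall c R
  refine Real.le_sqrt_of_sq_le ((sq_setIntegral_le (continuous_dabs hf m) hBc).trans
    (mul_le_mul_of_nonneg_left ?_ measureReal_nonneg))
  rw [← integral_const_mul]
  exact setIntegral_mono (integrableOn_of_continuous ((continuous_dabs hf m).pow 2) hBc)
    (integrableOn_of_continuous (continuous_const.mul (continuous_dsq hf _)) hBc)
    fun y => dabs_sq_le _ _ _

/-- A uniform bound of the gradient by the derivatives of order at most three. -/
lemma exists_grad_bound {R : ℝ} (hR : 0 < R) (M : ℝ) : ∃ L, ∀ u : E3 → ℝ, ContDiff ℝ ∞ u → ∀ c,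
    (∀ m, m ≤ 3 → ∫ y in Metric.closedBall c R, dsq m u y ≤ M) →
      ∀ x ∈ Metric.closedBall c R, ∀ i, |dd i u x| ≤ L := by
  set V := R ^ 3 * unitVol with hV
  have hV0 : 0 < V := by have := unitVol_pos; positivity
  refine ⟨((2 * R) ^ (1 + 1) * (2 * √(V * (3 ^ (1 + 1) * M))) + √(V * (3 ^ 0 * M)) +
    2 * R * √(V * (3 ^ 1 * M))) / V, fun u hu c hM x hx i => ?_⟩
  have hBc := isCompact_closedBall c R
  -- The Taylor polynomial of degree one is used for w = ∂_i u, so derivatives of u up to order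
  -- three suffice.
  set w := dd i u with hw
  have hwc : ContDiff ℝ ∞ w := ContDiff.dd hu i
  have hVe : volume.real (Metric.closedBall c R) = V := volume_real_closedBall c hR.le
  have hm : ∀ m, m ≤ 2 → ∫ y in Metric.closedBall c R, dsq m w y ≤ M := fun m hm =>
    (setIntegral_dsq_dd_le hu m i c R).trans (hM _ (by omega))
  have h1 := taylor_mean le_rfl hwc hR hx
  have h2 := setIntegral_dabs_le hwc 0 c R
  have h3 := setIntegral_dabs_le hwc 1 c R
  have hmono : ∀ m ≤ 2, √(volume.real (Metric.closedBall c R) *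
      (3 ^ m * ∫ y in Metric.closedBall c R, dsq m w y)) ≤ √(V * (3 ^ m * M)) := fun m hm' => by
    rw [hVe]
    exact Real.sqrt_le_sqrt (mul_le_mul_of_nonneg_left (mul_le_mul_of_nonneg_left (hm m hm')
      (by positivity)) hV0.le)
  have h4 : V * |w x| ≤ (∫ y in Metric.closedBall c R, |w x - pval (taylorPoly 1 w y) x|) +
      (∫ y in Metric.closedBall c R, dabs 0 w y) + 2 * R * ∫ y in Metric.closedBall c R, dabs 1 w y := by
    have i1 : IntegrableOn (fun y => |w x - pval (taylorPoly 1 w y) x|) (Metric.closedBall c R) :=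
      integrableOn_of_continuous (continuous_const.sub (continuous_pval_taylorPoly 1 hwc x)).abs hBc
    have i2 : IntegrableOn (dabs 0 w) (Metric.closedBall c R) :=
      integrableOn_of_continuous (continuous_dabs hwc 0) hBc
    have i3 : IntegrableOn (fun y => 2 * R * dabs 1 w y) (Metric.closedBall c R) :=
      (integrableOn_of_continuous (continuous_dabs hwc 1) hBc).const_mul _
    rw [← integral_const_mul, ← integral_add i1 i2]
    have h5 := integral_add (i1.add i2) i3
    simp only [Pi.add_apply] at h5
    rw [← h5, ← hVe, ← smul_eq_mul, ← setIntegral_const]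
    refine setIntegral_mono_on (integrableOn_of_continuous continuous_const hBc) ((i1.add i2).add i3)
      Metric.isClosed_closedBall.measurableSet fun y hy => ?_
    have hxy : ‖x - y‖ ≤ 2 * R := by
      rw [← dist_eq_norm]
      rw [Metric.mem_closedBall] at hx hy
      linarith [dist_triangle_right x y c]
    have h6 : |pval (taylorPoly 1 w y) x| ≤ dabs 0 w y + 2 * R * dabs 1 w y := by
      have h7 := abs_iteratedFDeriv_le 0 w y (x - y)
      have h8 := abs_iteratedFDeriv_le 1 w y (x - y)
      simp only [taylorPoly, Finset.sum_range_succ, Finset.range_zero, Finset.sum_empty, zero_add, pval_add,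
        pval_smul, Nat.factorial, Nat.cast_one, inv_one, one_mul, mul_one, pval_taylorTerm _ hwc]
      rw [pow_zero, one_mul] at h7
      rw [pow_one] at h8
      have h9 := mul_le_mul_of_nonneg_right hxy (dabs_nonneg 1 w y)
      exact (abs_add_le _ _).trans (by linarith)
    have h10 := abs_add_le (w x - pval (taylorPoly 1 w y) x) (pval (taylorPoly 1 w y) x)
    rw [sub_add_cancel] at h10
    linarith
  rw [le_div_iff₀ hV0, mul_comm]
  have h5 : (2 * R) ^ (1 + 1) * (2 * √(volume.real (Metric.closedBall c R) *
      (3 ^ (1 + 1) * ∫ y in Metric.closedBall c R, dsq (1 + 1) w y))) ≤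
      (2 * R) ^ (1 + 1) * (2 * √(V * (3 ^ (1 + 1) * M))) :=
    mul_le_mul_of_nonneg_left (mul_le_mul_of_nonneg_left (hmono 2 le_rfl) zero_le_two) (by positivity)
  have h6 : 2 * R * (∫ y in Metric.closedBall c R, dabs 1 w y) ≤ 2 * R * √(V * (3 ^ 1 * M)) :=
    mul_le_mul_of_nonneg_left (h3.trans (hmono 1 (by norm_num))) (by positivity)
  linarith [h1.trans h5, h2.trans (hmono 0 (by norm_num))]

/-! ### Traces -/

lemma exists_abs_coord_ge {n : E3} (hn : ‖n‖ = 1) : ∃ j, 1 / 2 ≤ |n j| := by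
  by_contra! h
  have h1 : ‖n‖ ^ 2 = ∑ i, n i ^ 2 := by
    rw [EuclideanSpace.norm_sq_eq]; simp
  rw [hn, Fin.sum_univ_three] at h1
  have h2 : ∀ i, n i ^ 2 ≤ (1 / 2) ^ 2 := fun i => by
    rw [← sq_abs]; exact pow_le_pow_left₀ (abs_nonneg _) (h i).le 2
  linarith [h2 0, h2 1, h2 2]

/-- A piece of the boundary of a `C¹` domain has positive surface measure. -/
lemma hausdorffMeasure_frontier_pos {Ω : Set E3} (hΩ : IsC1Domain Ω) {y₀ : E3} (hy₀ : y₀ ∈ frontier Ω)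
    {ρ : ℝ} (hρ : 0 < ρ) : Measure.hausdorffMeasure (X := E3) 2 (frontier Ω ∩ Metric.ball y₀ ρ) ≠ 0 := by
  obtain ⟨r₀, hr₀, hflat⟩ := exists_flatAt hΩ (ε := 1 / 8) (by norm_num)
  obtain ⟨n, hn⟩ := hflat y₀ hy₀
  obtain ⟨j, hj⟩ := exists_abs_coord_ge hn.norm_eq
  obtain ⟨s, hs, hsr, hsρ⟩ : ∃ s > 0, 6 * s ≤ r₀ ∧ 6 * s ≤ ρ :=
    ⟨min r₀ ρ / 6, by positivity, by linarith [min_le_left r₀ ρ], by linarith [min_le_right r₀ ρ]⟩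
  -- π drops a coordinate along which the normal is at least 1/2. Lines in that direction near y₀
  -- meet Γ, so the 1-Lipschitz image of the piece of Γ contains a square of positive area.
  let π : E3 → Fin 2 → ℝ := fun x i => x (j.succAbove i)
  have hπ : LipschitzWith 1 π := by
    refine LipschitzWith.of_dist_le_mul fun x y => ?_
    rw [NNReal.coe_one, one_mul]
    refine (dist_pi_le_iff dist_nonneg).2 fun i => ?_
    have := PiLp.norm_apply_le (x - y) (j.succAbove i)
    rw [dist_eq_norm x y, Real.dist_eq]
    exact this
  have hsub : Metric.ball (π y₀) (s / 2) ⊆ π '' (frontier Ω ∩ Metric.ball y₀ ρ) := fun p hp => by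
    let M : E3 := WithLp.toLp 2 (j.insertNth (y₀ j) p : Fin 3 → ℝ)
    have hMj : M j = y₀ j := by simp [M]
    have hMi : ∀ i, M (j.succAbove i) = p i := fun i => by simp [M]
    have hMa : ‖M - y₀‖ ≤ s := by
      refine abs_le_of_sq_le_sq' ?_ hs.le |>.2
      rw [EuclideanSpace.norm_sq_eq, Fin.sum_univ_succAbove _ j, Fin.sum_univ_two]
      have h1 : ∀ i, ‖(M - y₀) (j.succAbove i)‖ ^ 2 ≤ (s / 2) ^ 2 := fun i => by
        refine pow_le_pow_left₀ (norm_nonneg _) ?_ 2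
        rw [PiLp.sub_apply, hMi]
        exact (dist_le_pi_dist p (π y₀) i).trans (Metric.mem_ball.1 hp).le
      have h2 : ‖(M - y₀) j‖ = 0 := by rw [PiLp.sub_apply, hMj, sub_self, norm_zero]
      rw [h2]
      have h3 := h1 0
      have h4 := h1 1
      nlinarith
    have hnj : |inner ℝ n (ee j)| = |n j| := by
      rw [EuclideanSpace.inner_single_right]; simp
    have hin : |inner ℝ n (M - y₀)| ≤ s := by
      have := abs_real_inner_le_norm n (M - y₀)
      rw [hn.norm_eq, one_mul] at this
      exact this.trans hMa
    have hdM : dist M y₀ ≤ s := by rwa [dist_eq_norm]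
    obtain ⟨P, hP, hMP, hPn⟩ := hn.exists_nearest hΩ.isOpen (A := {x | ∃ t : ℝ, x = M + t • ee j})
      (M := M) (d := ee j) (a := y₀) (κ := 1 / 2) (η := s) (τ := 4 * s) (fun x => Iff.rfl) (by simp) hy₀
      (Metric.mem_ball_self hr₀) hin (by rw [hnj]; exact hj) (by norm_num) (by norm_num)
      (by linarith) (by linarith) (by linarith)
    have hPA := ((hPn P).2 rfl).1.2
    refine ⟨P, ⟨hP, ?_⟩, ?_⟩
    · rw [Metric.mem_ball]
      linarith [dist_triangle_left P y₀ M]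
    · obtain ⟨t, rfl⟩ := hPA
      funext i
      simp only [π, PiLp.add_apply, PiLp.smul_apply, hMi]
      simp
  intro h0
  have h1 := hπ.hausdorffMeasure_image_le (d := 2) (by norm_num) (frontier Ω ∩ Metric.ball y₀ ρ)
  rw [h0, mul_zero] at h1
  have h2 := (measure_mono hsub).trans h1
  have h3 : (Measure.hausdorffMeasure 2 : Measure (Fin 2 → ℝ)) = volume := by
    have := hausdorffMeasure_pi_real (ι := Fin 2)
    simpa using this
  rw [h3] at h2
  exact absurd h2 (not_le.2 (Metric.measure_ball_pos _ _ (by positivity)))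

/-- Continuous representatives attain their traces. -/
lemma eq_of_hasTrace {Ω Ω' V : Set E3} (hΩ : IsC1Domain Ω) (hV : IsOpen V) (hΓV : frontier Ω ⊆ V)
    (hVΩ' : V ⊆ Ω') {u v g : E3 → ℝ} (hg : ContinuousOn g (frontier Ω)) (hv : ContinuousOn v V)
    (huv : ∀ᵐ x ∂volume.restrict V, u x = v x) (h : HasTrace Ω' (frontier Ω) u g) :
    ∀ y ∈ frontier Ω, v y = g y := by
  -- Near y the function u is a.e. equal to the continuous v, so the means of |u - g y| cannot tend
  -- to 0 unless v y = g y.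
  have hae : ∀ᵐ y ∂((Measure.hausdorffMeasure 2 : Measure E3).restrict (frontier Ω)), v y = g y := by
    rw [ae_restrict_iff' isClosed_frontier.measurableSet]
    have h' := (ae_restrict_iff' isClosed_frontier.measurableSet).1 h
    filter_upwards [h'] with y hy hyΓ
    have hyV := hΓV hyΓ
    have hc : ContinuousAt v y := hv.continuousAt (hV.mem_nhds hyV)
    have hlim := hy hyΓ
    by_contra hne
    set e := |v y - g y| with he
    have he0 : 0 < e := abs_pos.2 (sub_ne_zero.2 hne)
    obtain ⟨d, hd, hdV⟩ := Metric.isOpen_iff.1 hV y hyV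
    obtain ⟨d', hd', hdv⟩ := Metric.continuousAt_iff.1 hc (e / 2) (by positivity)
    have hev : ∀ᶠ r in 𝓝[>] (0 : ℝ), e / 2 ≤ ⨍ x in Metric.ball y r ∩ Ω', |u x - g y| := by
      filter_upwards [Ioo_mem_nhdsGT (lt_min hd hd')] with r hr
      have hrV : Metric.ball y r ⊆ V :=
        (Metric.ball_subset_ball (hr.2.le.trans (min_le_left _ _))).trans hdV
      rw [inter_eq_left.2 (hrV.trans hVΩ')]
      have hlow : ∀ x ∈ Metric.ball y r, e / 2 ≤ |v x - g y| := fun x hx => by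
        have h1 := hdv ((Metric.mem_ball.1 hx).trans_le (hr.2.le.trans (min_le_right _ _)))
        rw [Real.dist_eq] at h1
        have h2 := abs_sub_abs_le_abs_sub (v y - g y) (v x - g y)
        rw [sub_sub_sub_cancel_right] at h2
        rw [abs_sub_comm (v x)] at h1
        linarith
      have hup : ∀ x ∈ Metric.ball y r, |v x - g y| ≤ e + e / 2 := fun x hx => by
        have h1 := hdv ((Metric.mem_ball.1 hx).trans_le (hr.2.le.trans (min_le_right _ _)))
        rw [Real.dist_eq] at h1
        have h2 := abs_add_le (v x - v y) (v y - g y)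
        rw [sub_add_sub_cancel] at h2
        linarith
      have heq : ⨍ x in Metric.ball y r, |u x - g y| = ⨍ x in Metric.ball y r, |v x - g y| := by
        refine average_congr ?_
        filter_upwards [ae_restrict_of_ae_restrict_of_subset hrV huv] with x hx
        rw [hx]
      have hpos : 0 < volume.real (Metric.ball y r) :=
        ENNReal.toReal_pos (Metric.measure_ball_pos _ _ hr.1).ne' measure_ball_lt_top.ne
      rw [heq, setAverage_eq, smul_eq_mul, ← div_eq_inv_mul, le_div_iff₀ hpos, mul_comm, ← smul_eq_mul,
        ← setIntegral_const]
      refine setIntegral_mono_on (integrableOn_const measure_ball_lt_top.ne) ?_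
        Metric.isOpen_ball.measurableSet hlow
      have : IsFiniteMeasure (volume.restrict (Metric.ball y r)) :=
        isFiniteMeasure_restrict.2 measure_ball_lt_top.ne
      refine Integrable.of_bound ?_ (e + e / 2) ?_
      · exact ((hv.mono hrV).sub continuousOn_const).abs.aestronglyMeasurable Metric.isOpen_ball.measurableSet
      · refine (ae_restrict_iff' Metric.isOpen_ball.measurableSet).2 (Eventually.of_forall fun x hx => ?_)
        rw [Real.norm_eq_abs, abs_abs]
        exact hup x hx
    have := ge_of_tendsto hlim hev
    linarith
  -- The set where v ≠ g is relatively open in Γ; if nonempty, it would have positive measure.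
  intro y₀ hy₀
  by_contra hne
  have hcont : ContinuousWithinAt (fun y => v y - g y) (frontier Ω) y₀ :=
    ((hv.mono hΓV).sub hg) y₀ hy₀
  have hev := hcont.eventually_ne (sub_ne_zero.2 hne)
  obtain ⟨ρ, hρ, hρs⟩ := Metric.mem_nhdsWithin_iff.1 hev
  refine hausdorffMeasure_frontier_pos hΩ hy₀ hρ ?_
  rw [ae_restrict_iff' isClosed_frontier.measurableSet, ae_iff] at hae
  refine measure_mono_null (fun y hy => ?_) hae
  simp only [mem_ofPred_eq]
  push Not
  exact ⟨hy.1, fun h => hρs ⟨hy.2, hy.1⟩ (sub_eq_zero.2 h)⟩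

/-! ### Smooth approximation of Sobolev functions -/

section Approx

variable {m : ℕ} {D : Set E3} {u : E3 → ℝ}

lemma MemSobolev.hasWeakDeriv (hu : MemSobolev m D u) {j : ℕ} (hj : j ≤ m) (s : Fin j → Fin 3) :
    HasWeakDeriv D s u (weakDeriv D s u) := by
  have h := hu.2 j hj s
  rw [weakDeriv, dif_pos h]
  exact h.choose_spec

/-- The sum of the squares of the weak derivatives of order `m`. -/
def wsq (m : ℕ) (D : Set E3) (u : E3 → ℝ) (x : E3) : ℝ := ∑ s : Fin m → Fin 3, weakDeriv D s u x ^ 2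

lemma wsq_nonneg (m : ℕ) (D : Set E3) (u : E3 → ℝ) (x : E3) : 0 ≤ wsq m D u x :=
  Finset.sum_nonneg fun _ _ => sq_nonneg _

lemma MemSobolev.integrableOn_sq (hu : MemSobolev m D u) {j : ℕ} (hj : j ≤ m) (s : Fin j → Fin 3) :
    IntegrableOn (fun x => weakDeriv D s u x ^ 2) D := (hu.hasWeakDeriv hj s).1.integrable_sq

lemma MemSobolev.integrableOn_wsq (hu : MemSobolev m D u) {j : ℕ} (hj : j ≤ m) : IntegrableOn (wsq j D u) D :=
  integrable_finsetSum _ fun s _ => hu.integrableOn_sq hj s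

lemma MemSobolev.sq_sobolevSeminorm (hu : MemSobolev m D u) :
    sobolevSeminorm m D u ^ 2 = ∫ x in D, wsq m D u x := by
  rw [sobolevSeminorm, Real.sq_sqrt (Finset.sum_nonneg fun _ _ => integral_nonneg fun _ => sq_nonneg _)]
  exact (integral_finsetSum _ fun s _ => hu.integrableOn_sq le_rfl s).symm

/-- Mollification of a function on `D`, extended by zero. -/
def approx (D : Set E3) (u : E3 → ℝ) (n : ℕ) : E3 → ℝ := moll n (D.indicator u)

lemma dd_eq_dpart {f : E3 → ℝ} (i : Fin 3) (x : E3) : dd i f x = dpart (fun _ : Fin 1 => i) f x := by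
  rw [dpart, iteratedFDeriv_one_apply, dd]

lemma eventually_closedBall_subset (hD : IsOpen D) {x : E3} (hx : x ∈ D) :
    ∀ᶠ n in atTop, Metric.closedBall x (mrad n) ⊆ D := by
  obtain ⟨r, hr, hB⟩ := Metric.nhds_basis_closedBall.mem_iff.1 (hD.mem_nhds hx)
  filter_upwards [tendsto_mrad.eventually (ge_mem_nhds hr)] with n hn
  exact (Metric.closedBall_subset_closedBall hn).trans hB

variable (hD : IsOpen D)
include hD

lemma memLp_indicator {v : E3 → ℝ} (hv : MemLp v 2 (volume.restrict D)) : MemLp (D.indicator v) 2 :=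
  (memLp_indicator_iff_restrict hD.measurableSet).2 hv

lemma locallyIntegrable_indicator {v : E3 → ℝ} (hv : MemLp v 2 (volume.restrict D)) :
    LocallyIntegrable (D.indicator v) := (memLp_indicator hD hv).locallyIntegrable (by norm_num)

lemma contDiff_approx (hu : MemSobolev m D u) (n : ℕ) : ContDiff ℝ ∞ (approx D u n) :=
  contDiff_moll n (locallyIntegrable_indicator hD hu.1)

lemma dpart_approx (hu : MemSobolev m D u) {j : ℕ} (hj : j ≤ m) (s : Fin j → Fin 3) {n : ℕ} {x : E3}
    (hx : Metric.closedBall x (mrad n) ⊆ D) :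
    dpart s (approx D u n) x = moll n (D.indicator (weakDeriv D s u)) x :=
  dpart_moll hD.measurableSet (locallyIntegrable_indicator hD hu.1) (hu.hasWeakDeriv hj s) hx

lemma setIntegral_dsq_approx_le (hu : MemSobolev m D u) {j : ℕ} (hj : j ≤ m) {c : E3} {R d : ℝ} {n : ℕ}
    (hn : mrad n ≤ d) (hB : Metric.closedBall c (R + d) ⊆ D) :
    ∫ x in Metric.closedBall c R, dsq j (approx D u n) x ≤
      ∫ x in Metric.closedBall c (R + d), wsq j D u x := by
  have hsmooth := contDiff_approx hD hu n
  have hcB := isCompact_closedBall c R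
  simp only [dsq, wsq]
  have i1 : ∀ s : Fin j → Fin 3, IntegrableOn (fun x => dpart s (approx D u n) x ^ 2) (Metric.closedBall c R) :=
    fun s => integrableOn_of_continuous ((continuous_dpart hsmooth s).pow 2) hcB
  rw [integral_finsetSum _ fun s _ => i1 s,
    integral_finsetSum _ fun s _ => (hu.integrableOn_sq hj s).mono_set hB]
  refine Finset.sum_le_sum fun s _ => ?_
  have h1 := setIntegral_moll_sq_le (memLp_indicator hD (hu.hasWeakDeriv hj s).1) (c := c) (R := R) hn
  have h2 : ∫ x in Metric.closedBall c R, dpart s (approx D u n) x ^ 2 =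
      ∫ x in Metric.closedBall c R, moll n (D.indicator (weakDeriv D s u)) x ^ 2 :=
    setIntegral_congr_fun Metric.isClosed_closedBall.measurableSet fun x hx => by
      rw [dpart_approx hD hu hj s]
      refine (Metric.closedBall_subset_closedBall' ?_).trans hB
      rw [Metric.mem_closedBall] at hx
      linarith
  have h3 : ∫ x in Metric.closedBall c (R + d), D.indicator (weakDeriv D s u) x ^ 2 =
      ∫ x in Metric.closedBall c (R + d), weakDeriv D s u x ^ 2 :=
    setIntegral_congr_fun Metric.isClosed_closedBall.measurableSet fun x hx => by
      rw [indicator_of_mem (hB hx)]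
  rwa [h2, ← h3]

lemma ae_tendsto_approx (hu : MemSobolev m D u) :
    ∀ᵐ x, x ∈ D → Tendsto (fun n => approx D u n x) atTop (𝓝 (u x)) := by
  filter_upwards [ae_tendsto_moll (locallyIntegrable_indicator hD hu.1)] with x hx hxD
  rw [indicator_of_mem hxD] at hx
  exact hx

lemma ae_tendsto_dd_approx (hu : MemSobolev m D u) (hm : 1 ≤ m) (i : Fin 3) :
    ∀ᵐ x, x ∈ D → Tendsto (fun n => dd i (approx D u n) x) atTop
      (𝓝 (weakDeriv D (fun _ : Fin 1 => i) u x)) := by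
  filter_upwards [ae_tendsto_moll (locallyIntegrable_indicator hD
    (hu.hasWeakDeriv hm fun _ : Fin 1 => i).1)] with x hx hxD
  rw [indicator_of_mem hxD] at hx
  refine hx.congr' ?_
  filter_upwards [eventually_closedBall_subset hD hxD] with n hn
  rw [dd_eq_dpart, dpart_approx hD hu hm _ hn]

end Approx

lemma norm_fderiv_le_of_dd {f : E3 → ℝ} {x : E3} {K : ℝ} (hK : ∀ i, |dd i f x| ≤ K) :
    ‖fderiv ℝ f x‖ ≤ 3 * K := by
  have hK0 : 0 ≤ K := (abs_nonneg _).trans (hK 0)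
  refine ContinuousLinearMap.opNorm_le_bound _ (by positivity) fun v => ?_
  conv_lhs => rw [eq_sum_ee v, map_sum]
  have h : ∀ i ∈ Finset.univ, ‖fderiv ℝ f x (v i • ee i)‖ ≤ K * ‖v‖ := fun i _ => by
    rw [map_smul, norm_smul, mul_comm]
    exact mul_le_mul (hK i) (PiLp.norm_apply_le v i) (norm_nonneg _) hK0
  refine (norm_sum_le_of_le _ h).trans ?_
  rw [Finset.sum_const, Finset.card_univ, Fintype.card_fin, nsmul_eq_mul]
  push_cast
  linarith

/-- Functions in `H³` are continuous, and the smooth approximations converge at every point. -/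
lemma exists_continuous_rep {m : ℕ} (hm : 3 ≤ m) {D K : Set E3} {u : E3 → ℝ} (hD : IsOpen D)
    (hu : MemSobolev m D u) {d : ℝ} (hd : 0 < d) (hK : ∀ x ∈ K, Metric.closedBall x (2 * d) ⊆ D) :
    ∃ v : E3 → ℝ, ContinuousOn v (Metric.thickening d K) ∧
      ∀ x ∈ Metric.thickening d K, Tendsto (fun n => approx D u n x) atTop (𝓝 (v x)) := by
  -- The L² norms on D of the derivatives of orders 0 to 3 bound those of all fine mollifications on
  -- balls of radius d, which are therefore equi-Lipschitz there.
  obtain ⟨L, hL⟩ := exists_grad_bound hd (∑ j ∈ Finset.range 4, ∫ x in D, wsq j D u x)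
  have hlip : ∀ x₀ ∈ K, ∀ n, mrad n ≤ d → ∀ x ∈ Metric.closedBall x₀ d, ∀ y ∈ Metric.closedBall x₀ d,
      |approx D u n x - approx D u n y| ≤ 3 * L * dist x y := fun x₀ hx₀ n hn x hx y hy => by
    have hB : Metric.closedBall x₀ (d + d) ⊆ D := by rw [← two_mul]; exact hK x₀ hx₀
    have h1 : ∀ z ∈ Metric.closedBall x₀ d, ∀ i, |dd i (approx D u n) z| ≤ L :=
      hL _ (contDiff_approx hD hu n) x₀ fun j hj => by
        refine (setIntegral_dsq_approx_le hD hu (hj.trans hm) hn hB).trans ?_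
        refine (setIntegral_mono_set (hu.integrableOn_wsq (hj.trans hm))
          (Eventually.of_forall fun x => wsq_nonneg _ _ _ _) hB.eventuallyLE).trans ?_
        exact Finset.single_le_sum (f := fun j => ∫ x in D, wsq j D u x)
          (fun j _ => integral_nonneg fun x => wsq_nonneg _ _ _ _) (Finset.mem_range.2 (by omega))
    rw [dist_eq_norm]
    exact (convex_closedBall x₀ d).norm_image_sub_le_of_norm_fderiv_le
      (fun z _ => (contDiff_approx hD hu n).differentiable (by simp) z)
      (fun z hz => norm_fderiv_le_of_dd (h1 z hz)) hy hx
  have hev : ∀ᶠ n in atTop, mrad n ≤ d := tendsto_mrad.eventually (ge_mem_nhds hd)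
  have hL0 : ∀ x₀ ∈ K, 0 ≤ L := fun x₀ hx₀ => by
    obtain ⟨n, hn⟩ := hev.exists
    have hx : x₀ + d • ee 0 ∈ Metric.closedBall x₀ d := by
      rw [Metric.mem_closedBall, dist_eq_norm, add_sub_cancel_left, norm_smul]
      simp [abs_of_pos hd]
    have h1 := hlip x₀ hx₀ n hn x₀ (Metric.mem_closedBall_self hd.le) _ hx
    have h2 : dist x₀ (x₀ + d • ee 0) = d := by
      rw [dist_eq_norm, sub_add_cancel_left, norm_neg, norm_smul]
      simp [abs_of_pos hd]
    rw [h2] at h1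
    have h3 := (abs_nonneg _).trans h1
    have h4 : 0 ≤ 3 * L := nonneg_of_mul_nonneg_left h3 hd
    linarith
  -- Convergence holds at almost every point, hence on a dense set, and equicontinuity extends it to
  -- every point.
  have hconv : ∀ x ∈ Metric.thickening d K, ∃ a, Tendsto (fun n => approx D u n x) atTop (𝓝 a) := fun x hx => by
    obtain ⟨x₀, hx₀, hxx₀⟩ := Metric.mem_thickening_iff.1 hx
    refine cauchySeq_tendsto_of_complete (Metric.cauchySeq_iff.2 fun ε hε => ?_)
    have hL0' := hL0 x₀ hx₀
    obtain ⟨η, hη, hηL⟩ : ∃ η > 0, 3 * L * η ≤ ε / 4 := by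
      refine ⟨ε / 4 / (3 * L + 1), by positivity, ?_⟩
      rw [mul_div_assoc', div_le_iff₀ (by positivity)]
      have : 0 ≤ ε / 4 := by positivity
      linarith
    obtain ⟨y, hyt, hy⟩ := (Measure.dense_of_ae (ae_tendsto_approx hD hu)).exists_mem_open
      (Metric.isOpen_ball.inter Metric.isOpen_ball : IsOpen (Metric.ball x₀ d ∩ Metric.ball x η))
      ⟨x, hxx₀, Metric.mem_ball_self hη⟩
    have hyD : y ∈ D := hK x₀ hx₀ (Metric.closedBall_subset_closedBall (by linarith)
      (Metric.ball_subset_closedBall hy.1))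
    obtain ⟨N₁, hN₁⟩ := Metric.cauchySeq_iff.1 (hyt hyD).cauchySeq (ε / 4) (by positivity)
    obtain ⟨N₂, hN₂⟩ := eventually_atTop.1 hev
    refine ⟨max N₁ N₂, fun p hp q hq => ?_⟩
    have hd1 : 3 * L * dist x y ≤ ε / 4 := by
      have := mul_le_mul_of_nonneg_left (Metric.mem_ball'.1 hy.2).le (by positivity : 0 ≤ 3 * L)
      linarith
    have h1 := hlip x₀ hx₀ p (hN₂ p ((le_max_right _ _).trans hp)) x (Metric.ball_subset_closedBall hxx₀) y
      (Metric.ball_subset_closedBall hy.1)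
    have h2 := hlip x₀ hx₀ q (hN₂ q ((le_max_right _ _).trans hq)) x (Metric.ball_subset_closedBall hxx₀) y
      (Metric.ball_subset_closedBall hy.1)
    have h3 := hN₁ p ((le_max_left _ _).trans hp) q ((le_max_left _ _).trans hq)
    rw [← Real.dist_eq] at h1 h2
    have h4 := dist_triangle4 (approx D u p x) (approx D u p y) (approx D u q y) (approx D u q x)
    rw [dist_comm (approx D u q x)] at h2
    linarith
  choose! v hv using hconv
  refine ⟨v, fun x hx => ?_, hv⟩
  obtain ⟨x₀, hx₀, hxx₀⟩ := Metric.mem_thickening_iff.1 hx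
  have hlipv : LipschitzOnWith (Real.toNNReal (3 * L)) v (Metric.ball x₀ d) :=
    LipschitzOnWith.of_dist_le_mul fun y hy z hz => by
      have hy' : y ∈ Metric.thickening d K := Metric.mem_thickening_iff.2 ⟨x₀, hx₀, hy⟩
      have hz' : z ∈ Metric.thickening d K := Metric.mem_thickening_iff.2 ⟨x₀, hx₀, hz⟩
      rw [Real.coe_toNNReal _ (by have := hL0 x₀ hx₀; positivity)]
      refine le_of_tendsto ((hv y hy').dist (hv z hz')) ?_
      filter_upwards [hev] with n hn
      exact hlip x₀ hx₀ n hn y (Metric.ball_subset_closedBall hy) z (Metric.ball_subset_closedBall hz)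
  exact (hlipv.continuousOn.continuousAt (Metric.isOpen_ball.mem_nhds hxx₀)).continuousWithinAt

/-- Interpolation of a pointwise limit of smooth functions. -/
lemma exists_interp_error_limit {k : ℕ} (hk : 1 < k) {σ : ℝ} (hσ : 1 ≤ σ) : ∃ C > 0, ∃ θ₀ > 0,
    ∀ {θ T c r pt}, θ ≤ θ₀ → LocalNodes k σ θ T c r pt → ∀ (f : ℕ → E3 → ℝ) (U : E3 → ℝ) (I : ℝ),
      (∀ n, ContDiff ℝ ∞ (f n)) →
      (∀ᶠ n in atTop, ∫ y in Metric.closedBall c (4 * σ * r), dsq (k + 1) (f n) y ≤ I) →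
      (∀ a ∈ nodeIdx T k, Tendsto (fun n => f n (pt a)) atTop (𝓝 (U (pt a)))) →
      ∀ q ∈ Pk k, (∀ a ∈ nodeIdx T k, pval q (pt a) = U (pt a)) → ∀ x ∈ hull T, ∀ i G,
      Tendsto (fun n => dd i (f n) x) atTop (𝓝 G) →
      (G - pgrad q i x) ^ 2 * r ^ 3 ≤ C * r ^ (2 * k) * I := by
  have hk0 : 0 < k := by omega
  obtain ⟨C, hC, θ₁, hθ₁, H⟩ := exists_interp_error hk hσ
  obtain ⟨C₂, hC₂, θ₂, hθ₂, hθ₂1, H₂⟩ := exists_grad_bound_pts k hk0 hσ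
  refine ⟨C, hC, min θ₁ θ₂, lt_min hθ₁ hθ₂, fun {θ T c r pt} hθ h f U I hf hI hU q hq hqU x hx i G hG => ?_⟩
  have h₂ := H₂ (hθ.trans (min_le_right _ _)) h
  have hr := h.pos
  have hinj : Function.Injective (evalAt k T pt) := (injective_iff_map_eq_zero _).2 fun p hp =>
    Subtype.ext (eq_zero_of_pts hk0 h.isTet (fun p hp => (h₂ p hp).1) p.2 fun a ha => congrFun hp ⟨a, ha⟩)
  have hsurj := evalAt_surjective_of_injective h.isTet hk0 hinj
  choose Q hQ using fun n => hsurj fun a => f n (pt a)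
  have hQpt : ∀ n, ∀ a ∈ nodeIdx T k, pval (Q n) (pt a) = f n (pt a) := fun n a ha => congrFun (hQ n) ⟨a, ha⟩
  -- The interpolants of the f n converge with their values at the points, by stability.
  have hlim : Tendsto (fun n => pgrad (Q n) i x) atTop (𝓝 (pgrad q i x)) := by
    rw [tendsto_iff_dist_tendsto_zero]
    have h0 : Tendsto (fun n => C₂ * (∑ a ∈ nodeIdx T k, |f n (pt a) - U (pt a)|) / r) atTop (𝓝 0) := by
      have : Tendsto (fun n => ∑ a ∈ nodeIdx T k, |f n (pt a) - U (pt a)|) atTop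
          (𝓝 (∑ a ∈ nodeIdx T k, |U (pt a) - U (pt a)|)) :=
        tendsto_finsetSum _ fun a ha => ((hU a ha).sub_const _).abs
      simp only [sub_self, abs_zero, Finset.sum_const_zero] at this
      simpa using (this.const_mul C₂).div_const r
    refine squeeze_zero (fun n => dist_nonneg) (fun n => ?_) h0
    have h1 := (h₂ _ (Submodule.sub_mem _ (Q n).2 hq)).2 i x (h.hull_subset' hσ hx)
    rw [Real.dist_eq, le_div_iff₀ hr]
    rw [pgrad_sub] at h1
    refine h1.trans (le_of_eq ?_)
    congr 1
    exact Finset.sum_congr rfl fun a ha => by rw [pval_sub, hQpt n a ha, hqU a ha]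
  refine le_of_tendsto (((hG.sub hlim).pow 2).mul_const (r ^ 3)) ?_
  filter_upwards [hI] with n hn
  refine (H (hθ.trans (min_le_left _ _)) h (f n) (hf n) (Q n) (Q n).2 (hQpt n) x hx i).trans ?_
  exact mul_le_mul_of_nonneg_left hn (by positivity)

/-! ### Lipschitz continuity of piecewise Lipschitz functions -/

/-- Along the segment from x to y, some piece is visited at parameters arbitrarily close to t from
the right; being closed it contains the point at t, so a lower right slope is at most L · dist x y.
The mean value inequality for such slopes concludes, up to the slack η. -/
lemma abs_sub_le_of_finite_closed_cover {ι : Type*} [Finite ι] {A : ι → Set E3} (hA : ∀ i, IsClosed (A i))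
    (hcov : ∀ x, ∃ i, x ∈ A i) {f : E3 → ℝ} (hf : Continuous f) {L : ℝ}
    (hL : ∀ i, ∀ x ∈ A i, ∀ y ∈ A i, |f x - f y| ≤ L * dist x y) (x y : E3) :
    |f y - f x| ≤ L * dist x y := by
  let γ : ℝ → E3 := fun t => x + t • (y - x)
  have hγ : Continuous γ := by fun_prop
  let g : ℝ → ℝ := fun t => f (γ t) - f x
  have hg : Continuous g := (hf.comp hγ).sub continuous_const
  have hslope : ∀ t ∈ Ico (0 : ℝ) 1, ∀ r, L * dist x y < r →
      ∃ᶠ z in 𝓝[>] t, slope (norm ∘ g) t z < r := fun t _ r hr => by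
    obtain ⟨i, hi⟩ : ∃ i, ∃ᶠ z in 𝓝[>] t, γ z ∈ A i := by
      by_contra! h
      obtain ⟨z, hz⟩ := (eventually_all.2 h).exists
      obtain ⟨i, hi⟩ := hcov (γ z)
      exact hz i hi
    have hti : γ t ∈ A i := (hA i).mem_of_frequently_of_tendsto hi
      (hγ.continuousAt.tendsto.mono_left nhdsWithin_le_nhds)
    refine (hi.and_eventually self_mem_nhdsWithin).mono fun z ⟨hz, hzt⟩ => ?_
    have hzt' : 0 < z - t := sub_pos.2 hzt
    have h1 := hL i _ hz _ hti
    have h2 : dist (γ z) (γ t) = (z - t) * dist x y := by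
      rw [dist_eq_norm, dist_eq_norm, ← norm_neg (x - y), neg_sub,
        show γ z - γ t = (z - t) • (y - x) by simp only [γ]; module, norm_smul, Real.norm_of_nonneg hzt'.le]
    have h3 : ‖g z‖ - ‖g t‖ ≤ |f (γ z) - f (γ t)| := by
      have := norm_sub_norm_le (g z) (g t)
      simpa only [g, sub_sub_sub_cancel_right, Real.norm_eq_abs] using this
    rw [slope_def_field, Function.comp, Function.comp, div_lt_iff₀ hzt']
    rw [h2] at h1
    have h4 := mul_lt_mul_of_pos_right hr hzt'
    linarith
  refine le_of_forall_pos_le_add fun η hη => ?_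
  have h := image_norm_le_of_liminf_right_slope_norm_lt_deriv_boundary (a := 0) (b := 1) hg.continuousOn hslope
    (B := fun t => (L * dist x y + η) * t) (B' := fun _ => L * dist x y + η) (by simp [g, γ])
    (by fun_prop) (fun t _ => by simpa using ((hasDerivAt_id t).const_mul (L * dist x y + η)).hasDerivWithinAt)
    (fun t _ _ => by linarith) (right_mem_Icc.2 zero_le_one)
  simpa [g, γ] using h

/-! ### Conforming functions and their weak gradient -/

section Patch

variable {𝒯 : TetMesh}

open Classical in
/-- The function equal to `w T` in the interior of `T`. -/
def patch (w : 𝒯.Elem → E3 → ℝ) (x : E3) : ℝ := ∑ T : 𝒯.Elem, (interior (hull T.1)).indicator (w T) x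

lemma patch_eq (w : 𝒯.Elem → E3 → ℝ) {T : 𝒯.Elem} {x : E3} (hx : x ∈ interior (hull T.1)) :
    patch w x = w T x := by
  rw [patch, Finset.sum_eq_single T]
  · exact indicator_of_mem hx _
  · intro S _ hST
    exact indicator_of_notMem (fun hxS => hST (Subtype.ext
      (TetMesh.eq_of_mem_interior S.2 T.2 hxS (interior_subset hx)))) _
  · exact fun h => absurd (Finset.mem_univ T) h

lemma patch_eq_zero (w : 𝒯.Elem → E3 → ℝ) {x : E3} (hx : x ∉ 𝒯.polyhedron) : patch w x = 0 :=
  Finset.sum_eq_zero fun T _ => indicator_of_notMem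
    (fun h => hx (TetMesh.hull_subset_polyhedron T.2 (interior_subset h))) _

/-- The frontier of a convex set is a null set. -/
lemma ae_mem_interior_or (𝒯 : TetMesh) :
    ∀ᵐ x : E3, (∃ T : 𝒯.Elem, x ∈ interior (hull T.1)) ∨ x ∉ 𝒯.polyhedron := by
  have h : ∀ T : 𝒯.Elem, ∀ᵐ x : E3, x ∉ frontier (hull T.1) := fun T =>
    compl_mem_ae_iff.2 ((convex_convexHull ℝ _).addHaar_frontier volume)
  filter_upwards [ae_all_iff.2 h] with x hx
  by_cases hxP : x ∈ 𝒯.polyhedron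
  · obtain ⟨T, hT, hxT⟩ := TetMesh.mem_polyhedron.1 hxP
    left
    refine ⟨⟨T, hT⟩, by_contra fun hxi => hx ⟨T, hT⟩ ⟨subset_closure hxT, hxi⟩⟩
  · exact Or.inr hxP

lemma exists_patch_bound {w : 𝒯.Elem → E3 → ℝ} (hw : ∀ T, Continuous (w T)) : ∃ K, ∀ x, |patch w x| ≤ K := by
  have h : ∀ T : 𝒯.Elem, ∃ K, 0 ≤ K ∧ ∀ x, |(interior (hull T.1)).indicator (w T) x| ≤ K := fun T => by
    obtain ⟨K, hK⟩ := (isCompact_hull T.1).exists_bound_of_continuousOn (hw T).continuousOn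
    refine ⟨max K 0, le_max_right _ _, fun x => ?_⟩
    by_cases hx : x ∈ interior (hull T.1)
    · rw [indicator_of_mem hx]
      exact (hK x (interior_subset hx)).trans (le_max_left _ _)
    · rw [indicator_of_notMem hx, abs_zero]; exact le_max_right _ _
  choose K _ hK using h
  exact ⟨∑ T, K T, fun x => (Finset.abs_sum_le_sum_abs _ _).trans (Finset.sum_le_sum fun T _ => hK T x)⟩

lemma aestronglyMeasurable_patch {w : 𝒯.Elem → E3 → ℝ} (hw : ∀ T, Continuous (w T)) :
    AEStronglyMeasurable (patch w) := by
  refine (Finset.measurable_sum _ fun T _ => ?_).aestronglyMeasurable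
  exact (hw T).measurable.indicator isOpen_interior.measurableSet

lemma memLp_patch {w : 𝒯.Elem → E3 → ℝ} (hw : ∀ T, Continuous (w T)) : MemLp (patch w) 2 := by
  obtain ⟨K, hK⟩ := exists_patch_bound hw
  have h1 : 𝒯.polyhedron.indicator (patch w) = patch w :=
    indicator_eq_self.2 fun x hx => by_contra fun h => hx (patch_eq_zero w h)
  rw [← h1, memLp_indicator_iff_restrict TetMesh.isClosed_polyhedron.measurableSet]
  have : IsFiniteMeasure (volume.restrict 𝒯.polyhedron) :=
    isFiniteMeasure_restrict.2 TetMesh.isCompact_polyhedron.measure_lt_top.ne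
  exact MemLp.of_bound (aestronglyMeasurable_patch hw).restrict K (Eventually.of_forall hK)

lemma setIntegral_mul_patch {D : Set E3} (hsub : ∀ T : 𝒯.Elem, hull T.1 ⊆ D)
    {F : E3 → ℝ} {w : 𝒯.Elem → E3 → ℝ} (hi : ∀ T : 𝒯.Elem, IntegrableOn (fun x => F x * w T x) (hull T.1)) :
    ∫ x in D, F x * patch w x = ∑ T : 𝒯.Elem, ∫ x in hull T.1, F x * w T x := by
  have h1 : ∀ x, F x * patch w x = ∑ T : 𝒯.Elem, (interior (hull T.1)).indicator (fun x => F x * w T x) x :=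
    fun x => by
      rw [patch, Finset.mul_sum]
      refine Finset.sum_congr rfl fun T _ => ?_
      by_cases hx : x ∈ interior (hull T.1) <;> simp [hx]
  simp only [h1]
  rw [integral_finsetSum _ fun T _ => (IntegrableOn.integrable_indicator ((hi T).mono_set interior_subset)
    isOpen_interior.measurableSet).integrableOn]
  refine Finset.sum_congr rfl fun T _ => ?_
  rw [setIntegral_indicator isOpen_interior.measurableSet,
    inter_eq_self_of_subset_right (interior_subset.trans (hsub T))]
  refine setIntegral_congr_set ?_
  filter_upwards [compl_mem_ae_iff.2 ((convex_convexHull ℝ (T.1 : Set E3)).addHaar_frontier volume)] with x hx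
  refine propext ⟨fun h => interior_subset h, fun h => by_contra fun h' => hx ⟨subset_closure h, h'⟩⟩

variable {k : ℕ}

/-- Conforming functions, extended by zero, are Lipschitz. -/
lemma MemV.exists_lipschitz {v : Piecewise 𝒯} (hv : MemV 𝒯 k v) : ∃ φ : E3 → ℝ, (∃ L, LipschitzWith L φ) ∧
    (∀ x ∉ 𝒯.polyhedron, φ x = 0) ∧ ∀ T : 𝒯.Elem, ∀ x ∈ hull T.1, φ x = pval (v T) x := by
  classical
  obtain ⟨_, φ, hφc, hφ0, hφ⟩ := hv
  let ψ : E3 → ℝ := 𝒯.polyhedron.piecewise φ 0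
  have hψ : Continuous ψ := by
    refine continuous_piecewise (fun x hx => ?_) ?_ continuousOn_const
    · refine hφ0 x ?_
      rw [TetMesh.bdry_eq]
      rwa [frontier, TetMesh.isClosed_polyhedron.closure_eq] at hx
    · rwa [TetMesh.isClosed_polyhedron.closure_eq]
  have hψ0 : ∀ x ∉ 𝒯.polyhedron, ψ x = 0 := fun x hx => piecewise_eq_of_notMem _ _ _ hx
  have hψT : ∀ T : 𝒯.Elem, ∀ x ∈ hull T.1, ψ x = pval (v T) x := fun T x hx => by
    rw [← hφ T x hx]; exact piecewise_eq_of_mem _ _ _ (TetMesh.hull_subset_polyhedron T.2 hx)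
  refine ⟨ψ, ?_, hψ0, hψT⟩
  have hT : ∀ T : 𝒯.Elem, ∃ K, 0 ≤ K ∧ ∀ x ∈ hull T.1, ∀ y ∈ hull T.1, |ψ x - ψ y| ≤ K * dist x y := fun T => by
    have h : ∀ i, ∃ K, ∀ x ∈ hull T.1, ‖pgrad (v T) i x‖ ≤ K := fun i =>
      (isCompact_hull T.1).exists_bound_of_continuousOn (continuous_pgrad (v T) i).continuousOn
    choose K hK using h
    refine ⟨3 * ∑ i, |K i|, by positivity, fun x hx y hy => ?_⟩
    rw [hψT T x hx, hψT T y hy]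
    refine abs_pval_sub_le (convex_convexHull ℝ _) (fun z hz i => (hK i z hz).trans ((le_abs_self _).trans ?_)) hx hy
    exact Finset.single_le_sum (f := fun i => |K i|) (fun _ _ => abs_nonneg _) (Finset.mem_univ i)
  choose K hK0 hK using hT
  have hL0 : 0 ≤ ∑ T, K T := Finset.sum_nonneg fun T _ => hK0 T
  -- The pieces are the elements and the closure of the complement, on which the extension vanishes.
  let A : Option 𝒯.Elem → Set E3 := fun o => o.elim (closure 𝒯.polyhedronᶜ) fun T => hull T.1
  have hz : ∀ x ∈ closure 𝒯.polyhedronᶜ, ψ x = 0 := fun x hx =>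
    closure_minimal (s := 𝒯.polyhedronᶜ) (t := {x | ψ x = 0}) hψ0 (isClosed_eq hψ continuous_const) hx
  refine ⟨Real.toNNReal (∑ T, K T), LipschitzWith.of_dist_le_mul fun x y => ?_⟩
  rw [Real.coe_toNNReal _ hL0, dist_comm (ψ x), Real.dist_eq]
  refine abs_sub_le_of_finite_closed_cover (A := A) ?_ ?_ hψ ?_ x y
  · rintro (_ | T)
    · exact isClosed_closure
    · exact isClosed_hull T.1
  · intro x
    by_cases hx : x ∈ 𝒯.polyhedron
    · obtain ⟨T, hT, hxT⟩ := TetMesh.mem_polyhedron.1 hx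
      exact ⟨some ⟨T, hT⟩, hxT⟩
    · exact ⟨none, subset_closure hx⟩
  · rintro (_ | T) x hx y hy
    · rw [hz x hx, hz y hy, sub_self, abs_zero]
      exact mul_nonneg hL0 dist_nonneg
    · exact (hK T x hx y hy).trans (mul_le_mul_of_nonneg_right
        (Finset.single_le_sum (fun T _ => hK0 T) (Finset.mem_univ T)) dist_nonneg)

/-- Lipschitz functions may be integrated by parts against test functions, and almost everywhere the
line derivative is that of the local polynomial or zero. No jumps across faces have to be computed.
-/
lemma hasWeakDeriv_patch {v : Piecewise 𝒯} {φ : E3 → ℝ} (hL : ∃ L, LipschitzWith L φ)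
    (h0 : ∀ x ∉ 𝒯.polyhedron, φ x = 0) (hT : ∀ T : 𝒯.Elem, ∀ x ∈ hull T.1, φ x = pval (v T) x) (i : Fin 3) :
    HasWeakDeriv univ (fun _ : Fin 1 => i) φ (patch fun T => pgrad (v T) i) := by
  obtain ⟨L, hL⟩ := hL
  refine ⟨?_, fun ψ hψ => ?_⟩
  · rw [Measure.restrict_univ]
    exact memLp_patch fun T => continuous_pgrad (v T) i
  · rw [Measure.restrict_univ]
    obtain ⟨L', hL'⟩ := ContDiff.lipschitzWith_of_hasCompactSupport hψ.2.1 hψ.1 (by simp)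
    have h1 := hL.integral_lineDeriv_mul_eq (μ := volume) hL' hψ.2.1 (ee i)
    have h2 : ∫ x, lineDeriv ℝ φ x (ee i) * ψ x = ∫ x, patch (fun T => pgrad (v T) i) x * ψ x := by
      refine integral_congr_ae ?_
      filter_upwards [ae_mem_interior_or 𝒯] with x hx
      congr 1
      rcases hx with ⟨T, hx⟩ | hx
      · rw [patch_eq _ hx]
        have he : φ =ᶠ[𝓝 x] pval (v T) := by
          filter_upwards [mem_interior_iff_mem_nhds.1 hx] with y hy using hT T y hy
        rw [he.lineDeriv_eq, ((hasFDerivAt_pval (v T) x).differentiableAt).lineDeriv_eq_fderiv,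
          fderiv_pval_single]
      · rw [patch_eq_zero _ hx]
        have he : φ =ᶠ[𝓝 x] fun _ => 0 := by
          filter_upwards [TetMesh.isClosed_polyhedron.isOpen_compl.mem_nhds hx] with y hy using h0 y hy
        rw [he.lineDeriv_eq]
        simp [lineDeriv]
    have h3 : ∀ x, lineDeriv ℝ ψ x (-ee i) = -iteratedFDeriv ℝ 1 ψ x fun _ => ee i := fun x => by
      rw [(hψ.1.differentiable (by simp) x).lineDeriv_eq_fderiv, map_neg, iteratedFDeriv_one_apply]
    rw [← h2, h1]
    simp only [h3, neg_mul, integral_neg, pow_one, one_mul, neg_neg]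
    congr 1
    funext x
    exact mul_comm _ _

end Patch

/-! ### The weak formulation of the Poisson equation against conforming functions -/

section Green

variable {D : Set E3}

lemma tsupport_dd_subset (i : Fin 3) (φ : E3 → ℝ) : tsupport (dd i φ) ⊆ tsupport φ := by
  refine closure_minimal (fun x hx => ?_) (isClosed_tsupport φ)
  refine tsupport_fderiv_subset ℝ (f := φ) (subset_closure fun h => hx ?_)
  rw [dd, h]; rfl

lemma IsTest.isTest_dd {φ : E3 → ℝ} (hφ : IsTest D φ) (i : Fin 3) : IsTest D (dd i φ) :=
  ⟨ContDiff.dd hφ.1 i, hφ.2.1.of_isClosed_subset (isClosed_tsupport _) (tsupport_dd_subset i φ),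
    (tsupport_dd_subset i φ).trans hφ.2.2⟩

lemma IsTest.integrable_mul {φ : E3 → ℝ} (hφ : IsTest D φ) {F : E3 → ℝ} (hF : MemLp F 2 (volume.restrict D)) :
    Integrable (fun x => F x * φ x) (volume.restrict D) :=
  hF.integrable_mul (((hφ.1.continuous.memLp_of_hasCompactSupport hφ.2.1 : MemLp φ 2)).restrict D)

lemma laplacian_eq_sum_dd {φ : E3 → ℝ} (hφ : ContDiff ℝ ∞ φ) (x : E3) : (Δ φ) x = ∑ i, dd i (dd i φ) x := by
  rw [InnerProductSpace.laplacian_eq_iteratedFDeriv_orthonormalBasis φ (EuclideanSpace.basisFun (Fin 3) ℝ)]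
  refine Finset.sum_congr rfl fun i _ => ?_
  have h := ContDiff.dpart_succ hφ (s := fun _ : Fin 2 => i) x
  have h1 : dd i φ = dpart (Fin.tail fun _ : Fin 2 => i) φ := funext fun y => dd_eq_dpart i y
  rw [h1, show dd i (dpart (Fin.tail fun _ : Fin 2 => i) φ) x = _ from h.symm, dpart]
  congr 1
  funext j
  fin_cases j <;> simp [ee]

lemma SolvesPoissonEq.sum_integral_eq {m : ℕ} {u f φ : E3 → ℝ} (h : SolvesPoissonEq D f u)
    (hu : MemSobolev m D u) (hm : 1 ≤ m) (hφ : IsTest D φ) :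
    ∑ i, ∫ x in D, weakDeriv D (fun _ : Fin 1 => i) u x * dd i φ x = ∫ x in D, f x * φ x := by
  rw [← h φ hφ]
  simp only [laplacian_eq_sum_dd hφ.1, Finset.mul_sum]
  rw [integral_finsetSum _ fun i _ => ((hφ.isTest_dd i).isTest_dd i).integrable_mul hu.1, ← Finset.sum_neg_distrib]
  refine Finset.sum_congr rfl fun i _ => ?_
  have h1 := (hu.hasWeakDeriv hm fun _ : Fin 1 => i).2 (dd i φ) (hφ.isTest_dd i)
  have h2 : ∀ x, iteratedFDeriv ℝ 1 (dd i φ) x (fun _ => EuclideanSpace.single i 1) =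
      dd i (dd i φ) x := fun x => (dd_eq_dpart i x).symm
  simp only [h2] at h1
  rw [h1]
  ring

lemma moll_eq_zero {K : Set E3} {w : E3 → ℝ} (hw : ∀ x ∉ K, w x = 0) {n : ℕ} {d : ℝ} (hn : mrad n ≤ d) {x : E3}
    (hx : x ∉ Metric.cthickening d K) : moll n w x = 0 := by
  rw [moll_apply]
  refine integral_eq_zero_of_ae (Eventually.of_forall fun t => ?_)
  rcases le_or_gt (mrad n) ‖t‖ with ht | ht
  · simp [rho_eq_zero ht]
  · have : w (x - t) = 0 := hw _ fun h => hx (Metric.mem_cthickening_of_dist_le x _ _ _ h (by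
      rw [dist_eq_norm, sub_sub_cancel]; exact ht.le.trans hn))
    simp [this]

/-- Dominated convergence: for large n the mollifications are bounded by M and supported in one
compact subset of D. -/
lemma tendsto_setIntegral_mul_moll {K : Set E3} (hK : IsCompact K) {d : ℝ} (hd : 0 < d)
    (hKD : Metric.cthickening d K ⊆ D) {F w : E3 → ℝ} (hF : MemLp F 2 (volume.restrict D))
    (hw : LocallyIntegrable w) {M : ℝ} (hM : ∀ x, |w x| ≤ M) (h0 : ∀ x ∉ K, w x = 0) :
    Tendsto (fun n => ∫ x in D, F x * moll n w x) atTop (𝓝 (∫ x in D, F x * w x)) := by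
  have hS : IsCompact (Metric.cthickening d K) := hK.cthickening
  refine tendsto_integral_filter_of_dominated_convergence
    (fun x => (Metric.cthickening d K).indicator (fun x => |F x| * M) x) ?_ ?_ ?_ ?_
  · exact Eventually.of_forall fun n => hF.1.mul (contDiff_moll n hw).continuous.aestronglyMeasurable
  · filter_upwards [tendsto_mrad.eventually (ge_mem_nhds hd)] with n hn
    refine Eventually.of_forall fun x => ?_
    by_cases hx : x ∈ Metric.cthickening d K
    · rw [indicator_of_mem hx, norm_mul]
      exact mul_le_mul_of_nonneg_left (abs_moll_le hM n x) (abs_nonneg _)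
    · rw [indicator_of_notMem hx, moll_eq_zero h0 hn hx, mul_zero, norm_zero]
  · rw [integrable_indicator_iff hS.isClosed.measurableSet]
    have : IsFiniteMeasure (volume.restrict (Metric.cthickening d K)) :=
      isFiniteMeasure_restrict.2 hS.measure_lt_top.ne
    rw [IntegrableOn, Measure.restrict_restrict_of_subset hKD]
    exact ((hF.mono_measure (Measure.restrict_mono hKD le_rfl)).integrable (by norm_num)).abs.mul_const M
  · refine ae_restrict_of_ae ?_
    filter_upwards [ae_tendsto_moll hw] with x hx using hx.const_mul _

/-- The extension of v by zero is not smooth, but its fine mollifications are test functions on D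
with derivatives equal to the mollified piecewise gradient; the equation passes to the limit. -/
lemma SolvesPoissonEq.sum_integral_pgrad_eq_load {m : ℕ} {u f : E3 → ℝ} (h : SolvesPoissonEq D f u)
    (hD : IsOpen D) (hu : MemSobolev m D u) (hm : 1 ≤ m) (hf : MemLp f 2 (volume.restrict D)) {𝒯 : TetMesh}
    (hsub : ∀ T : 𝒯.Elem, hull T.1 ⊆ D) {k : ℕ} {v : Piecewise 𝒯} (hv : MemV 𝒯 k v) :
    ∑ T : 𝒯.Elem, ∫ x in hull T.1, ∑ i, weakDeriv D (fun _ : Fin 1 => i) u x * pgrad (v T) i x = load 𝒯 f v := by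
  obtain ⟨φ, hL, h0, hT⟩ := hv.exists_lipschitz
  have hφc : Continuous φ := by obtain ⟨L, hL⟩ := hL; exact hL.continuous
  have hPD : 𝒯.polyhedron ⊆ D := fun x hx => by
    obtain ⟨T, hT, hxT⟩ := TetMesh.mem_polyhedron.1 hx
    exact hsub ⟨T, hT⟩ hxT
  have hPc : IsCompact 𝒯.polyhedron := TetMesh.isCompact_polyhedron
  obtain ⟨d, hd, hdD⟩ := hPc.exists_cthickening_subset_open hD hPD
  let G : Fin 3 → E3 → ℝ := fun i => patch fun T => pgrad (v T) i
  have hG : ∀ i, MemLp (G i) 2 := fun i => memLp_patch fun T => continuous_pgrad (v T) i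
  have hGl : ∀ i, LocallyIntegrable (G i) := fun i => (hG i).locallyIntegrable (by norm_num)
  have hDi := fun i => hu.hasWeakDeriv hm fun _ : Fin 1 => i
  have hint : ∀ {F : E3 → ℝ}, MemLp F 2 (volume.restrict D) → ∀ {p : E3 → ℝ}, Continuous p → ∀ T : 𝒯.Elem,
      IntegrableOn (fun x => F x * p x) (hull T.1) := fun {F} hF {p} hp T => by
    have : IsFiniteMeasure (volume.restrict (hull T.1)) :=
      isFiniteMeasure_restrict.2 (isCompact_hull T.1).measure_lt_top.ne
    have h1 := (hF.mono_measure (Measure.restrict_mono (hsub T) le_rfl)).integrable (by norm_num)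
    exact IntegrableOn.mul_continuousOn h1 hp.continuousOn (isCompact_hull T.1)
  have hφb : ∃ M, ∀ x, |φ x| ≤ M := by
    obtain ⟨M, hM⟩ := hPc.exists_bound_of_continuousOn hφc.continuousOn
    refine ⟨max M 0, fun x => ?_⟩
    by_cases hx : x ∈ 𝒯.polyhedron
    · exact (hM x hx).trans (le_max_left _ _)
    · rw [h0 x hx, abs_zero]; exact le_max_right _ _
  obtain ⟨M, hM⟩ := hφb
  have htest : ∀ n, mrad n ≤ d → IsTest D (moll n φ) := fun n hn => by
    have hs : tsupport (moll n φ) ⊆ Metric.cthickening d 𝒯.polyhedron :=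
      closure_minimal (fun x hx => by_contra fun h => hx (moll_eq_zero h0 hn h)) Metric.isClosed_cthickening
    exact ⟨contDiff_moll n hφc.locallyIntegrable,
      hPc.cthickening.of_isClosed_subset (isClosed_tsupport _) hs, hs.trans hdD⟩
  have hdd : ∀ n i x, dd i (moll n φ) x = moll n (G i) x := fun n i x => by
    have h1 := dpart_moll MeasurableSet.univ (u := φ) (by rw [indicator_univ]; exact hφc.locallyIntegrable)
      (hasWeakDeriv_patch hL h0 hT i) (subset_univ (Metric.closedBall x (mrad n)))
    rw [indicator_univ, indicator_univ] at h1
    rw [dd_eq_dpart, h1]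
  have hlim1 : Tendsto (fun n => ∑ i, ∫ x in D, weakDeriv D (fun _ : Fin 1 => i) u x * dd i (moll n φ) x) atTop
      (𝓝 (∑ i, ∫ x in D, weakDeriv D (fun _ : Fin 1 => i) u x * G i x)) := by
    refine tendsto_finsetSum _ fun i _ => ?_
    simp only [hdd]
    obtain ⟨K, hK⟩ := exists_patch_bound fun T => continuous_pgrad (v T) i
    exact tendsto_setIntegral_mul_moll hPc hd hdD (hDi i).1 (hGl i) hK fun x hx => patch_eq_zero _ hx
  have hlim2 := tendsto_setIntegral_mul_moll hPc hd hdD hf hφc.locallyIntegrable hM h0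
  have heq : (fun n => ∑ i, ∫ x in D, weakDeriv D (fun _ : Fin 1 => i) u x * dd i (moll n φ) x) =ᶠ[atTop]
      fun n => ∫ x in D, f x * moll n φ x := by
    filter_upwards [tendsto_mrad.eventually (ge_mem_nhds hd)] with n hn using h.sum_integral_eq hu hm (htest n hn)
  have hmain := tendsto_nhds_unique (hlim1.congr' heq) hlim2
  have hR : ∫ x in D, f x * φ x = load 𝒯 f v := by
    rw [load, ← setIntegral_mul_patch hsub fun T => hint hf (continuous_pval (v T)) T]
    refine integral_congr_ae (ae_restrict_of_ae ?_)
    filter_upwards [ae_mem_interior_or 𝒯] with x hx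
    congr 1
    rcases hx with ⟨T, hx⟩ | hx
    · rw [patch_eq _ hx, hT T x (interior_subset hx)]
    · rw [patch_eq_zero _ hx, h0 x hx]
  rw [← hR, ← hmain]
  have h3 : ∀ i, ∫ x in D, weakDeriv D (fun _ : Fin 1 => i) u x * G i x =
      ∑ T : 𝒯.Elem, ∫ x in hull T.1, weakDeriv D (fun _ : Fin 1 => i) u x * pgrad (v T) i x := fun i =>
    setIntegral_mul_patch hsub fun T => hint (hDi i).1 (continuous_pgrad (v T) i) T
  simp only [h3]
  rw [Finset.sum_comm]
  exact Finset.sum_congr rfl fun T _ =>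
    integral_finsetSum _ fun i _ => hint (hDi i).1 (continuous_pgrad (v T) i) T

end Green

/-! ### Uniqueness of weak derivatives -/

/-- Test functions on D are test functions on D', so both derivatives have the same integrals
against them. Two domains are needed because the error involves the gradient of u on Ω and the
analysis that of `u'` on Ω'. -/
lemma HasWeakDeriv.ae_eq {D D' : Set E3} (hD : IsOpen D) (hD' : IsOpen D') (hsub : D ⊆ D') {m : ℕ} {s : Fin m → Fin 3}
    {u u' v v' : E3 → ℝ} (huu' : u' =ᵐ[volume.restrict D] u) (h : HasWeakDeriv D s u v)
    (h' : HasWeakDeriv D' s u' v') : v =ᵐ[volume.restrict D] v' := by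
  have hv' : MemLp v' 2 (volume.restrict D) := h'.1.mono_measure (Measure.restrict_mono hsub le_rfl)
  have hext : ∀ {F : E3 → ℝ}, (∀ x ∉ D, F x = 0) → ∫ x in D', F x = ∫ x in D, F x := fun {F} hF =>
    setIntegral_eq_of_subset_of_forall_sdiff_eq_zero hD'.measurableSet hsub fun x hx => hF x hx.2
  have hloc : LocallyIntegrable (D.indicator fun x => v x - v' x) :=
    locallyIntegrable_indicator hD (h.1.sub hv')
  have hz := hD.ae_eq_zero_of_integral_contDiff_smul_eq_zero (hloc.locallyIntegrableOn D) fun φ h1 h2 h3 => by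
    have hφ : IsTest D φ := ⟨h1, h2, h3⟩
    have e1 := h.2 φ hφ
    have e2 := h'.2 φ ⟨h1, h2, h3.trans hsub⟩
    rw [hext fun x hx => ?_, hext fun x hx => ?_] at e2
    · have e3 : ∫ x in D, u x * iteratedFDeriv ℝ m φ x (fun i => EuclideanSpace.single (s i) (1 : ℝ)) =
          ∫ x in D, u' x * iteratedFDeriv ℝ m φ x (fun i => EuclideanSpace.single (s i) (1 : ℝ)) := by
        refine integral_congr_ae ?_
        filter_upwards [huu'] with x hx
        rw [hx]
      rw [e3, e2] at e1
      have e4 := mul_left_cancel₀ (pow_ne_zero m (by norm_num : (-1 : ℝ) ≠ 0)) e1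
      have e5 : ∀ x, φ x • D.indicator (fun x => v x - v' x) x = D.indicator (fun x => v x * φ x - v' x * φ x) x :=
        fun x => by
          by_cases hx : x ∈ D
          · simp only [indicator_of_mem hx, smul_eq_mul]; ring
          · simp only [indicator_of_notMem hx, smul_zero]
      simp only [e5]
      rw [integral_indicator hD.measurableSet, integral_sub (hφ.integrable_mul h.1) (hφ.integrable_mul hv'), e4,
        sub_self]
    · have : φ x = 0 := by_contra fun hc => hx (h3 (subset_tsupport φ hc))
      simp [this]
    · have : iteratedFDeriv ℝ m φ x = 0 := by_contra fun hc => hx (h3 (support_iteratedFDeriv_subset m hc))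
      simp [this]
  refine (ae_restrict_iff' hD.measurableSet).2 ?_
  filter_upwards [hz] with x hx hxD
  have := hx hxD
  rw [indicator_of_mem hxD] at this
  linarith

/-! ### Overlap of balls around the elements -/

section Overlap

variable {𝒯 : TetMesh} {c : 𝒯.Elem → E3} {r : 𝒯.Elem → ℝ}

/-- The inscribed balls of distinct elements are disjoint, and all lie within 6σH of x. On a graded
mesh many enlarged balls of different sizes may contain x; only their total volume is controlled. -/
lemma sum_pow_three_le {σ H : ℝ} (hσ : 1 ≤ σ) (hr : ∀ T, 0 < r T) (hB : ∀ T, Metric.closedBall (c T) (r T) ⊆ hull T.1)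
    (hH0 : 0 ≤ H) (hH : ∀ T, r T ≤ H) (x : E3) {s : Finset 𝒯.Elem}
    (hs : ∀ T ∈ s, x ∈ Metric.closedBall (c T) (5 * σ * r T)) : ∑ T ∈ s, r T ^ 3 ≤ (6 * σ * H) ^ 3 := by
  have hint : ∀ T, Metric.ball (c T) (r T) ⊆ interior (hull T.1) := fun T =>
    interior_maximal (Metric.ball_subset_closedBall.trans (hB T)) Metric.isOpen_ball
  have hdis : (s : Set 𝒯.Elem).PairwiseDisjoint fun T => Metric.ball (c T) (r T) := fun S _ T _ hST =>
    Set.disjoint_left.2 fun y hS hT => hST (Subtype.ext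
      (TetMesh.eq_of_mem_interior S.2 T.2 (hint S hS) (interior_subset (hint T hT))))
  have hsub : (⋃ T ∈ s, Metric.ball (c T) (r T)) ⊆ Metric.closedBall x (6 * σ * H) :=
    iUnion₂_subset fun T hT y hy => by
      have h1 := Metric.mem_closedBall.1 (hs T hT)
      have h2 := Metric.mem_ball.1 hy
      have h3 := dist_triangle_right y x (c T)
      have h4 : 0 < r T := hr T
      rw [Metric.mem_closedBall]
      calc dist y x ≤ r T + 5 * σ * r T := by linarith
        _ ≤ σ * r T + 5 * σ * r T := by gcongr; exact le_mul_of_one_le_left h4.le hσ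
        _ = 6 * σ * r T := by ring
        _ ≤ 6 * σ * H := by gcongr; exact hH T
  have h1 := measureReal_mono (μ := volume) hsub (isCompact_closedBall _ _).measure_lt_top.ne
  rw [measureReal_biUnion_finset hdis (fun T _ => Metric.isOpen_ball.measurableSet)
    (fun T _ => measure_ball_lt_top.ne), volume_real_closedBall x (by positivity)] at h1
  have h2 : ∀ T, volume.real (Metric.ball (c T) (r T)) = r T ^ 3 * unitVol := fun T => by
    rw [← volume_real_closedBall (c T) (hr T).le]
    simp only [measureReal_def]
    rw [Measure.addHaar_closedBall_eq_addHaar_ball]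
  simp only [h2, ← Finset.sum_mul] at h1
  exact le_of_mul_le_mul_right h1 unitVol_pos

/-- Since 2k ≥ 3, the weight r^(2k) is at most H^(2k-3) r³, and the volume bound at each point
replaces a bound on the number of overlaps. -/
lemma sum_mul_setIntegral_le {σ H : ℝ} (hσ : 1 ≤ σ) (hr : ∀ T, 0 < r T)
    (hB : ∀ T, Metric.closedBall (c T) (r T) ⊆ hull T.1) (hH0 : 0 ≤ H) (hH : ∀ T, r T ≤ H) {k : ℕ} (hk : 1 < k)
    {D : Set E3} (hBD : ∀ T, Metric.closedBall (c T) (5 * σ * r T) ⊆ D) {F : E3 → ℝ} (hF0 : ∀ x, 0 ≤ F x)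
    (hF : IntegrableOn F D) :
    ∑ T, r T ^ (2 * k) * ∫ x in Metric.closedBall (c T) (5 * σ * r T), F x ≤
      (6 * σ) ^ 3 * H ^ (2 * k) * ∫ x in D, F x := by
  classical
  have hk3 : 2 * k - 3 + 3 = 2 * k := by omega
  have hm : ∀ T, MeasurableSet (Metric.closedBall (c T) (5 * σ * r T)) := fun T => Metric.isClosed_closedBall.measurableSet
  have h1 : ∀ T, r T ^ (2 * k) * ∫ x in Metric.closedBall (c T) (5 * σ * r T), F x =
      ∫ x in D, r T ^ (2 * k) * (Metric.closedBall (c T) (5 * σ * r T)).indicator F x := fun T => by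
    rw [integral_const_mul, setIntegral_indicator (hm T), inter_eq_self_of_subset_right (hBD T)]
  simp only [h1]
  have hi : ∀ T, Integrable (fun x => r T ^ (2 * k) * (Metric.closedBall (c T) (5 * σ * r T)).indicator F x)
      (volume.restrict D) := fun T => (hF.indicator (hm T)).const_mul _
  rw [← integral_finsetSum _ fun T _ => hi T, ← integral_const_mul]
  refine integral_mono (integrable_finsetSum _ fun T _ => hi T) (hF.const_mul _) fun x => ?_
  have h2 : ∑ T, r T ^ (2 * k) * (Metric.closedBall (c T) (5 * σ * r T)).indicator F x =
      (∑ T with x ∈ Metric.closedBall (c T) (5 * σ * r T), r T ^ (2 * k)) * F x := by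
    rw [Finset.sum_mul, Finset.sum_filter]
    refine Finset.sum_congr rfl fun T _ => ?_
    split_ifs with h
    · rw [indicator_of_mem h]
    · rw [indicator_of_notMem h, mul_zero]
  show ∑ T, r T ^ (2 * k) * (Metric.closedBall (c T) (5 * σ * r T)).indicator F x ≤ (6 * σ) ^ 3 * H ^ (2 * k) * F x
  rw [h2]
  refine mul_le_mul_of_nonneg_right ?_ (hF0 x)
  calc ∑ T with x ∈ Metric.closedBall (c T) (5 * σ * r T), r T ^ (2 * k)
      ≤ ∑ T with x ∈ Metric.closedBall (c T) (5 * σ * r T), H ^ (2 * k - 3) * r T ^ 3 :=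
        Finset.sum_le_sum fun T _ => by
          rw [← hk3, pow_add, hk3]
          exact mul_le_mul_of_nonneg_right (pow_le_pow_left₀ (hr T).le (hH T) _) (pow_nonneg (hr T).le 3)
    _ = H ^ (2 * k - 3) * ∑ T with x ∈ Metric.closedBall (c T) (5 * σ * r T), r T ^ 3 := by rw [Finset.mul_sum]
    _ ≤ H ^ (2 * k - 3) * (6 * σ * H) ^ 3 := mul_le_mul_of_nonneg_left
        (sum_pow_three_le hσ hr hB hH0 hH x fun T hT => (Finset.mem_filter.1 hT).2) (pow_nonneg hH0 _)
    _ = (6 * σ) ^ 3 * H ^ (2 * k) := by rw [← hk3, pow_add, hk3]; ring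

end Overlap

/-! ### The Strang-type error estimate -/

section Strang

variable {𝒯 : TetMesh} {k : ℕ}

/-- The square of the error of the elementwise gradient of `w` with respect to the field `G`. -/
def errSq (G : Fin 3 → E3 → ℝ) (w : Piecewise 𝒯) : ℝ :=
  ∑ T : 𝒯.Elem, ∫ x in hull T.1, ∑ i, (G i x - pgrad (w T) i x) ^ 2

variable {G : Fin 3 → E3 → ℝ} (hG : ∀ T : 𝒯.Elem, ∀ i, MemLp (G i) 2 (volume.restrict (hull T.1)))
include hG

lemma integrableOn_sum_mul_pgrad (T : 𝒯.Elem) (p : MvPolynomial (Fin 3) ℝ) :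
    IntegrableOn (fun x => ∑ i, G i x * pgrad p i x) (hull T.1) := by
  have : IsFiniteMeasure (volume.restrict (hull T.1)) :=
    isFiniteMeasure_restrict.2 (isCompact_hull T.1).measure_lt_top.ne
  refine integrable_finsetSum _ fun i _ => ?_
  have h1 : IntegrableOn (G i) (hull T.1) := (hG T i).integrable (by norm_num)
  exact h1.mul_continuousOn (continuous_pgrad p i).continuousOn (isCompact_hull T.1)

lemma integrableOn_errSq (T : 𝒯.Elem) (p : MvPolynomial (Fin 3) ℝ) :
    IntegrableOn (fun x => ∑ i, (G i x - pgrad p i x) ^ 2) (hull T.1) := by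
  have : IsFiniteMeasure (volume.restrict (hull T.1)) :=
    isFiniteMeasure_restrict.2 (isCompact_hull T.1).measure_lt_top.ne
  refine integrable_finsetSum _ fun i _ => ?_
  obtain ⟨K, hK⟩ := (isCompact_hull T.1).exists_bound_of_continuousOn (continuous_pgrad p i).continuousOn
  have h1 : MemLp (pgrad p i) 2 (volume.restrict (hull T.1)) :=
    MemLp.of_bound (continuous_pgrad p i).aestronglyMeasurable K
      ((ae_restrict_iff' (isClosed_hull T.1).measurableSet).2 (Eventually.of_forall hK))
  exact ((hG T i).sub h1).integrable_sq

lemma errSq_le (w q : Piecewise 𝒯) : errSq G w ≤ 2 * errSq G q + 2 * gradNormSq (w - q) := by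
  rw [errSq, errSq, gradNormSq, Finset.mul_sum, Finset.mul_sum, ← Finset.sum_add_distrib]
  refine Finset.sum_le_sum fun T _ => ?_
  have i1 := (integrableOn_errSq hG T (q T)).const_mul 2
  have i2 := (integrableOn_gradSq ((w - q) T) T.1).const_mul 2
  rw [← integral_const_mul, ← integral_const_mul, ← integral_add i1 i2]
  refine integral_mono (integrableOn_errSq hG T (w T)) (i1.add i2) fun x => ?_
  simp only [gradSq, Finset.mul_sum, ← Finset.sum_add_distrib]
  refine Finset.sum_le_sum fun i _ => ?_
  rw [Pi.sub_apply, pgrad_sub]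
  linarith [sq_nonneg (G i x - pgrad (q T) i x + (pgrad (w T) i x - pgrad (q T) i x))]

/-- Young's inequality ab ≤ 4a² + b²/16, the small weight being absorbed by coercivity. -/
lemma sum_integral_sub_bilin_le (q v : Piecewise 𝒯) :
    (∑ T : 𝒯.Elem, ∫ x in hull T.1, ∑ i, G i x * pgrad (v T) i x) - bilin 𝒯 q v ≤
      4 * errSq G q + 1 / 16 * gradNormSq v := by
  rw [bilin, errSq, gradNormSq, Finset.mul_sum, Finset.mul_sum, ← Finset.sum_add_distrib, ← Finset.sum_sub_distrib]
  refine Finset.sum_le_sum fun T _ => ?_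
  have i1 := (integrableOn_errSq hG T (q T)).const_mul 4
  have i2 := (integrableOn_gradSq (v T) T.1).const_mul (1 / 16)
  have i3 := integrableOn_sum_mul_pgrad hG T (v T)
  have i4 : IntegrableOn (fun x => ∑ i, pgrad (q T) i x * pgrad (v T) i x) (hull T.1) :=
    integrableOn_of_continuous (continuous_finsetSum _ fun i _ =>
      (continuous_pgrad _ i).mul (continuous_pgrad _ i)) (isCompact_hull T.1)
  rw [← integral_const_mul, ← integral_const_mul, ← integral_add i1 i2, ← integral_sub i3 i4]
  refine integral_mono (i3.sub i4) (i1.add i2) fun x => ?_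
  simp only [gradSq, Finset.mul_sum, ← Finset.sum_add_distrib, ← Finset.sum_sub_distrib]
  refine Finset.sum_le_sum fun i _ => ?_
  linarith [sq_nonneg (2 * (G i x - pgrad (q T) i x) - 1 / 4 * pgrad (v T) i x)]

/-- With N = ‖grad_h(w - q)‖² and E = `errSq G q`: N/2 ≤ a_h(w - q, v) ≤ 4E + (4N)/16, so N ≤ 16E,
and the triangle inequality gives 2E + 32E. -/
lemma StableNodes.errSq_le {Γ : Set E3} {ν : Finset E3 → E3} {θ : ℝ} {pt : Finset E3 → (E3 → ℕ) → E3}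
    (hM : StableNodes 𝒯 Γ ν k θ pt) (hk : 0 < k) {f g : E3 → ℝ} {w q : Piecewise 𝒯}
    (hw : IsDiscreteSolution 𝒯 Γ ν k f g w) (hq : MemW 𝒯 Γ ν k g q)
    (hf : ∀ v, MemV 𝒯 k v → ∑ T : 𝒯.Elem, ∫ x in hull T.1, ∑ i, G i x * pgrad (v T) i x = load 𝒯 f v) :
    errSq G w ≤ 34 * errSq G q := by
  have hwq := hM.memW_sub hw.1 hq
  obtain ⟨v, hv, hvw⟩ := hM.exists_conforming hk hwq
  obtain ⟨h1, h2⟩ := hM.le_bilin hwq hv hvw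
  have h3 := sum_integral_sub_bilin_le hG q v
  have h4 := CurvedFEM.errSq_le hG w q
  rw [hf v hv, ← hw.2 v hv, ← bilin_sub_left] at h3
  linarith

end Strang

/-! ### The error estimate -/

lemma exists_errSq_interp_le {k : ℕ} (hk : 1 < k) {σ : ℝ} (hσ : 1 ≤ σ) : ∃ C > 0, ∃ θ₀ > 0,
    ∀ {θ : ℝ} {𝒯 : TetMesh} {Γ : Set E3} {ν : Finset E3 → E3} {pt : Finset E3 → (E3 → ℕ) → E3}, θ ≤ θ₀ →
      𝒯.ShapeRegular σ → ModifiedNodes 𝒯 Γ ν k θ pt → ∀ {D : Set E3} {u : E3 → ℝ}, IsOpen D →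
      MemSobolev (k + 1) D u → (∀ T : 𝒯.Elem, ∀ x ∈ hull T.1, Metric.closedBall x (5 * σ * 𝒯.size) ⊆ D) →
      ∀ (U : E3 → ℝ) (q : Piecewise 𝒯), (∀ T : 𝒯.Elem, ∀ a ∈ nodeIdx T.1 k,
        Tendsto (fun n => approx D u n (pt T.1 a)) atTop (𝓝 (U (pt T.1 a)))) → (∀ T, q T ∈ Pk k) →
      (∀ T : 𝒯.Elem, ∀ a ∈ nodeIdx T.1 k, pval (q T) (pt T.1 a) = U (pt T.1 a)) →
      errSq (fun i => weakDeriv D (fun _ : Fin 1 => i) u) q ≤ C * 𝒯.size ^ (2 * k) * ∫ x in D, wsq (k + 1) D u x := by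
  obtain ⟨C, hC, θ₀, hθ₀, H⟩ := exists_interp_error_limit hk hσ
  have hσ0 : 0 < σ := one_pos.trans_le hσ
  have hV := unitVol_pos
  refine ⟨3 * C * ((2 * σ) ^ 3 * unitVol) * (6 * σ) ^ 3, by positivity, θ₀, hθ₀,
    fun {θ 𝒯 Γ ν pt} hθ hreg hM D u hD hu hsub U q hU hq hqU => ?_⟩
  choose c r hl using fun T : 𝒯.Elem => hreg.exists_localNodes hM T.2
  have hr : ∀ T, 0 < r T := fun T => (hl T).pos
  have hrs : ∀ T, r T ≤ 𝒯.size := fun T => by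
    refine le_trans ?_ (TetMesh.diam_le_size T.2)
    have h1 : c T + r T • ee 0 ∈ hull T.1 := (hl T).ball_subset (by
      rw [Metric.mem_closedBall, dist_eq_norm, add_sub_cancel_left, norm_smul, Real.norm_of_nonneg (hr T).le]
      simp [ee])
    have h2 := dist_le_diam_hull h1 ((hl T).ball_subset (Metric.mem_closedBall_self (hr T).le))
    rw [dist_eq_norm, add_sub_cancel_left, norm_smul, Real.norm_of_nonneg (hr T).le] at h2
    simpa [ee] using h2
  have hsize : 0 ≤ 𝒯.size := by
    obtain ⟨T, hT⟩ := 𝒯.nonempty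
    exact (hr ⟨T, hT⟩).le.trans (hrs ⟨T, hT⟩)
  have hBD : ∀ T, Metric.closedBall (c T) (5 * σ * r T) ⊆ D := fun T =>
    (Metric.closedBall_subset_closedBall (mul_le_mul_of_nonneg_left (hrs T) (by positivity))).trans
      (hsub T _ ((hl T).ball_subset (Metric.mem_closedBall_self (hr T).le)))
  have hTD : ∀ T : 𝒯.Elem, hull T.1 ⊆ D := fun T x hx => hsub T x hx (Metric.mem_closedBall_self (by positivity))
  set I : 𝒯.Elem → ℝ := fun T => ∫ x in Metric.closedBall (c T) (5 * σ * r T), wsq (k + 1) D u x with hI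
  have hI0 : ∀ T, 0 ≤ I T := fun T => integral_nonneg fun x => wsq_nonneg _ _ _ x
  have hpt : ∀ T : 𝒯.Elem, ∀ᵐ x, x ∈ hull T.1 → ∀ i,
      (weakDeriv D (fun _ : Fin 1 => i) u x - pgrad (q T) i x) ^ 2 ≤ C * r T ^ (2 * k) * I T / r T ^ 3 := fun T => by
    filter_upwards [ae_all_iff.2 fun i => ae_tendsto_dd_approx hD hu (by omega) i] with x hx hxT i
    rw [le_div_iff₀ (pow_pos (hr T) 3)]
    refine H hθ (hl T) (fun n => approx D u n) U (I T) (contDiff_approx hD hu) ?_ (hU T) (q T) (hq T) (hqU T) x hxT i _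
      (hx i (hTD T hxT))
    -- The ball of radius 4σr of the interpolation estimate grows by the mollification radius, at
    -- most σr; hence the radius 5σr.
    filter_upwards [tendsto_mrad.eventually (ge_mem_nhds (mul_pos hσ0 (hr T)))] with n hn
    have h5 : 4 * σ * r T + σ * r T = 5 * σ * r T := by ring
    have := setIntegral_dsq_approx_le hD hu le_rfl (c := c T) (R := 4 * σ * r T) hn (by rw [h5]; exact hBD T)
    rwa [h5] at this
  have hloc : ∀ T : 𝒯.Elem, ∫ x in hull T.1, ∑ i, (weakDeriv D (fun _ : Fin 1 => i) u x - pgrad (q T) i x) ^ 2 ≤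
      3 * C * ((2 * σ) ^ 3 * unitVol) * (r T ^ (2 * k) * I T) := fun T => by
    have hfin : volume (hull T.1) < ⊤ := (isCompact_hull T.1).measure_lt_top
    have h1 : ∫ x in hull T.1, ∑ i, (weakDeriv D (fun _ : Fin 1 => i) u x - pgrad (q T) i x) ^ 2 ≤
        ∫ x in hull T.1, 3 * (C * r T ^ (2 * k) * I T / r T ^ 3) := by
      refine integral_mono_of_nonneg (Eventually.of_forall fun x => Finset.sum_nonneg fun _ _ => sq_nonneg _)
        (integrableOn_const hfin.ne) ((ae_restrict_iff' (isClosed_hull T.1).measurableSet).2 ?_)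
      filter_upwards [hpt T] with x hx hxT
      refine (Finset.sum_le_sum fun i _ => hx hxT i).trans_eq ?_
      rw [Finset.sum_const, Finset.card_univ, Fintype.card_fin, nsmul_eq_mul]; norm_num
    refine h1.trans ?_
    rw [setIntegral_const, smul_eq_mul]
    have h0 : 0 ≤ 3 * (C * r T ^ (2 * k) * I T / r T ^ 3) := by
      have := hI0 T; have := hr T; positivity
    refine (mul_le_mul_of_nonneg_right ((hl T).volume_hull_le hσ) h0).trans_eq ?_
    have := (hr T).ne'
    field_simp
  refine (Finset.sum_le_sum fun T _ => hloc T).trans ?_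
  rw [← Finset.mul_sum]
  have h2 := sum_mul_setIntegral_le hσ hr (fun T => (hl T).ball_subset) hsize hrs hk hBD
    (fun x => wsq_nonneg (k + 1) D u x) (hu.integrableOn_wsq le_rfl)
  refine (mul_le_mul_of_nonneg_left h2 (by positivity)).trans_eq ?_
  ring

/-- The weak gradients of u and `u'` agree almost everywhere on Ω, and enlarging Ω ∩ T to T only
increases the integral. -/
lemma gradError_sq_le {𝒯 : TetMesh} {Ω Ω' : Set E3} (hΩ : IsOpen Ω) (hΩ' : IsOpen Ω') (hsub : Ω ⊆ Ω') {m : ℕ} (hm : 1 ≤ m)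
    {u u' : E3 → ℝ} (hu : MemSobolev m Ω u) (hu' : MemSobolev m Ω' u') (huu' : u' =ᵐ[volume.restrict Ω] u)
    (hT : ∀ T : 𝒯.Elem, hull T.1 ⊆ Ω') (w : Piecewise 𝒯) :
    gradError 𝒯 Ω u w ^ 2 ≤ errSq (fun i => weakDeriv Ω' (fun _ : Fin 1 => i) u') w := by
  rw [gradError, Real.sq_sqrt (Finset.sum_nonneg fun T _ => integral_nonneg fun x =>
    Finset.sum_nonneg fun i _ => sq_nonneg _)]
  refine Finset.sum_le_sum fun T _ => ?_
  have hG : ∀ T : 𝒯.Elem, ∀ i : Fin 3,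
      MemLp (weakDeriv Ω' (fun _ : Fin 1 => i) u') 2 (volume.restrict (hull T.1)) := fun T i =>
    (hu'.hasWeakDeriv hm fun _ => i).1.mono_measure (Measure.restrict_mono (hT T) le_rfl)
  have h1 : ∫ x in Ω ∩ hull T.1, ∑ i, (weakDeriv Ω (fun _ : Fin 1 => i) u x - pgrad (w T) i x) ^ 2 =
      ∫ x in Ω ∩ hull T.1, ∑ i, (weakDeriv Ω' (fun _ : Fin 1 => i) u' x - pgrad (w T) i x) ^ 2 := by
    refine integral_congr_ae (ae_restrict_of_ae_restrict_of_subset inter_subset_left ?_)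
    filter_upwards [ae_all_iff.2 fun i : Fin 3 => (hu.hasWeakDeriv hm fun _ => i).ae_eq hΩ hΩ' hsub huu'
      (hu'.hasWeakDeriv hm fun _ => i)] with x hx
    simp only [hx]
  rw [h1]
  exact setIntegral_mono_set (integrableOn_errSq hG T (w T))
    (Eventually.of_forall fun x => Finset.sum_nonneg fun i _ => sq_nonneg _) inter_subset_right.eventuallyLE

end CurvedFEM

end


theorem mainTheorem6 (k : ℕ) (hk : 1 < k)
    (Ω Ω' : Set E3) (hΩ : IsC1Domain Ω) (hΩ' : IsOpen Ω') (hΩΩ' : closure Ω ⊆ Ω')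
    (σ δ : ℝ) (hδ₀ : 0 ≤ δ) (hδ : δ < 1) :
    ∃ C h₀ : ℝ, 0 < C ∧ 0 < h₀ ∧
      ∀ (𝒯 : TetMesh) (ν : Finset E3 → E3),
        𝒯.Fits Ω → 𝒯.ShapeRegular σ → 𝒯.AtMostOneEdgeOrFace → IsSkinChoice 𝒯 δ ν →
        𝒯.size ≤ h₀ →
      ∀ f g u f' u' : E3 → ℝ,
        -- the exact problem and the regularity of its solution
        ContinuousOn g (frontier Ω) →
        MemSobolev (k + 1) Ω u → SolvesPoissonEq Ω f u → HasTrace Ω (frontier Ω) u g →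
        -- the extended right-hand side and the extended solution
        MemSobolev (k - 1) Ω' f' → f' =ᵐ[volume.restrict Ω] f →
        MemSobolev (k + 1) Ω' u' → SolvesPoissonEq Ω' f' u' →
        u' =ᵐ[volume.restrict Ω] u → HasTrace Ω' (frontier Ω) u' g →
        -- the modified approximate problem is well posed and its solution satisfies the estimate
        (∃! u_h : Piecewise 𝒯, IsDiscreteSolution 𝒯 (frontier Ω) ν k f' g u_h) ∧
        ∀ u_h : Piecewise 𝒯, IsDiscreteSolution 𝒯 (frontier Ω) ν k f' g u_h →
          gradError 𝒯 Ω u u_h ≤ C * sobolevSeminorm (k + 1) Ω' u' * 𝒯.size ^ k := by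
  by_cases hσ : 1 ≤ σ
  swap
  -- No mesh is shape regular with σ < 1, so any constants do.
  · exact ⟨1, 1, one_pos, one_pos, fun 𝒯 ν _ hreg => absurd hreg.one_le hσ⟩
  have hk0 : 0 < k := one_pos.trans hk
  have hσ0 : 0 < σ := one_pos.trans_le hσ
  obtain ⟨C, hC, θ₁, hθ₁, hinterp⟩ := exists_errSq_interp_le hk hσ
  obtain ⟨θ₂, hθ₂, hθ₂1, hstable⟩ := exists_stable k hk0 hσ
  -- θ depends on k and σ only; the bound on h that realizes it is taken afterwards.
  have hθ : 0 < min θ₁ θ₂ := lt_min hθ₁ hθ₂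
  have hθ1 : min θ₁ θ₂ ≤ 1 := (min_le_right _ _).trans hθ₂1
  obtain ⟨h₁, hh₁, hnodes⟩ := exists_modifiedNodes hΩ hσ hδ₀ hδ hθ hk0
  have hcpt : IsCompact (closure Ω) := hΩ.isBounded.isCompact_closure
  obtain ⟨d₁, hd₁, hthick⟩ := hcpt.exists_cthickening_subset_open hΩ' hΩΩ'
  obtain ⟨d, hd, hdd⟩ : ∃ d, 0 < d ∧ 2 * d = d₁ := ⟨d₁ / 2, by positivity, by ring⟩
  have hball : ∀ x ∈ closure Ω, Metric.closedBall x (2 * d) ⊆ Ω' := fun x hx => by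
    rw [hdd]; exact (Metric.closedBall_subset_cthickening hx d₁).trans hthick
  have hVΩ' : Metric.thickening d (closure Ω) ⊆ Ω' :=
    (Metric.thickening_subset_cthickening_of_le (by linarith) _).trans hthick
  -- 34 is the quasi-optimality constant and C that of interpolation, both for squared errors. The
  -- bound d/(8σ) gives 6σh < d: balls of radius 5σh around points of the elements, which may stick
  -- out of Ω, stay within d of a vertex and hence in Ω'.
  refine ⟨Real.sqrt (34 * C), min h₁ (d / (8 * σ)), by positivity, by positivity,
    fun 𝒯 ν hfit hreg hone hν hsize f g u f' u' hg hu _ _ hf' _ hu' hpoisson huu' htrace => ?_⟩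
  obtain ⟨pt, hM⟩ := hnodes 𝒯 ν hfit hreg hone hν (hsize.trans (min_le_left _ _))
  have hS := hstable _ hθ.le (min_le_right _ _) 𝒯 _ ν pt hreg hM
  have hsize0 : 0 ≤ 𝒯.size := by
    obtain ⟨T, hT⟩ := 𝒯.nonempty
    exact Metric.diam_nonneg.trans (TetMesh.diam_le_size hT)
  have hsized : 6 * σ * 𝒯.size < d := by
    have h1 := hsize.trans (min_le_right _ _)
    rw [le_div_iff₀ (by positivity)] at h1
    linarith
  have hV : ∀ T : 𝒯.Elem, ∀ x ∈ hull T.1,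
      Metric.closedBall x (5 * σ * 𝒯.size) ⊆ Metric.thickening d (closure Ω) := fun T x hx y hy => by
    obtain ⟨v, hv⟩ : T.1.Nonempty := Finset.card_pos.1 (by rw [𝒯.card_eq _ T.2]; norm_num)
    refine Metric.mem_thickening_iff.2 ⟨v, (hfit _ T.2 v hv).1, ?_⟩
    have h1 := (dist_le_diam_hull hx (subset_convexHull ℝ _ hv)).trans (TetMesh.diam_le_size T.2)
    have h2 := Metric.mem_closedBall.1 hy
    have h3 := dist_triangle y x v
    have h4 : 𝒯.size ≤ σ * 𝒯.size := le_mul_of_one_le_left hsize0 hσ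
    linarith
  have hTV : ∀ T : 𝒯.Elem, hull T.1 ⊆ Metric.thickening d (closure Ω) := fun T x hx =>
    hV T x hx (Metric.mem_closedBall_self (by positivity))
  have hTΩ' : ∀ T : 𝒯.Elem, hull T.1 ⊆ Ω' := fun T => (hTV T).trans hVΩ'
  obtain ⟨U, hUc, hUlim⟩ := exists_continuous_rep (by omega : 3 ≤ k + 1) hΩ' hu' hd hball
  have hUu : ∀ᵐ x ∂volume.restrict (Metric.thickening d (closure Ω)), u' x = U x := by
    rw [ae_restrict_iff' Metric.isOpen_thickening.measurableSet]
    filter_upwards [ae_tendsto_approx hΩ' hu'] with x hx hxV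
    exact tendsto_nhds_unique (hx (hVΩ' hxV)) (hUlim x hxV)
  -- The trace condition holds only almost everywhere, whereas interpolation needs the values of the
  -- continuous representative at individual points of Γ.
  have hUg : ∀ x ∈ frontier Ω, U x = g x := eq_of_hasTrace hΩ Metric.isOpen_thickening
    (frontier_subset_closure.trans (Metric.self_subset_thickening hd _)) hVΩ' hg hUc hUu htrace
  have hptV : ∀ T : 𝒯.Elem, ∀ a ∈ nodeIdx T.1 k, pt T.1 a ∈ Metric.thickening d (closure Ω) := fun T a ha => by
    refine hV T _ (node_mem_hull (TetMesh.isTet T.2) hk0 ha) ?_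
    rw [Metric.mem_closedBall, dist_comm]
    refine (hM.dist_le T.1 T.2 a ha).trans ?_
    have h1 : min θ₁ θ₂ * Metric.diam (hull T.1) ≤ 1 * 𝒯.size :=
      mul_le_mul hθ1 (TetMesh.diam_le_size T.2) Metric.diam_nonneg zero_le_one
    have h4 : 𝒯.size ≤ σ * 𝒯.size := le_mul_of_one_le_left hsize0 hσ
    linarith
  refine ⟨hS.existsUnique hk0 fun T => ?_, fun w hw => ?_⟩
  · have : IsFiniteMeasure (volume.restrict (hull T.1)) :=
      isFiniteMeasure_restrict.2 (isCompact_hull T.1).measure_lt_top.ne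
    exact (hf'.1.mono_measure (Measure.restrict_mono (hTΩ' T) le_rfl)).integrable (by norm_num)
  -- The interpolant of U belongs to W_h^g because the boundary interpolation points lie on Γ, where
  -- U = g.
  obtain ⟨q, hq, hqU⟩ := hS.exists_memW hk0 hUg
  have hqk : ∀ T, q T ∈ Pk k := fun T => mem_Pk.2 (hq.degree T)
  have h1 := hinterp (min_le_left _ _) hreg hM hΩ' hu' (fun T x hx => (hV T x hx).trans hVΩ') U q
    (fun T a ha => hUlim _ (hptV T a ha)) hqk hqU
  have hm : 1 ≤ k + 1 := by omega
  have h2 := hS.errSq_le (G := fun i => weakDeriv Ω' (fun _ : Fin 1 => i) u')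
    (fun T i => (hu'.hasWeakDeriv hm fun _ => i).1.mono_measure (Measure.restrict_mono (hTΩ' T) le_rfl))
    hk0 hw hq fun v hv => hpoisson.sum_integral_pgrad_eq_load hΩ' hu' hm hf'.1 hTΩ' hv
  have h3 := gradError_sq_le hΩ.isOpen hΩ' (subset_closure.trans hΩΩ') hm hu hu' huu' hTΩ' w
  rw [← hu'.sq_sobolevSeminorm] at h1
  have hnn : 0 ≤ sobolevSeminorm (k + 1) Ω' u' := Real.sqrt_nonneg _
  refine le_of_sq_le_sq ?_ (by positivity)
  rw [mul_pow, mul_pow, Real.sq_sqrt (by positivity), ← pow_mul, mul_comm k 2]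
  linarith
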